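/- **Setting.** Let $K,L,\mathscr N_0$ be integers with $4\le L<K$, $\mathscr N_0\ge 4$ and $\frac L4<\mathscr N_0<\frac K2$. Let $V=\mathbb T_K\times\mathbb T_L$ be the periodic square lattice with nearest-neighbor bonds $E$, let $\Omega$ be the set of $\eta\in\{0,1\}^V$ with exactly $L\mathscr N_0$ occupied sites (sites with $\eta(x)=1$), and let $\mathbb H(\eta)=-\sum_{\{x,y\}\in E}\eta(x)\eta(y)$ and $\mathbb H_0=-2L\mathscr N_0+L$. Write $\eta\sim\xi$ if $\xi\ne\eta$ arises from $\eta$ by exchanging the states of two neighboring sites; this makes $\Omega$ a graph. The height of a path in $\Omega$ is the maximum of $\mathbb H$ along it, and $\Phi(\eta,\xi)$, $\Phi(\mathcal A,\mathcal B)$ denote the minimal height of a path from $\eta$ to $\xi$, resp. from $\mathcal A$ to $\mathcal B$. Let $\mathcal S$ be the set of minimizers of $\mathbb H$, $\overline\Phi=\max_{s,s'\in\mathcal S}\Phi(s,s')$ and $\overline\Omega=\{\eta:\Phi(\mathcal S,\eta)\le\overline\Phi\}$. A *stable plateau* is a nonempty connected $\mathcal P\subseteq\Omega$ on which $\mathbb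 H$ is constant and such that every configuration outside $\mathcal P$ adjacent to $\mathcal P$ has strictly larger energy. Let $\mathscr P^1$ be the collection of all stable plateaux contained in $\overline\Omega$. **Notation.** For $k\in\mathbb T_K$, $\mathfrak c^k=\{k\}\times\mathbb T_L$ and $\mathfrak c^{[k,k']}=\mathfrak c^k\cup\mathfrak c^{k+1}\cup\dots\cup\mathfrak c^{k'}$. For $1\le m\le L-1$ and $\ell\in\mathbb T_L$, $\mathfrak s^k_{m;\ell}=\{k\}\times\{\ell,\ell+1,\dots,\ell+m-1\}$, and $\mathfrak S^k_m=\{\mathfrak s^k_{m;\ell}:\ell\in\mathbb T_L\}$ is the set of $m$-sticks in $\mathfrak c^k$. For sticks $W,W'$ in neighboring columns, $W\vdash W'$ means that the set of vertical positions of $W'$ is contained in that of $W$. Two subsets of $V$ are *separated* if their graph distance in the lattice is at least $3$. Configurations are described by their sets of occupied sites. - $\sigma^k$: $\mathfrak c^{[k,k+\mathscr N_0-1]}$. - $\sigma^k_{m;\ell,\ell'}$ ($1\le m\le L-1$): $\mathfrak c^{[k+1,k+\mathscr N_0-1]}\cup\mathfrak s^k_{L-m;\ell}\cup\mathfrak s^{k+\mathscr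 N_0}_{m;\ell'}$; and $\mathcal S^k_m=\{\sigma^k_{m;\ell,\ell'}:\ell,\ell'\in\mathbb T_L\}$. - $\mathcal R^k$: $\mathfrak c^{[k,k+\mathscr N_0-2]}\cup W\cup W'$, $W\in\mathfrak S^{k+\mathscr N_0-1}_{L-1}$, $W'\in\mathfrak S^{k+\mathscr N_0}_1$, $W\vdash W'$. - $\mathcal D^k_m$: configurations of energy $\mathbb H_0+3$ reachable from $\mathcal S^k_m$ by exchanges within $\mathfrak c^k\cup\mathfrak c^{k+\mathscr N_0}$ between configurations of energy at most $\mathbb H_0+4$, excluding all $\xi$ with $\Phi(\eta,\xi)<\mathbb H_0+4$ for some $\eta\in\mathcal S^k_m$. - $\mathcal R^k_{m,+}$: $\mathfrak c^{[k+1,k+\mathscr N_0-2]}\cup W\cup W'\cup W''$, $W\in\mathfrak S^k_{L-m}$, $W'\in\mathfrak S^{k+\mathscr N_0-1}_{L-1}$, $W''\in\mathfrak S^{k+\mathscr N_0}_{m+1}$, $W'\vdash W''$. - $\mathcal R^k_{m,-}$: $\mathfrak c^{[k+1,k+\mathscr N_0-1]}\cup W\cup W'\cup W''$, $W\in\mathfrak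 S^k_{L-m}$, $W'\in\mathfrak S^{k+\mathscr N_0}_{m-1}$, $W''\in\mathfrak S^{k+\mathscr N_0+1}_1$, $W'\vdash W''$. - $\mathcal L^k_{m,-}$: $\mathfrak c^{[k+2,k+\mathscr N_0-1]}\cup W\cup W'\cup W''$, $W\in\mathfrak S^k_{L-m+1}$, $W'\in\mathfrak S^{k+1}_{L-1}$, $W''\in\mathfrak S^{k+\mathscr N_0}_m$, $W'\vdash W$. - $\mathcal L^k_{m,+}$: $\mathfrak c^{[k+1,k+\mathscr N_0-1]}\cup W\cup W'\cup W''$, $W\in\mathfrak S^{k-1}_1$, $W'\in\mathfrak S^k_{L-m-1}$, $W''\in\mathfrak S^{k+\mathscr N_0}_m$, $W'\vdash W$. - $\mathcal R^k_{(i)}$: $\mathfrak c^{[k,k+\mathscr N_0-2]}\cup W\cup W'$, $W\in\mathfrak S^{k+\mathscr N_0-1}_{L-i}$, $W'\in\mathfrak S^{k+\mathscr N_0}_i$, $W\vdash W'$. - $\widehat{\mathcal R}^k_{(i)}$: $\mathfrak c^{[k,k+\mathscr N_0-2]}\cup W\cup W'\cup W''$ with sticks of length at least $2$, where either $W,W'$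 are separated sticks in $\mathfrak c^{k+\mathscr N_0-1}$ and $W''$ is a stick in $\mathfrak c^{k+\mathscr N_0}$ with $|W|+|W'|=L-i$, $|W''|=i$, $W\vdash W''$; or $W$ is a stick in $\mathfrak c^{k+\mathscr N_0-1}$ and $W',W''$ are separated sticks in $\mathfrak c^{k+\mathscr N_0}$ with $|W|=L-i$, $|W'|+|W''|=i$, $W\vdash W'$, $W\vdash W''$. - $\mathcal R^k_{(i),+}$: $(\mathfrak c^{[k,k+\mathscr N_0-2]}\cup W\cup W')\setminus\{w\}$, $W\in\mathfrak S^{k+\mathscr N_0-1}_{L-i+1}$, $W'\in\mathfrak S^{k+\mathscr N_0}_i$, $w\in\mathfrak c^k$, $W\vdash W'$. - $\widehat{\mathcal R}^k_{(i),+}$: $\mathfrak c^{[k,k+\mathscr N_0-3]}\cup W\cup W'\cup W''$, $W\in\mathfrak S^{k+\mathscr N_0-2}_{L-1}$, $W'\in\mathfrak S^{k+\mathscr N_0-1}_{L-i+1}$, $W''\in\mathfrak S^{k+\mathscr N_0}_i$, $W\vdash W'\vdash W''$. - $\mathcal R^k_{(i),-}$: $\mathfrak c^{[k,k+\mathscr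 N_0-2]}\cup W\cup W'\cup\{w\}$, $W\in\mathfrak S^{k+\mathscr N_0-1}_{L-i}$, $W'\in\mathfrak S^{k+\mathscr N_0}_{i-1}$, $w\in\mathfrak c^{k-1}$, $W\vdash W'$. - $\widehat{\mathcal R}^k_{(i),-}$: $\mathfrak c^{[k,k+\mathscr N_0-2]}\cup W\cup W'\cup W''$, $W\in\mathfrak S^{k+\mathscr N_0-1}_{L-i}$, $W'\in\mathfrak S^{k+\mathscr N_0}_{i-1}$, $W''\in\mathfrak S^{k+\mathscr N_0+1}_1$, $W\vdash W'\vdash W''$. - $\mathcal L^k,\ \mathcal L^k_{(i)},\ \widehat{\mathcal L}^k_{(i)},\ \mathcal L^k_{(i),\mp},\ \widehat{\mathcal L}^k_{(i),\mp}$: the images of $\mathcal R^k,\ \mathcal R^k_{(i)},\ \widehat{\mathcal R}^k_{(i)},\ \mathcal R^k_{(i),\pm},\ \widehat{\mathcal R}^k_{(i),\pm}$ under the horizontal reflection $(x,y)\mapsto(2k+\mathscr N_0-1-x,\,y)$. **Theorem.** The elements of $\mathscr P^1$ are exactly the following sets, with $k$ ranging over $\mathbb T_K$, and they have the indicated energies.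 - Energy $\mathbb H_0$: $\{\sigma^k\}$. - Energy $\mathbb H_0+2$: - $\{\sigma^k_{m;\ell,\ell'}\}$ for $2\le m\le L-2$ and $\ell,\ell'\in\mathbb T_L$; - $\mathcal S^k_1$, $\mathcal S^{k-1}_{L-1}$, $\mathcal R^k$ and $\mathcal L^k$; - $\{\eta\}$ for $\eta\in\mathcal R^k_{(i)}\cup\mathcal L^k_{(i)}$ and $2\le i\le\frac L2$. - Energy $\mathbb H_0+3$: - $\{\eta\}$ for $\eta\in\mathcal D^k_m$ and $2\le m\le L-2$; - the connected components of each of $\mathcal R^k_{m,+},\mathcal R^k_{m,-},\mathcal L^k_{m,-},\mathcal L^k_{m,+}$ for $2\le m\le L-2$; - $\{\eta\}$ for $\eta\in\widehat{\mathcal R}^k_{(i)}\cup\widehat{\mathcal L}^k_{(i)}$ and $2\le i\le\frac{L-2}2$; - the connected components of each of $\mathcal R^k_{(i),\pm},\mathcal L^k_{(i),\mp},\widehat{\mathcal R}^k_{(i),\pm},\widehat{\mathcal L}^k_{(i),\mp}$ for $2\le i\le\frac{L+1}2$. -/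

import Mathlib

/-! ### Energy landscapes: paths, communication heights, stable plateaux -/

namespace Landscape

variable {Ω : Type*} (G : SimpleGraph Ω) (H : Ω → ℤ)

/-- The ground states: the global minimizers of the Hamiltonian. -/
def groundStates : Set Ω := {s | ∀ η, H s ≤ H η}

/-- The height of a path: the maximal energy along it. -/
noncomputable def height {G : SimpleGraph Ω} {η ξ : Ω} (w : G.Walk η ξ) : ℤ :=
  sSup {h | ∃ ζ ∈ w.support, H ζ = h}

/-- The communication height `Φ(A, B)` between two sets of configurations:
the minimal height of a path from `A` to `B`. -/
noncomputable def commHeightSets (A B : Set Ω) : ℤ :=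
  sInf {h | ∃ η ∈ A, ∃ ξ ∈ B, ∃ w : G.Walk η ξ, height H w = h}

/-- The communication height `Φ(η, ξ)` between two configurations. -/
noncomputable def commHeight (η ξ : Ω) : ℤ := commHeightSets G H {η} {ξ}

/-- The energy barrier between the ground states: the maximum of `Φ(s, s')`
over ground states `s`, `s'`. -/
noncomputable def groundBarrier : ℤ :=
  sSup {h | ∃ s ∈ groundStates H, ∃ s' ∈ groundStates H, commHeight G H s s' = h}

/-- The set `Ω̄` of the configurations reachable from the ground states by paths of height
at most the energy barrier between the ground states. -/
def reachable : Set Ω :=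
  {η | commHeightSets G H (groundStates H) {η} ≤ groundBarrier G H}

/-- The outer boundary of a set of configurations. -/
def boundary (A : Set Ω) : Set Ω := {η | η ∉ A ∧ ∃ ξ ∈ A, G.Adj η ξ}

/-- All configurations of `A` have energy `h`. -/
def HasEnergy (A : Set Ω) (h : ℤ) : Prop := ∀ η ∈ A, H η = h

/-- A stable plateau: a nonempty connected set of constant energy all of whose boundary
configurations have strictly higher energy. (`SimpleGraph.Connected` includes nonemptiness.) -/
structure IsStablePlateau (P : Set Ω) : Prop where
  connected : (G.induce P).Connected
  const : ∀ η ∈ P, ∀ ξ ∈ P, H η = H ξ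
  boundary_higher : ∀ η ∈ P, ∀ ζ ∈ boundary G P, H η < H ζ

/-- The collection of all stable plateaux in `Ω̄`. -/
def stablePlateaux : Set (Set Ω) := {P | IsStablePlateau G H P ∧ P ⊆ reachable G H}

/-- The connected components (maximal connected subsets) of a set of configurations. -/
def components (A : Set Ω) : Set (Set Ω) :=
  {P | ∃ C : (G.induce A).ConnectedComponent, P = Subtype.val '' C.supp}

end Landscape

/-! ### The Kawasaki model on the torus -/

namespace Kawasaki

open Landscape

/-- The periodic square lattice `𝕋_K × 𝕋_L` with nearest-neighbor bonds. -/
def torus (K L : ℕ) : SimpleGraph (ZMod K × ZMod L) :=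
  (SimpleGraph.circulantGraph ({1} : Set (ZMod K))).boxProd
    (SimpleGraph.circulantGraph ({1} : Set (ZMod L)))

/-- Configurations of `L * N₀` particles on the torus, a configuration `η ∈ {0, 1}^V` being
identified with its set `{x | η x = 1}` of occupied sites. -/
abbrev Config (K L N₀ : ℕ) : Type :=
  {A : Finset (ZMod K × ZMod L) // A.card = L * N₀}

variable {K L N₀ : ℕ}

/-- The set of occupied sites of a configuration. -/
def occ (η : Config K L N₀) : Set (ZMod K × ZMod L) := ↑η.1

/-- The Hamiltonian: minus the number of bonds with both ends occupied. -/
noncomputable def energy (η : Config K L N₀) : ℤ :=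
  -(({e | e ∈ (torus K L).edgeSet ∧ ∀ x ∈ e, x ∈ occ η}.ncard : ℕ) : ℤ)

/-- `ξ ≠ η` arises from `η` by exchanging the states of the neighboring sites `x` and `y`. -/
def IsExchange (x y : ZMod K × ZMod L) (η ξ : Config K L N₀) : Prop :=
  (torus K L).Adj x y ∧ ξ ≠ η ∧ occ ξ = Equiv.swap x y '' occ η

/-- The graph of the Kawasaki dynamics on the configuration space. -/
def graph (K L N₀ : ℕ) : SimpleGraph (Config K L N₀) where
  Adj η ξ := ∃ x y, IsExchange x y η ξ
  symm := ⟨by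
    rintro η ξ ⟨x, y, hxy, hne, h⟩
    refine ⟨x, y, hxy, hne.symm, ?_⟩
    rw [h, Set.image_image]
    simp⟩
  loopless := ⟨by
    rintro η ⟨x, y, -, hne, -⟩
    exact hne rfl⟩

/-- The ground energy `H₀ = -2 L N₀ + L`. -/
def H₀ (L N₀ : ℕ) : ℤ := -2 * L * N₀ + L

/-- The union of the `n` consecutive columns `k, k + 1, …, k + n - 1`. -/
def cols (k : ZMod K) (n : ℕ) : Set (ZMod K × ZMod L) :=
  {x | ∃ j : ℕ, j < n ∧ x.1 = k + j}

/-- The `m`-stick in column `k` starting from position `ℓ`. -/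
def stick (k : ZMod K) (m : ℕ) (ℓ : ZMod L) : Set (ZMod K × ZMod L) :=
  {x | x.1 = k ∧ ∃ j : ℕ, j < m ∧ x.2 = ℓ + j}

/-- The collection of all `m`-sticks in column `k`. -/
def sticks (k : ZMod K) (m : ℕ) : Set (Set (ZMod K × ZMod L)) :=
  Set.range (stick k m)

/-- `W'` sits on `W`, written `W ⊢ W'` for sticks in adjacent columns: the vertical positions
of `W'` are among those of `W`. -/
def Sits (W W' : Set (ZMod K × ZMod L)) : Prop := Prod.snd '' W' ⊆ Prod.snd '' W

/-- Every site of `A` is at graph distance at least three from every site of `B`. -/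
def Separated (A B : Set (ZMod K × ZMod L)) : Prop :=
  ∀ x ∈ A, ∀ y ∈ B, 3 ≤ (torus K L).dist x y

/-- The configurations obtained from those in `𝒜` by horizontal reflection with respect to the
vertical center line of the columns `k, …, k + N₀ - 1`. -/
def reflect (k : ZMod K) (𝒜 : Set (Config K L N₀)) : Set (Config K L N₀) :=
  {η | ∃ ξ ∈ 𝒜, occ η =
    (fun x : ZMod K × ZMod L => (2 * k + (N₀ : ZMod K) - 1 - x.1, x.2)) '' occ ξ}

/-- The singleton of the configuration whose occupied columns are `k, …, k + N₀ - 1`. -/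
def strip (k : ZMod K) : Set (Config K L N₀) := {η | occ η = cols k N₀}

/-- The singleton of the shallow bottom `σ^k_{m;ℓ,ℓ'}`. -/
def bottom (k : ZMod K) (m : ℕ) (ℓ ℓ' : ZMod L) : Set (Config K L N₀) :=
  {η | occ η = cols (k + 1) (N₀ - 1) ∪ stick k (L - m) ℓ ∪ stick (k + (N₀ : ZMod K)) m ℓ'}

/-- The collection `S^k_m` of the shallow bottoms `σ^k_{m;ℓ,ℓ'}` over all `ℓ`, `ℓ'`. -/
def bottoms (k : ZMod K) (m : ℕ) : Set (Config K L N₀) := ⋃ ℓ, ⋃ ℓ', bottom k m ℓ ℓ'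

/-- The collection `R^k`. -/
def setR (k : ZMod K) : Set (Config K L N₀) :=
  {η | ∃ W ∈ sticks (k + (N₀ : ZMod K) - 1) (L - 1), ∃ W' ∈ sticks (k + (N₀ : ZMod K)) 1,
    Sits W W' ∧ occ η = cols k (N₀ - 1) ∪ W ∪ W'}

/-- The collection `L^k`. -/
def setL (k : ZMod K) : Set (Config K L N₀) := reflect k (setR k)

/-- The neighborhood `N(η)` of the configurations at communication height below `H₀ + 4`. -/
def nbhd (η : Config K L N₀) : Set (Config K L N₀) :=
  {ξ | commHeight (graph K L N₀) energy η ξ < H₀ L N₀ + 4}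

/-- The valley `N^k_m` around the shallow bottoms `S^k_m`. -/
def valley (k : ZMod K) (m : ℕ) : Set (Config K L N₀) := ⋃ η ∈ bottoms k m, nbhd η

/-- An allowed jump (both energies at most `H₀ + 4`) inside the region `U` of the lattice. -/
def AllowedJumpIn (U : Set (ZMod K × ZMod L)) (η ξ : Config K L N₀) : Prop :=
  (∃ x ∈ U, ∃ y ∈ U, IsExchange x y η ξ) ∧
    energy η ≤ H₀ L N₀ + 4 ∧ energy ξ ≤ H₀ L N₀ + 4

/-- The collection `D^k_m`: the configurations of energy `H₀ + 3` that are reachable from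
`S^k_m` by allowed jumps inside the columns `k` and `k + N₀`, excluding the valley `N^k_m`. -/
def setD (k : ZMod K) (m : ℕ) : Set (Config K L N₀) :=
  {η | energy η = H₀ L N₀ + 3 ∧ η ∉ valley k m ∧
    ∃ ξ ∈ bottoms k m,
      Relation.ReflTransGen (AllowedJumpIn (cols k 1 ∪ cols (k + (N₀ : ZMod K)) 1)) ξ η}

/-- The collection `R^k_{m,+}`. -/
def setRmPlus (k : ZMod K) (m : ℕ) : Set (Config K L N₀) :=
  {η | ∃ W ∈ sticks k (L - m), ∃ W' ∈ sticks (k + (N₀ : ZMod K) - 1) (L - 1),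
    ∃ W'' ∈ sticks (k + (N₀ : ZMod K)) (m + 1),
    Sits W' W'' ∧ occ η = cols (k + 1) (N₀ - 2) ∪ W ∪ W' ∪ W''}

/-- The collection `R^k_{m,-}`. -/
def setRmMinus (k : ZMod K) (m : ℕ) : Set (Config K L N₀) :=
  {η | ∃ W ∈ sticks k (L - m), ∃ W' ∈ sticks (k + (N₀ : ZMod K)) (m - 1),
    ∃ W'' ∈ sticks (k + (N₀ : ZMod K) + 1) 1,
    Sits W' W'' ∧ occ η = cols (k + 1) (N₀ - 1) ∪ W ∪ W' ∪ W''}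

/-- The collection `L^k_{m,-}`. -/
def setLmMinus (k : ZMod K) (m : ℕ) : Set (Config K L N₀) :=
  {η | ∃ W ∈ sticks k (L - m + 1), ∃ W' ∈ sticks (k + 1) (L - 1),
    ∃ W'' ∈ sticks (k + (N₀ : ZMod K)) m,
    Sits W' W ∧ occ η = cols (k + 2) (N₀ - 2) ∪ W ∪ W' ∪ W''}

/-- The collection `L^k_{m,+}`. -/
def setLmPlus (k : ZMod K) (m : ℕ) : Set (Config K L N₀) :=
  {η | ∃ W ∈ sticks (k - 1) 1, ∃ W' ∈ sticks k (L - m - 1),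
    ∃ W'' ∈ sticks (k + (N₀ : ZMod K)) m,
    Sits W' W ∧ occ η = cols (k + 1) (N₀ - 1) ∪ W ∪ W' ∪ W''}

/-- The collection `R^k_{(i)}`. -/
def setRi (k : ZMod K) (i : ℕ) : Set (Config K L N₀) :=
  {η | ∃ W ∈ sticks (k + (N₀ : ZMod K) - 1) (L - i), ∃ W' ∈ sticks (k + (N₀ : ZMod K)) i,
    Sits W W' ∧ occ η = cols k (N₀ - 1) ∪ W ∪ W'}

/-- The collection `R̂^k_{(i)}`: either column `k + N₀ - 1` holds two separated sticks, on one of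
which the stick in column `k + N₀` sits, or column `k + N₀` holds two separated sticks, both
sitting on the stick in column `k + N₀ - 1`; all sticks have length at least two. -/
def setRhat (k : ZMod K) (i : ℕ) : Set (Config K L N₀) :=
  {η | (∃ a b : ℕ, 2 ≤ a ∧ 2 ≤ b ∧ 2 ≤ i ∧ a + b = L - i ∧
      ∃ W ∈ sticks (k + (N₀ : ZMod K) - 1) a, ∃ W' ∈ sticks (k + (N₀ : ZMod K) - 1) b, ∃ W'' ∈ sticks (k + (N₀ : ZMod K)) i,
      Separated W W' ∧ Sits W W'' ∧ occ η = cols k (N₀ - 1) ∪ W ∪ W' ∪ W'') ∨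
    (∃ a b : ℕ, 2 ≤ a ∧ 2 ≤ b ∧ 2 ≤ L - i ∧ a + b = i ∧
      ∃ W ∈ sticks (k + (N₀ : ZMod K) - 1) (L - i), ∃ W' ∈ sticks (k + (N₀ : ZMod K)) a, ∃ W'' ∈ sticks (k + (N₀ : ZMod K)) b,
      Separated W' W'' ∧ Sits W W' ∧ Sits W W'' ∧
        occ η = cols k (N₀ - 1) ∪ W ∪ W' ∪ W'')}

/-- The collection `R^k_{(i),+}`. -/
def setRiPlus (k : ZMod K) (i : ℕ) : Set (Config K L N₀) :=
  {η | ∃ W ∈ sticks (k + (N₀ : ZMod K) - 1) (L - i + 1), ∃ W' ∈ sticks (k + (N₀ : ZMod K)) i,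
    ∃ w ∈ (cols k 1 : Set (ZMod K × ZMod L)),
    Sits W W' ∧ occ η = (cols k (N₀ - 1) ∪ W ∪ W') \ {w}}

/-- The collection `R̂^k_{(i),+}`. -/
def setRhatPlus (k : ZMod K) (i : ℕ) : Set (Config K L N₀) :=
  {η | ∃ W ∈ sticks (k + (N₀ : ZMod K) - 2) (L - 1), ∃ W' ∈ sticks (k + (N₀ : ZMod K) - 1) (L - i + 1),
    ∃ W'' ∈ sticks (k + (N₀ : ZMod K)) i,
    Sits W W' ∧ Sits W' W'' ∧ occ η = cols k (N₀ - 2) ∪ W ∪ W' ∪ W''}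

/-- The collection `R^k_{(i),-}`. -/
def setRiMinus (k : ZMod K) (i : ℕ) : Set (Config K L N₀) :=
  {η | ∃ W ∈ sticks (k + (N₀ : ZMod K) - 1) (L - i), ∃ W' ∈ sticks (k + (N₀ : ZMod K)) (i - 1),
    ∃ w ∈ (cols (k - 1) 1 : Set (ZMod K × ZMod L)),
    Sits W W' ∧ occ η = cols k (N₀ - 1) ∪ W ∪ W' ∪ {w}}

/-- The collection `R̂^k_{(i),-}`. -/
def setRhatMinus (k : ZMod K) (i : ℕ) : Set (Config K L N₀) :=
  {η | ∃ W ∈ sticks (k + (N₀ : ZMod K) - 1) (L - i), ∃ W' ∈ sticks (k + (N₀ : ZMod K)) (i - 1),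
    ∃ W'' ∈ sticks (k + (N₀ : ZMod K) + 1) 1,
    Sits W W' ∧ Sits W' W'' ∧ occ η = cols k (N₀ - 1) ∪ W ∪ W' ∪ W''}

/-- The collection `L^k_{(i)}`. -/
def setLi (k : ZMod K) (i : ℕ) : Set (Config K L N₀) := reflect k (setRi k i)

/-- The collection `L̂^k_{(i)}`. -/
def setLhat (k : ZMod K) (i : ℕ) : Set (Config K L N₀) := reflect k (setRhat k i)

/-- The collection `L^k_{(i),-}`. -/
def setLiMinus (k : ZMod K) (i : ℕ) : Set (Config K L N₀) := reflect k (setRiPlus k i)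

/-- The collection `L̂^k_{(i),-}`. -/
def setLhatMinus (k : ZMod K) (i : ℕ) : Set (Config K L N₀) := reflect k (setRhatPlus k i)

/-- The collection `L^k_{(i),+}`. -/
def setLiPlus (k : ZMod K) (i : ℕ) : Set (Config K L N₀) := reflect k (setRiMinus k i)

/-- The collection `L̂^k_{(i),+}`. -/
def setLhatPlus (k : ZMod K) (i : ℕ) : Set (Config K L N₀) := reflect k (setRhatMinus k i)

/-- The collection of all stable plateaux in `Ω̄` for the Kawasaki model. -/
def plateaux (K L N₀ : ℕ) : Set (Set (Config K L N₀)) :=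
  stablePlateaux (graph K L N₀) energy

/-- The classified sets at energy `H₀`. -/
def ListedZero (P : Set (Config K L N₀)) : Prop := ∃ k : ZMod K, P = strip k

/-- The classified sets at energy `H₀ + 2`. -/
def ListedTwo (P : Set (Config K L N₀)) : Prop :=
  ∃ k : ZMod K,
    (∃ m : ℕ, 2 ≤ m ∧ m + 2 ≤ L ∧ ∃ ℓ ℓ' : ZMod L, P = bottom k m ℓ ℓ') ∨
    P = bottoms k 1 ∨ P = bottoms (k - 1) (L - 1) ∨ P = setR k ∨ P = setL k ∨
    (∃ i : ℕ, 2 ≤ i ∧ 2 * i ≤ L ∧ ∃ η ∈ setRi k i ∪ setLi k i, P = {η})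

/-- The classified sets at energy `H₀ + 3`. -/
def ListedThree (P : Set (Config K L N₀)) : Prop :=
  ∃ k : ZMod K,
    (∃ m : ℕ, 2 ≤ m ∧ m + 2 ≤ L ∧ ∃ η ∈ setD k m, P = {η}) ∨
    (∃ m : ℕ, 2 ≤ m ∧ m + 2 ≤ L ∧
      ∃ 𝒜 ∈ ({setRmPlus k m, setRmMinus k m, setLmMinus k m, setLmPlus k m} :
        Set (Set (Config K L N₀))), P ∈ components (graph K L N₀) 𝒜) ∨
    (∃ i : ℕ, 2 ≤ i ∧ 2 * i + 2 ≤ L ∧ ∃ η ∈ setRhat k i ∪ setLhat k i, P = {η}) ∨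
    (∃ i : ℕ, 2 ≤ i ∧ 2 * i ≤ L + 1 ∧
      ∃ 𝒜 ∈ ({setRiPlus k i, setRiMinus k i, setLiMinus k i, setLiPlus k i,
          setRhatPlus k i, setRhatMinus k i, setLhatMinus k i, setLhatPlus k i} :
        Set (Set (Config K L N₀))), P ∈ components (graph K L N₀) 𝒜)

end Kawasaki

set_option linter.unusedSectionVars false
set_option linter.unnecessarySeqFocus false

/-! ### Energy landscapes -/

namespace Landscape

open Relation

variable {Ω : Type*} {G : SimpleGraph Ω} {H : Ω → ℤ}

/-- There is a path of height at most `c`. -/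
def Linked (G : SimpleGraph Ω) (H : Ω → ℤ) (c : ℤ) (a b : Ω) : Prop :=
  ∃ w : G.Walk a b, ∀ ζ ∈ w.support, H ζ ≤ c

theorem Linked.refl {c : ℤ} {a : Ω} (h : H a ≤ c) : Linked G H c a a :=
  ⟨.nil, by simpa using h⟩

theorem Linked.symm {c : ℤ} {a b : Ω} (h : Linked G H c a b) : Linked G H c b a := by
  obtain ⟨w, hw⟩ := h; exact ⟨w.reverse, by simpa using hw⟩

theorem Linked.trans {c : ℤ} {a b d : Ω} (h : Linked G H c a b) (h' : Linked G H c b d) :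
    Linked G H c a d := by
  obtain ⟨w, hw⟩ := h; obtain ⟨w', hw'⟩ := h'; refine ⟨w.append w', fun ζ hζ => ?_⟩
  rcases (SimpleGraph.Walk.mem_support_append_iff _ _).1 hζ with h | h
  · exact hw ζ h
  · exact hw' ζ h

theorem Linked.of_adj {c : ℤ} {a b : Ω} (h : G.Adj a b) (ha : H a ≤ c) (hb : H b ≤ c) :
    Linked G H c a b := by
  refine ⟨h.toWalk, fun ζ hζ => ?_⟩; simp at hζ
  rcases hζ with rfl | rfl <;> assumption

theorem Linked.left {c : ℤ} {a b : Ω} (h : Linked G H c a b) : H a ≤ c := by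
  obtain ⟨w, hw⟩ := h; exact hw a w.start_mem_support

theorem Linked.right {c : ℤ} {a b : Ω} (h : Linked G H c a b) : H b ≤ c := h.symm.left

/-- A property that is preserved by the steps of height at most `c` is preserved by the paths
of height at most `c`. -/
theorem Linked.preserves {c : ℤ} {a b : Ω} (h : Linked G H c a b) (S : Ω → Prop)
    (hS : ∀ x y, S x → G.Adj x y → H x ≤ c → H y ≤ c → S y) (ha : S a) : S b := by
  obtain ⟨w, hw⟩ := h
  induction w with
  | nil => exact ha
  | @cons u v t huv w ih =>
    refine ih (hS u v ha huv (hw u (by simp)) (hw v ?_)) (fun ζ hζ => hw ζ (by simp [hζ]))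
    simp [w.start_mem_support]

theorem Linked.map {c : ℤ} {a b : Ω} (φ : G ≃g G) (hφ : ∀ η, H (φ η) = H η)
    (h : Linked G H c a b) : Linked G H c (φ a) (φ b) := by
  obtain ⟨w, hw⟩ := h; refine ⟨w.map φ.toHom, fun ζ hζ => ?_⟩
  rw [SimpleGraph.Walk.support_map] at hζ; obtain ⟨ζ', h1, rfl⟩ := List.mem_map.1 hζ
  exact (hφ ζ').le.trans (hw ζ' h1)

theorem height_le_iff {c : ℤ} {a b : Ω} (w : G.Walk a b) :
    height H w ≤ c ↔ ∀ ζ ∈ w.support, H ζ ≤ c := by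
  have hfin : {h | ∃ ζ ∈ w.support, H ζ = h}.Finite := by
    have : {h | ∃ ζ ∈ w.support, H ζ = h} = H '' {ζ | ζ ∈ w.support} := by
      ext; simp
    rw [this]; exact (List.finite_toSet w.support).image H
  rw [height, csSup_le_iff hfin.bddAbove ⟨H a, a, w.start_mem_support, rfl⟩]
  constructor
  · intro h ζ hζ; exact h _ ⟨ζ, hζ, rfl⟩
  · rintro h _ ⟨ζ, hζ, rfl⟩; exact h ζ hζ

theorem commHeightSets_le_iff {m c : ℤ} (hm : ∀ η, m ≤ H η) (hc : c < 0) {A B : Set Ω} :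
    commHeightSets G H A B ≤ c ↔ ∃ a ∈ A, ∃ b ∈ B, Linked G H c a b := by
  have hb : BddBelow {h | ∃ η ∈ A, ∃ ξ ∈ B, ∃ w : G.Walk η ξ, height H w = h} := by
    refine ⟨m, ?_⟩
    rintro _ ⟨η, -, ξ, -, w, rfl⟩
    exact (hm η).trans ((height_le_iff w).1 le_rfl η w.start_mem_support)
  constructor
  · intro h; rw [commHeightSets] at h; rcases Set.eq_empty_or_nonempty
      {h | ∃ η ∈ A, ∃ ξ ∈ B, ∃ w : G.Walk η ξ, height H w = h} with he | hne
    · rw [he, Int.csInf_empty] at h; omega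
    · obtain ⟨η, hη, ξ, hξ, w, hw⟩ := Int.csInf_mem hne hb
      exact ⟨η, hη, ξ, hξ, w, (height_le_iff w).1 (hw.le.trans h)⟩
  · rintro ⟨a, ha, b, hb', w, hw⟩
    exact (csInf_le hb ⟨a, ha, b, hb', w, rfl⟩).trans ((height_le_iff w).2 hw)

theorem commHeight_le_iff {m c : ℤ} (hm : ∀ η, m ≤ H η) (hc : c < 0) {a b : Ω} :
    commHeight G H a b ≤ c ↔ Linked G H c a b := by
  rw [commHeight, commHeightSets_le_iff hm hc]; simp

theorem groundBarrier_eq {m c : ℤ} (hm : ∀ η, m ≤ H η) (hc : c < 0)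
    (h : ∀ s ∈ groundStates H, ∀ s' ∈ groundStates H, Linked G H c s s')
    {s s' : Ω} (hs : s ∈ groundStates H) (hs' : s' ∈ groundStates H)
    (hn : ¬ Linked G H (c - 1) s s') : groundBarrier G H = c := by
  refine IsGreatest.csSup_eq ⟨⟨s, hs, s', hs', le_antisymm ?_ ?_⟩, ?_⟩
  · exact (commHeight_le_iff hm hc).2 (h s hs s' hs')
  · by_contra hlt
    exact hn ((commHeight_le_iff hm (by omega)).1 (by omega))
  · rintro _ ⟨t, ht, t', ht', rfl⟩; exact (commHeight_le_iff hm hc).2 (h t ht t' ht')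

theorem mem_reachable_iff {m c : ℤ} (hm : ∀ η, m ≤ H η) (hc : c < 0)
    (hb : groundBarrier G H = c) {η : Ω} :
    η ∈ reachable G H ↔ ∃ s ∈ groundStates H, Linked G H c s η := by
  rw [reachable, Set.mem_ofPred_eq, hb, commHeightSets_le_iff hm hc]; simp

/-- Steps inside a set of configurations. -/
abbrev StepIn (G : SimpleGraph Ω) (P : Set Ω) (a b : Ω) : Prop := G.Adj a b ∧ a ∈ P ∧ b ∈ P

theorem stepIn_symm {P : Set Ω} {a b : Ω} (h : ReflTransGen (StepIn G P) a b) :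
    ReflTransGen (StepIn G P) b a := by
  induction h with
  | refl => exact .refl
  | tail _ hxy ih => exact .head ⟨hxy.1.symm, hxy.2.2, hxy.2.1⟩ ih

theorem induce_reachable_iff {P : Set Ω} {a b : Ω} (ha : a ∈ P) (hb : b ∈ P) :
    (G.induce P).Reachable ⟨a, ha⟩ ⟨b, hb⟩ ↔ ReflTransGen (StepIn G P) a b := by
  rw [SimpleGraph.reachable_iff_reflTransGen]
  constructor
  · intro h
    exact ReflTransGen.lift (p := StepIn G P) Subtype.val (fun x y hxy => ⟨hxy, x.2, y.2⟩) _ _ h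
  · intro h
    induction h with
    | refl => exact .refl
    | @tail x y _ hxy ih =>
      exact (ih hxy.2.1).tail (show (G.induce P).Adj ⟨x, hxy.2.1⟩ ⟨y, hb⟩ from hxy.1)

theorem induce_connected_iff {P : Set Ω} : (G.induce P).Connected ↔
      P.Nonempty ∧ ∀ a ∈ P, ∀ b ∈ P, ReflTransGen (StepIn G P) a b := by
  rw [SimpleGraph.connected_iff]
  constructor
  · rintro ⟨h1, ⟨⟨a, ha⟩⟩⟩
    exact ⟨⟨a, ha⟩, fun a ha b hb => (induce_reachable_iff ha hb).1 (h1 _ _)⟩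
  · rintro ⟨⟨a, ha⟩, h⟩
    exact ⟨fun x y => (induce_reachable_iff x.2 y.2).2 (h _ x.2 _ y.2), ⟨⟨a, ha⟩⟩⟩

theorem mem_components {A P : Set Ω} : P ∈ components G A ↔
      ∃ a ∈ A, P = {b | b ∈ A ∧ ReflTransGen (StepIn G A) a b} := by
  have key : ∀ a (ha : a ∈ A), Subtype.val '' ((G.induce A).connectedComponentMk ⟨a, ha⟩).supp =
      {b | b ∈ A ∧ ReflTransGen (StepIn G A) a b} := by
    intro a ha
    ext b
    simp only [Set.mem_image, SimpleGraph.ConnectedComponent.mem_supp_iff,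
      SimpleGraph.ConnectedComponent.eq, Subtype.exists, exists_and_right, exists_eq_right,
      Set.mem_ofPred_eq]
    constructor
    · rintro ⟨hb, h⟩; exact ⟨hb, (induce_reachable_iff ha hb).1 h.symm⟩
    · rintro ⟨hb, h⟩; exact ⟨hb, ((induce_reachable_iff ha hb).2 h).symm⟩
  constructor
  · rintro ⟨C, rfl⟩
    induction C using SimpleGraph.ConnectedComponent.ind with
    | _ v =>
      obtain ⟨a, ha⟩ := v; exact ⟨a, ha, key a ha⟩
  · rintro ⟨a, ha, rfl⟩; exact ⟨(G.induce A).connectedComponentMk ⟨a, ha⟩, (key a ha).symm⟩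

/-- A set of configurations of energy `h` that cannot be left without raising the energy. -/
structure Basin (G : SimpleGraph Ω) (H : Ω → ℤ) (h : ℤ) (A : Set Ω) : Prop where
  energy : ∀ η ∈ A, H η = h
  closed : ∀ η ∈ A, ∀ ξ, G.Adj η ξ → H ξ ≤ h → ξ ∈ A

theorem IsStablePlateau.closed {P : Set Ω} (hP : IsStablePlateau G H P) {η ξ : Ω} (hη : η ∈ P)
    (h : G.Adj η ξ) (hle : H ξ ≤ H η) : ξ ∈ P := by
  by_contra hξ
  have := hP.boundary_higher η hη ξ ⟨hξ, η, hη, h.symm⟩; omega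

theorem IsStablePlateau.mem_of_linked {P : Set Ω} (hP : IsStablePlateau G H P) {η ξ : Ω}
    (hη : η ∈ P) (h : Linked G H (H η) η ξ) : ξ ∈ P := by
  refine h.preserves (· ∈ P) (fun x y hx hxy _ hy => hP.closed hx hxy ?_) hη
  rw [hP.const x hx η hη]; exact hy

theorem IsStablePlateau.energy_eq_of_linked {P : Set Ω} (hP : IsStablePlateau G H P) {η ξ : Ω}
    (hη : η ∈ P) (h : Linked G H (H η) η ξ) : H ξ = H η :=
  hP.const ξ (hP.mem_of_linked hη h) η hη

theorem Basin.component_isStablePlateau {h : ℤ} {A P : Set Ω} (hA : Basin G H h A)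
    (hP : P ∈ components G A) : IsStablePlateau G H P ∧ P ⊆ A := by
  obtain ⟨a, ha, rfl⟩ := mem_components.1 hP; refine ⟨⟨?_, ?_, ?_⟩, fun b hb => hb.1⟩
  · rw [induce_connected_iff]; refine ⟨⟨a, ha, .refl⟩, ?_⟩
    have key : ∀ b, ReflTransGen (StepIn G A) a b → ReflTransGen
          (StepIn G {b | b ∈ A ∧ ReflTransGen (StepIn G A) a b}) a b := by
      intro b hb
      induction hb with
      | refl => exact .refl
      | @tail x y hx hxy ih => exact ih.tail ⟨hxy.1, ⟨hxy.2.1, hx⟩, ⟨hxy.2.2, hx.tail hxy⟩⟩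
    intro b hb c hc; refine ReflTransGen.trans ?_ (key c hc.2); exact stepIn_symm (key b hb.2)
  · intro η hη ξ hξ; rw [hA.energy η hη.1, hA.energy ξ hξ.1]
  · rintro η hη ζ ⟨hζ, ξ, hξ, hadj⟩; rw [hA.energy η hη.1]; by_contra hle
    have hζA := hA.closed ξ hξ.1 ζ hadj.symm (by omega)
    exact hζ ⟨hζA, hξ.2.tail ⟨hadj.symm, hξ.1, hζA⟩⟩

theorem Basin.mem_components_of_mem {h : ℤ} {A P : Set Ω} (hA : Basin G H h A)
    (hP : IsStablePlateau G H P) {η : Ω} (hη : η ∈ P) (hη' : η ∈ A) : P ∈ components G A := by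
  rw [mem_components]; refine ⟨η, hη', ?_⟩; have hPc := (induce_connected_iff.1 hP.connected).2
  ext b
  constructor
  · intro hb; have := hPc η hη b hb
    clear hb
    induction this with
    | refl => exact ⟨hη', .refl⟩
    | @tail x y hx hxy ih =>
      have hy : y ∈ A := by
        refine hA.closed x ih.1 y hxy.1 ?_; rw [hP.const y hxy.2.2 x hxy.2.1, hA.energy x ih.1]
      exact ⟨hy, ih.2.tail ⟨hxy.1, ih.1, hy⟩⟩
  · rintro ⟨hb, hr⟩
    clear hb
    induction hr with
    | refl => exact hη
    | @tail x y hx hxy ih =>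
      refine hP.closed ih hxy.1 ?_; rw [hA.energy x hxy.2.1, hA.energy y hxy.2.2]

theorem Basin.eq_of_connected {h : ℤ} {A P : Set Ω} (hA : Basin G H h A)
    (hc : ∀ a ∈ A, ∀ b ∈ A, ReflTransGen (StepIn G A) a b)
    (hP : IsStablePlateau G H P) {η : Ω} (hη : η ∈ P) (hη' : η ∈ A) : P = A := by
  obtain ⟨a, ha, rfl⟩ := mem_components.1 (hA.mem_components_of_mem hP hη hη')
  ext b; exact ⟨fun hb => hb.1, fun hb => ⟨hb, hc a ha b hb⟩⟩

theorem Basin.isStablePlateau_of_connected {h : ℤ} {A : Set Ω} (hA : Basin G H h A)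
    (hc : ∀ a ∈ A, ∀ b ∈ A, ReflTransGen (StepIn G A) a b) (hne : A.Nonempty) :
    IsStablePlateau G H A := by
  obtain ⟨a, ha⟩ := hne
  have : A ∈ components G A :=
    mem_components.2 ⟨a, ha, by ext b; exact ⟨fun hb => ⟨hb, hc a ha b hb⟩, fun hb => hb.1⟩⟩
  exact (hA.component_isStablePlateau this).1

theorem singleton_connected (η : Ω) :
    ∀ a ∈ ({η} : Set Ω), ∀ b ∈ ({η} : Set Ω), ReflTransGen (StepIn G {η}) a b := by
  rintro a rfl b rfl; exact .refl

/-! ### Symmetries of the landscape -/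

theorem image_reflTransGen (φ : G ≃g G) {P : Set Ω} {a b : Ω} (h : ReflTransGen (StepIn G P) a b) :
    ReflTransGen (StepIn G (φ '' P)) (φ a) (φ b) :=
  ReflTransGen.lift (p := StepIn G (φ '' P)) φ
    (fun x y hxy => ⟨φ.map_adj_iff.2 hxy.1, ⟨x, hxy.2.1, rfl⟩, ⟨y, hxy.2.2, rfl⟩⟩) _ _ h

theorem image_components (φ : G ≃g G) {A P : Set Ω} (h : P ∈ components G A) :
    φ '' P ∈ components G (φ '' A) := by
  obtain ⟨a, ha, rfl⟩ := mem_components.1 h; refine mem_components.2 ⟨φ a, ⟨a, ha, rfl⟩, ?_⟩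
  ext b
  constructor
  · rintro ⟨c, ⟨hc, hr⟩, rfl⟩; exact ⟨⟨c, hc, rfl⟩, image_reflTransGen φ hr⟩
  · rintro ⟨⟨c, hc, rfl⟩, hr⟩; refine ⟨c, ⟨hc, ?_⟩, rfl⟩; have := image_reflTransGen φ.symm hr
    rw [← Set.image_comp] at this; simpa using this

theorem Basin.image (φ : G ≃g G) (hφ : ∀ η, H (φ η) = H η) {h : ℤ} {A : Set Ω}
    (hA : Basin G H h A) : Basin G H h (φ '' A) := by
  constructor
  · rintro _ ⟨η, hη, rfl⟩; rw [hφ, hA.energy η hη]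
  · rintro _ ⟨η, hη, rfl⟩ ξ hadj hle; refine ⟨φ.symm ξ, hA.closed η hη _ ?_ ?_, by simp⟩
    · rw [← φ.map_adj_iff]; simpa using hadj
    · rw [← hφ]; simpa using hle

theorem image_isStablePlateau (φ : G ≃g G) (hφ : ∀ η, H (φ η) = H η) {P : Set Ω}
    (hP : IsStablePlateau G H P) : IsStablePlateau G H (φ '' P) := by
  obtain ⟨⟨η, hη⟩, hc⟩ := induce_connected_iff.1 hP.connected
  have hB : Basin G H (H η) P :=
    ⟨fun ξ hξ => hP.const ξ hξ η hη, fun x hx y hxy hy => hP.closed hx hxy (by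
      rw [hP.const x hx η hη]; exact hy)⟩
  refine (hB.image φ hφ).isStablePlateau_of_connected ?_ ⟨φ η, η, hη, rfl⟩
  rintro _ ⟨a, ha, rfl⟩ _ ⟨b, hb, rfl⟩; exact image_reflTransGen φ (hc a ha b hb)

theorem map_mem_groundStates (φ : G ≃g G) (hφ : ∀ η, H (φ η) = H η) {s : Ω}
    (hs : s ∈ groundStates H) : φ s ∈ groundStates H := by
  intro η; rw [hφ]; exact hs η

end Landscape

namespace Kawasaki

open Landscape Finset Relation

/-! ### Subsets of a cycle: arcs and number of arcs -/

section Cycle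

variable {n : ℕ}

/-- The number of maximal arcs of a proper nonempty subset of the cycle `ZMod n`
(zero for the empty and for the full set). -/
def brk (W : Finset (ZMod n)) : ℕ := (W.filter fun y => y + 1 ∉ W).card

/-- The number of neighbors of `y` in `W`. -/
def nb (W : Finset (ZMod n)) (y : ZMod n) : ℕ :=
  (if y - 1 ∈ W then 1 else 0) + (if y + 1 ∈ W then 1 else 0)

/-- The arc of length `m` starting from `ℓ`. -/
def arc (ℓ : ZMod n) (m : ℕ) : Finset (ZMod n) := (range m).image fun j : ℕ => ℓ + j

theorem natCast_ne_natCast {i j : ℕ} (hi : i < n) (hj : j < n) (h : i ≠ j) : (i : ZMod n) ≠ j := by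
  intro e; rw [ZMod.natCast_eq_natCast_iff'] at e
  rw [Nat.mod_eq_of_lt hi, Nat.mod_eq_of_lt hj] at e; exact h e

theorem add_natCast_inj {a : ZMod n} {i j : ℕ} (h : a + i = a + j) (hi : i < n := by omega)
    (hj : j < n := by omega) : i = j := by
  by_contra hne
  exact natCast_ne_natCast hi hj hne (add_left_cancel h)

theorem natCast_ne_zero {i : ℕ} (hi : i < n) (h : i ≠ 0) : (i : ZMod n) ≠ 0 := by
  have := natCast_ne_natCast hi (Nat.zero_lt_of_lt hi) h; simpa using this

theorem one_ne_zero' (hn : 2 ≤ n := by omega) : (1 : ZMod n) ≠ 0 := by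
  simpa using natCast_ne_zero (n := n) (i := 1) (by omega) (by omega)

theorem two_ne_zero' (hn : 3 ≤ n := by omega) : (2 : ZMod n) ≠ 0 := by
  simpa using natCast_ne_zero (n := n) (i := 2) (by omega) (by omega)

theorem three_ne_zero' (hn : 4 ≤ n) : (3 : ZMod n) ≠ 0 := by
  simpa using natCast_ne_zero (n := n) (i := 3) (by omega) (by omega)

theorem exists_index [NeZero n] (a t : ZMod n) : ∃ i < n, t = a + i :=
  ⟨(t - a).val, ZMod.val_lt _, by simp⟩

theorem mem_arc {ℓ y : ZMod n} {m : ℕ} : y ∈ arc ℓ m ↔ ∃ j < m, y = ℓ + j := by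
  simp only [arc, mem_image, mem_range]
  exact ⟨fun ⟨j, h, e⟩ => ⟨j, h, e.symm⟩, fun ⟨j, h, e⟩ => ⟨j, h, e.symm⟩⟩

theorem mem_arc_index {ℓ : ZMod n} {m i : ℕ} (hi : i < n := by omega) (hm : m ≤ n := by omega) :
    ℓ + i ∈ arc ℓ m ↔ i < m := by
  rw [mem_arc]
  constructor
  · rintro ⟨j, hj, e⟩; have := add_natCast_inj e hi; omega
  · intro h; exact ⟨i, h, rfl⟩

@[simp] theorem arc_zero (ℓ : ZMod n) : arc ℓ 0 = ∅ := by simp [arc]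

theorem arc_one (ℓ : ZMod n) : arc ℓ 1 = {ℓ} := by simp [arc]

theorem arc_full [NeZero n] (ℓ : ZMod n) : arc ℓ n = univ := by
  ext y; simp only [mem_univ, iff_true]; exact mem_arc.2 (exists_index ℓ y)

theorem arc_succ (ℓ : ZMod n) (m : ℕ) : arc ℓ (m + 1) = insert (ℓ + m) (arc ℓ m) := by
  simp [arc, range_add_one]

theorem arc_add (ℓ : ZMod n) (a b : ℕ) : arc ℓ (a + b) = arc ℓ a ∪ arc (ℓ + a) b := by
  induction b with
  | zero => simp
  | succ b ih =>
    rw [← add_assoc, arc_succ, ih, arc_succ, union_insert]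
    push_cast; rw [add_assoc]

theorem arc_succ' (ℓ : ZMod n) (m : ℕ) : arc ℓ (m + 1) = insert ℓ (arc (ℓ + 1) m) := by
  rw [add_comm, arc_add, arc_one]; rw [Nat.cast_one, insert_eq]

theorem arc_mono (ℓ : ZMod n) {a b : ℕ} (h : a ≤ b := by omega) : arc ℓ a ⊆ arc ℓ b := by
  intro y hy; obtain ⟨j, hj, e⟩ := mem_arc.1 hy; exact mem_arc.2 ⟨j, by omega, e⟩

theorem card_arc {ℓ : ZMod n} {m : ℕ} (hm : m ≤ n := by omega) : (arc ℓ m).card = m := by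
  rw [arc, card_image_of_injOn, card_range]; intro i hi j hj e
  simp only [coe_range, Set.mem_Iio] at hi hj; exact add_natCast_inj e

theorem self_ne_add_one (hn : 2 ≤ n) (y : ZMod n) : y + 1 ≠ y := by
  simpa using one_ne_zero' hn

theorem self_ne_sub_one (hn : 2 ≤ n) (y : ZMod n) : y - 1 ≠ y := by
  simpa using one_ne_zero' hn

theorem brk_insert (hn : 2 ≤ n) {W : Finset (ZMod n)} {y : ZMod n} (hy : y ∉ W) :
    brk (insert y W) + nb W y = brk W + 1 := by
  have h1 := self_ne_add_one hn y; have h2 := self_ne_sub_one hn y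
  have key : (insert y W).filter (fun t => t + 1 ∉ insert y W) =
      (if y + 1 ∈ W then ∅ else {y}) ∪ (W.filter fun t => t + 1 ∉ W).erase (y - 1) := by
    ext t
    split_ifs with h
    · simp only [mem_filter, mem_insert, not_or, empty_union, mem_erase]
      constructor
      · rintro ⟨rfl | ht, h3, h4⟩
        · exact absurd h h4
        · exact ⟨fun e => h3 (by rw [e]; ring), ht, h4⟩
      · rintro ⟨h3, h4, h5⟩; exact ⟨Or.inr h4, fun e => h3 (by rw [← e]; ring), h5⟩
    · simp only [mem_filter, mem_insert, not_or, mem_union, mem_singleton, mem_erase]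
      constructor
      · rintro ⟨rfl | ht, h3, h4⟩
        · exact Or.inl rfl
        · exact Or.inr ⟨fun e => h3 (by rw [e]; ring), ht, h4⟩
      · rintro (rfl | ⟨h3, h4, h5⟩)
        · exact ⟨Or.inl rfl, h1, h⟩
        · exact ⟨Or.inr h4, fun e => h3 (by rw [← e]; ring), h5⟩
  have hd : Disjoint (if y + 1 ∈ W then (∅ : Finset (ZMod n)) else {y})
      ((W.filter fun t => t + 1 ∉ W).erase (y - 1)) := by
    split_ifs
    · simp
    · simp [hy]
  unfold brk nb; rw [key, card_union_of_disjoint hd]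
  by_cases h3 : y - 1 ∈ W
  · have h4 : y - 1 ∈ W.filter fun t => t + 1 ∉ W := by simp [h3, hy]
    have h5 := card_erase_add_one h4
    split_ifs <;> simp <;> omega
  · have h4 : y - 1 ∉ W.filter fun t => t + 1 ∉ W := by simp [h3]
    rw [erase_eq_of_notMem h4]
    split_ifs <;> simp <;> omega

theorem nb_erase (hn : 2 ≤ n) (W : Finset (ZMod n)) (y : ZMod n) : nb (W.erase y) y = nb W y := by
  have h1 := self_ne_add_one hn y; have h2 := self_ne_sub_one hn y; simp [nb, h1, h2]

theorem brk_erase (hn : 2 ≤ n) {W : Finset (ZMod n)} {y : ZMod n} (hy : y ∈ W) :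
    brk (W.erase y) + 1 = brk W + nb W y := by
  have := brk_insert hn (notMem_erase y W); rw [insert_erase hy, nb_erase hn] at this; omega

theorem nb_le_two (W : Finset (ZMod n)) (y : ZMod n) : nb W y ≤ 2 := by
  unfold nb; split_ifs <;> omega

theorem brk_insert_le (hn : 2 ≤ n) (W : Finset (ZMod n)) (y : ZMod n) :
    brk (insert y W) ≤ brk W + 1 := by
  by_cases hy : y ∈ W
  · rw [insert_eq_of_mem hy]; omega
  · have := brk_insert hn hy; omega

theorem brk_erase_le (hn : 2 ≤ n) (W : Finset (ZMod n)) (y : ZMod n) :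
    brk (W.erase y) ≤ brk W + 1 := by
  by_cases hy : y ∈ W
  · have := brk_erase hn hy; have := nb_le_two W y; omega
  · rw [erase_eq_of_notMem hy]; omega

/-- Effect on the number of arcs of the exchange of the states of `y` and `y + s`. -/
theorem brk_move {W : Finset (ZMod n)} {y s : ZMod n} (hs : s = 1 ∨ s = -1) (hy : y ∈ W)
    (hy' : y + s ∉ W) (hn : 4 ≤ n := by omega) :
    brk (insert (y + s) (W.erase y)) + (if y + s + s ∈ W then 1 else 0) =
      brk W + (if y - s ∈ W then 1 else 0) := by
  have e1 := brk_erase (by omega) hy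
  have h1 : y + s ∉ W.erase y := fun h => hy' (mem_of_mem_erase h)
  have e2 := brk_insert (by omega) h1; have h2 := two_ne_zero' (n := n)
  have h3 := one_ne_zero' (n := n)
  rcases hs with rfl | rfl
  · have h4 : y + 1 + 1 ≠ y := by
      intro h; apply h2; linear_combination h
    simp [nb, hy', h4] at e1 e2; simp only [mem_erase] at *
    split_ifs at * <;> omega
  · have h4 : y - 1 - 1 ≠ y := by
      intro h; apply h2; linear_combination -h
    rw [← sub_eq_add_neg] at hy'; simp only [← sub_eq_add_neg, sub_neg_eq_add] at *
    simp [nb, hy', h4] at e1 e2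
    split_ifs at * <;> omega

theorem exists_break {W : Finset (ZMod n)} {a : ZMod n} {i j : ℕ} (hij : i < j)
    (hi : a + i ∈ W) (hj : a + j ∉ W) :
    ∃ t, i ≤ t ∧ t < j ∧ a + t ∈ W ∧ a + t + 1 ∉ W := by
  induction j, hij using Nat.le_induction with
  | base => exact ⟨i, le_rfl, by omega, hi, by push_cast at hj; rwa [add_assoc]⟩
  | succ j hij ih =>
    by_cases h : a + j ∈ W
    · exact ⟨j, by omega, by omega, h, by push_cast at hj; rwa [add_assoc]⟩
    · obtain ⟨t, h1, h2, h3⟩ := ih h; exact ⟨t, h1, by omega, h3⟩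

theorem two_le_brk {W : Finset (ZMod n)} {a : ZMod n} {i₁ i₂ i₃ i₄ : ℕ} (h12 : i₁ < i₂)
    (h23 : i₂ < i₃) (h34 : i₃ < i₄) (h4 : i₄ < n) (m1 : a + i₁ ∈ W)
    (m2 : a + i₂ ∉ W) (m3 : a + i₃ ∈ W) (m4 : a + i₄ ∉ W) :
    2 ≤ brk W := by
  obtain ⟨t, t1, t2, t3, t4⟩ := exists_break h12 m1 m2
  obtain ⟨u, u1, u2, u3, u4⟩ := exists_break h34 m3 m4
  have hne : a + t ≠ a + u := fun e => by
    have := add_natCast_inj e; omega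
  rw [← card_pair hne]
  apply card_le_card
  intro z hz
  rcases mem_insert.1 hz with rfl | hz
  · simp [t3, t4]
  · rw [mem_singleton.1 hz]; simp [u3, u4]

theorem three_le_brk {W : Finset (ZMod n)} {a : ZMod n} {i₁ i₂ i₃ i₄ i₅ i₆ : ℕ} (h12 : i₁ < i₂)
    (h23 : i₂ < i₃) (h34 : i₃ < i₄) (h45 : i₄ < i₅) (h56 : i₅ < i₆) (h6 : i₆ < n)
    (m1 : a + i₁ ∈ W) (m2 : a + i₂ ∉ W) (m3 : a + i₃ ∈ W)
    (m4 : a + i₄ ∉ W) (m5 : a + i₅ ∈ W) (m6 : a + i₆ ∉ W) :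
    3 ≤ brk W := by
  obtain ⟨t, t1, t2, t3, t4⟩ := exists_break h12 m1 m2
  obtain ⟨u, u1, u2, u3, u4⟩ := exists_break h34 m3 m4
  obtain ⟨v, v1, v2, v3, v4⟩ := exists_break h56 m5 m6
  have n1 : a + t ≠ a + u := fun e => by
    have := add_natCast_inj e; omega
  have n2 : a + t ≠ a + v := fun e => by
    have := add_natCast_inj e; omega
  have n3 : a + u ≠ a + v := fun e => by
    have := add_natCast_inj e; omega
  have hc : ({a + t, a + u, a + v} : Finset (ZMod n)).card = 3 :=
    card_eq_three.2 ⟨_, _, _, n1, n2, n3, rfl⟩; rw [← hc]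
  apply card_le_card
  intro z hz; simp only [mem_insert, mem_singleton] at hz
  rcases hz with rfl | rfl | rfl
  · simp [t3, t4]
  · simp [u3, u4]
  · simp [v3, v4]

theorem brk_empty : brk (∅ : Finset (ZMod n)) = 0 := by simp [brk]

theorem brk_empty_le : brk (∅ : Finset (ZMod n)) ≤ 1 := by simp [brk]

theorem brk_univ [NeZero n] : brk (univ : Finset (ZMod n)) = 0 := by simp [brk]

theorem brk_eq_zero [NeZero n] {W : Finset (ZMod n)} : brk W = 0 ↔ W = ∅ ∨ W = univ := by
  constructor
  · intro h
    by_contra! hne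
    obtain ⟨a, ha⟩ := hne.1
    have : ∃ b, b ∉ W := by
      by_contra! hb
      exact hne.2 (eq_univ_of_forall hb)
    obtain ⟨b, hb⟩ := this; obtain ⟨i, hi, rfl⟩ := exists_index a b
    have hi0 : 0 < i := by
      rcases Nat.eq_zero_or_pos i with rfl | h
      · simp at hb; exact absurd ha hb
      · exact h
    obtain ⟨t, _, _, h3, h4⟩ := exists_break (a := a) (i := 0) hi0 (by simpa using ha) hb
    rw [brk, card_eq_zero] at h; have : a + t ∈ (W.filter fun y => y + 1 ∉ W) := by simp [h3, h4]
    rw [h] at this; simp at this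
  · rintro (rfl | rfl)
    · exact brk_empty
    · exact brk_univ

theorem one_le_brk [NeZero n] {W : Finset (ZMod n)} (h : W ≠ ∅) (h' : W ≠ univ) : 1 ≤ brk W := by
  by_contra hc
  rcases brk_eq_zero.1 (by omega : brk W = 0) with h1 | h1
  · exact h h1
  · exact h' h1

/-- A proper nonempty subset has an element whose predecessor is missing. -/
theorem exists_start [NeZero n] {W : Finset (ZMod n)} (h : W ≠ ∅) (h' : W ≠ univ) :
    ∃ a ∈ W, a - 1 ∉ W := by
  by_contra! hc
  obtain ⟨a, ha⟩ := nonempty_iff_ne_empty.2 h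
  apply h'
  have : ∀ i : ℕ, a - i ∈ W := by
    intro i
    induction i with
    | zero => simpa using ha
    | succ i ih =>
      have := hc _ ih
      push_cast; rwa [← sub_sub]
  refine eq_univ_of_forall fun b => ?_; have := this (a - b).val; simpa using this

/-- The run of `W` starting from `ℓ`. -/
theorem exists_run {W : Finset (ZMod n)} {ℓ : ZMod n} {N : ℕ} (h : ℓ ∈ W) (hN : ℓ + N ∉ W) :
    ∃ a, 0 < a ∧ a ≤ N ∧ (∀ i < a, ℓ + i ∈ W) ∧ ℓ + a ∉ W := by
  classical
  have hex : ∃ a : ℕ, ℓ + a ∉ W := ⟨N, hN⟩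
  refine ⟨Nat.find hex, ?_, Nat.find_min' hex hN, fun i hi => ?_, Nat.find_spec hex⟩
  · rcases Nat.eq_zero_or_pos (Nat.find hex) with h0 | h0
    · have := Nat.find_spec hex
      rw [h0] at this
      simp at this
      exact absurd h this
    · exact h0
  · have := Nat.find_min hex hi
    simpa using this

theorem sub_one_eq_index [NeZero n] (ℓ : ZMod n) : ℓ + ((n - 1 : ℕ) : ZMod n) = ℓ - 1 := by
  have : 1 ≤ n := NeZero.one_le
  push_cast [Nat.cast_sub this]; simp [sub_eq_add_neg]

theorem eq_arc_of_start [NeZero n] {W : Finset (ZMod n)} (hb : brk W ≤ 1) {ℓ : ZMod n}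
    (hℓ : ℓ ∈ W) (hℓ' : ℓ - 1 ∉ W) : W = arc ℓ W.card := by
  have hn : 1 ≤ n := NeZero.one_le
  obtain ⟨a, ha0, haN, hrun, hend⟩ := exists_run (N := n - 1) hℓ (by rwa [sub_one_eq_index])
  have hW : W = arc ℓ a := by
    ext y
    obtain ⟨i, hi, rfl⟩ := exists_index ℓ y
    rw [mem_arc_index hi]
    constructor
    · intro hy
      by_contra hai
      have h1 : i ≠ a := fun e => hend (e ▸ hy)
      have h2 : i ≠ n - 1 := fun e => hℓ' (by rw [← sub_one_eq_index, ← e]; exact hy)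
      have := two_le_brk (a := ℓ) (i₁ := 0) (i₂ := a) (i₃ := i) (i₄ := n - 1) ha0 (by omega)
        (by omega) (by omega) (by simpa using hℓ) hend hy (by rwa [sub_one_eq_index])
      omega
    · exact hrun i
  conv_lhs => rw [hW]
  rw [hW, card_arc]

theorem exists_eq_arc [NeZero n] {W : Finset (ZMod n)} (hb : brk W ≤ 1) :
    ∃ ℓ, W = arc ℓ W.card := by
  by_cases h : W = ∅
  · exact ⟨0, by simp [h]⟩
  by_cases h' : W = univ
  · refine ⟨0, ?_⟩; rw [h', card_univ, ZMod.card, arc_full]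
  obtain ⟨ℓ, h1, h2⟩ := exists_start h h'; exact ⟨ℓ, eq_arc_of_start hb h1 h2⟩

theorem brk_union_le (A B : Finset (ZMod n)) : brk (A ∪ B) ≤ brk A + brk B := by
  unfold brk; refine le_trans (card_le_card ?_) (card_union_le _ _); intro y
  simp only [mem_filter, mem_union, not_or]
  rintro ⟨h | h, h1, h2⟩
  · exact Or.inl ⟨h, h1⟩
  · exact Or.inr ⟨h, h2⟩

theorem brk_arc_le (ℓ : ZMod n) (m : ℕ) : brk (arc ℓ m) ≤ 1 := by
  unfold brk; rw [card_le_one]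
  have : ∀ y ∈ (arc ℓ m).filter (fun y => y + 1 ∉ arc ℓ m), y = ℓ + ((m - 1 : ℕ) : ZMod n) := by
    intro y hy; obtain ⟨h1, h2⟩ := mem_filter.1 hy; obtain ⟨j, hj, rfl⟩ := mem_arc.1 h1
    by_contra hne
    have hj' : j ≠ m - 1 := fun e => hne (by rw [e])
    exact h2 (mem_arc.2 ⟨j + 1, by omega, by push_cast; ring⟩)
  intro a ha b hb; rw [this a ha, this b hb]

theorem brk_arc [NeZero n] {ℓ : ZMod n} {m : ℕ} (h : 0 < m := by omega)
    (h' : m < n := by omega) : brk (arc ℓ m) = 1 := by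
  refine le_antisymm (brk_arc_le _ _) (one_le_brk ?_ ?_)
  · intro e; have := card_arc (ℓ := ℓ) h'.le; rw [e] at this; simp at this; omega
  · intro e; have := card_arc (ℓ := ℓ) h'.le; rw [e, card_univ, ZMod.card] at this; omega

/-- A set with two arcs, one of which starts from `ℓ`. -/
theorem eq_two_arcs [NeZero n] {W : Finset (ZMod n)} (hb : brk W = 2) {ℓ : ZMod n}
    (hℓ : ℓ ∈ W) (hℓ' : ℓ - 1 ∉ W) :
    ∃ a b c, 0 < a ∧ a < b ∧ 0 < c ∧ b + c < n ∧ W = arc ℓ a ∪ arc (ℓ + b) c := by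
  classical
  have hn : 1 ≤ n := NeZero.one_le
  have hlast : ℓ + ((n - 1 : ℕ) : ZMod n) ∉ W := by rwa [sub_one_eq_index]
  obtain ⟨a, ha0, haN, hrun, hend⟩ := exists_run (N := n - 1) hℓ hlast
  have hex : ∃ b, a < b ∧ b < n ∧ ℓ + b ∈ W := by
    by_contra! hc
    have hW : W = arc ℓ a := by
      ext y
      obtain ⟨i, hi, rfl⟩ := exists_index ℓ y
      rw [mem_arc_index hi]
      constructor
      · intro hy
        by_contra hai
        have h1 : i ≠ a := fun e => hend (e ▸ hy)
        exact hc i (by omega) hi hy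
      · exact hrun i
    have := brk_arc_le ℓ a
    rw [← hW] at this
    omega
  obtain ⟨hab, hbn, hbW⟩ := Nat.find_spec hex
  have hmin : ∀ i, a ≤ i → i < Nat.find hex → ℓ + i ∉ W := by
    intro i h1 h2 h3
    have := Nat.find_min hex h2
    rcases eq_or_lt_of_le h1 with rfl | h1
    · exact hend h3
    · exact this ⟨h1, by omega, h3⟩
  generalize Nat.find hex = b at *
  have hb1 : b ≠ n - 1 := fun e => hlast (e ▸ hbW)
  obtain ⟨c, hc0, hcN, hrun', hend'⟩ := exists_run (N := n - 1 - b) hbW (by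
    rw [add_assoc, ← Nat.cast_add]
    rwa [show b + (n - 1 - b) = n - 1 by omega])
  refine ⟨a, b, c, ha0, hab, hc0, by omega, ?_⟩
  ext y
  obtain ⟨i, hi, rfl⟩ := exists_index ℓ y
  rw [mem_union, mem_arc_index hi]
  have hsecond : ℓ + (i : ZMod n) ∈ arc (ℓ + (b : ZMod n)) c ↔ b ≤ i ∧ i < b + c := by
    rw [mem_arc]
    constructor
    · rintro ⟨j, hj, e⟩
      rw [add_assoc, ← Nat.cast_add] at e
      have := add_natCast_inj e hi
      omega
    · rintro ⟨h1, h2⟩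
      refine ⟨i - b, by omega, ?_⟩
      rw [add_assoc, ← Nat.cast_add]
      congr 2; omega
  rw [hsecond]
  constructor
  · intro hy
    by_contra hne
    push Not at hne
    have h1 : b < i := by
      by_contra h
      have : i ≠ b := by rintro rfl; exact absurd (hne.2 le_rfl) (by omega)
      exact hmin i (by omega) (by omega) hy
    have h2 : i ≠ b + c := by
      rintro rfl
      apply hend'
      rw [add_assoc, ← Nat.cast_add]; exact hy
    have h3 : i ≠ n - 1 := fun e => hlast (e ▸ hy)
    have := hne.2 h1.le
    have := three_le_brk (a := ℓ) (i₁ := 0) (i₂ := a) (i₃ := b) (i₄ := b + c) (i₅ := i)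
      (i₆ := n - 1) ha0 hab (by omega) (by omega) (by omega) (by omega) (by simpa using hℓ) hend
      hbW (by push_cast; rw [← add_assoc]; exact hend') hy hlast
    omega
  · rintro (h | ⟨h1, h2⟩)
    · exact hrun i h
    · have := hrun' (i - b) (by omega)
      rw [add_assoc, ← Nat.cast_add] at this
      rwa [show b + (i - b) = i by omega] at this

/-- No isolated element and no isolated missing element. -/
def Fat (W : Finset (ZMod n)) : Prop := (∀ y ∈ W, 1 ≤ nb W y) ∧ ∀ y, y ∉ W → nb W y ≤ 1

theorem eq_singleton_of_nb_eq_zero [NeZero n] (hn : 2 ≤ n) {W : Finset (ZMod n)} {y : ZMod n}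
    (hy : y ∈ W) (h : nb W y = 0) (hb : brk W ≤ 1) : W = {y} := by
  have h1 := brk_erase hn hy; have h2 : brk (W.erase y) = 0 := by omega
  rcases brk_eq_zero.1 h2 with h3 | h3
  · rw [← insert_erase hy, h3]; rfl
  · have := notMem_erase y W; rw [h3] at this; simp at this

theorem insert_eq_univ_of_nb_eq_two [NeZero n] (hn : 2 ≤ n) {W : Finset (ZMod n)} {y : ZMod n}
    (hy : y ∉ W) (h : nb W y = 2) (hb : brk W ≤ 1) : insert y W = univ := by
  have h1 := brk_insert hn hy; have h2 : brk (insert y W) = 0 := by omega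
  rcases brk_eq_zero.1 h2 with h3 | h3
  · simp at h3
  · exact h3

theorem card_add_one_of_nb_eq_two [NeZero n] (hn : 2 ≤ n) {W : Finset (ZMod n)} {y : ZMod n}
    (hy : y ∉ W) (h : nb W y = 2) (hb : brk W ≤ 1) : W.card + 1 = n := by
  rw [← card_insert_of_notMem hy, insert_eq_univ_of_nb_eq_two hn hy h hb, card_univ, ZMod.card]

theorem fat_of_brk_le_one [NeZero n] {W : Finset (ZMod n)} (hb : brk W ≤ 1) (h1 : W.card ≠ 1)
    (h2 : W.card + 1 ≠ n) (hn : 2 ≤ n := by omega) : Fat W := by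
  constructor
  · intro y hy; by_contra h; have := eq_singleton_of_nb_eq_zero hn hy (by omega) hb; rw [this] at h1
    simp at h1
  · intro y hy; by_contra h; have := nb_le_two W y
    exact h2 (card_add_one_of_nb_eq_two hn hy (by omega) hb)

theorem Fat.brk_le_insert (hn : 2 ≤ n) {W : Finset (ZMod n)} (hW : Fat W) (y : ZMod n) :
    brk W ≤ brk (insert y W) := by
  by_cases hy : y ∈ W
  · rw [insert_eq_of_mem hy]
  · have := brk_insert hn hy; have := hW.2 y hy; omega

theorem Fat.brk_le_erase (hn : 2 ≤ n) {W : Finset (ZMod n)} (hW : Fat W) (y : ZMod n) :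
    brk W ≤ brk (W.erase y) := by
  by_cases hy : y ∈ W
  · have := brk_erase hn hy; have := hW.1 y hy; omega
  · rw [erase_eq_of_notMem hy]

theorem Fat.brk_move {W : Finset (ZMod n)} (hW : Fat W) {y s : ZMod n} (hs : s = 1 ∨ s = -1)
    (hy : y ∈ W) (hy' : y + s ∉ W) (hn : 4 ≤ n := by omega) :
    brk (insert (y + s) (W.erase y)) = brk W + 1 := by
  have h1 := Kawasaki.brk_move hs hy hy' hn; have h2 := hW.1 y hy; have h3 := hW.2 _ hy'
  unfold nb at h2 h3
  rcases hs with rfl | rfl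
  · simp only [hy', if_false, add_sub_cancel_right, hy, if_true] at h2 h3
    split_ifs at * <;> omega
  · rw [← sub_eq_add_neg] at hy'
    simp only [← sub_eq_add_neg, sub_neg_eq_add, hy', if_false, sub_add_cancel, hy, if_true]
      at h1 h2 h3 ⊢
    split_ifs at * <;> omega

end Cycle

/-! ### Columns, rows and the energy -/

section Columns

variable {K L : ℕ}

/-- Finite sets of sites of the torus. -/
abbrev Sites (K L : ℕ) := Finset (ZMod K × ZMod L)

/-- The occupied positions in column `x`. -/
def col (A : Sites K L) (x : ZMod K) : Finset (ZMod L) :=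
  (A.filter fun v => v.1 = x).image Prod.snd

/-- The occupied positions in row `y`. -/
def row (A : Sites K L) (y : ZMod L) : Finset (ZMod K) :=
  (A.filter fun v => v.2 = y).image Prod.fst

@[simp] theorem mem_col {A : Sites K L} {x : ZMod K} {y : ZMod L} : y ∈ col A x ↔ (x, y) ∈ A := by
  simp [col]

@[simp] theorem mem_row {A : Sites K L} {x : ZMod K} {y : ZMod L} : x ∈ row A y ↔ (x, y) ∈ A := by
  simp [row]

theorem ext_col {A B : Sites K L} (h : ∀ x, col A x = col B x) : A = B := by
  ext ⟨x, y⟩; rw [← mem_col, h, mem_col]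

theorem col_insert_self (A : Sites K L) (x : ZMod K) (y : ZMod L) :
    col (insert (x, y) A) x = insert y (col A x) := by
  ext t; simp

theorem col_insert_of_ne (A : Sites K L) {x x' : ZMod K} (y : ZMod L)
    (h : x' ≠ x) : col (insert (x, y) A) x' = col A x' := by
  ext t; simp [h]

theorem col_erase_self (A : Sites K L) (x : ZMod K) (y : ZMod L) :
    col (A.erase (x, y)) x = (col A x).erase y := by
  ext t; simp

theorem col_erase_of_ne (A : Sites K L) {x x' : ZMod K} (y : ZMod L)
    (h : x' ≠ x) : col (A.erase (x, y)) x' = col A x' := by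
  ext t; simp [h]

theorem row_insert_self (A : Sites K L) (x : ZMod K) (y : ZMod L) :
    row (insert (x, y) A) y = insert x (row A y) := by
  ext t; simp

theorem row_insert_of_ne (A : Sites K L) (x : ZMod K) {y y' : ZMod L}
    (h : y' ≠ y) : row (insert (x, y) A) y' = row A y' := by
  ext t; simp [h]

theorem row_erase_self (A : Sites K L) (x : ZMod K) (y : ZMod L) :
    row (A.erase (x, y)) y = (row A y).erase x := by
  ext t; simp

theorem row_erase_of_ne (A : Sites K L) (x : ZMod K) {y y' : ZMod L}
    (h : y' ≠ y) : row (A.erase (x, y)) y' = row A y' := by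
  ext t; simp [h]

theorem circulant_adj {n : ℕ} (hn : 2 ≤ n) {a b : ZMod n} :
    (SimpleGraph.circulantGraph ({1} : Set (ZMod n))).Adj a b ↔ b = a + 1 ∨ b = a - 1 := by
  rw [SimpleGraph.circulantGraph_adj]; have h1 := one_ne_zero' hn; simp only [Set.mem_singleton_iff]
  constructor
  · rintro ⟨-, h | h⟩
    · right; linear_combination -h
    · left; linear_combination h
  · rintro (rfl | rfl)
    · exact ⟨fun h => h1 (by linear_combination -h), by right; ring⟩
    · exact ⟨fun h => h1 (by linear_combination h), by left; ring⟩

theorem torus_adj {u v : ZMod K × ZMod L} (hK : 2 ≤ K := by omega) (hL : 2 ≤ L := by omega) :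
    (torus K L).Adj u v ↔ (u.1 = v.1 ∧ (v.2 = u.2 + 1 ∨ v.2 = u.2 - 1)) ∨
      (u.2 = v.2 ∧ (v.1 = u.1 + 1 ∨ v.1 = u.1 - 1)) := by
  rw [torus, SimpleGraph.boxProd_adj, circulant_adj hK, circulant_adj hL]
  tauto

variable [NeZero K] [NeZero L]

theorem card_eq_sum_col (A : Sites K L) : A.card = ∑ x, (col A x).card := by
  rw [card_eq_sum_card_fiberwise (f := Prod.fst) (t := univ) (by simp)]
  refine sum_congr rfl fun x _ => ?_; rw [col, card_image_of_injOn]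
  rintro ⟨a, b⟩ h ⟨c, d⟩ h' e; simp at h h' e; simp [h.2, h'.2, e]

theorem card_eq_sum_row (A : Sites K L) : A.card = ∑ y, (row A y).card := by
  rw [card_eq_sum_card_fiberwise (f := Prod.snd) (t := univ) (by simp)]
  refine sum_congr rfl fun x _ => ?_; rw [row, card_image_of_injOn]
  rintro ⟨a, b⟩ h ⟨c, d⟩ h' e; simp at h h' e; simp [h.2, h'.2, e]

/-- The number of vertical arcs, summed over all columns. -/
def cB (A : Sites K L) : ℕ := ∑ x, brk (col A x)

/-- The number of horizontal arcs, summed over all rows. -/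
def hB (A : Sites K L) : ℕ := ∑ x, (col A x \ col A (x + 1)).card

theorem cB_eq_card (A : Sites K L) : (A.filter fun v => (v.1, v.2 + 1) ∉ A).card = cB A := by
  rw [card_eq_sum_col, cB]; refine sum_congr rfl fun x _ => ?_; rw [brk]
  congr 1
  ext y; simp

theorem hB_eq_card (A : Sites K L) : (A.filter fun v => (v.1 + 1, v.2) ∉ A).card = hB A := by
  rw [card_eq_sum_col, hB]; refine sum_congr rfl fun x _ => ?_
  congr 1
  ext y; simp

theorem hB_eq_sum_row (A : Sites K L) : hB A = ∑ y, brk (row A y) := by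
  rw [← hB_eq_card, card_eq_sum_row]; refine sum_congr rfl fun x _ => ?_; rw [brk]
  congr 1
  ext y; simp

theorem energy_eq {N₀ : ℕ} (hK : 3 ≤ K) (hL : 3 ≤ L) (η : Config K L N₀) :
    energy η = H₀ L N₀ + (cB η.1 + hB η.1 : ℤ) - L := by
  obtain ⟨A, hA⟩ := η
  set E₁ := (A.filter fun v => (v.1, v.2 + 1) ∈ A).image fun v => s(v, (v.1, v.2 + 1)) with hE₁
  set E₂ := (A.filter fun v => (v.1 + 1, v.2) ∈ A).image fun v => s(v, (v.1 + 1, v.2)) with hE₂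
  have k1 := one_ne_zero' (n := K); have k2 := two_ne_zero' (n := K)
  have l1 := one_ne_zero' (n := L); have l2 := two_ne_zero' (n := L)
  have hset : {e | e ∈ (torus K L).edgeSet ∧ ∀ x ∈ e, x ∈ occ (⟨A, hA⟩ : Config K L N₀)} =
      ((E₁ ∪ E₂ : Finset (Sym2 (ZMod K × ZMod L))) : Set (Sym2 (ZMod K × ZMod L))) := by
    ext e
    induction e using Sym2.ind with
    | _ u v =>
      simp only [Set.mem_ofPred_eq, SimpleGraph.mem_edgeSet, Sym2.mem_iff, forall_eq_or_imp,
        forall_eq, occ, mem_coe, mem_union, hE₁, hE₂, mem_image,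
        mem_filter, torus_adj (by omega : 2 ≤ K) (by omega : 2 ≤ L)]; obtain ⟨a, b⟩ := u
      obtain ⟨c, d⟩ := v
      constructor
      · rintro ⟨⟨h, h' | h'⟩ | ⟨h, h' | h'⟩, hu, hv⟩
        · simp only at h h'; subst h h'; exact Or.inl ⟨(a, b), ⟨hu, hv⟩, rfl⟩
        · simp only at h h'; subst h h'
          exact Or.inl ⟨(a, b - 1), ⟨hv, by simpa using hu⟩, by simp [Sym2.eq_swap]⟩
        · simp only at h h'; subst h h'; exact Or.inr ⟨(a, b), ⟨hu, hv⟩, rfl⟩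
        · simp only at h h'; subst h h'
          exact Or.inr ⟨(a - 1, b), ⟨hv, by simpa using hu⟩, by simp [Sym2.eq_swap]⟩
      · rintro (⟨⟨x, y⟩, ⟨h1, h2⟩, h⟩ | ⟨⟨x, y⟩, ⟨h1, h2⟩, h⟩)
        · rcases Sym2.eq_iff.1 h with ⟨h3, h4⟩ | ⟨h3, h4⟩ <;>
            simp only [Prod.mk.injEq] at h3 h4 <;> obtain ⟨rfl, rfl⟩ := h3 <;>
            obtain ⟨rfl, rfl⟩ := h4 <;> simp [h1, h2]
        · rcases Sym2.eq_iff.1 h with ⟨h3, h4⟩ | ⟨h3, h4⟩ <;>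
            simp only [Prod.mk.injEq] at h3 h4 <;> obtain ⟨rfl, rfl⟩ := h3 <;>
            obtain ⟨rfl, rfl⟩ := h4 <;> simp [h1, h2]
  have hdisj : Disjoint E₁ E₂ := by
    rw [disjoint_left]; intro e h1 h2; obtain ⟨⟨x, y⟩, -, rfl⟩ := mem_image.1 h1
    obtain ⟨⟨x', y'⟩, -, h⟩ := mem_image.1 h2
    rcases Sym2.eq_iff.1 h with ⟨h3, h4⟩ | ⟨h3, h4⟩ <;> simp only [Prod.mk.injEq] at h3 h4
    · exact l1 (by linear_combination h3.2 - h4.2)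
    · exact l1 (by linear_combination h4.2 - h3.2)
  have hc₁ : E₁.card = (A.filter fun v => (v.1, v.2 + 1) ∈ A).card := by
    apply card_image_of_injOn
    rintro ⟨x, y⟩ - ⟨x', y'⟩ - h
    rcases Sym2.eq_iff.1 h with ⟨h3, h4⟩ | ⟨h3, h4⟩
    · exact h3
    · simp only [Prod.mk.injEq] at h3 h4
      exact absurd (by linear_combination h4.2 - h3.2 : (2 : ZMod L) = 0) l2
  have hc₂ : E₂.card = (A.filter fun v => (v.1 + 1, v.2) ∈ A).card := by
    apply card_image_of_injOn
    rintro ⟨x, y⟩ - ⟨x', y'⟩ - h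
    rcases Sym2.eq_iff.1 h with ⟨h3, h4⟩ | ⟨h3, h4⟩
    · exact h3
    · simp only [Prod.mk.injEq] at h3 h4
      exact absurd (by linear_combination h4.1 - h3.1 : (2 : ZMod K) = 0) k2
  have s₁ := card_filter_add_card_filter_not (s := A) fun v => (v.1, v.2 + 1) ∈ A
  have s₂ := card_filter_add_card_filter_not (s := A) fun v => (v.1 + 1, v.2) ∈ A
  rw [cB_eq_card] at s₁; rw [hB_eq_card] at s₂
  rw [energy, hset, Set.ncard_coe_finset, card_union_of_disjoint hdisj, hc₁, hc₂, H₀]; simp only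
  have hA' : (A.card : ℤ) = L * N₀ := by exact_mod_cast hA
  zify at s₁ s₂
  push_cast
  linarith

/-! ### Exchanges -/

end Columns

section Exchange

variable {K L : ℕ}

/-- The result of moving the particle at `p` to `q`. -/
def mv (A : Sites K L) (p q : ZMod K × ZMod L) : Sites K L :=
  insert q (A.erase p)

theorem card_mv {A : Sites K L} {p q : ZMod K × ZMod L} (hp : p ∈ A) (hq : q ∉ A) :
    (mv A p q).card = A.card := by
  have h : q ∉ A.erase p := fun h => hq (mem_of_mem_erase h)
  rw [mv, card_insert_of_notMem h, card_erase_add_one hp]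

theorem isExchange_iff {N₀ : ℕ} {x y : ZMod K × ZMod L} {η ξ : Config K L N₀} :
    IsExchange x y η ξ ↔ (torus K L).Adj x y ∧
      ((x ∈ η.1 ∧ y ∉ η.1 ∧ ξ.1 = mv η.1 x y) ∨ (y ∈ η.1 ∧ x ∉ η.1 ∧ ξ.1 = mv η.1 y x)) := by
  have hocc : occ ξ = Equiv.swap x y '' occ η ↔ ∀ v, v ∈ ξ.1 ↔ Equiv.swap x y v ∈ η.1 := by
    rw [Set.ext_iff]; refine forall_congr' fun v => ?_; rw [Set.mem_image_equiv, Equiv.symm_swap]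
    simp [occ]
  rw [IsExchange, hocc]; refine and_congr_right fun hxy => ?_; have hne : x ≠ y := hxy.ne
  have key : ∀ a b : ZMod K × ZMod L, a ≠ b → a ∈ η.1 → b ∉ η.1 →
      ((∀ v, v ∈ ξ.1 ↔ Equiv.swap a b v ∈ η.1) ↔ ξ.1 = mv η.1 a b) := by
    intro a b hab ha hb; rw [Finset.ext_iff]; refine forall_congr' fun v => ?_
    rw [mv, mem_insert, mem_erase]
    by_cases h1 : v = a
    · subst h1; simp [hb, hab]
    by_cases h2 : v = b
    · subst h2; simp [ha]
    rw [Equiv.swap_apply_of_ne_of_ne h1 h2]; simp [h1, h2]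
  constructor
  · rintro ⟨h1, h2⟩
    by_cases hx : x ∈ η.1 <;> by_cases hy : y ∈ η.1
    · refine absurd (Subtype.ext (ext fun v => ?_)) h1; rw [h2]
      by_cases h3 : v = x
      · subst h3; simp [hx, hy]
      by_cases h4 : v = y
      · subst h4; simp [hx, hy]
      rw [Equiv.swap_apply_of_ne_of_ne h3 h4]
    · exact Or.inl ⟨hx, hy, (key x y hne hx hy).1 h2⟩
    · exact Or.inr ⟨hy, hx, (key y x hne.symm hy hx).1 (by rwa [Equiv.swap_comm])⟩
    · refine absurd (Subtype.ext (ext fun v => ?_)) h1; rw [h2]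
      by_cases h3 : v = x
      · subst h3; simp [hx, hy]
      by_cases h4 : v = y
      · subst h4; simp [hx, hy]
      rw [Equiv.swap_apply_of_ne_of_ne h3 h4]
  · rintro (⟨hx, hy, h⟩ | ⟨hy, hx, h⟩)
    · refine ⟨fun e => ?_, (key x y hne hx hy).2 h⟩; rw [e] at h; exact hy (by rw [h]; simp [mv])
    · refine ⟨fun e => ?_, ?_⟩
      · rw [e] at h; exact hx (by rw [h]; simp [mv])
      · rw [Equiv.swap_comm]; exact (key y x hne.symm hy hx).2 h

theorem graph_adj {N₀ : ℕ} {η ξ : Config K L N₀} : (graph K L N₀).Adj η ξ ↔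
      ∃ p q, (torus K L).Adj p q ∧ p ∈ η.1 ∧ q ∉ η.1 ∧ ξ.1 = mv η.1 p q := by
  constructor
  · rintro ⟨x, y, h⟩; obtain ⟨h1, h2 | h2⟩ := isExchange_iff.1 h
    · exact ⟨x, y, h1, h2⟩
    · exact ⟨y, x, h1.symm, h2⟩
  · rintro ⟨p, q, h1, h2⟩; exact ⟨p, q, isExchange_iff.2 ⟨h1, Or.inl h2⟩⟩

/-- Every exchange is vertical or horizontal. -/
theorem exists_move {N₀ : ℕ} {η ξ : Config K L N₀} (h : (graph K L N₀).Adj η ξ)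
    (hK : 2 ≤ K := by omega) (hL : 2 ≤ L := by omega) :
    (∃ x y s, (s = 1 ∨ s = -1) ∧ (x, y) ∈ η.1 ∧ (x, y + s) ∉ η.1 ∧ ξ.1 = mv η.1 (x, y) (x, y + s)) ∨
    (∃ x y s, (s = 1 ∨ s = -1) ∧ (x, y) ∈ η.1 ∧ (x + s, y) ∉ η.1 ∧
      ξ.1 = mv η.1 (x, y) (x + s, y)) := by
  obtain ⟨⟨x, y⟩, ⟨x', y'⟩, h1, h2, h3, h4⟩ := graph_adj.1 h
  rcases (torus_adj hK hL).1 h1 with ⟨e, e' | e'⟩ | ⟨e, e' | e'⟩ <;> simp only at e e' <;>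
    subst e e'
  · exact Or.inl ⟨x, y, 1, Or.inl rfl, h2, h3, h4⟩
  · exact Or.inl ⟨x, y, -1, Or.inr rfl, h2, by rwa [← sub_eq_add_neg], by rwa [← sub_eq_add_neg]⟩
  · exact Or.inr ⟨x, y, 1, Or.inl rfl, h2, h3, h4⟩
  · exact Or.inr ⟨x, y, -1, Or.inr rfl, h2, by rwa [← sub_eq_add_neg], by rwa [← sub_eq_add_neg]⟩

theorem col_mv_vertical (A : Sites K L) (x : ZMod K) (y y' : ZMod L) :
    col (mv A (x, y) (x, y')) x = insert y' ((col A x).erase y) := by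
  rw [mv, col_insert_self, col_erase_self]

theorem col_mv_vertical_of_ne (A : Sites K L) {x x' : ZMod K} (y y' : ZMod L)
    (h : x' ≠ x) : col (mv A (x, y) (x, y')) x' = col A x' := by
  rw [mv, col_insert_of_ne _ _ h, col_erase_of_ne _ _ h]

theorem col_mv_source (A : Sites K L) {x x' : ZMod K} (y : ZMod L) (h : x ≠ x') :
    col (mv A (x, y) (x', y)) x = (col A x).erase y := by
  rw [mv, col_insert_of_ne _ _ h, col_erase_self]

theorem col_mv_target (A : Sites K L) {x x' : ZMod K} (y : ZMod L) (h : x ≠ x') :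
    col (mv A (x, y) (x', y)) x' = insert y (col A x') := by
  rw [mv, col_insert_self, col_erase_of_ne _ _ h.symm]

theorem col_mv_other (A : Sites K L) {x x' x'' : ZMod K} (y : ZMod L)
    (h : x'' ≠ x) (h' : x'' ≠ x') : col (mv A (x, y) (x', y)) x'' = col A x'' := by
  rw [mv, col_insert_of_ne _ _ h', col_erase_of_ne _ _ h]

theorem row_mv_horizontal (A : Sites K L) (x x' : ZMod K) (y : ZMod L) :
    row (mv A (x, y) (x', y)) y = insert x' ((row A y).erase x) := by
  rw [mv, row_insert_self, row_erase_self]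

theorem row_mv_horizontal_of_ne (A : Sites K L) (x x' : ZMod K) {y y' : ZMod L}
    (h : y' ≠ y) : row (mv A (x, y) (x', y)) y' = row A y' := by
  rw [mv, row_insert_of_ne _ _ h, row_erase_of_ne _ _ h]

theorem sum_eq_of_one {ι : Type*} [Fintype ι] [DecidableEq ι] {f g : ι → ℕ} (a : ι)
    (h : ∀ b, b ≠ a → f b = g b) : (∑ i, f i) + g a = (∑ i, g i) + f a := by
  rw [← add_sum_erase _ f (mem_univ a), ← add_sum_erase _ g (mem_univ a)]
  have : ∑ i ∈ univ.erase a, f i = ∑ i ∈ univ.erase a, g i :=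
    sum_congr rfl fun b hb => h b (ne_of_mem_erase hb); omega

theorem sum_eq_of_two {ι : Type*} [Fintype ι] [DecidableEq ι] {f g : ι → ℕ} {a a' : ι}
    (haa : a ≠ a') (h : ∀ b, b ≠ a → b ≠ a' → f b = g b) :
    (∑ i, f i) + g a + g a' = (∑ i, g i) + f a + f a' := by
  have h1 := mem_erase.2 ⟨haa.symm, mem_univ a'⟩
  rw [← add_sum_erase _ f (mem_univ a), ← add_sum_erase _ g (mem_univ a),
    ← add_sum_erase _ f h1, ← add_sum_erase _ g h1]
  have : ∑ i ∈ (univ.erase a).erase a', f i = ∑ i ∈ (univ.erase a).erase a', g i :=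
    sum_congr rfl fun b hb => h b (by simp at hb; exact hb.2) (by simp at hb; exact hb.1); omega

variable [NeZero K] [NeZero L]

theorem cB_mv_vertical (A : Sites K L) (x : ZMod K) (y y' : ZMod L) :
    cB (mv A (x, y) (x, y')) + brk (col A x) = cB A + brk (insert y' ((col A x).erase y)) := by
  rw [← col_mv_vertical]; exact sum_eq_of_one (f := fun t => brk (col (mv A (x, y) (x, y')) t))
    (g := fun t => brk (col A t)) x
    fun b hb => by rw [col_mv_vertical_of_ne _ _ _ hb]

theorem cB_mv_horizontal (A : Sites K L) {x x' : ZMod K} (h : x ≠ x') (y : ZMod L) :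
    cB (mv A (x, y) (x', y)) + brk (col A x) + brk (col A x') =
      cB A + brk ((col A x).erase y) + brk (insert y (col A x')) := by
  rw [← col_mv_source _ _ h, ← col_mv_target _ _ h]
  exact sum_eq_of_two (f := fun t => brk (col (mv A (x, y) (x', y)) t))
    (g := fun t => brk (col A t)) h
    fun b hb hb' => by rw [col_mv_other _ _ hb hb']

theorem hB_mv_horizontal (A : Sites K L) (x x' : ZMod K) (y : ZMod L) :
    hB (mv A (x, y) (x', y)) + brk (row A y) = hB A + brk (insert x' ((row A y).erase x)) := by
  rw [← row_mv_horizontal, hB_eq_sum_row, hB_eq_sum_row]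
  exact sum_eq_of_one (f := fun t => brk (row (mv A (x, y) (x', y)) t))
    (g := fun t => brk (row A t)) y
    fun b hb => by rw [row_mv_horizontal_of_ne _ _ _ hb]

theorem card_col_mv_vertical {A : Sites K L} {x : ZMod K} {y y' : ZMod L}
    (h : (x, y) ∈ A) (h' : (x, y') ∉ A) (x' : ZMod K) :
    (col (mv A (x, y) (x, y')) x').card = (col A x').card := by
  by_cases hx : x' = x
  · subst hx
    rw [col_mv_vertical, card_insert_of_notMem (by simp [h']),
      card_erase_add_one (by simpa using h)]
  · rw [col_mv_vertical_of_ne _ _ _ hx]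

theorem cB_insert_le (hL : 2 ≤ L) (A : Sites K L) (v : ZMod K × ZMod L) :
    cB (insert v A) ≤ cB A + 1 := by
  obtain ⟨x, y⟩ := v
  have := sum_eq_of_one (f := fun t => brk (col (insert (x, y) A) t)) (g := fun t => brk (col A t)) x
    fun b hb => by rw [col_insert_of_ne _ _ hb]
  simp only [col_insert_self] at this; have h2 := brk_insert_le hL (col A x) y; simp only [cB]
  omega

theorem hB_insert_le (hK : 2 ≤ K) (A : Sites K L) (v : ZMod K × ZMod L) :
    hB (insert v A) ≤ hB A + 1 := by
  obtain ⟨x, y⟩ := v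
  have := sum_eq_of_one (f := fun t => brk (row (insert (x, y) A) t)) (g := fun t => brk (row A t)) y
    fun b hb => by rw [row_insert_of_ne _ _ hb]
  simp only [row_insert_self] at this; have h2 := brk_insert_le hK (row A y) x
  rw [hB_eq_sum_row, hB_eq_sum_row]; omega

theorem cB_erase_le (hL : 2 ≤ L) (A : Sites K L) (v : ZMod K × ZMod L) :
    cB (A.erase v) ≤ cB A + 1 := by
  obtain ⟨x, y⟩ := v
  have := sum_eq_of_one (f := fun t => brk (col (A.erase (x, y)) t)) (g := fun t => brk (col A t)) x
    fun b hb => by rw [col_erase_of_ne _ _ hb]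
  simp only [col_erase_self] at this; have h2 := brk_erase_le hL (col A x) y; simp only [cB]; omega

theorem hB_erase_le (hK : 2 ≤ K) (A : Sites K L) (v : ZMod K × ZMod L) :
    hB (A.erase v) ≤ hB A + 1 := by
  obtain ⟨x, y⟩ := v
  have := sum_eq_of_one (f := fun t => brk (row (A.erase (x, y)) t)) (g := fun t => brk (row A t)) y
    fun b hb => by rw [row_erase_of_ne _ _ hb]
  simp only [row_erase_self] at this; have h2 := brk_erase_le hK (row A y) x
  rw [hB_eq_sum_row, hB_eq_sum_row]; omega

end Exchange

variable {K L N₀ : ℕ} [NeZero K] [NeZero L]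

/-! ### Unimodal sets: the columns grow up to a full column and then decrease -/

section Unimodal

theorem sum_frame (z : ZMod K) (g : ZMod K → ℕ) : ∑ x, g x = ∑ j ∈ range K, g (z + j) := by
  symm; refine sum_bij (fun j _ => z + j) (by simp) ?_ ?_ (by simp)
  · intro i hi j hj e; exact add_natCast_inj e (mem_range.1 hi) (mem_range.1 hj)
  · intro x _; obtain ⟨j, hj, e⟩ := exists_index z x; exact ⟨j, mem_range.2 hj, e.symm⟩

theorem card_sdiff_add_card_comm {α : Type*} [DecidableEq α] (s t : Finset α) :
    (s \ t).card + t.card = s.card + (t \ s).card := by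
  rw [card_sdiff_add_card, union_comm, ← card_sdiff_add_card, add_comm]

theorem telescope {α : Type*} [DecidableEq α] (w : ℕ → Finset α) {f m : ℕ} (h : f ≤ m) :
    ∑ j ∈ Ico f m, (w j \ w (j + 1)).card + (w m).card =
      (w f).card + ∑ j ∈ Ico f m, (w (j + 1) \ w j).card := by
  induction m, h using Nat.le_induction with
  | base => simp
  | succ m hm ih =>
    rw [sum_Ico_succ_top hm, sum_Ico_succ_top hm]
    have := card_sdiff_add_card_comm (w m) (w (m + 1)); omega

theorem hB_frame (A : Sites K L) {z : ZMod K} {f : ℕ} (hz : col A z = ∅)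
    (hf : col A (z + f) = univ) (hfK : f < K) :
    hB A = L + ∑ j ∈ range f, (col A (z + j) \ col A (z + ((j + 1 : ℕ) : ZMod K))).card +
      ∑ j ∈ Ico f K, (col A (z + ((j + 1 : ℕ) : ZMod K)) \ col A (z + j)).card := by
  have h1 := telescope (fun j => col A (z + j)) hfK.le
  simp only [hf, CharP.cast_eq_zero, add_zero, hz, card_empty, card_univ, ZMod.card] at h1
  rw [hB, sum_frame z, ← sum_range_add_sum_Ico _ hfK.le]
  have h2 : ∀ j : ℕ, z + j + 1 = z + ((j + 1 : ℕ) : ZMod K) := fun j => by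
    push_cast; ring
  simp only [h2]; omega

/-- Unimodality with respect to the empty columns `z - 1`, `z` and the full column `z + f`. -/
structure Uni (A : Sites K L) (z : ZMod K) (f : ℕ) : Prop where
  zero : col A z = ∅
  last : col A (z - 1) = ∅
  full : col A (z + f) = univ
  lt : f < K
  mono : ∀ j < f, col A (z + j) ⊆ col A (z + ((j + 1 : ℕ) : ZMod K))
  anti : ∀ j, f ≤ j → j < K → col A (z + ((j + 1 : ℕ) : ZMod K)) ⊆ col A (z + j)

theorem Uni.hB_eq {A : Sites K L} {z : ZMod K} {f : ℕ} (h : Uni A z f) : hB A = L := by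
  have h1 : ∑ j ∈ range f, (col A (z + j) \ col A (z + ((j + 1 : ℕ) : ZMod K))).card = 0 :=
    sum_eq_zero fun j hj => by
      rw [sdiff_eq_empty_iff_subset.2 (h.mono j (mem_range.1 hj)), card_empty]
  have h2 : ∑ j ∈ Ico f K, (col A (z + ((j + 1 : ℕ) : ZMod K)) \ col A (z + j)).card = 0 :=
    sum_eq_zero fun j hj => by
      rw [mem_Ico] at hj; rw [sdiff_eq_empty_iff_subset.2 (h.anti j hj.1 hj.2), card_empty]
  rw [hB_frame A h.zero h.full h.lt, h1, h2, add_zero, add_zero]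

theorem uni_of_hB_eq {A : Sites K L} {z : ZMod K} {f : ℕ} (hz : col A z = ∅)
    (hz' : col A (z - 1) = ∅) (hf : col A (z + f) = univ) (hfK : f < K)
    (h : hB A = L) : Uni A z f := by
  rw [hB_frame A hz hf hfK] at h
  have h1 : ∑ j ∈ range f, (col A (z + j) \ col A (z + ((j + 1 : ℕ) : ZMod K))).card = 0 := by omega
  have h2 : ∑ j ∈ Ico f K, (col A (z + ((j + 1 : ℕ) : ZMod K)) \ col A (z + j)).card = 0 := by omega
  rw [sum_eq_zero_iff] at h1 h2; refine ⟨hz, hz', hf, hfK, fun j hj => ?_, fun j hj hj' => ?_⟩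
  · have := h1 j (mem_range.2 hj); rwa [card_eq_zero, sdiff_eq_empty_iff_subset] at this
  · have := h2 j (mem_Ico.2 ⟨hj, hj'⟩); rwa [card_eq_zero, sdiff_eq_empty_iff_subset] at this

theorem Uni.mono_le {A : Sites K L} {z : ZMod K} {f : ℕ} (h : Uni A z f) {i j : ℕ}
    (hij : i ≤ j) (hj : j ≤ f) : col A (z + i) ⊆ col A (z + j) := by
  induction j, hij using Nat.le_induction with
  | base => exact subset_rfl
  | succ j hij ih => exact (ih (by omega)).trans (h.mono j (by omega))

theorem Uni.anti_le {A : Sites K L} {z : ZMod K} {f : ℕ} (h : Uni A z f) {i j : ℕ}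
    (hi : f ≤ i) (hij : i ≤ j) (hj : j ≤ K) :
    col A (z + j) ⊆ col A (z + i) := by
  induction j, hij using Nat.le_induction with
  | base => exact subset_rfl
  | succ j hij ih => exact (h.anti j (by omega) (by omega)).trans (ih (by omega))

/-- The profile of `mk`. -/
def prof (a : ℕ) (Z W₁ W₂ W₃ : Finset (ZMod L)) (j : ℕ) : Finset (ZMod L) :=
  if j = 1 then Z else if 2 ≤ j ∧ j ≤ a + 1 then univ else if j = a + 2 then W₁ else
    if j = a + 3 then W₂ else if j = a + 4 then W₃ else ∅

/-- Full columns `k, …, k + a - 1`, with `Z` in column `k - 1` and `W₁`, `W₂`, `W₃` in the columns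
`k + a`, `k + a + 1`, `k + a + 2`. -/
def mk (k : ZMod K) (a : ℕ) (Z W₁ W₂ W₃ : Finset (ZMod L)) : Sites K L :=
  univ.filter fun v => v.2 ∈ prof a Z W₁ W₂ W₃ (v.1 - (k - 2)).val

variable {k : ZMod K} {a : ℕ} {Z W₁ W₂ W₃ : Finset (ZMod L)}

theorem col_mk (x : ZMod K) : col (mk k a Z W₁ W₂ W₃) x = prof a Z W₁ W₂ W₃ (x - (k - 2)).val := by
  ext y; simp [mk]

theorem col_mk_index {j : ℕ} (hj : j < K := by omega) :
    col (mk k a Z W₁ W₂ W₃) (k - 2 + j) = prof a Z W₁ W₂ W₃ j := by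
  rw [col_mk, add_sub_cancel_left, ZMod.val_natCast_of_lt hj]

theorem sum_prof {F : Finset (ZMod L) → ℕ} (hF : F ∅ = 0) (ha : a + 5 ≤ K) :
    ∑ j ∈ range K, F (prof a Z W₁ W₂ W₃ j) = F Z + a * F univ + F W₁ + F W₂ + F W₃ := by
  obtain ⟨r, rfl⟩ := Nat.exists_eq_add_of_le ha
  rw [show a + 5 + r = 2 + (a + (3 + r)) by ring, sum_range_add, sum_range_add, sum_range_add]
  have h0 : ∑ x ∈ range 2, F (prof a Z W₁ W₂ W₃ x) = F Z := by
    simp [sum_range_succ, prof, hF]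
  have h1 : ∑ x ∈ range a, F (prof a Z W₁ W₂ W₃ (2 + x)) = a * F univ := by
    rw [sum_congr rfl (g := fun _ => F univ)]
    · simp
    · intro x hx; have := mem_range.1 hx; rw [prof, if_neg (by omega), if_pos (by omega)]
  have h2 : ∑ x ∈ range 3, F (prof a Z W₁ W₂ W₃ (2 + (a + x))) = F W₁ + F W₂ + F W₃ := by
    have e : ∀ i < 3, prof a Z W₁ W₂ W₃ (2 + (a + i)) = if i = 0 then W₁ else
        if i = 1 then W₂ else W₃ := by
      intro i hi; rw [prof, if_neg (by omega), if_neg (by omega)]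
      interval_cases i
      · rw [if_pos (by omega)]; rfl
      · rw [if_neg (by omega), if_pos (by omega)]; rfl
      · rw [if_neg (by omega), if_neg (by omega), if_pos (by omega)]; rfl
    rw [sum_congr rfl fun i hi => by rw [e i (mem_range.1 hi)]]; simp [sum_range_succ]
  have h3 : ∑ x ∈ range r, F (prof a Z W₁ W₂ W₃ (2 + (a + (3 + x)))) = 0 := by
    refine sum_eq_zero fun x _ => ?_
    rw [prof, if_neg (by omega), if_neg (by omega), if_neg (by omega), if_neg (by omega),
      if_neg (by omega), hF]
  rw [h0, h1, h2, h3]; ring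

theorem sum_col_mk {F : Finset (ZMod L) → ℕ} (hF : F ∅ = 0) (ha : a + 5 ≤ K) :
    ∑ x, F (col (mk k a Z W₁ W₂ W₃) x) = F Z + a * F univ + F W₁ + F W₂ + F W₃ := by
  rw [sum_frame (k - 2), ← sum_prof hF ha]
  exact sum_congr rfl fun j hj => by rw [col_mk_index (mem_range.1 hj)]

theorem cB_mk (ha : a + 5 ≤ K := by omega) :
    cB (mk k a Z W₁ W₂ W₃) = brk Z + brk W₁ + brk W₂ + brk W₃ := by
  rw [cB, sum_col_mk brk_empty ha, brk_univ]; ring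

theorem card_mk (ha : a + 5 ≤ K := by omega) :
    (mk k a Z W₁ W₂ W₃).card = a * L + Z.card + W₁.card + W₂.card + W₃.card := by
  rw [card_eq_sum_col, sum_col_mk card_empty ha, card_univ, ZMod.card]; ring

theorem uni_mk (ha : 1 ≤ a) (haK : a + 6 ≤ K) (h12 : W₂ ⊆ W₁) (h23 : W₃ ⊆ W₂) {f : ℕ}
    (hf : 2 ≤ f := by omega) (hf' : f ≤ a + 1 := by omega) : Uni (mk k a Z W₁ W₂ W₃) (k - 2) f := by
  have e0 : prof a Z W₁ W₂ W₃ 0 = ∅ := by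
    rw [prof, if_neg (by omega), if_neg (by omega), if_neg (by omega), if_neg (by omega),
      if_neg (by omega)]
  have elarge : ∀ j, a + 5 ≤ j → prof a Z W₁ W₂ W₃ j = ∅ := fun j hj => by
    rw [prof, if_neg (by omega), if_neg (by omega), if_neg (by omega), if_neg (by omega),
      if_neg (by omega)]
  have efull : ∀ j, 2 ≤ j → j ≤ a + 1 → prof a Z W₁ W₂ W₃ j = univ := fun j h h' => by
    rw [prof, if_neg (by omega), if_pos (by omega)]
  have e1 : prof a Z W₁ W₂ W₃ (a + 2) = W₁ := by
    rw [prof, if_neg (by omega), if_neg (by omega), if_pos rfl]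
  have e2 : prof a Z W₁ W₂ W₃ (a + 3) = W₂ := by
    rw [prof, if_neg (by omega), if_neg (by omega), if_neg (by omega), if_pos rfl]
  have e3 : prof a Z W₁ W₂ W₃ (a + 4) = W₃ := by
    rw [prof, if_neg (by omega), if_neg (by omega), if_neg (by omega), if_neg (by omega), if_pos rfl]
  refine ⟨?_, ?_, ?_, by omega, ?_, ?_⟩
  · have := col_mk_index (k := k) (a := a) (Z := Z) (W₁ := W₁) (W₂ := W₂) (W₃ := W₃) (j := 0)
      (K := K); rw [Nat.cast_zero, add_zero] at this; rw [this, e0]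
  · rw [← sub_one_eq_index, col_mk_index, elarge _ (by omega)]
  · rw [col_mk_index, efull f hf hf']
  · intro j hj; rw [col_mk_index, col_mk_index]
    rcases Nat.eq_zero_or_pos j with rfl | hj0
    · rw [e0]; exact empty_subset _
    · rw [efull (j + 1) (by omega) (by omega)]; exact subset_univ _
  · intro j hj hjK
    by_cases hlast : j + 1 = K
    · rw [hlast, ZMod.natCast_self, add_zero]
      have := col_mk_index (k := k) (a := a) (Z := Z) (W₁ := W₁) (W₂ := W₂) (W₃ := W₃) (j := 0)
        (K := K); rw [Nat.cast_zero, add_zero] at this; rw [this, e0]; exact empty_subset _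
    · rw [col_mk_index, col_mk_index]
      rcases (by omega : j ≤ a + 1 ∨ j = a + 2 ∨ j = a + 3 ∨ a + 5 ≤ j + 1) with h | rfl | rfl | h
      · rw [efull j (by omega) h]; exact subset_univ _
      · rw [e1, e2]; exact h12
      · rw [e2, e3]; exact h23
      · rw [elarge _ h]; exact empty_subset _

theorem hB_mk (ha : 1 ≤ a) (haK : a + 6 ≤ K) (h12 : W₂ ⊆ W₁) (h23 : W₃ ⊆ W₂) :
    hB (mk k a Z W₁ W₂ W₃) = L :=
  (uni_mk ha haK h12 h23 (f := 2) le_rfl).hB_eq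

end Unimodal

/-! ### Isoperimetry: ground states and tame configurations -/

/-- The standing assumptions on the parameters. -/
class Adm (K L N₀ : ℕ) : Prop where
  four_le_L : 4 ≤ L
  L_lt_K : L < K
  four_le_N : 4 ≤ N₀
  L_lt : L < 4 * N₀
  lt_K : 2 * N₀ < K

/-- The configurations that communicate with the ground states at the ground barrier. -/
abbrev reached (K L N₀ : ℕ) [NeZero K] [NeZero L] : Set (Config K L N₀) :=
  reachable (graph K L N₀) energy

/-- The columns that are neither empty nor full. -/
def partialCols (A : Sites K L) : Finset (ZMod K) :=
  univ.filter fun x => col A x ≠ ∅ ∧ col A x ≠ univ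

/-- The full columns. -/
def fullCols (A : Sites K L) : Finset (ZMod K) :=
  univ.filter fun x => col A x = univ

/-- There is a full column, but no full row. -/
def Tame (A : Sites K L) : Prop :=
  (∃ x, col A x = univ) ∧ ∀ y, row A y ≠ univ

theorem card_le_brk_sum {n : ℕ} [NeZero n] {ι : Type*} [Fintype ι] (S : Finset ι)
    (W : ι → Finset (ZMod n)) (hS : ∀ x ∈ S, W x ≠ ∅ ∧ W x ≠ univ) :
    S.card ≤ ∑ x, brk (W x) := by
  calc S.card = ∑ x ∈ S, 1 := by simp
    _ ≤ ∑ x ∈ S, brk (W x) := sum_le_sum fun x hx => one_le_brk (hS x hx).1 (hS x hx).2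
    _ ≤ ∑ x, brk (W x) := sum_le_univ_sum_of_nonneg fun _ => Nat.zero_le _

theorem card_partialCols_le (A : Sites K L) : (partialCols A).card ≤ cB A :=
  card_le_brk_sum _ _ fun x hx => by simpa [partialCols] using hx

theorem Tame.row_ne {A : Sites K L} (h : Tame A) (y : ZMod L) : row A y ≠ ∅ ∧ row A y ≠ univ := by
  obtain ⟨⟨x, hx⟩, h2⟩ := h; refine ⟨fun e => ?_, h2 y⟩
  have : x ∈ row A y := by rw [mem_row, ← mem_col, hx]; simp
  rw [e] at this; simp at this

theorem Tame.le_hB {A : Sites K L} (h : Tame A) : L ≤ hB A := by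
  have := card_le_brk_sum univ (row A) fun y _ => h.row_ne y
  rwa [card_univ, ZMod.card, ← hB_eq_sum_row] at this

theorem card_lt_of_ne_univ {n : ℕ} [NeZero n] {W : Finset (ZMod n)} (h : W ≠ univ) :
    W.card < n := by
  have := card_lt_univ_of_notMem (s := W) (x := (by
    have : ∃ x, x ∉ W := by
      by_contra! hc
      exact h (eq_univ_of_forall hc)
    exact this.choose)) (by
    have : ∃ x, x ∉ W := by
      by_contra! hc
      exact h (eq_univ_of_forall hc)
    exact this.choose_spec); rwa [ZMod.card] at this

theorem card_eq_full_add (A : Sites K L) :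
    A.card = (fullCols A).card * L + ∑ x ∈ partialCols A, (col A x).card := by
  have hd : Disjoint (fullCols A) (partialCols A) := by
    rw [disjoint_left]; intro x h1 h2; simp only [fullCols, partialCols, mem_filter] at h1 h2
    exact h2.2.2 h1.2
  rw [card_eq_sum_col, ← sum_subset (subset_univ (fullCols A ∪ partialCols A)), sum_union hd]
  · congr 1; rw [sum_congr rfl (g := fun _ => L)]
    · simp
    · intro x hx; simp only [fullCols, mem_filter] at hx; rw [hx.2, card_univ, ZMod.card]
  · intro x _ hx
    simp only [fullCols, partialCols, mem_union, mem_filter, mem_univ,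
      true_and, not_or, not_and, not_not] at hx; by_contra hne
    exact hx.1 (hx.2 fun e => hne (by rw [e]; rfl))

/-- The number of full rows is controlled by the sizes of the columns. -/
theorem fullRows_card_le (A : Sites K L) (x : ZMod K) :
    (univ.filter fun y => row A y = univ).card ≤ (col A x).card := by
  apply card_le_card
  intro y hy; simp only [mem_filter, mem_univ, true_and] at hy; rw [mem_col, ← mem_row, hy]; simp

theorem sub_fullRows_le_hB {A : Sites K L} (h : ∀ y, row A y ≠ ∅) :
    L ≤ hB A + (univ.filter fun y => row A y = univ).card := by
  have h1 := card_le_brk_sum (univ.filter fun y => ¬ row A y = univ) (row A)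
    fun y hy => ⟨h y, by simpa using hy⟩; rw [← hB_eq_sum_row] at h1
  have h2 := card_filter_add_card_filter_not (s := univ) fun y => row A y = univ
  rw [card_univ, ZMod.card] at h2; omega

/-- The arithmetic behind the fact that a cross has a large boundary. -/
theorem cross_bound {K L N a q b : ℤ} (hL : 0 < L) (hK : 9 ≤ K) (hLK : L + 1 ≤ K)
    (hNK : 2 * N + 1 ≤ K) (ha : 1 ≤ a) (hb : 1 ≤ b) (h : a * L + q * b ≤ L * N)
    (hq : a + q = K) (hq0 : 0 ≤ q) : b + 5 ≤ q := by
  by_contra hlt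
  obtain rfl : q = K - a := by omega
  have h0 : 0 ≤ (K - a) * b := mul_nonneg hq0 (by omega)
  have haN : a ≤ N := by
    by_contra hlt
    have : L * N < L * a := mul_lt_mul_of_pos_left (by omega) hL
    linarith [mul_comm a L]
  have e1 : (K - a) * (K - a - 4) ≤ (K - a) * b := mul_le_mul_of_nonneg_left (by omega) hq0
  have e2 : (L : ℤ) * (N - a) ≤ (K - 1) * (N - a) :=
    mul_le_mul_of_nonneg_right (by omega) (by omega)
  have e3 : (K - 1) * (2 * (N - a)) ≤ (K - 1) * (K - 1 - 2 * a) :=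
    mul_le_mul_of_nonneg_left (by omega) (by omega)
  have e4 : (K - 3 - a) ^ 2 + a ^ 2 ≤ 10 := by
    have : (K - 3 - a) ^ 2 + a ^ 2 - 10 =
      2 * ((K - a) * (K - a - 4)) - (K - 1) * (K - 1 - 2 * a) := by ring
    linarith [mul_comm a L, mul_sub L N a, mul_left_comm (K - 1) 2 (N - a)]
  have ha3 : a ≤ 3 := by nlinarith [sq_nonneg (K - 3 - a)]
  have ha' : a = 1 ∨ a = 2 ∨ a = 3 := by omega
  rcases ha' with rfl | rfl | rfl <;> nlinarith

theorem full_row_full_col {N₀ : ℕ} [hp : Adm K L N₀] {A : Sites K L}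
    (hA : A.card = L * N₀) (hc : ∃ x, col A x = univ) (hr : ∃ y, row A y = univ) :
    L + 5 ≤ cB A + hB A := by
  obtain ⟨x₀, hx₀⟩ := hc; obtain ⟨y₀, hy₀⟩ := hr
  set b := (univ.filter fun y => row A y = univ).card with hb
  have hb1 : 1 ≤ b := card_pos.2 ⟨y₀, by simpa using hy₀⟩
  have hrow := sub_fullRows_le_hB (A := A) fun y e => by
    have : x₀ ∈ row A y := by rw [mem_row, ← mem_col, hx₀]; simp
    rw [e] at this; simp at this
  have hcol : ∀ x, col A x ≠ ∅ := fun x e => by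
    have : y₀ ∈ col A x := by rw [mem_col, ← mem_row, hy₀]; simp
    rw [e] at this; simp at this
  have ha1 : 1 ≤ (fullCols A).card := card_pos.2 ⟨x₀, by simpa [fullCols] using hx₀⟩
  have hsplit : (fullCols A).card + (partialCols A).card = K := by
    have h2 := card_filter_add_card_filter_not (s := univ) fun x => col A x = univ
    rw [card_univ, ZMod.card] at h2
    have : partialCols A = univ.filter fun x => ¬ col A x = univ := by
      ext x; simp [partialCols, hcol x]
    rw [this]; exact h2
  have hpc := card_partialCols_le A; have hcard := card_eq_full_add A
  have hge : (partialCols A).card * b ≤ ∑ x ∈ partialCols A, (col A x).card := by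
    rw [← smul_eq_mul]; exact card_nsmul_le_sum _ _ _ fun x _ => fullRows_card_le A x
  rw [← hb] at hrow; obtain ⟨h1, h2, h3, h4, h5⟩ := hp
  suffices h : b + 5 ≤ (partialCols A).card by omega
  have hmain : (fullCols A).card * L + (partialCols A).card * b ≤ L * N₀ := by omega
  have := cross_bound (K := K) (L := L) (N := N₀) (a := (fullCols A).card)
    (q := (partialCols A).card) (b := b) (by omega) (by omega) (by omega) (by omega) (by omega)
    (by omega) (by exact_mod_cast hmain) (by omega) (by omega); omega

theorem full_row_no_full_col {N₀ : ℕ} [hp : Adm K L N₀] {A : Sites K L}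
    (hA : A.card = L * N₀) (hc : ∀ x, col A x ≠ univ) (hr : ∃ y, row A y = univ) :
    L < cB A + hB A ∧ ((∀ y, row A y ≠ ∅) → L + 5 ≤ cB A + hB A) := by
  obtain ⟨y₀, hy₀⟩ := hr
  have hcol : ∀ x, col A x ≠ ∅ := fun x e => by
    have : y₀ ∈ col A x := by rw [mem_col, ← mem_row, hy₀]; simp
    rw [e] at this; simp at this
  have h1 := card_le_brk_sum univ (col A) fun x _ => ⟨hcol x, hc x⟩; rw [card_univ, ZMod.card] at h1
  change K ≤ cB A at h1; obtain ⟨p1, p2, p3, p4, p5⟩ := hp; refine ⟨by omega, fun hrow => ?_⟩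
  have h2 := sub_fullRows_le_hB hrow
  set b := (univ.filter fun y => row A y = univ).card with hb
  have h3 : K * b ≤ A.card := by
    rw [card_eq_sum_col]
    have := card_nsmul_le_sum univ (fun x => (col A x).card) b fun x _ => fullRows_card_le A x
    rwa [card_univ, ZMod.card, smul_eq_mul] at this
  have h4 : 2 * b < L := by
    by_contra hlt
    have : K * L ≤ 2 * (L * N₀) := by nlinarith
    nlinarith
  omega

theorem card_le_rows_mul_cols (A : Sites K L) : A.card ≤ (univ.filter fun x => col A x ≠ ∅).card *
      (univ.filter fun y => row A y ≠ ∅).card := by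
  rw [← card_product]
  apply card_le_card
  rintro ⟨x, y⟩ h; simp only [mem_product, mem_filter, mem_univ, true_and]
  exact ⟨ne_empty_of_mem (mem_col.2 h), ne_empty_of_mem (mem_row.2 h)⟩

/-- The isoperimetric inequality for sets other than the tame ones. -/
theorem lt_of_not_tame {N₀ : ℕ} [hp : Adm K L N₀] {A : Sites K L}
    (hA : A.card = L * N₀) (ht : ¬ Tame A) : L < cB A + hB A := by
  by_cases hr : ∃ y, row A y = univ
  · by_cases hc : ∃ x, col A x = univ
    · have := full_row_full_col hA hc hr; omega
    · exact (full_row_no_full_col hA (by simpa using hc) hr).1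
  · have hc : ¬ ∃ x, col A x = univ := fun hc => ht ⟨hc, by simpa using hr⟩
    push Not at hr hc; have h1 := card_le_brk_sum (univ.filter fun x => col A x ≠ ∅) (col A)
      fun x hx => ⟨by simpa using hx, hc x⟩
    have h2 := card_le_brk_sum (univ.filter fun y => row A y ≠ ∅) (row A)
      fun x hx => ⟨by simpa using hx, hr x⟩; rw [← hB_eq_sum_row] at h2
    change _ ≤ cB A at h1; have h3 := card_le_rows_mul_cols A; rw [hA] at h3
    obtain ⟨p1, p2, p3, p4, p5⟩ := hp
    generalize (univ.filter fun x => col A x ≠ ∅).card = p at *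
    generalize (univ.filter fun y => row A y ≠ ∅).card = q at *; by_contra hlt
    have h5 : p + q ≤ L := by omega
    have h6 : 4 * (p * q) ≤ L * L := by nlinarith [sq_nonneg ((p : ℤ) - q), mul_le_mul h5 h5 (by omega) (by omega)]
    nlinarith

/-- The strips. -/
def stripSet (L : ℕ) [NeZero L] (N₀ : ℕ) (k : ZMod K) : Sites K L :=
  arc k N₀ ×ˢ univ

theorem col_stripSet (N₀ : ℕ) (k x : ZMod K) :
    col (stripSet L N₀ k) x = if x ∈ arc k N₀ then univ else ∅ := by
  ext y
  split_ifs with h <;> simp [stripSet, h]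

theorem card_stripSet {N₀ : ℕ} (h : N₀ ≤ K) (k : ZMod K) : (stripSet L N₀ k).card = L * N₀ := by
  rw [stripSet, card_product, card_arc h, card_univ, ZMod.card, mul_comm]

theorem occ_eq_coe {N₀ : ℕ} {η : Config K L N₀} {B : Sites K L} : occ η = ↑B ↔ η.1 = B := by
  rw [occ, coe_inj]

theorem coe_stripSet (N₀ : ℕ) (k : ZMod K) : (↑(stripSet L N₀ k) : Set _) = cols (L := L) k N₀ := by
  ext ⟨x, y⟩; simp [stripSet, cols, mem_arc]

theorem mem_strip {N₀ : ℕ} {k : ZMod K} {η : Config K L N₀} :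
    η ∈ strip k ↔ η.1 = stripSet L N₀ k := by
  rw [strip, Set.mem_ofPred_eq, ← coe_stripSet, occ_eq_coe]

theorem cB_stripSet (N₀ : ℕ) (k : ZMod K) : cB (stripSet L N₀ k) = 0 := by
  refine sum_eq_zero fun x _ => ?_; rw [col_stripSet]
  split_ifs
  · exact brk_univ
  · exact brk_empty

theorem hB_stripSet {N₀ : ℕ} (h0 : 0 < N₀) (h : N₀ < K) (k : ZMod K) :
    hB (stripSet L N₀ k) = L := by
  rw [hB_eq_sum_row, sum_congr rfl (g := fun _ => 1)]
  · simp [ZMod.card]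
  · intro y _; have : row (stripSet L N₀ k) y = arc k N₀ := by ext x; simp [stripSet]
    rw [this, brk_arc h0 h]

theorem exists_strip {N₀ : ℕ} {A : Sites K L} (hA : A.card = L * N₀)
    (hQ : ∀ x, col A x = ∅ ∨ col A x = univ) (hh : hB A < 2 * L) :
    ∃ k, A = stripSet L N₀ k := by
  have hL : 0 < L := Nat.pos_of_ne_zero (NeZero.ne L)
  have hrow : ∀ y, row A y = fullCols A := by
    intro y
    ext x; rw [mem_row, ← mem_col]
    rcases hQ x with h | h
    · have : (∅ : Finset (ZMod L)) ≠ univ := univ_nonempty.ne_empty.symm; simp [h, fullCols, this]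
    · simp [h, fullCols]
  rw [hB_eq_sum_row] at hh; simp only [hrow, sum_const, card_univ, ZMod.card, smul_eq_mul] at hh
  have hb : brk (fullCols A) ≤ 1 := by
    by_contra hlt
    nlinarith
  have hcard := card_eq_full_add A
  have hQ' : partialCols A = ∅ := by
    rw [partialCols, filter_eq_empty_iff]; intro x _
    rcases hQ x with h | h <;> simp [h]
  rw [hQ', sum_empty, hA, add_zero, mul_comm] at hcard
  have hN := Nat.eq_of_mul_eq_mul_right hL hcard; obtain ⟨k, hk⟩ := exists_eq_arc hb
  rw [← hN] at hk; refine ⟨k, ext_col fun x => ?_⟩; rw [col_stripSet, ← hk]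
  rcases hQ x with h | h
  · have : (∅ : Finset (ZMod L)) ≠ univ := univ_nonempty.ne_empty.symm; simp [h, fullCols, this]
  · simp [h, fullCols]

theorem cols_trivial_of_cB_eq_zero {A : Sites K L} (h : cB A = 0) (x : ZMod K) :
    col A x = ∅ ∨ col A x = univ := by
  rw [cB, sum_eq_zero_iff] at h; exact brk_eq_zero.1 (h x (mem_univ x))

theorem le_cB_add_hB {N₀ : ℕ} [hp : Adm K L N₀] {A : Sites K L}
    (hA : A.card = L * N₀) : L ≤ cB A + hB A := by
  by_cases ht : Tame A
  · exact ht.le_hB.trans (by omega)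
  · exact (lt_of_not_tame hA ht).le

theorem energy_eq' {N₀ : ℕ} [hp : Adm K L N₀] (η : Config K L N₀) :
    energy η = H₀ L N₀ + (cB η.1 + hB η.1 : ℤ) - L :=
  energy_eq (by have := hp.1; have := hp.2; omega) (by have := hp.1; omega) η

theorem energy_ge {N₀ : ℕ} [hp : Adm K L N₀] (η : Config K L N₀) : H₀ L N₀ ≤ energy η := by
  have := le_cB_add_hB η.2; rw [energy_eq']; omega

theorem energy_strip {N₀ : ℕ} [hp : Adm K L N₀] {k : ZMod K} {η : Config K L N₀}
    (h : η ∈ strip k) : energy η = H₀ L N₀ := by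
  have h3 := hp.5; have h4 := hp.3
  rw [energy_eq', mem_strip.1 h, cB_stripSet, hB_stripSet (by omega) (by omega)]
  push_cast; ring

/-- The strip as a configuration. -/
def stripConfig {N₀ : ℕ} (hp : Adm K L N₀) (k : ZMod K) : Config K L N₀ :=
  ⟨stripSet L N₀ k, card_stripSet (by have := hp.5; omega) k⟩

theorem stripConfig_mem {N₀ : ℕ} [hp : Adm K L N₀] (k : ZMod K) : stripConfig hp k ∈ strip k :=
  mem_strip.2 rfl

theorem mem_groundStates_iff {N₀ : ℕ} [hp : Adm K L N₀] {η : Config K L N₀} :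
    η ∈ groundStates (energy (K := K) (L := L) (N₀ := N₀)) ↔ ∃ k, η ∈ strip k := by
  constructor
  · intro h; have h1 := h (stripConfig hp 0)
    rw [energy_strip (stripConfig_mem 0), energy_eq'] at h1
    have ht : Tame η.1 := by
      by_contra ht
      have := lt_of_not_tame η.2 ht; omega
    have h2 := ht.le_hB; have h3 := hp.1
    obtain ⟨k, hk⟩ := exists_strip η.2 (cols_trivial_of_cB_eq_zero (by omega)) (by omega)
    exact ⟨k, mem_strip.2 hk⟩
  · rintro ⟨k, hk⟩ ξ; rw [energy_strip hk]; exact energy_ge ξ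

theorem tame_strip {N₀ : ℕ} [hp : Adm K L N₀] (k : ZMod K) : Tame (stripSet L N₀ k) := by
  have h3 := hp.5; have h4 := hp.3
  constructor
  · refine ⟨k, ?_⟩; rw [col_stripSet, if_pos]; rw [mem_arc]; exact ⟨0, by omega, by simp⟩
  · intro y e; have : row (stripSet L N₀ k) y = arc k N₀ := by ext x; simp [stripSet]
    have h5 := card_arc (ℓ := k) (m := N₀) (n := K); rw [← this, e, card_univ, ZMod.card] at h5
    omega

/-- Tameness is preserved at low energies. -/
theorem tame_step {N₀ : ℕ} [hp : Adm K L N₀] {η ξ : Config K L N₀} (ht : Tame η.1)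
    (hadj : (graph K L N₀).Adj η ξ) (hξ : energy ξ ≤ H₀ L N₀ + 4) : Tame ξ.1 := by
  have ⟨p1, p2, p3, p4, p5⟩ := hp; rw [energy_eq'] at hξ
  by_cases hc : ∃ x, col ξ.1 x = univ
  · refine ⟨hc, ?_⟩
    by_contra! hr
    have := full_row_full_col ξ.2 hc hr; omega
  exfalso
  push Not at hc; obtain ⟨⟨f, hf⟩, -⟩ := ht
  have hrow : ∀ y, row ξ.1 y ≠ ∅ := by
    rcases exists_move hadj with
      ⟨x, y, s, hs, hin, hout, hm⟩ | ⟨x, y, s, hs, hin, hout, hm⟩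
    · exfalso
      apply hc f
      rw [hm]
      by_cases hfx : f = x
      · subst hfx; rw [← mem_col, hf] at hout; simp at hout
      · rw [col_mv_vertical_of_ne _ _ _ hfx, hf]
    · intro y' e
      by_cases hy : y' = y
      · subst hy; rw [hm, row_mv_horizontal] at e; simp at e
      · rw [hm, row_mv_horizontal_of_ne _ _ _ hy] at e
        have : f ∈ row η.1 y' := by rw [mem_row, ← mem_col, hf]; simp
        rw [e] at this; simp at this
  by_cases hr : ∃ y, row ξ.1 y = univ
  · have := (full_row_no_full_col ξ.2 hc hr).2 hrow; omega
  push Not at hr; have h1 := card_le_brk_sum univ (row ξ.1) fun y _ => ⟨hrow y, hr y⟩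
  rw [card_univ, ZMod.card, ← hB_eq_sum_row] at h1; have h2 := card_partialCols_le ξ.1
  have h3 := card_eq_full_add ξ.1
  have h4 : fullCols ξ.1 = ∅ := by
    rw [fullCols, filter_eq_empty_iff]; exact fun x _ => hc x
  rw [h4, card_empty, zero_mul, zero_add, ξ.2] at h3
  have h5 : ∑ x ∈ partialCols ξ.1, (col ξ.1 x).card ≤ (partialCols ξ.1).card * (L - 1) := by
    refine (sum_le_card_nsmul _ _ (L - 1) fun x _ => ?_).trans_eq (smul_eq_mul _ _)
    have := card_lt_of_ne_univ (hc x); omega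
  have h6 : (partialCols ξ.1).card ≤ 4 := by omega
  have h7 : L * 4 ≤ L * N₀ := Nat.mul_le_mul_left _ p3
  have h8 : (partialCols ξ.1).card * (L - 1) ≤ 4 * (L - 1) := Nat.mul_le_mul_right _ h6; omega

theorem tame_of_linked {N₀ : ℕ} [hp : Adm K L N₀] {η ξ : Config K L N₀} (ht : Tame η.1)
    (h : Linked (graph K L N₀) energy (H₀ L N₀ + 4) η ξ) : Tame ξ.1 :=
  h.preserves (fun ζ => Tame ζ.1) (fun _ _ h1 h2 _ h3 => tame_step h1 h2 h3) ht

variable [hp : Adm K L N₀]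

/-! ### Transport of a single particle or of a single hole -/

theorem fullCols_bounds {A : Sites K L} (hA : A.card = L * N₀) : (partialCols A).card ≠ 1 ∧
      ((partialCols A).card = 0 → (fullCols A).card = N₀) ∧
      ((partialCols A).card ≠ 0 → (fullCols A).card < N₀ ∧
        N₀ < (fullCols A).card + (partialCols A).card) := by
  have h := card_eq_full_add A; have hL := hp.1
  have h1 : ∑ x ∈ partialCols A, (col A x).card ≤ (partialCols A).card * (L - 1) :=
    (sum_le_card_nsmul _ _ (L - 1) fun x hx => by
      have := card_lt_of_ne_univ (W := col A x) (by simp [partialCols] at hx; exact hx.2)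
      omega).trans_eq (smul_eq_mul _ _)
  have h2 : (partialCols A).card * 1 ≤ ∑ x ∈ partialCols A, (col A x).card := by
    refine (smul_eq_mul _ _).symm.trans_le (card_nsmul_le_sum _ _ _ fun x hx => ?_)
    simp [partialCols] at hx; exact card_pos.2 (nonempty_iff_ne_empty.2 hx.1)
  rw [hA] at h
  generalize (partialCols A).card = q at *
  generalize (fullCols A).card = a at *
  generalize ∑ x ∈ partialCols A, (col A x).card = s at *
  have h3 : q * (L - 1) + q = q * L := by
    obtain ⟨l, rfl⟩ : ∃ l, L = l + 1 := ⟨L - 1, by omega⟩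
    simp; ring
  refine ⟨?_, ?_, ?_⟩
  · rintro rfl
    have h4 : a < N₀ := by
      by_contra hlt
      have : L * N₀ ≤ a * L := by rw [mul_comm a]; exact Nat.mul_le_mul_left _ (by omega)
      omega
    have h5 : (a + 1) * L ≤ N₀ * L := Nat.mul_le_mul_right _ h4; rw [mul_comm N₀] at h5
    rw [add_mul] at h5; omega
  · rintro rfl; have : L * a = L * N₀ := by rw [mul_comm L a]; omega
    exact Nat.eq_of_mul_eq_mul_left (by omega) this
  · intro hq
    constructor
    · by_contra hlt
      have : L * N₀ ≤ a * L := by rw [mul_comm a]; exact Nat.mul_le_mul_left _ (by omega)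
      omega
    · by_contra hlt
      have : (a + q) * L ≤ L * N₀ := by rw [mul_comm]; exact Nat.mul_le_mul_left _ (by omega)
      rw [add_mul] at this; omega

theorem two_le_card_emptyCols {A : Sites K L}
    (hA : A.card = L * N₀) (hq : (partialCols A).card ≤ 3) :
    2 ≤ (univ.filter fun x => col A x = ∅).card := by
  have h := fullCols_bounds hA
  have h3 := card_filter_add_card_filter_not (s := univ) fun x => col A x = ∅
  rw [card_univ, ZMod.card] at h3
  have h4 : (univ.filter fun x => ¬ col A x = ∅) = fullCols A ∪ partialCols A := by
    have : (univ : Finset (ZMod L)) ≠ ∅ := univ_nonempty.ne_empty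
    ext x
    by_cases hx : col A x = univ
    · simp [fullCols, partialCols, hx]; exact this
    · simp [fullCols, partialCols, hx]
  have h5 := card_union_le (fullCols A) (partialCols A); rw [← h4] at h5
  obtain ⟨p1, p2, p3, p4, p5⟩ := hp
  by_cases h0 : (partialCols A).card = 0
  · have := h.2.1 h0; omega
  · have := h.2.2 h0; omega

theorem exists_two_empty {A : Sites K L} (h2 : 2 ≤ (univ.filter fun x => col A x = ∅).card)
    (hfull : ∃ x, col A x = univ) (hh : hB A = L) :
    ∃ z, col A z = ∅ ∧ col A (z - 1) = ∅ := by
  obtain ⟨z, hz, z', hz', hne⟩ := one_lt_card.1 (by omega :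
    1 < (univ.filter fun x => col A x = ∅).card)
  simp only [mem_filter, mem_univ, true_and] at hz hz'; obtain ⟨x, hx⟩ := hfull
  obtain ⟨f, hfK, rfl⟩ := exists_index z x; obtain ⟨i, hi, rfl⟩ := exists_index z z'
  have hfr := hB_frame A hz hx hfK
  have h1 : ∑ j ∈ range f, (col A (z + j) \ col A (z + ((j + 1 : ℕ) : ZMod K))).card = 0 := by omega
  have h2 : ∑ j ∈ Ico f K, (col A (z + ((j + 1 : ℕ) : ZMod K)) \ col A (z + j)).card = 0 := by omega
  rw [sum_eq_zero_iff] at h1 h2; have hi0 : i ≠ 0 := by rintro rfl; simp at hne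
  by_cases hif : i ≤ f
  · refine ⟨z + 1, ?_, by rwa [add_sub_cancel_right]⟩
    have key : ∀ m, m + 1 ≤ i → col A (z + ((i - m : ℕ) : ZMod K)) = ∅ := by
      intro m hm
      induction m with
      | zero => simpa using hz'
      | succ m ih =>
        have h3 := h1 (i - (m + 1)) (mem_range.2 (by omega))
        rw [card_eq_zero, sdiff_eq_empty_iff_subset,
          show i - (m + 1) + 1 = i - m by omega, ih (by omega)] at h3; exact subset_empty.1 h3
    have := key (i - 1) (by omega); rwa [show i - (i - 1) = 1 by omega, Nat.cast_one] at this
  · refine ⟨z, hz, ?_⟩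
    have key : ∀ m, i ≤ m → m < K → col A (z + m) = ∅ := by
      intro m hm
      induction m, hm using Nat.le_induction with
      | base => intro _; exact hz'
      | succ m hm ih =>
        intro hmK; have h3 := h2 m (mem_Ico.2 ⟨by omega, by omega⟩)
        rw [card_eq_zero, sdiff_eq_empty_iff_subset, ih (by omega)] at h3; exact subset_empty.1 h3
    have := key (K - 1) (by omega) (by omega); rwa [sub_one_eq_index] at this

theorem exists_uni_of_two_empty {A : Sites K L} (h2 : 2 ≤ (univ.filter fun x => col A x = ∅).card)
    (hfull : ∃ x, col A x = univ) (hh : hB A = L) : ∃ z f, Uni A z f := by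
  obtain ⟨z, hz, hz'⟩ := exists_two_empty h2 hfull hh; obtain ⟨x, hx⟩ := hfull
  obtain ⟨f, hfK, rfl⟩ := exists_index z x; exact ⟨z, f, uni_of_hB_eq hz hz' hx hfK hh⟩

theorem exists_uni {A : Sites K L}
    (hA : A.card = L * N₀) (hfull : ∃ x, col A x = univ) (hq : (partialCols A).card ≤ 3)
    (hh : hB A = L) : ∃ z f, Uni A z f :=
  exists_uni_of_two_empty (two_le_card_emptyCols hA hq) hfull hh

/-- Steps between sites satisfying a condition. -/
abbrev SiteStep (K L : ℕ) (S : ZMod K × ZMod L → Prop) (p q : ZMod K × ZMod L) : Prop :=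
  (torus K L).Adj p q ∧ S p ∧ S q

theorem siteStep_symm {S : ZMod K × ZMod L → Prop} {p q : ZMod K × ZMod L}
    (h : ReflTransGen (SiteStep K L S) p q) :
    ReflTransGen (SiteStep K L S) q p := by
  induction h with
  | refl => exact .refl
  | tail _ hxy ih => exact .head ⟨hxy.1.symm, hxy.2.2, hxy.2.1⟩ ih

theorem adj_right (hK : 2 ≤ K) (hL : 2 ≤ L) (x : ZMod K) (y : ZMod L) :
    (torus K L).Adj (x, y) (x + 1, y) :=
  (torus_adj hK hL).2 (Or.inr ⟨rfl, Or.inl rfl⟩)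

theorem adj_up (hK : 2 ≤ K) (hL : 2 ≤ L) (x : ZMod K) (y : ZMod L) :
    (torus K L).Adj (x, y) (x, y + 1) :=
  (torus_adj hK hL).2 (Or.inl ⟨rfl, Or.inl rfl⟩)

theorem siteStep_column (hK : 2 ≤ K) (hL : 2 ≤ L) {S : ZMod K × ZMod L → Prop} {x : ZMod K}
    (h : ∀ y, S (x, y)) (y : ZMod L) :
    ReflTransGen (SiteStep K L S) (x, y) (x, 0) := by
  apply siteStep_symm
  obtain ⟨i, -, rfl⟩ := exists_index 0 y
  induction i with
  | zero => simp only [Nat.cast_zero, add_zero]; exact .refl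
  | succ i ih =>
    refine ih.tail ⟨?_, h _, h _⟩
    push_cast; rw [← add_assoc]; exact adj_up hK hL _ _

theorem siteStep_row (hK : 2 ≤ K) (hL : 2 ≤ L) {S : ZMod K × ZMod L → Prop} {z : ZMod K}
    {y : ZMod L}
    {i j : ℕ} (hij : i ≤ j) (h : ∀ m, i ≤ m → m ≤ j → S (z + m, y)) :
    ReflTransGen (SiteStep K L S) (z + i, y) (z + j, y) := by
  induction j, hij using Nat.le_induction with
  | base => exact .refl
  | succ j hij ih =>
    refine (ih fun m h1 h2 => h m h1 (by omega)).tail ⟨?_, h j hij (by omega), h _ (by omega) le_rfl⟩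
    push_cast; rw [← add_assoc]; exact adj_right hK hL _ _

/-- The complement of a unimodal set is connected. -/
theorem Uni.compl_connected (hK : 2 ≤ K) (hL : 2 ≤ L) {B : Sites K L} {z : ZMod K} {f : ℕ}
    (hB : Uni B z f) {v w : ZMod K × ZMod L} (hv : v ∉ B) (hw : w ∉ B) :
    ReflTransGen (SiteStep K L (· ∉ B)) v w := by
  have key : ∀ v, v ∉ B → ReflTransGen (SiteStep K L (· ∉ B)) v (z, 0) := by
    rintro ⟨x, y⟩ hv; obtain ⟨j, hj, rfl⟩ := exists_index z x
    have hcol := siteStep_column hK hL (S := (· ∉ B)) (x := z) (fun y => by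
      rw [← mem_col, hB.zero]; simp) y; refine ReflTransGen.trans ?_ hcol; rw [← mem_col] at hv
    by_cases hjf : f ≤ j
    · have := siteStep_row hK hL (S := (· ∉ B)) (z := z) (y := y) hj.le fun m h1 h2 h3 => by
        rw [← mem_col] at h3; exact hv (hB.anti_le hjf h1 h2 h3)
      simpa using this
    · have := siteStep_row hK hL (S := (· ∉ B)) (z := z) (y := y) (Nat.zero_le j) fun m h1 h2 h3 => by
        rw [← mem_col] at h3; exact hv (hB.mono_le h2 (by omega) h3)
      simpa using siteStep_symm this
  exact (key v hv).trans (siteStep_symm (key w hw))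

/-- A unimodal set is connected. -/
theorem Uni.connected (hK : 2 ≤ K) (hL : 2 ≤ L) {B : Sites K L} {z : ZMod K} {f : ℕ}
    (hB : Uni B z f) {v w : ZMod K × ZMod L} (hv : v ∈ B) (hw : w ∈ B) :
    ReflTransGen (SiteStep K L (· ∈ B)) v w := by
  have key : ∀ v, v ∈ B → ReflTransGen (SiteStep K L (· ∈ B)) v (z + f, 0) := by
    rintro ⟨x, y⟩ hv; obtain ⟨j, hj, rfl⟩ := exists_index z x
    have hcol := siteStep_column hK hL (S := (· ∈ B)) (x := z + f) (fun y => by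
      rw [← mem_col, hB.full]; simp) y; refine ReflTransGen.trans ?_ hcol; rw [← mem_col] at hv
    by_cases hjf : f ≤ j
    · exact siteStep_symm (siteStep_row hK hL (S := (· ∈ B)) (z := z) (y := y) hjf fun m h1 h2 => by
        rw [← mem_col]; exact hB.anti_le h1 h2 hj.le hv)
    · exact siteStep_row hK hL (S := (· ∈ B)) (z := z) (y := y) (by omega) fun m h1 h2 => by
        rw [← mem_col]; exact hB.mono_le h1 h2 hv
  exact (key v hv).trans (siteStep_symm (key w hw))

theorem energy_le_of {h : ℕ} {η : Config K L N₀}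
    (hle : cB η.1 + hB η.1 ≤ L + h) : energy η ≤ H₀ L N₀ + h := by
  rw [energy_eq']; omega

/-- An additional particle may be moved through the complement of a unimodal set. -/
theorem linked_insert {B : Sites K L} {z : ZMod K} {f : ℕ}
    (hB : Uni B z f) {h : ℕ} (hle : cB B + 2 ≤ h) {v w : ZMod K × ZMod L} (hv : v ∉ B)
    (hw : w ∉ B) {η ξ : Config K L N₀} (hη : η.1 = insert v B) (hξ : ξ.1 = insert w B) :
    Linked (graph K L N₀) energy (H₀ L N₀ + h) η ξ := by
  have hL := hp.1; have hK := hp.2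
  have hen : ∀ (ζ : Config K L N₀) u, ζ.1 = insert u B → energy ζ ≤ H₀ L N₀ + h := by
    intro ζ u hu; have h1 := cB_insert_le (by omega : 2 ≤ L) B u
    have h2 := hB_insert_le (by omega : 2 ≤ K) B u; rw [hB.hB_eq] at h2
    exact energy_le_of (by rw [hu]; omega)
  have hcard : B.card + 1 = L * N₀ := by
    rw [← η.2, hη, card_insert_of_notMem hv]
  have hpath := hB.compl_connected (by omega) (by omega) hv hw
  clear hw
  induction hpath generalizing ξ with
  | refl =>
    obtain rfl : η = ξ := Subtype.ext (by rw [hη, hξ]); exact .refl (hen η v hη)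
  | @tail u w _ huw ih =>
    obtain ⟨hadj, hu, hw⟩ := huw
    let ζ : Config K L N₀ := ⟨insert u B, by rw [card_insert_of_notMem hu, hcard]⟩
    refine (ih (ξ := ζ) rfl).trans (.of_adj ?_ (hen ζ u rfl) (hen ξ w hξ))
    refine graph_adj.2 ⟨u, w, hadj, mem_insert_self _ _, ?_, ?_⟩
    · rw [mem_insert, not_or]; exact ⟨hadj.ne', hw⟩
    · rw [hξ, mv, erase_insert hu]

/-- A hole may be moved through a unimodal set. -/
theorem linked_erase {B : Sites K L} {z : ZMod K} {f : ℕ}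
    (hB : Uni B z f) {h : ℕ} (hle : cB B + 2 ≤ h) {v w : ZMod K × ZMod L} (hv : v ∈ B)
    (hw : w ∈ B) {η ξ : Config K L N₀} (hη : η.1 = B.erase v) (hξ : ξ.1 = B.erase w) :
    Linked (graph K L N₀) energy (H₀ L N₀ + h) η ξ := by
  have hL := hp.1; have hK := hp.2
  have hen : ∀ (ζ : Config K L N₀) u, ζ.1 = B.erase u → energy ζ ≤ H₀ L N₀ + h := by
    intro ζ u hu; have h1 := cB_erase_le (by omega : 2 ≤ L) B u
    have h2 := hB_erase_le (by omega : 2 ≤ K) B u; rw [hB.hB_eq] at h2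
    exact energy_le_of (by rw [hu]; omega)
  have hcard : B.card = L * N₀ + 1 := by
    rw [← η.2, hη, card_erase_add_one hv]
  have hpath := hB.connected (by omega) (by omega) hv hw
  clear hw
  induction hpath generalizing ξ with
  | refl =>
    obtain rfl : η = ξ := Subtype.ext (by rw [hη, hξ]); exact .refl (hen η v hη)
  | @tail u w _ huw ih =>
    obtain ⟨hadj, hu, hw⟩ := huw
    let ζ : Config K L N₀ := ⟨B.erase u, by
      have := card_erase_add_one hu
      omega⟩; refine (ih (ξ := ζ) rfl).trans (.of_adj ?_ (hen ζ u rfl) (hen ξ w hξ))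
    refine graph_adj.2 ⟨w, u, hadj.symm, mem_erase.2 ⟨hadj.ne', hw⟩, notMem_erase _ _, ?_⟩
    rw [hξ, mv, erase_right_comm, insert_erase (mem_erase.2 ⟨hadj.ne, hu⟩)]

/-! ### Modifying the normal form -/

section NormalForm

variable {k : ZMod K} {a : ℕ} {Z W₁ W₂ W₃ : Finset (ZMod L)}

theorem val_eq_iff {n : ℕ} [NeZero n] {x z : ZMod n} {j : ℕ} (hj : j < n) :
    (x - z).val = j ↔ x = z + j := by
  constructor
  · rintro rfl; simp
  · rintro rfl; rw [add_sub_cancel_left, ZMod.val_natCast_of_lt hj]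

theorem col_mk_left (ha : a + 5 ≤ K := by omega) : col (mk k a Z W₁ W₂ W₃) (k - 1) = Z := by
  have := col_mk_index (k := k) (a := a) (Z := Z) (W₁ := W₁) (W₂ := W₂) (W₃ := W₃) (j := 1) (K := K)
  rw [Nat.cast_one, show k - 2 + 1 = k - 1 by ring] at this; rw [this, prof, if_pos rfl]

theorem col_mk_full {j : ℕ} (hj : j < a := by omega) (ha : a + 5 ≤ K := by omega) :
    col (mk k a Z W₁ W₂ W₃) (k + j) = univ := by
  have := col_mk_index (k := k) (a := a) (Z := Z) (W₁ := W₁) (W₂ := W₂) (W₃ := W₃) (j := j + 2)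
    (K := K); rw [show k - 2 + ((j + 2 : ℕ) : ZMod K) = k + j by push_cast; ring] at this
  rw [this, prof, if_neg (by omega), if_pos (by omega)]

theorem col_mk_one (ha : a + 5 ≤ K := by omega) : col (mk k a Z W₁ W₂ W₃) (k + a) = W₁ := by
  have := col_mk_index (k := k) (a := a) (Z := Z) (W₁ := W₁) (W₂ := W₂) (W₃ := W₃) (j := a + 2)
    (K := K); rw [show k - 2 + ((a + 2 : ℕ) : ZMod K) = k + a by push_cast; ring] at this
  rw [this, prof, if_neg (by omega), if_neg (by omega), if_pos rfl]

theorem col_mk_two (ha : a + 5 ≤ K := by omega) : col (mk k a Z W₁ W₂ W₃) (k + a + 1) = W₂ := by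
  have := col_mk_index (k := k) (a := a) (Z := Z) (W₁ := W₁) (W₂ := W₂) (W₃ := W₃) (j := a + 3)
    (K := K); rw [show k - 2 + ((a + 3 : ℕ) : ZMod K) = k + a + 1 by push_cast; ring] at this
  rw [this, prof, if_neg (by omega), if_neg (by omega), if_neg (by omega), if_pos rfl]

theorem col_mk_three (ha : a + 5 ≤ K := by omega) : col (mk k a Z W₁ W₂ W₃) (k + a + 2) = W₃ := by
  have := col_mk_index (k := k) (a := a) (Z := Z) (W₁ := W₁) (W₂ := W₂) (W₃ := W₃) (j := a + 4)
    (K := K); rw [show k - 2 + ((a + 4 : ℕ) : ZMod K) = k + a + 2 by push_cast; ring] at this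
  rw [this, prof, if_neg (by omega), if_neg (by omega), if_neg (by omega), if_neg (by omega),
    if_pos rfl]

/-- The five special columns of the normal form, and the remaining ones. -/
theorem col_cases (x : ZMod K) : x = k - 1 ∨ (∃ j < a, x = k + j) ∨ x = k + a ∨ x = k + a + 1 ∨
      x = k + a + 2 ∨ (∀ Z W₁ W₂ W₃ : Finset (ZMod L), col (mk k a Z W₁ W₂ W₃) x = ∅) := by
  obtain ⟨j, hj, rfl⟩ := exists_index (k - 2) x
  by_cases h1 : j = 1
  · subst h1; left; push_cast; ring
  by_cases h2 : 2 ≤ j ∧ j ≤ a + 1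
  · right; left; refine ⟨j - 2, by omega, ?_⟩; rw [Nat.cast_sub h2.1]; push_cast; ring
  by_cases h3 : j = a + 2
  · subst h3; right; right; left; push_cast; ring
  by_cases h4 : j = a + 3
  · subst h4; right; right; right; left; push_cast; ring
  by_cases h5 : j = a + 4
  · subst h5; right; right; right; right; left; push_cast; ring
  right; right; right; right; right; intro Z W₁ W₂ W₃
  rw [col_mk_index hj, prof, if_neg h1, if_neg h2, if_neg h3, if_neg h4, if_neg h5]

theorem eq_mk (ha : a + 5 ≤ K) {A : Sites K L} (hZ : col A (k - 1) = Z)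
    (hF : ∀ j < a, col A (k + j) = univ) (h1 : col A (k + a) = W₁)
    (h2 : col A (k + a + 1) = W₂) (h3 : col A (k + a + 2) = W₃)
    (hE : ∀ x, x ≠ k - 1 → (∀ j < a, x ≠ k + j) → x ≠ k + a →
      x ≠ k + a + 1 → x ≠ k + a + 2 → col A x = ∅) :
    A = mk k a Z W₁ W₂ W₃ := by
  refine ext_col fun x => ?_
  by_cases e0 : x = k - 1
  · rw [e0, hZ, col_mk_left ha]
  by_cases e1 : ∃ j < a, x = k + j
  · obtain ⟨j, hj, rfl⟩ := e1; rw [hF j hj, col_mk_full hj ha]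
  by_cases e2 : x = k + a
  · rw [e2, h1, col_mk_one ha]
  by_cases e3 : x = k + a + 1
  · rw [e3, h2, col_mk_two ha]
  by_cases e4 : x = k + a + 2
  · rw [e4, h3, col_mk_three ha]
  rw [hE x e0 (fun j hj e => e1 ⟨j, hj, e⟩) e2 e3 e4]
  rcases col_cases (L := L) (k := k) (a := a) x with h | ⟨j, hj, h⟩ | h | h | h | h
  · exact absurd h e0
  · exact absurd ⟨j, hj, h⟩ e1
  · exact absurd h e2
  · exact absurd h e3
  · exact absurd h e4
  · exact (h _ _ _ _).symm

theorem idx_ne {x : ZMod K} {i j : ℕ} (h : i ≠ j) (hi : i < K := by omega)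
    (hj : j < K := by omega) :
    x + i ≠ x + j := fun e => h (add_natCast_inj e hi hj)

theorem col_left_idx : k - 1 = k - 2 + ((1 : ℕ) : ZMod K) := by push_cast; ring
theorem col_one_idx : k + a = k - 2 + ((a + 2 : ℕ) : ZMod K) := by push_cast; ring
theorem col_two_idx : k + a + 1 = k - 2 + ((a + 3 : ℕ) : ZMod K) := by push_cast; ring
theorem col_three_idx : k + a + 2 = k - 2 + ((a + 4 : ℕ) : ZMod K) := by push_cast; ring

theorem col_mk_congr {Z' W₁' W₂' W₃' : Finset (ZMod L)} {x : ZMod K} {j : ℕ} (hx : x ≠ k - 2 + j)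
    (h : ∀ i, i ≠ j → prof a Z W₁ W₂ W₃ i = prof a Z' W₁' W₂' W₃' i) (hj : j < K := by omega) :
    col (mk k a Z W₁ W₂ W₃) x = col (mk k a Z' W₁' W₂' W₃') x := by
  rw [col_mk, col_mk]; exact h _ fun e => hx ((val_eq_iff hj).1 e)

theorem prof_congr_left {Z' : Finset (ZMod L)} (i : ℕ) (h : i ≠ 1) :
    prof a Z W₁ W₂ W₃ i = prof a Z' W₁ W₂ W₃ i := by simp [prof, h]
theorem prof_congr_one {W₁' : Finset (ZMod L)} (i : ℕ) (h : i ≠ a + 2) :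
    prof a Z W₁ W₂ W₃ i = prof a Z W₁' W₂ W₃ i := by simp [prof, h]
theorem prof_congr_two {W₂' : Finset (ZMod L)} (i : ℕ) (h : i ≠ a + 3) :
    prof a Z W₁ W₂ W₃ i = prof a Z W₁ W₂' W₃ i := by simp [prof, h]
theorem prof_congr_three {W₃' : Finset (ZMod L)} (i : ℕ) (h : i ≠ a + 4) :
    prof a Z W₁ W₂ W₃ i = prof a Z W₁ W₂ W₃' i := by simp [prof, h]

theorem insert_mk_left (y : ZMod L) (ha : a + 5 ≤ K := by omega) :
    insert (k - 1, y) (mk k a Z W₁ W₂ W₃) = mk k a (insert y Z) W₁ W₂ W₃ := by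
  refine ext_col fun x => ?_
  by_cases hx : x = k - 1
  · rw [hx, col_insert_self, col_mk_left ha, col_mk_left ha]
  · rw [col_insert_of_ne _ _ hx]; rw [col_left_idx] at hx; exact col_mk_congr hx prof_congr_left

theorem insert_mk_one (y : ZMod L) (ha : a + 5 ≤ K := by omega) :
    insert (k + a, y) (mk k a Z W₁ W₂ W₃) = mk k a Z (insert y W₁) W₂ W₃ := by
  refine ext_col fun x => ?_
  by_cases hx : x = k + a
  · rw [hx, col_insert_self, col_mk_one ha, col_mk_one ha]
  · rw [col_insert_of_ne _ _ hx]; rw [col_one_idx] at hx; exact col_mk_congr hx prof_congr_one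

theorem insert_mk_two (y : ZMod L) (ha : a + 5 ≤ K := by omega) :
    insert (k + a + 1, y) (mk k a Z W₁ W₂ W₃) = mk k a Z W₁ (insert y W₂) W₃ := by
  refine ext_col fun x => ?_
  by_cases hx : x = k + a + 1
  · rw [hx, col_insert_self, col_mk_two ha, col_mk_two ha]
  · rw [col_insert_of_ne _ _ hx]; rw [col_two_idx] at hx; exact col_mk_congr hx prof_congr_two

theorem insert_mk_three (ha : a + 5 ≤ K) (y : ZMod L) :
    insert (k + a + 2, y) (mk k a Z W₁ W₂ W₃) = mk k a Z W₁ W₂ (insert y W₃) := by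
  refine ext_col fun x => ?_
  by_cases hx : x = k + a + 2
  · rw [hx, col_insert_self, col_mk_three ha, col_mk_three ha]
  · rw [col_insert_of_ne _ _ hx]; rw [col_three_idx] at hx; exact col_mk_congr hx prof_congr_three

theorem erase_mk_left (ha : a + 5 ≤ K) (y : ZMod L) :
    (mk k a Z W₁ W₂ W₃).erase (k - 1, y) = mk k a (Z.erase y) W₁ W₂ W₃ := by
  refine ext_col fun x => ?_
  by_cases hx : x = k - 1
  · rw [hx, col_erase_self, col_mk_left ha, col_mk_left ha]
  · rw [col_erase_of_ne _ _ hx]; rw [col_left_idx] at hx; exact col_mk_congr hx prof_congr_left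

theorem erase_mk_one (y : ZMod L) (ha : a + 5 ≤ K := by omega) :
    (mk k a Z W₁ W₂ W₃).erase (k + a, y) = mk k a Z (W₁.erase y) W₂ W₃ := by
  refine ext_col fun x => ?_
  by_cases hx : x = k + a
  · rw [hx, col_erase_self, col_mk_one ha, col_mk_one ha]
  · rw [col_erase_of_ne _ _ hx]; rw [col_one_idx] at hx; exact col_mk_congr hx prof_congr_one

theorem erase_mk_two (y : ZMod L) (ha : a + 5 ≤ K := by omega) :
    (mk k a Z W₁ W₂ W₃).erase (k + a + 1, y) = mk k a Z W₁ (W₂.erase y) W₃ := by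
  refine ext_col fun x => ?_
  by_cases hx : x = k + a + 1
  · rw [hx, col_erase_self, col_mk_two ha, col_mk_two ha]
  · rw [col_erase_of_ne _ _ hx]; rw [col_two_idx] at hx; exact col_mk_congr hx prof_congr_two

/-- A full first column on the right belongs to the block. -/
theorem mk_univ_one : mk k a Z univ W₂ W₃ = mk k (a + 1) Z W₂ W₃ ∅ := by
  refine ext_col fun x => ?_; rw [col_mk, col_mk]
  generalize (x - (k - 2)).val = j
  unfold prof; have e : ∀ n : ℕ, a + 1 + n = a + (n + 1) := fun n => by omega
  rw [e, e, e, e]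
  split_ifs <;> first | rfl | omega

/-- A full column on the left belongs to the block. -/
theorem mk_univ_left (ha : a + 6 ≤ K) : mk k a univ W₁ W₂ W₃ = mk (k - 1) (a + 1) ∅ W₁ W₂ W₃ := by
  have e : k - 1 + ((a + 1 : ℕ) : ZMod K) = k + a := by push_cast; ring
  refine eq_mk (by omega) ?_ ?_ ?_ ?_ ?_ ?_
  · have := col_mk_index (k := k) (a := a) (Z := univ) (W₁ := W₁) (W₂ := W₂) (W₃ := W₃)
      (j := 0) (K := K); rw [show k - 1 - 1 = k - 2 + ((0 : ℕ) : ZMod K) by push_cast; ring, this]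
    simp [prof]
  · intro j hj
    rcases Nat.eq_zero_or_pos j with rfl | hj0
    · rw [Nat.cast_zero, add_zero, col_mk_left]
    · have := col_mk_full (k := k) (Z := univ) (W₁ := W₁) (W₂ := W₂) (W₃ := W₃) (K := K)
        (j := j - 1) (a := a)
      rw [show k - 1 + j = k + ((j - 1 : ℕ) : ZMod K) by
        rw [Nat.cast_sub hj0]; push_cast; ring]; exact this
  · rw [e, col_mk_one]
  · rw [e, col_mk_two]
  · rw [e, col_mk_three]
  · intro x _ hF h1 h2 h3; rw [e] at h1 h2 h3
    rcases col_cases (L := L) (k := k) (a := a) x with h | ⟨j, hj, h⟩ | h | h | h | h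
    · exact absurd (by rw [h]; simp) (hF 0 (by omega))
    · exact absurd (by rw [h]; push_cast; ring) (hF (j + 1) (by omega))
    · exact absurd h h1
    · exact absurd h h2
    · exact absurd h h3
    · exact h _ _ _ _

theorem mk_empty_eq_stripSet (ha : a + 5 ≤ K) : mk k a ∅ ∅ ∅ ∅ = stripSet L a k := by
  refine (eq_mk ha ?_ ?_ ?_ ?_ ?_ ?_).symm
  · rw [col_stripSet, if_neg]; rw [mem_arc]
    rintro ⟨j, hj, e⟩
    rw [col_left_idx, show k + j = k - 2 + ((j + 2 : ℕ) : ZMod K) by push_cast; ring] at e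
    exact (idx_ne (by omega)) e
  · intro j hj; rw [col_stripSet, if_pos (mem_arc.2 ⟨j, hj, rfl⟩)]
  · rw [col_stripSet, if_neg]; rw [mem_arc]
    rintro ⟨j, hj, e⟩; exact (idx_ne (by omega)) e
  · rw [col_stripSet, if_neg]; rw [mem_arc]
    rintro ⟨j, hj, e⟩; rw [show k + a + 1 = k + ((a + 1 : ℕ) : ZMod K) by push_cast; ring] at e
    exact (idx_ne (by omega)) e
  · rw [col_stripSet, if_neg]; rw [mem_arc]
    rintro ⟨j, hj, e⟩; rw [show k + a + 2 = k + ((a + 2 : ℕ) : ZMod K) by push_cast; ring] at e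
    exact (idx_ne (by omega)) e
  · intro x _ hF _ _ _; rw [col_stripSet, if_neg]; rw [mem_arc]
    rintro ⟨j, hj, e⟩; exact hF j hj e

theorem arc_pred_notMem {ℓ : ZMod L} {m : ℕ} (hm : m < L := by omega) : ℓ + m ∉ arc ℓ m := by
  rw [mem_arc_index hm hm.le]; omega

/-! ### The barrier between neighboring strips: upper bound -/

/-- The base for the transport between two arcs on both sides of the block. -/
theorem linked_two_sided_step {k : ZMod K} {ℓ ℓ' : ZMod L} {m n : ℕ}
    (hmn : n + m + 1 = L) {η ξ : Config K L N₀}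
    (hη : η.1 = mk k (N₀ - 1) (arc ℓ' n) (arc ℓ (m + 1)) ∅ ∅)
    (hξ : ξ.1 = mk k (N₀ - 1) (arc ℓ' (n + 1)) (arc ℓ m) ∅ ∅) :
    Linked (graph K L N₀) energy (H₀ L N₀ + 4) η ξ := by
  have ⟨p1, p2, p3, p4, p5⟩ := hp
  have hB := uni_mk (K := K) (k := k) (a := N₀ - 1) (Z := arc ℓ' n) (W₁ := arc ℓ m) (W₂ := ∅)
    (W₃ := ∅) (f := 2) (by omega) (by omega) (empty_subset _) (empty_subset _) le_rfl
  refine linked_insert hB (h := 4) ?_ (v := (k + ((N₀ - 1 : ℕ) : ZMod K), ℓ + m))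
    (w := (k - 1, ℓ' + n)) ?_ ?_ ?_ ?_
  · rw [cB_mk, brk_empty]; have := brk_arc_le ℓ' n; have := brk_arc_le ℓ m; omega
  · rw [← mem_col, col_mk_one]; exact arc_pred_notMem
  · rw [← mem_col, col_mk_left]; exact arc_pred_notMem
  · rw [hη, insert_mk_one, arc_succ]
  · rw [hξ, insert_mk_left, arc_succ]

theorem linked_two_sided_left {k : ZMod K} {Z W : Finset (ZMod L)}
    (hZ : brk Z ≤ 1) (hW : brk W ≤ 1) (hc : Z.card + W.card = L) {η : Config K L N₀}
    (hη : η.1 = mk k (N₀ - 1) Z W ∅ ∅) :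
    Linked (graph K L N₀) energy (H₀ L N₀ + 4) η (stripConfig hp (k - 1)) := by
  have ⟨p1, p2, p3, p4, p5⟩ := hp; obtain ⟨ℓ', hZ⟩ := exists_eq_arc hZ
  obtain ⟨ℓ, hW⟩ := exists_eq_arc hW; rw [hZ, hW] at hη
  clear hZ hW
  generalize Z.card = n at *
  generalize W.card = m at *
  induction m generalizing n η with
  | zero =>
    obtain rfl : n = L := by omega
    rw [arc_full, mk_univ_left (by omega), arc_zero, Nat.sub_add_cancel (by omega),
      mk_empty_eq_stripSet (by omega)] at hη
    obtain rfl : η = stripConfig hp (k - 1) := Subtype.ext hη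
    exact .refl (by rw [energy_strip (stripConfig_mem _)]; omega)
  | succ m ih =>
    let ξ : Config K L N₀ := ⟨mk k (N₀ - 1) (arc ℓ' (n + 1)) (arc ℓ m) ∅ ∅, by
      rw [card_mk, card_arc, card_arc, card_empty]
      obtain ⟨N, rfl⟩ : ∃ N, N₀ = N + 1 := ⟨N₀ - 1, by omega⟩; rw [Nat.add_sub_cancel]
      rw [mul_add, mul_comm N]
      omega⟩
    exact (linked_two_sided_step (by omega) hη (ξ := ξ) rfl).trans (ih (η := ξ) (n + 1) (by omega) rfl)

theorem mk_strip (k : ZMod K) : stripSet L N₀ k = mk k (N₀ - 1) ∅ univ ∅ ∅ := by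
  have ⟨p1, p2, p3, p4, p5⟩ := hp
  rw [mk_univ_one, Nat.sub_add_cancel (by omega), mk_empty_eq_stripSet (by omega)]

theorem linked_strip_pred (k : ZMod K) :
    Linked (graph K L N₀) energy (H₀ L N₀ + 4) (stripConfig hp k) (stripConfig hp (k - 1)) :=
  linked_two_sided_left (k := k) (Z := ∅) (W := univ) (by rw [brk_empty]; omega)
    (by rw [brk_univ]; omega) (by simp [ZMod.card]) (mk_strip k)

theorem linked_strips (k k' : ZMod K) :
    Linked (graph K L N₀) energy (H₀ L N₀ + 4) (stripConfig hp k) (stripConfig hp k') := by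
  obtain ⟨i, -, rfl⟩ := exists_index k' k
  induction i with
  | zero =>
    rw [Nat.cast_zero, add_zero]; exact .refl (by rw [energy_strip (stripConfig_mem _)]; omega)
  | succ i ih =>
    have := linked_strip_pred (L := L) (N₀ := N₀) (k' + ((i + 1 : ℕ) : ZMod K))
    rw [show k' + ((i + 1 : ℕ) : ZMod K) - 1 = k' + i by push_cast; ring] at this
    exact this.trans ih

/-- Two nested arcs on the same side of the block are at height at most four from a strip. -/
theorem linked_one_sided {k : ZMod K} {W₁ W₂ : Finset (ZMod L)}
    (h1 : brk W₁ ≤ 1) (h2 : brk W₂ ≤ 1) (h12 : W₂ ⊆ W₁) (hc : W₁.card + W₂.card = L)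
    {η : Config K L N₀} (hη : η.1 = mk k (N₀ - 1) ∅ W₁ W₂ ∅) :
    Linked (graph K L N₀) energy (H₀ L N₀ + 4) η (stripConfig hp k) := by
  have ⟨p1, p2, p3, p4, p5⟩ := hp; obtain ⟨ℓ', e1⟩ := exists_eq_arc h1
  obtain ⟨ℓ, e2⟩ := exists_eq_arc h2; rw [e1, e2] at hη h12
  clear e1 e2 h1 h2
  generalize W₁.card = n at *
  generalize W₂.card = m at *
  induction m generalizing n η with
  | zero =>
    obtain rfl : n = L := by omega
    rw [arc_full, arc_zero, ← mk_strip] at hη; obtain rfl : η = stripConfig hp k := Subtype.ext hη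
    exact .refl (by rw [energy_strip (stripConfig_mem _)]; omega)
  | succ m ih =>
    have hsub : arc ℓ m ⊆ arc ℓ' n := (arc_mono ℓ).trans h12
    let ξ : Config K L N₀ := ⟨mk k (N₀ - 1) ∅ (arc ℓ' (n + 1)) (arc ℓ m) ∅, by
      rw [card_mk, card_arc, card_arc, card_empty]
      obtain ⟨N, rfl⟩ : ∃ N, N₀ = N + 1 := ⟨N₀ - 1, by omega⟩; rw [Nat.add_sub_cancel]
      rw [mul_add, mul_comm N]
      omega⟩; refine Linked.trans ?_ (ih (η := ξ) (n + 1) (by omega) (hsub.trans (arc_mono _)) rfl)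
    have hB := uni_mk (K := K) (k := k) (a := N₀ - 1) (Z := ∅) (W₁ := arc ℓ' n) (W₂ := arc ℓ m)
      (W₃ := ∅) (f := 2) (by omega) (by omega) hsub (empty_subset _) le_rfl
    refine linked_insert hB (h := 4) ?_ (v := (k + ((N₀ - 1 : ℕ) : ZMod K) + 1, ℓ + m))
      (w := (k + ((N₀ - 1 : ℕ) : ZMod K), ℓ' + n)) ?_ ?_ ?_ ?_
    · rw [cB_mk, brk_empty]; have := brk_arc_le ℓ' n; have := brk_arc_le ℓ m; omega
    · rw [← mem_col, col_mk_two]; exact arc_pred_notMem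
    · rw [← mem_col, col_mk_one]; exact arc_pred_notMem
    · rw [hη, insert_mk_two, arc_succ]
    · rw [insert_mk_one, ← arc_succ]

end NormalForm

/-! ### The barrier between neighboring strips: lower bound -/

section Rows

variable {n : ℕ} [NeZero n]

theorem nb_eq_of_sign {s : ZMod n} (hs : s = 1 ∨ s = -1) (W : Finset (ZMod n)) (y : ZMod n) :
    nb W y = (if y + s ∈ W then 1 else 0) + (if y - s ∈ W then 1 else 0) := by
  rcases hs with rfl | rfl
  · simp only [nb]; omega
  · simp only [nb, sub_neg_eq_add, ← sub_eq_add_neg]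

theorem two_le_brk_of_gap {s : ZMod n} (hs : s = 1 ∨ s = -1) {R : Finset (ZMod n)} {i : ZMod n}
    (hi : i ∉ R) (h1 : i + s ∈ R) (h2 : i - s ∈ R) (hR : R.card + 1 ≠ n) (hn : 2 ≤ n := by omega) :
    2 ≤ brk R := by
  by_contra hlt
  exact hR (card_add_one_of_nb_eq_two hn hi (by rw [nb_eq_of_sign hs, if_pos h1, if_pos h2])
    (by omega))

theorem two_le_brk_of_isolated {s : ZMod n} (hs : s = 1 ∨ s = -1) {R : Finset (ZMod n)}
    {i j : ZMod n} (hi : i ∈ R) (h1 : i + s ∉ R) (h2 : i - s ∉ R) (hj : j ∈ R) (hij : j ≠ i)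
    (hn : 2 ≤ n := by omega) : 2 ≤ brk R := by
  by_contra hlt
  have := eq_singleton_of_nb_eq_zero hn hi (by rw [nb_eq_of_sign hs, if_neg h1, if_neg h2])
    (by omega); rw [this, mem_singleton] at hj; exact hij hj

theorem adjacent_of_brk_pair (hn : 2 ≤ n) {a b : ZMod n} (hab : b ≠ a)
    (h : brk ({a, b} : Finset (ZMod n)) ≤ 1) : ∃ t : ZMod n, (t = 1 ∨ t = -1) ∧ b = a + t := by
  by_contra! hc
  have h1 := hc 1 (Or.inl rfl); have h2 := hc (-1) (Or.inr rfl)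
  have := two_le_brk_of_isolated (s := 1) (R := {a, b}) (i := a) (j := b) (Or.inl rfl)
      (by simp) (by simp [self_ne_add_one hn, h1.symm]) (by simp [one_ne_zero' hn, sub_eq_add_neg, h2.symm]) (by simp) hab hn
  omega

theorem adjacent_of_brk_compl_pair (hn : 4 ≤ n) {a b : ZMod n} (hab : b ≠ a)
    {W : Finset (ZMod n)} (hW : ∀ v, v ∈ W ↔ v ≠ a ∧ v ≠ b)
    (h : brk W ≤ 1) : ∃ t : ZMod n, (t = 1 ∨ t = -1) ∧ b = a + t := by
  by_contra! hc
  have h1 := hc 1 (Or.inl rfl); have h2 := hc (-1) (Or.inr rfl)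
  have hcard : W.card + 2 = n := by
    have : W = univ \ {a, b} := by ext v; simp [hW]
    have h3 := card_sdiff_add_card_eq_card (subset_univ ({a, b} : Finset (ZMod n)))
    rw [← this, card_pair hab.symm, card_univ, ZMod.card] at h3; exact h3
  have := two_le_brk_of_gap (s := 1) (R := W) (i := a) (Or.inl rfl)
      (by simp [hW]) (by rw [hW]; exact ⟨self_ne_add_one (by omega) _, h1.symm⟩)
      (by
        rw [hW, sub_eq_add_neg]
        exact ⟨by rw [← sub_eq_add_neg]; exact self_ne_sub_one (by omega) _, h2.symm⟩) (by omega)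
  omega

theorem sign_ne_zero {s : ZMod n} (hs : s = 1 ∨ s = -1) (hn : 2 ≤ n := by omega) : s ≠ 0 := by
  rcases hs with rfl | rfl
  · exact one_ne_zero' hn
  · exact neg_ne_zero.2 (one_ne_zero' hn)

theorem two_sign_ne_zero {s : ZMod n} (hs : s = 1 ∨ s = -1)
    (hn : 3 ≤ n := by omega) : s + s ≠ 0 := by
  rcases hs with rfl | rfl
  · rw [one_add_one_eq_two]; exact two_ne_zero' hn
  · rw [← neg_add, one_add_one_eq_two]; exact neg_ne_zero.2 (two_ne_zero' hn)

theorem three_sign_ne_zero (hn : 4 ≤ n) {s : ZMod n} (hs : s = 1 ∨ s = -1) : s + s + s ≠ 0 := by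
  rcases hs with rfl | rfl
  · rw [show (1 : ZMod n) + 1 + 1 = 3 by norm_num]; exact three_ne_zero' hn
  · rw [show (-1 : ZMod n) + -1 + -1 = -3 by norm_num]; exact neg_ne_zero.2 (three_ne_zero' hn)

theorem sign_cases {s t : ZMod n} (hs : s = 1 ∨ s = -1) (ht : t = 1 ∨ t = -1) : t = s ∨ t = -s := by
  rcases hs with rfl | rfl <;> rcases ht with rfl | rfl <;> simp

theorem not_adjacent_add_two (hn : 4 ≤ n) {t : ZMod n} (ht : t = 1 ∨ t = -1) (a : ZMod n) :
    ¬ ∃ s : ZMod n, (s = 1 ∨ s = -1) ∧ a + t + t = a + s := by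
  rintro ⟨s, hs, e⟩
  rcases sign_cases ht hs with rfl | rfl
  · exact (sign_ne_zero ht) (by linear_combination e)
  · exact three_sign_ne_zero hn ht (by linear_combination e)

theorem two_le_brk_pair (hn : 4 ≤ n) {t : ZMod n} (ht : t = 1 ∨ t = -1) (a : ZMod n) :
    2 ≤ brk {a, a + t + t} := by
  by_contra hlt
  exact not_adjacent_add_two hn ht a (adjacent_of_brk_pair (by omega)
    (fun e => (two_sign_ne_zero ht) (by linear_combination e)) (by omega))

theorem two_le_brk_compl_pair (hn : 4 ≤ n) {t a : ZMod n} (ht : t = 1 ∨ t = -1)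
    {W : Finset (ZMod n)} (hW : ∀ v, v ∈ W ↔ v ≠ a ∧ v ≠ a + t + t) : 2 ≤ brk W := by
  by_contra hlt
  exact not_adjacent_add_two hn ht a (adjacent_of_brk_compl_pair hn
    (fun e => (two_sign_ne_zero ht) (by linear_combination e)) hW (by omega))

/-- The end of an arc and the sites around it. -/
theorem arc_edge {k i s : ZMod n} {m : ℕ} (hs : s = 1 ∨ s = -1) (hi : i ∈ arc k m)
    (ho : i + s ∉ arc k m) (hm : 4 ≤ m := by omega) (hmn : m + 4 ≤ n := by omega) :
    i - s ∈ arc k m ∧ i - s - s ∈ arc k m ∧ i + s + s ∉ arc k m ∧ i + s + s + s ∉ arc k m := by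
  obtain ⟨j, hj, rfl⟩ := mem_arc.1 hi
  have key : ∀ d : ℕ, d < n → ∀ x, x = k + d → (x ∈ arc k m ↔ d < m) := by
    rintro d hd x rfl; exact mem_arc_index hd
  rcases hs with rfl | rfl
  · have hjm : j + 1 = m := by
      by_contra hne
      exact ho ((key (j + 1) (by omega) _ (by push_cast; ring)).2 (by omega))
    subst hjm
    refine ⟨(key (j - 1) (by omega) _ ?_).2 (by omega), (key (j - 2) (by omega) _ ?_).2 (by omega),
      fun h => absurd ((key (j + 2) (by omega) _ ?_).1 h) (by omega),
      fun h => absurd ((key (j + 3) (by omega) _ ?_).1 h) (by omega)⟩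
    · rw [Nat.cast_sub (by omega)]; push_cast; ring
    · rw [Nat.cast_sub (by omega)]; push_cast; ring
    · push_cast; ring
    · push_cast; ring
  · have hj0 : j = 0 := by
      by_contra hne
      refine ho ((key (j - 1) (by omega) _ ?_).2 (by omega))
      rw [Nat.cast_sub (by omega)]; push_cast; ring
    subst hj0; have hnn : (n : ZMod n) = 0 := ZMod.natCast_self n
    refine ⟨(key 1 (by omega) _ ?_).2 (by omega), (key 2 (by omega) _ ?_).2 (by omega),
      fun h => absurd ((key (n - 2) (by omega) _ ?_).1 h) (by omega),
      fun h => absurd ((key (n - 3) (by omega) _ ?_).1 h) (by omega)⟩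
    · push_cast; ring
    · push_cast; ring
    · rw [Nat.cast_sub (by omega), hnn]; push_cast; ring
    · rw [Nat.cast_sub (by omega), hnn]; push_cast; ring

end Rows

theorem Tame.add_card_le_hB {A : Sites K L} (h : Tame A) (S : Finset (ZMod L))
    (hS : ∀ y ∈ S, 2 ≤ brk (row A y)) : L + S.card ≤ hB A := by
  rw [hB_eq_sum_row]
  calc L + S.card = ∑ y : ZMod L, (1 + if y ∈ S then 1 else 0) := by
        rw [sum_add_distrib]; simp [ZMod.card]
    _ ≤ _ := sum_le_sum fun y _ => by
        have := one_le_brk (h.row_ne y).1 (h.row_ne y).2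
        split_ifs with hy
        · exact hS y hy
        · omega

theorem sum_brk_le_cB (A : Sites K L) (S : Finset (ZMod K)) : ∑ x ∈ S, brk (col A x) ≤ cB A :=
  sum_le_univ_sum_of_nonneg fun _ => Nat.zero_le _

theorem mem_stripSet {k x : ZMod K} {y : ZMod L} : (x, y) ∈ stripSet L N₀ k ↔ x ∈ arc k N₀ := by
  simp [stripSet]

/-- All sites of the strip at `k` except `p`, `u` are occupied, and in addition the outer sites
`q`, `r`. -/
def TwoOut (N₀ : ℕ) (k : ZMod K) (p u q r : ZMod K × ZMod L) (A : Sites K L) : Prop :=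
  ∀ v, v ∈ A ↔ (v.1 ∈ arc k N₀ ∧ v ≠ p ∧ v ≠ u) ∨ v = q ∨ v = r

theorem TwoOut.swap {k : ZMod K} {p u q r : ZMod K × ZMod L} {A : Sites K L}
    (h : TwoOut N₀ k p u q r A) : TwoOut N₀ k u p r q A := fun v => by
  rw [h v, and_comm (a := v ≠ p), or_comm (a := v = q)]

theorem TwoOut.row_card_le {k : ZMod K} {p u q r : ZMod K × ZMod L}
    {A : Sites K L} (h : TwoOut N₀ k p u q r A) (hN : N₀ ≤ K) (y : ZMod L) :
    (row A y).card ≤ N₀ + 2 := by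
  have : row A y ⊆ insert q.1 (insert r.1 (arc k N₀)) := by
    intro x hx; rw [mem_row, h] at hx
    rcases hx with ⟨h1, -⟩ | e | e
    · simp [h1]
    · simp [← e]
    · simp [← e]
  refine (card_le_card this).trans ((card_insert_le _ _).trans ?_)
  have := card_insert_le r.1 (arc k N₀); rw [card_arc hN] at this; omega

theorem TwoOut.col_ne (hL : 4 ≤ L) {k : ZMod K} {p u q r : ZMod K × ZMod L}
    {A : Sites K L} (h : TwoOut N₀ k p u q r A) (x : ZMod K) :
    (x ∈ arc k N₀ → col A x ≠ ∅) ∧ (x ∉ arc k N₀ → col A x ≠ univ) := by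
  have key : ∀ a b : ZMod L, ∃ y, y ≠ a ∧ y ≠ b := by
    intro a b
    by_contra! hc
    have : (univ : Finset (ZMod L)) ⊆ {a, b} := fun y _ => by
      by_cases hy : y = a
      · simp [hy]
      · simp [hc y hy]
    have h1 := card_le_card this; rw [card_univ, ZMod.card] at h1
    have := card_le_two (a := a) (b := b); omega
  constructor
  · intro hx e; obtain ⟨y, h1, h2⟩ := key p.2 u.2
    have : y ∈ col A x := by
      rw [mem_col, h]; exact Or.inl ⟨hx, fun e => h1 (by rw [← e]), fun e => h2 (by rw [← e])⟩
    simp [e] at this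
  · intro hx e; obtain ⟨y, h1, h2⟩ := key q.2 r.2; have : y ∈ col A x := by simp [e]
    rw [mem_col, h] at this
    rcases this with ⟨h3, -⟩ | e | e
    · exact hx h3
    · exact h1 (by rw [← e])
    · exact h2 (by rw [← e])

theorem TwoOut.hole_partial (hL : 4 ≤ L) {k : ZMod K} {p u q r : ZMod K × ZMod L}
    {A : Sites K L} (h : TwoOut N₀ k p u q r A) {x : ZMod K} {y : ZMod L}
    (hx : x ∈ arc k N₀) (hy : (x, y) ∉ A) : x ∈ partialCols A := by
  simp only [partialCols, mem_filter, mem_univ, true_and]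
  exact ⟨(h.col_ne hL x).1 hx, fun e => hy (by rw [← mem_col, e]; simp)⟩

theorem TwoOut.particle_partial (hL : 4 ≤ L) {k : ZMod K} {p u q r : ZMod K × ZMod L}
    {A : Sites K L} (h : TwoOut N₀ k p u q r A) {x : ZMod K} {y : ZMod L}
    (hx : x ∉ arc k N₀) (hy : (x, y) ∈ A) : x ∈ partialCols A := by
  simp only [partialCols, mem_filter, mem_univ, true_and]
  exact ⟨fun e => by rw [← mem_col, e] at hy; simp at hy, (h.col_ne hL x).2 hx⟩

/-- The hole at `(i, y)` and the particle at `(i + s, y)` next to it, with a second hole and a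
second particle in the same columns, but on different sides of `y`. -/
def Diagonal (N₀ : ℕ) (k : ZMod K) (A : Sites K L) : Prop :=
  ∃ (i s : ZMod K) (y t : ZMod L), (s = 1 ∨ s = -1) ∧ (t = 1 ∨ t = -1) ∧ i ∈ arc k N₀ ∧
    i + s ∉ arc k N₀ ∧ TwoOut N₀ k (i, y) (i, y - t) (i + s, y) (i + s, y + t) A

theorem TwoOut.two_le_brk_row {k i s : ZMod K} {y : ZMod L}
    {u r : ZMod K × ZMod L} {A : Sites K L} (hs : s = 1 ∨ s = -1)
    (hi : i ∈ arc k N₀) (ho : i + s ∉ arc k N₀) (h : TwoOut N₀ k (i, y) u (i + s, y) r A)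
    (hr : r.1 ∉ arc k N₀) (hcB : cB A ≤ 3) : 2 ≤ brk (row A y) := by
  have ⟨p1, p2, p3, p4, p5⟩ := hp; obtain ⟨e1, e2, e3, -⟩ := arc_edge hs hi ho
  have hcard := h.row_card_le (by omega) y
  have hiR : i ∉ row A y := by
    rw [mem_row, h]
    rintro (⟨-, h1, -⟩ | h1 | h1)
    · exact h1 rfl
    · exact (sign_ne_zero hs) (by simpa using congrArg Prod.fst h1)
    · rw [← h1] at hr; exact hr hi
  have hoR : i + s ∈ row A y := by rw [mem_row, h]; simp
  by_cases hb : i - s ∈ row A y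
  · exact two_le_brk_of_gap hs hiR hoR hb (by omega)
  have hu' : u = (i - s, y) := by
    by_contra hne
    refine hb ?_; rw [mem_row, h]; refine Or.inl ⟨e1, fun e => ?_, Ne.symm hne⟩
    exact (sign_ne_zero hs) (by simpa using congrArg Prod.fst e)
  have hb2 : i - s - s ∈ row A y := by
    rw [mem_row, h, hu']; refine Or.inl ⟨e2, fun e => ?_, fun e => ?_⟩
    · have := congrArg Prod.fst e; simp only [sub_sub, sub_eq_self] at this
      exact (two_sign_ne_zero hs) this
    · exact (sign_ne_zero hs) (by simpa using congrArg Prod.fst e)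
  by_cases ho2 : i + s + s ∈ row A y
  · exfalso
    have hsub : ({i - s, i, i + s, i + s + s} : Finset (ZMod K)) ⊆ partialCols A := by
      intro x hx; simp only [mem_insert, mem_singleton] at hx
      rcases hx with rfl | rfl | rfl | rfl
      · exact h.hole_partial p1 e1 (by rwa [mem_row] at hb)
      · exact h.hole_partial p1 hi (by rwa [mem_row] at hiR)
      · exact h.particle_partial p1 ho (by rwa [mem_row] at hoR)
      · exact h.particle_partial p1 e3 (by rwa [mem_row] at ho2)
    have h4 : ({i - s, i, i + s, i + s + s} : Finset (ZMod K)).card = 4 := by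
      have a1 := sign_ne_zero (n := K) hs; have a2 := two_sign_ne_zero (n := K) hs
      have a3 : i - s ≠ i := by simpa using a1
      have a4 : i - s ∉ ({i + s, i + s + s} : Finset (ZMod K)) := by
        intro hx; simp only [mem_insert, mem_singleton] at hx
        rcases hx with hx | hx
        · exact ho (hx ▸ e1)
        · exact e3 (hx ▸ e1)
      have a5 : i ≠ i + s := by simpa using a1
      have a6 : i ≠ i + s + s := by rw [add_assoc]; simpa using a2
      have a7 : i + s ≠ i + s + s := by simpa using a1
      rw [card_insert_of_notMem (by rw [mem_insert]; exact not_or.2 ⟨a3, a4⟩),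
        card_insert_of_notMem (by simp only [mem_insert, mem_singleton, not_or]; exact ⟨a5, a6⟩),
        card_pair a7]
    have := (card_le_card hsub).trans (card_partialCols_le A); omega
  · exact two_le_brk_of_isolated hs hoR ho2 (by rwa [add_sub_cancel_right]) hb2 fun e => ho (e ▸ e2)

theorem TwoOut.diagonal {k i s : ZMod K} {y : ZMod L}
    {u r : ZMod K × ZMod L} {A : Sites K L} (ht : Tame A) (hs : s = 1 ∨ s = -1)
    (hi : i ∈ arc k N₀) (ho : i + s ∉ arc k N₀) (h : TwoOut N₀ k (i, y) u (i + s, y) r A)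
    (hr : r.1 ∉ arc k N₀) (hu : u.1 ∈ arc k N₀) (hu' : u ≠ (i, y)) (hr' : r ≠ (i + s, y))
    (hle : cB A + hB A ≤ L + 3) : Diagonal N₀ k A := by
  have ⟨p1, p2, p3, p4, p5⟩ := hp; have hL := ht.le_hB
  have hrow := h.two_le_brk_row hs hi ho hr (by omega)
  have h1 := ht.add_card_le_hB {y} (by simpa using hrow); rw [card_singleton] at h1
  have hio : i ≠ i + s := by simpa using sign_ne_zero (n := K) hs
  have hiA : (i, y) ∉ A := by
    rw [h]
    rintro (⟨-, h1, -⟩ | h1 | h1)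
    · exact h1 rfl
    · exact hio (congrArg Prod.fst h1)
    · rw [← h1] at hr; exact hr hi
  have hoA : (i + s, y) ∈ A := by rw [h]; simp
  have huA : u ∉ A := by
    rw [h]
    rintro (⟨-, -, h1⟩ | h1 | h1)
    · exact h1 rfl
    · rw [h1] at hu; exact ho hu
    · rw [h1] at hu; exact hr hu
  have hrA : r ∈ A := by rw [h]; simp
  have hpar : ∀ x ∈ partialCols A, 1 ≤ brk (col A x) := fun x hx => by
    simp only [partialCols, mem_filter, mem_univ, true_and] at hx; exact one_le_brk hx.1 hx.2
  have hpi := h.hole_partial p1 hi hiA; have hpo := h.particle_partial p1 ho hoA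
  have hthird : ∀ x ∈ partialCols A, x = i ∨ x = i + s := by
    intro x hx
    by_contra! hne
    have := (card_le_card (show ({x, i, i + s} : Finset (ZMod K)) ⊆ partialCols A by
      intro z hz; simp only [mem_insert, mem_singleton] at hz
      rcases hz with rfl | rfl | rfl <;> assumption)).trans (card_partialCols_le A)
    rw [card_insert_of_notMem (by simp [hne.1, hne.2]), card_pair hio] at this; omega
  have hsum := sum_brk_le_cB A {i, i + s}; rw [sum_pair hio] at hsum; have hb1 := hpar i hpi
  have hb2 := hpar _ hpo; obtain ⟨ui, y'⟩ := u; obtain ⟨ro, y''⟩ := r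
  dsimp only at hu hr
  obtain rfl : ui = i := (hthird ui (h.hole_partial p1 hu huA)).resolve_right fun e => ho (e ▸ hu)
  obtain rfl : ro = ui + s := (hthird ro (h.particle_partial p1 hr hrA)).resolve_left fun e => hr (e ▸ hi)
  have hy' : y' ≠ y := fun e => hu' (by rw [e]); have hy'' : y'' ≠ y := fun e => hr' (by rw [e])
  obtain ⟨t', ht', rfl⟩ := adjacent_of_brk_compl_pair p1 hy' (W := col A ui) (fun v => by
    rw [mem_col, h]; simp [hi, hio]) (by omega)
  have hco : col A (ui + s) = {y, y''} := by
    ext v; rw [mem_col, h]; simp [ho]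
  obtain ⟨t, ht'', rfl⟩ := adjacent_of_brk_pair (by omega) hy'' (by rw [← hco]; omega)
  have htt : t' = -t := (sign_cases ht'' ht').resolve_left fun e => by
    subst e; have hrow' := h.swap.two_le_brk_row hs hi ho ho (by omega)
    have := ht.add_card_le_hB {y, y + t'} (by
      intro v hv; simp only [mem_insert, mem_singleton] at hv
      rcases hv with rfl | rfl <;> assumption)
    rw [card_pair hy'.symm] at this; omega
  subst htt; exact ⟨ui, s, y, t, hs, ht'', hi, ho, by rwa [sub_eq_add_neg]⟩

theorem card_col_mv_horizontal {A : Sites K L} {x x' : ZMod K} (h : x ≠ x')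
    (y : ZMod L) (z : ZMod K) : (col (mv A (x, y) (x', y)) z).card ≤ (col A z).card + 1 ∧
      (col A z).card ≤ (col (mv A (x, y) (x', y)) z).card + 1 := by
  by_cases h1 : z = x
  · rw [h1, col_mv_source _ _ h]; have := card_erase_le (s := col A x) (a := y)
    have := pred_card_le_card_erase (s := col A x) (a := y); omega
  by_cases h2 : z = x'
  · rw [h2, col_mv_target _ _ h]; have := card_insert_le y (col A x')
    have := card_le_card (subset_insert y (col A x')); omega
  rw [col_mv_other _ _ h1 h2]; omega

theorem mem_partialCols_of_card {A : Sites K L} {x : ZMod K}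
    (h : 0 < (col A x).card) (h' : (col A x).card < L) : x ∈ partialCols A := by
  simp only [partialCols, mem_filter, mem_univ, true_and]
  constructor
  · intro e; simp [e] at h
  · intro e; simp [e, ZMod.card] at h'

theorem mem_mv {A : Sites K L} {p q v : ZMod K × ZMod L} :
    v ∈ mv A p q ↔ v = q ∨ (v ≠ p ∧ v ∈ A) := by
  simp [mv]

theorem mem_mv_of_ne {A : Sites K L} {p q v : ZMod K × ZMod L} (hp : v ≠ p)
    (hq : v ≠ q) : v ∈ mv A p q ↔ v ∈ A := by
  simp [mem_mv, hp, hq]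

theorem card_row_mv_le (A : Sites K L) (p q : ZMod K × ZMod L) (y : ZMod L) :
    (row (mv A p q) y).card ≤ (row A y).card + 1 := by
  refine (card_le_card (t := insert q.1 (row A y)) fun z hz => ?_).trans (card_insert_le _ _)
  rw [mem_row, mem_mv] at hz; rw [mem_insert, mem_row]; exact hz.imp (congrArg Prod.fst) And.right

theorem mem_swap_compl_pair {n : ℕ} {W : Finset (ZMod n)} {a b c : ZMod n}
    (hW : ∀ w, w ∈ W ↔ w ≠ a ∧ w ≠ b) (hab : a ≠ b) (hc : c ≠ a) (w : ZMod n) :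
    w ∈ insert a (W.erase c) ↔ w ≠ b ∧ w ≠ c := by
  rw [mem_insert, mem_erase, hW]
  grind

theorem swap_pair {n : ℕ} {W : Finset (ZMod n)} {a b c : ZMod n}
    (hW : ∀ w, w ∈ W ↔ w = a ∨ w = b) (hab : b ≠ a) : insert c (W.erase a) = {c, b} := by
  ext w; rw [mem_insert, mem_erase, hW, mem_insert, mem_singleton]
  grind

theorem step_to_twoOut {k : ZMod K} {η ξ : Config K L N₀}
    (h1 : (η.1 \ stripSet L N₀ k).card ≤ 1) (hadj : (graph K L N₀).Adj η ξ) (ht : Tame ξ.1)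
    (hle : cB ξ.1 + hB ξ.1 ≤ L + 3) :
    (ξ.1 \ stripSet L N₀ k).card ≤ 1 ∨ Diagonal N₀ k ξ.1 := by
  have ⟨p1, p2, p3, p4, p5⟩ := hp
  by_cases hd : (ξ.1 \ stripSet L N₀ k).card ≤ 1
  · exact Or.inl hd
  right; have key : ∀ p q, ξ.1 = mv η.1 p q → q ∉ stripSet L N₀ k ∧ p ∈ stripSet L N₀ k ∧
      (ξ.1 \ stripSet L N₀ k).card = 2 := by
    intro p q e
    have hsub : ξ.1 \ stripSet L N₀ k ⊆ insert q (η.1 \ stripSet L N₀ k) := by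
      intro v hv; rw [e, mem_sdiff, mem_mv] at hv; rw [mem_insert, mem_sdiff]
      tauto
    have hc := (card_le_card hsub).trans (card_insert_le _ _)
    refine ⟨fun hq => hd ?_, ?_, by omega⟩
    · refine (card_le_card fun v hv => ?_).trans h1; have := hsub hv; rw [mem_insert] at this
      rcases this with rfl | h
      · exact absurd hq (mem_sdiff.1 hv).2
      · exact h
    · by_contra hps
      refine hd ((card_le_card (t := insert q ((η.1 \ stripSet L N₀ k).erase p))
        fun v hv => ?_).trans ((card_insert_le _ _).trans ?_))
      · rw [e, mem_sdiff, mem_mv] at hv; simp only [mem_insert, mem_erase, mem_sdiff]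
        tauto
      · by_cases hpη : p ∈ η.1
        · have := card_erase_add_one (s := η.1 \ stripSet L N₀ k) (a := p) (mem_sdiff.2 ⟨hpη, hps⟩)
          omega
        · exfalso; have hq : q ∉ η.1 ∨ q ∈ η.1 := by tauto
          have hcard := ξ.2; rw [e, mv, erase_eq_of_notMem hpη] at hcard
          rcases hq with hq | hq
          · rw [card_insert_of_notMem hq, η.2] at hcard; omega
          · refine hd ?_; rwa [e, mv, erase_eq_of_notMem hpη, insert_eq_of_mem hq]
  rcases exists_move hadj with ⟨x, y, s, hs, hpη, hqη, e⟩ | ⟨x, y, s, hs, hpη, hqη, e⟩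
  · obtain ⟨h2, h3, -⟩ := key _ _ e; rw [mem_stripSet] at h2 h3; exact absurd h3 h2
  obtain ⟨h2, h3, h4⟩ := key _ _ e
  have h5 : (stripSet L N₀ k \ ξ.1).card = 2 := by
    have := card_sdiff_add_card_comm (stripSet L N₀ k) ξ.1
    rw [h4, ξ.2, card_stripSet (by omega)] at this; omega
  have hq : (x + s, y) ∈ ξ.1 \ stripSet L N₀ k := by
    rw [mem_sdiff, e, mem_mv]; exact ⟨Or.inl rfl, h2⟩
  have hp' : (x, y) ∈ stripSet L N₀ k \ ξ.1 := by
    rw [mem_sdiff, e, mem_mv]; refine ⟨h3, ?_⟩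
    rintro (h | ⟨h, -⟩)
    · rw [h] at hpη; exact hqη hpη
    · exact h rfl
  obtain ⟨r, hr⟩ : ∃ r, (ξ.1 \ stripSet L N₀ k).erase (x + s, y) = {r} := by
    rw [← card_eq_one, card_erase_of_mem hq, h4]
  obtain ⟨u, hu⟩ : ∃ u, (stripSet L N₀ k \ ξ.1).erase (x, y) = {u} := by
    rw [← card_eq_one, card_erase_of_mem hp', h5]
  have hr' : r ∈ (ξ.1 \ stripSet L N₀ k).erase (x + s, y) := by rw [hr]; simp
  have hu' : u ∈ (stripSet L N₀ k \ ξ.1).erase (x, y) := by rw [hu]; simp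
  rw [mem_erase, mem_sdiff] at hr' hu'; rw [mem_stripSet] at h2 h3
  have hT : TwoOut N₀ k (x, y) u (x + s, y) r ξ.1 := by
    intro v; have a1 : v ∈ stripSet L N₀ k ↔ v.1 ∈ arc k N₀ := mem_stripSet
    have a2 : v ∈ (ξ.1 \ stripSet L N₀ k).erase (x + s, y) ↔ v = r := by rw [hr]; simp
    have a3 : v ∈ (stripSet L N₀ k \ ξ.1).erase (x, y) ↔ v = u := by rw [hu]; simp
    rw [mem_erase, mem_sdiff] at a2 a3; rw [mem_sdiff] at hq hp'; rw [← a1]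
    constructor
    · intro hv
      by_cases hb : v ∈ stripSet L N₀ k
      · exact Or.inl ⟨hb, fun e => hp'.2 (e ▸ hv), fun e => hu'.2.2 (e ▸ hv)⟩
      · by_cases hvq : v = (x + s, y)
        · exact Or.inr (Or.inl hvq)
        · exact Or.inr (Or.inr (a2.1 ⟨hvq, hv, hb⟩))
    · rintro (⟨hb, h6, h7⟩ | rfl | rfl)
      · by_contra hv
        exact h7 (a3.1 ⟨h6, hb, hv⟩)
      · exact hq.1
      · exact hr'.2.1
  exact hT.diagonal ht hs h3 h2 (fun h => hr'.2.2 (mem_stripSet.2 h))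
    (mem_stripSet.1 hu'.2.1) hu'.1 hr'.1 hle

set_option maxHeartbeats 400000 in
theorem step_from_diagonal {k : ZMod K} {η ξ : Config K L N₀}
    (h : Diagonal N₀ k η.1) (hadj : (graph K L N₀).Adj η ξ) (ht : Tame ξ.1)
    (hle : cB ξ.1 + hB ξ.1 ≤ L + 3) : (ξ.1 \ stripSet L N₀ k).card ≤ 1 := by
  have ⟨p1, p2, p3, p4, p5⟩ := hp; obtain ⟨i, s, y, t, hs, ht', hi, ho, h⟩ := h
  obtain ⟨e1, e2, e3, e4⟩ := arc_edge hs hi ho; have hs0 := sign_ne_zero (n := K) hs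
  have ht0 := sign_ne_zero (n := L) ht'; have htt0 := two_sign_ne_zero (n := L) ht'
  have hyt : ∀ {y : ZMod L}, y ≠ y - t := fun e => ht0 (by linear_combination e)
  have hio : i ≠ i + s := by simpa using hs0
  have hi1 : i - s ≠ i := by simpa using hs0
  have hi2 : i - s ≠ i + s := fun e => ho (e ▸ e1)
  have mi : ∀ v, (i, v) ∈ η.1 ↔ v ≠ y ∧ v ≠ y - t := fun v => by
    rw [h]; simp [hi, hio]
  have mo : ∀ v, (i + s, v) ∈ η.1 ↔ v = y ∨ v = y + t := fun v => by
    rw [h]; simp [ho]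
  have mx : ∀ x v, x ≠ i → x ≠ i + s → ((x, v) ∈ η.1 ↔ x ∈ arc k N₀) := fun x v h1 h2 => by
    rw [h]; simp [h1, h2]
  have hrowcard : ∀ v, (row ξ.1 v).card ≤ N₀ + 3 := by
    intro v
    have key : ∀ p q, ξ.1 = mv η.1 p q → (row ξ.1 v).card ≤ N₀ + 3 := fun p q e => by
      rw [e]; have := (card_row_mv_le η.1 p q v); have := h.row_card_le (by omega) v; omega
    rcases exists_move hadj with ⟨x, w, τ, -, -, -, e⟩ | ⟨x, w, τ, -, -, -, e⟩
    · exact key _ _ e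
    · exact key _ _ e
  have gap : ∀ v, (i, v) ∉ ξ.1 → (i + s, v) ∈ ξ.1 → (i - s, v) ∈ ξ.1 → 2 ≤ brk (row ξ.1 v) := by
    intro v h1 h2 h3
    refine two_le_brk_of_gap (i := i) hs (by rwa [mem_row]) (by rwa [mem_row]) (by rwa [mem_row]) ?_
    have := hrowcard v; omega
  have one : ∀ v, 2 ≤ brk (row ξ.1 v) → L + 1 ≤ hB ξ.1 := by
    intro v hv; have := ht.add_card_le_hB {v} (by simpa using hv); rwa [card_singleton] at this
  have hci : (col η.1 i).card + 2 = L := by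
    have e : col η.1 i = univ \ {y, y - t} := by ext v; rw [mem_col, mi]; simp
    have := card_sdiff_add_card_eq_card (subset_univ ({y, y - t} : Finset (ZMod L)))
    rwa [← e, card_pair hyt, card_univ, ZMod.card] at this
  have hco : (col η.1 (i + s)).card = 2 := by
    have e : col η.1 (i + s) = {y, y + t} := by ext v; rw [mem_col, mo]; simp
    rw [e, card_pair (by simpa using ht0)]
  rcases exists_move hadj with ⟨x, v, τ, hτ, hpη, hqη, e⟩ | ⟨x, v, τ, hτ, hpη, hqη, e⟩
  · exfalso; have hτt := sign_cases ht' hτ; have hcard := fun z => card_col_mv_vertical hpη hqη z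
    rw [← e] at hcard
    have hpi : i ∈ partialCols ξ.1 := mem_partialCols_of_card (by rw [hcard]; omega)
      (by rw [hcard]; omega)
    have hpo : i + s ∈ partialCols ξ.1 := mem_partialCols_of_card (by rw [hcard]; omega)
      (by rw [hcard]; omega); simp only [partialCols, mem_filter, mem_univ, true_and] at hpi hpo
    have b1 := one_le_brk hpi.1 hpi.2; have b2 := one_le_brk hpo.1 hpo.2
    have hx : x = i ∨ x = i + s := by
      by_contra! hx
      exact hqη ((mx _ _ hx.1 hx.2).2 ((mx _ _ hx.1 hx.2).1 hpη))
    have few : ∀ w, (i, w) ∉ ξ.1 → (i + s, w) ∈ ξ.1 →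
        brk (col ξ.1 i) + brk (col ξ.1 (i + s)) ≤ 2 := fun w h1 h2 => by
      have hx' : i - s ≠ x := by rcases hx with rfl | rfl <;> assumption
      have := one w (gap w h1 h2 (by
        rw [e, mem_mv_of_ne (by simp [hx']) (by simp [hx']), mx _ _ hi1 hi2]; exact e1))
      have := sum_brk_le_cB ξ.1 {i, i + s}; rw [sum_pair hio] at this; omega
    rcases hx with rfl | rfl
    · rw [mi] at hpη hqη
      have mo' : ∀ w, (x + s, w) ∈ ξ.1 ↔ w = y ∨ w = y + t := fun w => by
        rw [e, mem_mv_of_ne (by simp [hs0]) (by simp [hs0]), mo]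
      have hcase : (v = y + t ∧ τ = -t) ∨ (v = y - t - t ∧ τ = t) := by
        rcases hτt with rfl | rfl
        · exact Or.inr ⟨eq_sub_of_add_eq (by_contra fun h => hqη
            ⟨fun hc => hpη.2 (eq_sub_of_add_eq hc), h⟩), rfl⟩
        · exact Or.inl ⟨by_contra fun h => hqη ⟨fun hc => h (by rw [← hc]; ring),
            fun hc => hpη.1 (by linear_combination hc)⟩, rfl⟩
      rcases hcase with ⟨rfl, rfl⟩ | ⟨rfl, rfl⟩
      · have hmi : ∀ w, w ∈ col ξ.1 x ↔ w ≠ y - t ∧ w ≠ y + t := fun w => by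
          rw [e, col_mv_vertical, add_neg_cancel_right]
          exact mem_swap_compl_pair (fun w => by rw [mem_col, mi]) hyt (by simpa using ht0) w
        have := two_le_brk_compl_pair p1 ht' (a := y - t) fun w => by rw [hmi, sub_add_cancel]
        have := few (y + t) (by simp [← mem_col, hmi]) ((mo' _).2 (Or.inr rfl)); omega
      · have hmi : ∀ w, w ∈ col ξ.1 x ↔ w ≠ y ∧ w ≠ y - τ - τ := fun w => by
          rw [e, col_mv_vertical, sub_add_cancel]
          exact mem_swap_compl_pair (fun w => by rw [mem_col, mi, and_comm]) (by simpa using ht0)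
            (fun e => ht0 (by linear_combination -e)) w
        have := two_le_brk_compl_pair p1 ht' (a := y - τ - τ) fun w => by
          rw [hmi, and_comm, sub_add_cancel, sub_add_cancel]
        have := few y (by simp [← mem_col, hmi]) ((mo' _).2 (Or.inl rfl)); omega
    · rw [mo] at hpη hqη
      have mi' : ∀ w, (i, w) ∈ ξ.1 ↔ w ≠ y ∧ w ≠ y - t := fun w => by
        rw [e, mem_mv_of_ne (by simp [hs0]) (by simp [hs0]), mi]
      have hcase : (v = y ∧ τ = -t) ∨ (v = y + t ∧ τ = t) := by
        rcases hpη with rfl | rfl <;> rcases hτt with rfl | rfl <;> simp at hqη ⊢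
      rcases hcase with ⟨rfl, rfl⟩ | ⟨rfl, rfl⟩
      · have hmo : col ξ.1 (i + s) = {v - t, v + t} := by
          rw [e, col_mv_vertical, ← sub_eq_add_neg]
          exact swap_pair (fun w => by rw [mem_col, mo]) (by simpa using ht0)
        have := two_le_brk_pair p1 ht' (v - t); rw [sub_add_cancel, ← hmo] at this
        have := few (v - t) (by simp [mi']) (by rw [← mem_col, hmo]; simp); omega
      · have hmo : col ξ.1 (i + s) = {y, y + τ + τ} := by
          rw [e, col_mv_vertical, pair_comm]
          exact swap_pair (fun w => by rw [mem_col, mo, or_comm]) (by simpa using ht0)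
        have := two_le_brk_pair p1 ht' y; rw [← hmo] at this
        have := few y (by simp [mi']) (by rw [← mem_col, hmo]; simp); omega
  · have hτ0 := sign_ne_zero (n := K) hτ; have hxτ : x ≠ x + τ := by simpa using hτ0
    have hcard := fun z => card_col_mv_horizontal (A := η.1) hxτ v z; rw [← e] at hcard
    have hpi : i ∈ partialCols ξ.1 := mem_partialCols_of_card (by have := hcard i; omega)
      (by have := hcard i; omega); have hpo : i + s ∈ partialCols ξ.1 := mem_partialCols_of_card
      (by have := hcard (i + s); omega) (by have := hcard (i + s); omega)
    have hτs := sign_cases hs hτ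
    have hother : v ≠ y → 2 ≤ brk (row ξ.1 y) := fun hv => by
      refine gap y ?_ ?_ ?_
      · rw [e, mem_mv_of_ne (by simp [hv.symm]) (by simp [hv.symm]), mi]; simp
      · rw [e, mem_mv_of_ne (by simp [hv.symm]) (by simp [hv.symm]), mo]; simp
      · rw [e, mem_mv_of_ne (by simp [hv.symm]) (by simp [hv.symm]), mx _ _ hi1 hi2]; exact e1
    have htwo : 2 ≤ cB ξ.1 := by
      refine le_trans ?_ (card_partialCols_le ξ.1); rw [← card_pair hio]
      refine card_le_card fun z hz => ?_; simp only [mem_insert, mem_singleton] at hz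
      rcases hz with rfl | rfl <;> assumption
    by_cases hc1 : x = i ∧ x + τ = i + s
    · exfalso; obtain ⟨rfl, hc⟩ := hc1; obtain rfl : τ = s := add_left_cancel hc; rw [mi] at hpη
      have hv := gap v (by rw [e, mem_mv]; simp [hτ0]) (by rw [e, mem_mv]; simp)
        (by rw [e, mem_mv_of_ne (by simp [hi1]) (by simp [hi2]), mx _ _ hi1 hi2]; exact e1)
      have := ht.add_card_le_hB {v, y} (by
        intro w hw; simp only [mem_insert, mem_singleton] at hw
        rcases hw with rfl | rfl
        · exact hv
        · exact hother hpη.1)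
      rw [card_pair hpη.1] at this; omega
    by_cases hc2 : x = i + s ∧ x + τ = i
    · obtain ⟨rfl, hc⟩ := hc2; rw [mo] at hpη; rw [hc, mi] at hqη
      obtain rfl : v = y := by
        by_contra hv
        have h1 : v = y + t := hpη.resolve_left hv
        have h2 : v = y - t := by_contra fun h => hqη ⟨hv, h⟩
        exact htt0 (by linear_combination h2 - h1)
      have : ξ.1 \ stripSet L N₀ k ⊆ {(i + s, v + t)} := by
        rintro ⟨z, w⟩ hz; rw [mem_sdiff, mem_stripSet, e, mem_mv, h, hc] at hz; rw [mem_singleton]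
        obtain ⟨hz1, hz2⟩ := hz
        rcases hz1 with hz1 | ⟨hz1, hz3 | hz3 | hz3⟩
        · rw [(Prod.mk.inj hz1).1] at hz2; exact absurd hi hz2
        · exact absurd hz3.1 hz2
        · exact absurd hz3 hz1
        · exact hz3
      exact (card_le_card this).trans (card_singleton _).le
    exfalso
    have hthree : 3 ≤ cB ξ.1 := by
      obtain ⟨z, hz, hzi, hzo⟩ : ∃ z ∈ partialCols ξ.1, z ≠ i ∧ z ≠ i + s := by
        by_cases hx : x ≠ i ∧ x ≠ i + s
        · refine ⟨x, mem_partialCols_of_card ?_ ?_, hx.1, hx.2⟩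
          · have hfull : col η.1 x = univ := by
              ext w; rw [mem_col, mx _ _ hx.1 hx.2, ← mx x v hx.1 hx.2]; simp [hpη]
            have := hcard x; rw [hfull, card_univ, ZMod.card] at this; omega
          · refine card_lt_of_ne_univ fun hu => ?_
            have : (x, v) ∈ ξ.1 := by rw [← mem_col, hu]; simp
            rw [e, mem_mv] at this; simp [hτ0] at this
        · have hx' : x + τ ≠ i ∧ x + τ ≠ i + s := by
            constructor
            · rintro hxi
              by_cases hx1 : x = i
              · rw [hx1] at hxi; exact hτ0 (by simpa using hxi)
              · exact hc2 ⟨by_contra fun h => hx ⟨hx1, h⟩, hxi⟩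
            · rintro hxi
              by_cases hx1 : x = i
              · exact hc1 ⟨hx1, hxi⟩
              · have hx2 : x = i + s := by_contra fun h => hx ⟨hx1, h⟩
                rw [hx2] at hxi; exact hτ0 (by simpa using hxi)
          refine ⟨x + τ, mem_partialCols_of_card ?_ ?_, hx'.1, hx'.2⟩
          · refine card_pos.2 ⟨v, ?_⟩; rw [mem_col, e, mem_mv]; simp
          · have hempty : col η.1 (x + τ) = ∅ := by
              rw [eq_empty_iff_forall_notMem]; intro w hw
              rw [mem_col, mx _ _ hx'.1 hx'.2, ← mx (x + τ) v hx'.1 hx'.2] at hw; exact hqη hw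
            have := hcard (x + τ); rw [hempty, card_empty] at this; omega
      refine le_trans ?_ (card_partialCols_le ξ.1)
      have h3 : ({z, i, i + s} : Finset (ZMod K)).card = 3 := by
        rw [card_insert_of_notMem (by simp [hzi, hzo]), card_pair hio]
      rw [← h3]; refine card_le_card fun w hw => ?_; simp only [mem_insert, mem_singleton] at hw
      rcases hw with rfl | rfl | rfl <;> assumption
    by_cases hv : v = y
    · subst hv; have hb : 2 ≤ brk (row η.1 v) := two_le_brk_of_gap (i := i) hs
        (by rw [mem_row, mi]; simp) (by rw [mem_row, mo]; simp)
        (by rw [mem_row, mx _ _ hi1 hi2]; exact e1) (by have := h.row_card_le (by omega) v; omega)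
      have hmr : ∀ z, z ∈ row η.1 v ↔ (z ∈ arc k N₀ ∧ z ≠ i) ∨ z = i + s := by
        intro z; rw [mem_row]
        by_cases hz1 : z = i
        · subst hz1; rw [mi]; simp [hs0]
        by_cases hz2 : z = i + s
        · subst hz2; rw [mo]; simp
        rw [mx _ _ hz1 hz2, and_iff_left hz1, or_iff_left hz2]
      have hmove := brk_move (n := K) (W := row η.1 v) (y := x) hτ (by rwa [mem_row]) (by rwa [mem_row])
      rw [← row_mv_horizontal, ← e] at hmove
      have hlt : ¬ 2 ≤ brk (row ξ.1 v) := fun h2 => by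
        have := one v h2; omega
      have hA : x + τ + τ ∈ row η.1 v := by
        by_contra hA
        rw [if_neg hA] at hmove; omega
      have hB' : x - τ ∉ row η.1 v := by
        intro hB'; rw [if_pos hB'] at hmove
        split_ifs at hmove <;> omega
      have hx : x ∈ row η.1 v := by rwa [mem_row]
      have hx2 : x + τ ∉ row η.1 v := by rwa [mem_row]
      rw [hmr] at hA hB' hx hx2
      by_cases hxo : x = i + s
      · subst hxo
        rcases hτs with rfl | rfl
        · rcases hA with hA | hA
          · exact e4 hA.1
          · exact (two_sign_ne_zero (n := K) hs) (by linear_combination hA)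
        · exact hc2 ⟨rfl, by ring⟩
      have hxI : x ∈ arc k N₀ ∧ x ≠ i := hx.resolve_right hxo
      have hτneg : -τ = 1 ∨ -τ = -1 := by
        rcases hτ with rfl | rfl
        · exact Or.inr rfl
        · exact Or.inl (neg_neg 1)
      by_cases hI : x + τ ∈ arc k N₀
      · have hxi : x + τ = i := by_contra fun h => hx2 (Or.inl ⟨hI, h⟩)
        by_cases hI' : x - τ ∈ arc k N₀
        · have : x - τ = i := by_contra fun h => hB' (Or.inl ⟨hI', h⟩)
          exact (two_sign_ne_zero (n := K) hτ) (by linear_combination hxi - this)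
        · have := arc_edge hτneg hxI.1 (by rwa [← sub_eq_add_neg])
          simp only [sub_neg_eq_add, hxi] at this
          rcases hτs with rfl | rfl
          · exact ho this.2.1
          · exact ho (by rw [show i + s = x by rw [← hxi]; ring]; exact hxI.1)
      · have := arc_edge hτ hxI.1 hI
        have hxi : x - τ = i := by_contra fun h => hB' (Or.inl ⟨this.1, h⟩); rw [hxi] at this
        rcases hτs with rfl | rfl
        · exact ho (by rw [← hxi, sub_add_cancel]; exact hxI.1)
        · rw [sub_neg_eq_add] at this; exact ho this.2.1
    · have := one y (hother hv); omega

theorem not_linked_strip_succ (k : ZMod K) :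
    ¬ Linked (graph K L N₀) energy (H₀ L N₀ + 4 - 1) (stripConfig hp k) (stripConfig hp (k + 1)) := by
  intro h; have ⟨p1, p2, p3, p4, p5⟩ := hp; have key := h.preserves (fun ζ => Tame ζ.1 ∧
    ((ζ.1 \ stripSet L N₀ k).card ≤ 1 ∨ Diagonal N₀ k ζ.1)) ?_ ?_
  · have hsd : univ.image (fun v : ZMod L => (k + N₀, v)) ⊆
        (stripConfig hp (k + 1)).1 \ stripSet L N₀ k := by
      intro v hv; obtain ⟨w, -, rfl⟩ := mem_image.1 hv; rw [mem_sdiff, mem_stripSet, mem_arc_index]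
      refine ⟨?_, by omega⟩
      rw [show (stripConfig hp (k + 1)).1 = stripSet L N₀ (k + 1) from rfl, mem_stripSet, mem_arc]
      refine ⟨N₀ - 1, by omega, ?_⟩; rw [Nat.cast_sub (by omega)]; push_cast; ring
    have hc := card_le_card hsd
    rw [card_image_of_injective _ (fun a b e => by simpa using e), card_univ, ZMod.card] at hc
    rcases key.2 with h1 | ⟨i, s, y, t, hs, ht, hi, ho, h1⟩
    · omega
    · have : (stripConfig hp (k + 1)).1 \ stripSet L N₀ k ⊆ {(i + s, y), (i + s, y + t)} := by
        rintro ⟨x, v⟩ hv; rw [mem_sdiff, mem_stripSet, h1] at hv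
        simp only [mem_insert, mem_singleton]
        tauto
      have := (card_le_card this).trans card_le_two; omega
  · rintro x y ⟨hx, hx'⟩ hadj - hy; have ht := tame_step hx hadj (by omega); refine ⟨ht, ?_⟩
    have hle : cB y.1 + hB y.1 ≤ L + 3 := by
      rw [energy_eq'] at hy; omega
    rcases hx' with hx' | hx'
    · exact step_to_twoOut hx' hadj ht hle
    · exact Or.inl (step_from_diagonal hx' hadj ht hle)
  · refine ⟨tame_strip k, Or.inl ?_⟩
    rw [show (stripConfig hp k).1 = stripSet L N₀ k from rfl, sdiff_self]; simp

theorem H₀_neg (hL : 4 ≤ L) (hN : 4 ≤ N₀) : H₀ L N₀ + 4 < 0 := by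
  have : (4 : ℤ) * 4 ≤ L * N₀ := mul_le_mul (by exact_mod_cast hL) (by exact_mod_cast hN)
    (by norm_num) (by positivity); have : (L : ℤ) * 4 ≤ L * N₀ := by gcongr; exact_mod_cast hN
  rw [H₀]; have : (-2 : ℤ) * L * N₀ = -2 * (L * N₀) := by ring
  rw [this]; have : (4 : ℤ) ≤ L := by exact_mod_cast hL
  linarith

theorem groundBarrier_kawasaki : groundBarrier (graph K L N₀) energy = H₀ L N₀ + 4 := by
  have hs : ∀ s ∈ groundStates (energy (K := K) (L := L) (N₀ := N₀)), ∃ k, s = stripConfig hp k := by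
    intro s hs; obtain ⟨k, hk⟩ := mem_groundStates_iff.1 hs; exact ⟨k, Subtype.ext (mem_strip.1 hk)⟩
  refine groundBarrier_eq energy_ge (H₀_neg hp.1 hp.3) ?_
    (mem_groundStates_iff.2 ⟨0, stripConfig_mem 0⟩)
    (mem_groundStates_iff.2 ⟨_, stripConfig_mem (0 + 1)⟩) (not_linked_strip_succ 0); intro s h s' h'
  obtain ⟨k, rfl⟩ := hs s h; obtain ⟨k', rfl⟩ := hs s' h'; exact linked_strips k k'

theorem mem_reachable {η : Config K L N₀} : η ∈ reached K L N₀ ↔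
      ∃ k, Linked (graph K L N₀) energy (H₀ L N₀ + 4) η (stripConfig hp k) := by
  rw [mem_reachable_iff energy_ge (H₀_neg hp.1 hp.3) groundBarrier_kawasaki]
  constructor
  · rintro ⟨s, hs, h⟩; obtain ⟨k, hk⟩ := mem_groundStates_iff.1 hs
    obtain rfl : s = stripConfig hp k := Subtype.ext (mem_strip.1 hk); exact ⟨k, h.symm⟩
  · rintro ⟨k, h⟩; exact ⟨_, mem_groundStates_iff.2 ⟨k, stripConfig_mem k⟩, h.symm⟩

theorem tame_of_reachable {η : Config K L N₀}
    (h : η ∈ reached K L N₀) : Tame η.1 := by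
  obtain ⟨k, hk⟩ := mem_reachable.1 h; exact tame_of_linked (tame_strip k) hk.symm

/-! ### Horizontal reflections -/

/-- The reflection `x ↦ c - x` of the columns. -/
def flipSite (c : ZMod K) : (ZMod K × ZMod L) ≃ (ZMod K × ZMod L) where
  toFun v := (c - v.1, v.2)
  invFun v := (c - v.1, v.2)
  left_inv v := by simp
  right_inv v := by simp

/-- The reflection of a set of sites. -/
def flipSet (c : ZMod K) (A : Sites K L) : Sites K L :=
  A.map (flipSite c).toEmbedding

theorem mem_flipSet {c : ZMod K} {A : Sites K L} {v : ZMod K × ZMod L} :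
    v ∈ flipSet c A ↔ flipSite c v ∈ A := by
  rw [flipSet, mem_map_equiv]; rfl

theorem col_flipSet (c : ZMod K) (A : Sites K L) (x : ZMod K) :
    col (flipSet c A) x = col A (c - x) := by
  ext y; rw [mem_col, mem_col, mem_flipSet]; rfl

theorem flipSet_flipSet (c : ZMod K) (A : Sites K L) : flipSet c (flipSet c A) = A :=
  ext_col fun x => by rw [col_flipSet, col_flipSet, sub_sub_cancel]

theorem cB_flipSet (c : ZMod K) (A : Sites K L) : cB (flipSet c A) = cB A := by
  rw [cB, cB, ← (Equiv.subLeft c).sum_comp]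
  simp only [col_flipSet, Equiv.subLeft_apply, sub_sub_cancel]

theorem hB_flipSet (c : ZMod K) (A : Sites K L) : hB (flipSet c A) = hB A := by
  have h1 : hB (flipSet c A) = ∑ x, (col A (x + 1) \ col A x).card := by
    rw [hB, ← (Equiv.subLeft (c - 1)).sum_comp]; refine sum_congr rfl fun x _ => ?_
    rw [col_flipSet, col_flipSet, Equiv.subLeft_apply]
    congr 3 <;> ring_nf
  have h2 : ∑ x, (col A (x + 1) \ col A x).card + ∑ x, (col A x).card =
      ∑ x, (col A (x + 1)).card + ∑ x, (col A x \ col A (x + 1)).card := by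
    rw [← sum_add_distrib, ← sum_add_distrib]
    exact sum_congr rfl fun x _ => card_sdiff_add_card_comm _ _
  have h3 : ∑ x, (col A (x + 1)).card = ∑ x, (col A x).card :=
    Equiv.sum_comp (Equiv.addRight (1 : ZMod K)) fun x => (col A x).card; rw [h1, hB]; omega

theorem flipSet_mv (c : ZMod K) (A : Sites K L) (p q : ZMod K × ZMod L) :
    flipSet c (mv A p q) = mv (flipSet c A) (flipSite c p) (flipSite c q) := by
  rw [flipSet, mv, mv, map_insert, map_erase]; rfl

theorem torus_adj_flipSite (hK : 2 ≤ K) (hL : 2 ≤ L) (c : ZMod K) {p q : ZMod K × ZMod L}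
    (h : (torus K L).Adj p q) : (torus K L).Adj (flipSite c p) (flipSite c q) := by
  rw [torus_adj hK hL] at h ⊢; simp only [flipSite, Equiv.coe_fn_mk]
  rcases h with ⟨h1, h2⟩ | ⟨h1, h2 | h2⟩
  · exact Or.inl ⟨by rw [h1], h2⟩
  · exact Or.inr ⟨h1, Or.inr (by rw [h2]; ring)⟩
  · exact Or.inr ⟨h1, Or.inl (by rw [h2]; ring)⟩

/-- The reflection of configurations. -/
def flipEquiv (N₀ : ℕ) (c : ZMod K) : Config K L N₀ ≃ Config K L N₀ where
  toFun η := ⟨flipSet c η.1, by rw [flipSet, card_map, η.2]⟩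
  invFun η := ⟨flipSet c η.1, by rw [flipSet, card_map, η.2]⟩
  left_inv η := Subtype.ext (flipSet_flipSet c η.1)
  right_inv η := Subtype.ext (flipSet_flipSet c η.1)

theorem adj_flipEquiv (c : ZMod K) {η ξ : Config K L N₀}
    (h : (graph K L N₀).Adj η ξ) : (graph K L N₀).Adj (flipEquiv N₀ c η) (flipEquiv N₀ c ξ) := by
  have ⟨p1, p2, p3, p4, p5⟩ := hp; rw [graph_adj] at h ⊢; obtain ⟨p, q, h1, h2, h3, h4⟩ := h
  refine ⟨flipSite c p, flipSite c q, torus_adj_flipSite (by omega) (by omega) c h1, ?_, ?_, ?_⟩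
  · change flipSite c p ∈ flipSet c η.1; rw [mem_flipSet]; simpa [flipSite] using h2
  · change flipSite c q ∉ flipSet c η.1; rw [mem_flipSet]; simpa [flipSite] using h3
  · change flipSet c ξ.1 = _; rw [h4, flipSet_mv]; rfl

/-- The reflection as an automorphism of the graph of the dynamics. -/
def flipIso (c : ZMod K) : graph K L N₀ ≃g graph K L N₀ where
  toEquiv := flipEquiv N₀ c
  map_rel_iff' {η ξ} := by
    constructor
    · intro h; have := adj_flipEquiv c h
      rwa [show flipEquiv N₀ c (flipEquiv N₀ c η) = η from (flipEquiv N₀ c).left_inv η,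
        show flipEquiv N₀ c (flipEquiv N₀ c ξ) = ξ from (flipEquiv N₀ c).left_inv ξ] at this
    · exact adj_flipEquiv c

theorem flipIso_val (c : ZMod K) (η : Config K L N₀) : (flipIso c η).1 = flipSet c η.1 := rfl

theorem flipIso_flipIso (c : ZMod K) (η : Config K L N₀) :
    flipIso c (flipIso c η) = η := Subtype.ext (flipSet_flipSet c η.1)

theorem energy_flipIso (c : ZMod K) (η : Config K L N₀) : energy (flipIso c η) = energy η := by
  rw [energy_eq', energy_eq', flipIso_val, cB_flipSet, hB_flipSet]

theorem mem_image_flipIso (c : ZMod K) {A : Set (Config K L N₀)}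
    {η : Config K L N₀} : η ∈ flipIso c '' A ↔ flipIso c η ∈ A := by
  constructor
  · rintro ⟨ξ, h, rfl⟩; rwa [flipIso_flipIso]
  · intro h; exact ⟨_, h, flipIso_flipIso c η⟩

theorem image_flipIso_flipIso (c : ZMod K) (A : Set (Config K L N₀)) :
    flipIso c '' (flipIso c '' A) = A := by
  ext η; rw [mem_image_flipIso, mem_image_flipIso, flipIso_flipIso]

theorem reflect_eq (k : ZMod K) (A : Set (Config K L N₀)) :
    reflect k A = flipIso (2 * k + (N₀ : ZMod K) - 1) '' A := by
  have key : ∀ η ξ : Config K L N₀, (occ η =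
      (fun x : ZMod K × ZMod L => (2 * k + N₀ - 1 - x.1, x.2)) '' occ ξ) ↔
      flipIso (2 * k + (N₀ : ZMod K) - 1) ξ = η := by
    intro η ξ
    rw [Subtype.ext_iff, flipIso_val, eq_comm, ← occ_eq_coe.trans eq_comm, flipSet,
      coe_map, eq_comm]; rfl
  ext η; simp only [reflect, Set.mem_ofPred_eq, Set.mem_image, key]

theorem flipIso_mem_reachable (c : ZMod K) {η : Config K L N₀}
    (h : η ∈ reached K L N₀) :
    flipIso c η ∈ reached K L N₀ := by
  obtain ⟨k, hk⟩ := mem_reachable.1 h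
  have h1 := map_mem_groundStates (flipIso (L := L) (N₀ := N₀) c) (energy_flipIso c)
    (mem_groundStates_iff.2 ⟨k, stripConfig_mem k⟩); obtain ⟨k', hk'⟩ := mem_groundStates_iff.1 h1
  refine mem_reachable.2 ⟨k', ?_⟩
  have : flipIso c (stripConfig hp k) = stripConfig hp k' := Subtype.ext (mem_strip.1 hk')
  rw [← this]; exact hk.map (flipIso c) (energy_flipIso c)

theorem image_mem_plateaux (c : ZMod K) {P : Set (Config K L N₀)}
    (h : P ∈ plateaux K L N₀) : flipIso c '' P ∈ plateaux K L N₀ := by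
  refine ⟨image_isStablePlateau _ (energy_flipIso c) h.1, ?_⟩
  rintro _ ⟨η, hη, rfl⟩; exact flipIso_mem_reachable c (h.2 hη)

theorem flipSet_mk_congr {c c' k k' : ZMod K} (h : c - k = c' - k') (a : ℕ)
    (Z W₁ W₂ W₃ : Finset (ZMod L)) :
    flipSet c (mk k a Z W₁ W₂ W₃) = flipSet c' (mk k' a Z W₁ W₂ W₃) := by
  refine ext_col fun x => ?_; rw [col_flipSet, col_flipSet, col_mk, col_mk]
  congr 2
  linear_combination h

/-! ### Moves from unimodal configurations -/

theorem Uni.tame {A : Sites K L} {z : ZMod K} {f : ℕ} (h : Uni A z f) : Tame A := by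
  refine ⟨⟨_, h.full⟩, fun y e => ?_⟩; have : z ∈ row A y := by rw [e]; simp
  rw [mem_row, ← mem_col, h.zero] at this; simp at this

theorem Uni.comparable {A : Sites K L} {z : ZMod K} {f : ℕ} (h : Uni A z f)
    (x : ZMod K) : col A x ⊆ col A (x + 1) ∨ col A (x + 1) ⊆ col A x := by
  obtain ⟨j, hj, rfl⟩ := exists_index z x
  rw [show z + j + 1 = z + ((j + 1 : ℕ) : ZMod K) by push_cast; ring]
  by_cases hjf : j < f
  · exact Or.inl (h.mono j hjf)
  · exact Or.inr (h.anti j (by omega) hj)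

theorem Uni.subset_of_notMem {A : Sites K L} {z : ZMod K} {f : ℕ} (h : Uni A z f)
    {x s : ZMod K} (hs : s = 1 ∨ s = -1) {y : ZMod L} (hy : (x, y) ∈ A) (hy' : (x + s, y) ∉ A) :
    col A (x + s) ⊆ col A x := by
  rw [← mem_col] at hy hy'
  rcases hs with rfl | rfl
  · exact (h.comparable x).resolve_left fun hc => hy' (hc hy)
  · have := h.comparable (x + -1); rw [neg_add_cancel_right] at this
    exact this.resolve_right fun hc => hy' (hc hy)

/-- There are at least two full columns. -/
def TwoFull (A : Sites K L) : Prop :=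
  ∃ x x', x ≠ x' ∧ col A x = univ ∧ col A x' = univ

theorem Tame.brk_row_eq_one {A : Sites K L} (h : Tame A) (hh : hB A = L)
    (y : ZMod L) : brk (row A y) = 1 := by
  have h1 := one_le_brk (h.row_ne y).1 (h.row_ne y).2; by_contra hne
  have := h.add_card_le_hB {y} (by simp; omega); rw [card_singleton] at this; omega

theorem Uni.row_card_le (hK : 2 ≤ K) {A : Sites K L} {z : ZMod K} {f : ℕ}
    (h : Uni A z f) (y : ZMod L) : (row A y).card + 2 ≤ K := by
  have : row A y ⊆ univ \ {z, z - 1} := by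
    intro x hx; rw [mem_row, ← mem_col] at hx
    simp only [mem_sdiff, mem_univ, mem_insert, mem_singleton, true_and]
    rintro (rfl | rfl)
    · rw [h.zero] at hx; simp at hx
    · rw [h.last] at hx; simp at hx
  have h1 := card_le_card this
  have h2 := card_sdiff_add_card_eq_card (subset_univ ({z, z - 1} : Finset (ZMod K)))
  rw [card_pair (self_ne_sub_one hK z).symm, card_univ, ZMod.card] at h2; omega

/-- A horizontal move from a unimodal configuration creates one additional horizontal bond. -/
theorem Uni.hB_horizontal (hK : 4 ≤ K) {A : Sites K L} {z : ZMod K} {f : ℕ}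
    (h : Uni A z f) (h2 : TwoFull A) {x s : ZMod K} (hs : s = 1 ∨ s = -1) {y : ZMod L}
    (hy : (x, y) ∈ A) (hy' : (x + s, y) ∉ A) : hB (mv A (x, y) (x + s, y)) = L + 1 := by
  have hrow := h.tame.brk_row_eq_one h.hB_eq y; have hcard := h.row_card_le (by omega) y
  have h1 := hB_mv_horizontal A x (x + s) y
  have h3 := brk_move (W := row A y) (y := x) hs (by rwa [mem_row]) (by rwa [mem_row]) hK
  obtain ⟨u, u', huu, hu, hu'⟩ := h2; have hur : u ∈ row A y := by rw [mem_row, ← mem_col, hu]; simp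
  have hur' : u' ∈ row A y := by rw [mem_row, ← mem_col, hu']; simp
  rw [← mem_row] at hy hy'
  have h4 : x + s + s ∉ row A y := by
    intro hc; have := two_le_brk_of_gap hs hy' hc (by rwa [add_sub_cancel_right]) (by omega); omega
  have h5 : x - s ∈ row A y := by
    by_contra hc
    have : ∃ v ∈ row A y, v ≠ x := by
      by_cases hux : u = x
      · exact ⟨u', hur', fun e => huu (hux.trans e.symm)⟩
      · exact ⟨u, hur, hux⟩
    obtain ⟨v, hv, hvx⟩ := this; have := two_le_brk_of_isolated hs hy hy' hc hv hvx; omega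
  rw [if_neg h4, if_pos h5] at h3; rw [h.hB_eq] at h1; omega

theorem mem_partialCols {A : Sites K L} {x : ZMod K} :
    x ∈ partialCols A ↔ 0 < (col A x).card ∧ (col A x).card < L := by
  refine ⟨fun h => ?_, fun h => mem_partialCols_of_card h.1 h.2⟩
  simp only [partialCols, mem_filter, mem_univ, true_and] at h
  exact ⟨card_pos.2 (nonempty_iff_ne_empty.2 h.1), card_lt_of_ne_univ h.2⟩

theorem partialCols_congr {A B : Sites K L}
    (h : ∀ x, (col A x).card = (col B x).card) : partialCols A = partialCols B := by
  ext x; rw [mem_partialCols, mem_partialCols, h]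

/-- A horizontal move from a unimodal configuration does not decrease the number of columns that
are neither empty nor full. -/
theorem Uni.card_partialCols_horizontal (hL : 2 ≤ L) {A : Sites K L} {z : ZMod K}
    {f : ℕ} (h : Uni A z f) {x s : ZMod K} (hs : s = 1 ∨ s = -1) (hx : x ≠ x + s) {y : ZMod L}
    (hy : (x, y) ∈ A) (hy' : (x + s, y) ∉ A) :
    (partialCols A).card ≤ (partialCols (mv A (x, y) (x + s, y))).card := by
  have hsub := h.subset_of_notMem hs hy hy'; have c1 := col_mv_source A y hx
  have c2 := col_mv_target A y hx
  set B := mv A (x, y) (x + s, y) with hB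
  rw [← mem_col] at hy hy'
  have hmem : ∀ w, w ≠ x → w ≠ x + s → (w ∈ partialCols B ↔ w ∈ partialCols A) := by
    intro w h1 h2; simp only [partialCols, mem_filter, hB, col_mv_other _ _ h1 h2]
  have cx : (col B x).card + 1 = (col A x).card := by
    rw [c1, card_erase_add_one hy]
  have cx' : (col B (x + s)).card = (col A (x + s)).card + 1 := by
    rw [c2, card_insert_of_notMem hy']
  have hlt : (col A (x + s)).card + 1 ≤ (col A x).card :=
    card_lt_card ⟨hsub, fun hc => hy' (hc hy)⟩; have hle := card_le_univ (col A x)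
  rw [ZMod.card] at hle
  by_cases hfirst : (col A x).card = 1
  · have e0 : x ∉ partialCols B := by rw [mem_partialCols]; omega
    have e1 : x + s ∈ partialCols B := by rw [mem_partialCols]; omega
    have e2 : x + s ∉ partialCols A := by rw [mem_partialCols]; omega
    refine card_le_card_of_injOn (fun w => if w = x then x + s else w) ?_ ?_
    · intro w hw
      dsimp only
      split_ifs with hwx
      · exact e1
      · by_cases hws : w = x + s
        · rw [hws] at hw; exact absurd hw e2
        · exact (hmem w hwx hws).2 hw
    · intro w hw w' hw' e; have n1 : w ≠ x + s := fun e => e2 (e ▸ hw)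
      have n2 : w' ≠ x + s := fun e => e2 (e ▸ hw')
      dsimp only at e
      split_ifs at e with a1 a2 a2
      · rw [a1, a2]
      · exact absurd e.symm n2
      · exact absurd e n1
      · exact e
  by_cases hlast : (col A (x + s)).card + 1 = L
  · have e1 : x ∈ partialCols B := by rw [mem_partialCols]; omega
    have e2 : x ∉ partialCols A := by rw [mem_partialCols]; omega
    refine card_le_card_of_injOn (fun w => if w = x + s then x else w) ?_ ?_
    · intro w hw
      dsimp only
      split_ifs with hwx
      · exact e1
      · by_cases hws : w = x
        · rw [hws] at hw; exact absurd hw e2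
        · exact (hmem w hws hwx).2 hw
    · intro w hw w' hw' e; have n1 : w ≠ x := fun e => e2 (e ▸ hw)
      have n2 : w' ≠ x := fun e => e2 (e ▸ hw')
      dsimp only at e
      split_ifs at e with a1 a2 a2
      · rw [a1, a2]
      · exact absurd e.symm n2
      · exact absurd e n1
      · exact e
  · refine card_le_card fun w hw => ?_
    by_cases h1 : w = x
    · rw [mem_partialCols, h1]; omega
    by_cases h2 : w = x + s
    · rw [mem_partialCols, h2]; omega
    exact (hmem w h1 h2).2 hw

theorem cB_eq_card_partialCols {A : Sites K L} (h : ∀ x, brk (col A x) ≤ 1) :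
    cB A = (partialCols A).card := by
  rw [partialCols, card_filter, cB]; refine sum_congr rfl fun x _ => ?_
  split_ifs with hx
  · have := one_le_brk hx.1 hx.2; have := h x; omega
  · rw [brk_eq_zero]
    tauto

/-- Low neighbors of unimodal configurations whose columns are arcs. -/
theorem Uni.neighbor {η ξ : Config K L N₀} {z : ZMod K} {f : ℕ}
    (h : Uni η.1 z f) (h2 : TwoFull η.1) (hb : ∀ x, brk (col η.1 x) ≤ 1) (hq : cB η.1 ≤ 4)
    (hadj : (graph K L N₀).Adj η ξ) (hle : cB ξ.1 + hB ξ.1 ≤ L + cB η.1) :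
    (∀ x, (col ξ.1 x).card = (col η.1 x).card) ∧ hB ξ.1 = L ∧ ∀ x, brk (col ξ.1 x) ≤ 1 := by
  have ⟨p1, p2, p3, p4, p5⟩ := hp
  have ht : Tame ξ.1 := tame_step h.tame hadj (by rw [energy_eq']; omega); have hL := ht.le_hB
  rcases exists_move hadj with ⟨x, y, s, hs, hpη, hqη, e⟩ | ⟨x, y, s, hs, hpη, hqη, e⟩
  · have hcard := fun x' => card_col_mv_vertical hpη hqη x'; rw [← e] at hcard
    have h3 := card_partialCols_le ξ.1
    rw [partialCols_congr hcard, ← cB_eq_card_partialCols hb] at h3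
    refine ⟨hcard, by omega, fun w => ?_⟩
    by_cases hw : w = x
    · subst hw; have := cB_mv_vertical η.1 w y (y + s); rw [← col_mv_vertical, ← e] at this
      have := hb w; omega
    · rw [e, col_mv_vertical_of_ne _ _ _ hw]; exact hb w
  · exfalso; have hxs : x ≠ x + s := by simpa using sign_ne_zero (n := K) hs
    have h3 := h.hB_horizontal (by omega) h2 hs hpη hqη
    have h4 := h.card_partialCols_horizontal (by omega) hs hxs hpη hqη; rw [← e] at h3 h4
    have h5 := card_partialCols_le ξ.1; rw [← cB_eq_card_partialCols hb] at h4; omega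

/-- The neighbors of a unimodal configuration with fat columns have higher energy. -/
theorem Uni.lt_of_fat {η ξ : Config K L N₀} {z : ZMod K} {f : ℕ}
    (h : Uni η.1 z f) (h2 : TwoFull η.1) (hfat : ∀ x, Fat (col η.1 x)) (hq : cB η.1 ≤ 4)
    (hadj : (graph K L N₀).Adj η ξ) : energy η < energy ξ := by
  have ⟨p1, p2, p3, p4, p5⟩ := hp; by_contra hge
  have hη : energy η ≤ H₀ L N₀ + 4 := by rw [energy_eq', h.hB_eq]; omega
  have ht : Tame ξ.1 := tame_step h.tame hadj (by omega); have hL := ht.le_hB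
  rw [energy_eq', energy_eq', h.hB_eq] at hge
  rcases exists_move hadj with ⟨x, y, s, hs, hpη, hqη, e⟩ | ⟨x, y, s, hs, hpη, hqη, e⟩
  · have := cB_mv_vertical η.1 x y (y + s)
    rw [(hfat x).brk_move hs (by rwa [mem_col]) (by rwa [mem_col]) p1, ← e] at this; omega
  · have hxs : x ≠ x + s := by simpa using sign_ne_zero (n := K) hs
    have h3 := h.hB_horizontal (by omega) h2 hs hpη hqη; have h4 := cB_mv_horizontal η.1 hxs y
    have h5 := (hfat x).brk_le_erase (by omega) y
    have h6 := (hfat (x + s)).brk_le_insert (by omega) y; rw [← e] at h3 h4; omega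

theorem Uni.basin_singleton {η : Config K L N₀} {z : ZMod K} {f : ℕ}
    (h : Uni η.1 z f) (h2 : TwoFull η.1) (hfat : ∀ x, Fat (col η.1 x)) (hq : cB η.1 ≤ 4) :
    Basin (graph K L N₀) energy (energy η) {η} := by
  constructor
  · rintro _ rfl; rfl
  · rintro _ rfl ξ hadj hle; have := h.lt_of_fat h2 hfat hq hadj; omega

/-! ### Families of unimodal configurations with arcs of given lengths -/

theorem eq_mk_of_frame {k : ZMod K} {a : ℕ} {B : Sites K L}
    (h0 : col B (k - 2) = ∅) (hE : ∀ j, a + 5 ≤ j → j < K → col B (k - 2 + j) = ∅)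
    (hF : ∀ j, 2 ≤ j → j ≤ a + 1 → col B (k - 2 + j) = univ) :
    B = mk k a (col B (k - 2 + ((1 : ℕ) : ZMod K))) (col B (k - 2 + ((a + 2 : ℕ) : ZMod K)))
      (col B (k - 2 + ((a + 3 : ℕ) : ZMod K))) (col B (k - 2 + ((a + 4 : ℕ) : ZMod K))) := by
  refine ext_col fun x => ?_; obtain ⟨j, hj, rfl⟩ := exists_index (k - 2) x
  rw [col_mk_index hj, prof]
  split_ifs with h1 h2 h3 h4 h5
  · rw [h1]
  · exact hF j h2.1 h2.2
  · rw [h3]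
  · rw [h4]
  · rw [h5]
  · rcases Nat.eq_zero_or_pos j with rfl | hj0
    · rw [Nat.cast_zero, add_zero, h0]
    · exact hE j (by omega) hj

/-- Full columns `k, …, k + a - 1` with arcs of lengths `z` to the left, and `w₁`, `w₂`, `w₃` to
the right. -/
def Fam (N₀ : ℕ) (k : ZMod K) (a z w₁ w₂ w₃ : ℕ) : Set (Config K L N₀) :=
  {η | ∃ ℓ₀ ℓ₁ ℓ₂ ℓ₃ : ZMod L, arc ℓ₂ w₂ ⊆ arc ℓ₁ w₁ ∧ arc ℓ₃ w₃ ⊆ arc ℓ₂ w₂ ∧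
    η.1 = mk k a (arc ℓ₀ z) (arc ℓ₁ w₁) (arc ℓ₂ w₂) (arc ℓ₃ w₃)}

/-- One if an arc of length `m` is neither empty nor full. -/
def ind (L m : ℕ) : ℕ := if 0 < m ∧ m < L then 1 else 0

theorem brk_arc_eq {ℓ : ZMod L} {m : ℕ} (hm : m ≤ L) : brk (arc ℓ m) = ind L m := by
  rw [ind]
  split_ifs with h
  · exact brk_arc h.1 h.2
  · have : m = 0 ∨ m = L := by omega
    rcases this with rfl | rfl
    · rw [arc_zero, brk_empty]
    · rw [arc_full, brk_univ]

theorem mem_fam_of_mk {k : ZMod K} {a z w₁ w₂ w₃ : ℕ} {Z W₁ W₂ W₃ : Finset (ZMod L)}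
    {η : Config K L N₀} (hη : η.1 = mk k a Z W₁ W₂ W₃) (h0 : brk Z ≤ 1) (h1 : brk W₁ ≤ 1)
    (h2 : brk W₂ ≤ 1) (h3 : brk W₃ ≤ 1) (h12 : W₂ ⊆ W₁) (h23 : W₃ ⊆ W₂) (c0 : Z.card = z)
    (c1 : W₁.card = w₁) (c2 : W₂.card = w₂) (c3 : W₃.card = w₃) :
    η ∈ Fam N₀ k a z w₁ w₂ w₃ := by
  obtain ⟨ℓ₀, e0⟩ := exists_eq_arc h0; obtain ⟨ℓ₁, e1⟩ := exists_eq_arc h1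
  obtain ⟨ℓ₂, e2⟩ := exists_eq_arc h2; obtain ⟨ℓ₃, e3⟩ := exists_eq_arc h3; rw [c0] at e0
  rw [c1] at e1; rw [c2] at e2; rw [c3] at e3; subst e0 e1 e2 e3
  exact ⟨ℓ₀, ℓ₁, ℓ₂, ℓ₃, h12, h23, hη⟩

theorem twoFull_mk {k : ZMod K} {a : ℕ} {Z W₁ W₂ W₃ : Finset (ZMod L)} (ha : 2 ≤ a)
    (haK : a + 6 ≤ K) : TwoFull (mk k a Z W₁ W₂ W₃) := by
  refine ⟨k + ((0 : ℕ) : ZMod K), k + ((1 : ℕ) : ZMod K), idx_ne (by omega),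
    col_mk_full, col_mk_full⟩

theorem brk_col_mk {k : ZMod K} {a : ℕ} {Z W₁ W₂ W₃ : Finset (ZMod L)} (h0 : brk Z ≤ 1)
    (h1 : brk W₁ ≤ 1) (h2 : brk W₂ ≤ 1) (h3 : brk W₃ ≤ 1) (x : ZMod K) :
    brk (col (mk k a Z W₁ W₂ W₃) x) ≤ 1 := by
  rw [col_mk, prof]
  split_ifs
  · exact h0
  · rw [brk_univ]; omega
  · exact h1
  · exact h2
  · exact h3
  · rw [brk_empty]; omega

theorem fat_empty : Fat (∅ : Finset (ZMod L)) := by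
  constructor
  · intro y hy; simp at hy
  · intro y _; simp [nb]

theorem fat_univ : Fat (univ : Finset (ZMod L)) := by
  constructor
  · intro y _; simp [nb]
  · intro y hy; simp at hy

theorem fat_col_mk {k : ZMod K} {a : ℕ} {Z W₁ W₂ W₃ : Finset (ZMod L)} (h0 : Fat Z)
    (h1 : Fat W₁) (h2 : Fat W₂) (h3 : Fat W₃) (x : ZMod K) :
    Fat (col (mk k a Z W₁ W₂ W₃) x) := by
  rw [col_mk, prof]
  split_ifs
  · exact h0
  · exact fat_univ
  · exact h1
  · exact h2
  · exact h3
  · exact fat_empty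

theorem energy_mk {k : ZMod K} {a : ℕ} {Z W₁ W₂ W₃ : Finset (ZMod L)}
    {η : Config K L N₀} (hη : η.1 = mk k a Z W₁ W₂ W₃) (h12 : W₂ ⊆ W₁) (h23 : W₃ ⊆ W₂)
    (ha : 1 ≤ a := by omega) (haK : a + 6 ≤ K := by omega) :
    energy η = H₀ L N₀ + (brk Z + brk W₁ + brk W₂ + brk W₃ : ℕ) := by
  rw [energy_eq', hη, hB_mk ha haK h12 h23, cB_mk]; omega

theorem fam_basin {k : ZMod K} {a z w₁ w₂ w₃ h : ℕ}
    (hh : ind L z + ind L w₁ + ind L w₂ + ind L w₃ = h) (ha : 2 ≤ a := by omega)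
    (haK : a + 6 ≤ K := by omega) (hz : z ≤ L := by omega) (h1 : w₁ ≤ L := by omega)
    (h2 : w₂ ≤ L := by omega) (h3 : w₃ ≤ L := by omega) (h4 : h ≤ 4 := by omega) :
    Basin (graph K L N₀) energy (H₀ L N₀ + h) (Fam N₀ k a z w₁ w₂ w₃) := by
  have ⟨p1, p2, p3, p4, p5⟩ := hp
  have hen : ∀ η ∈ Fam (K := K) (L := L) N₀ k a z w₁ w₂ w₃, energy η = H₀ L N₀ + h := by
    rintro η ⟨ℓ₀, ℓ₁, ℓ₂, ℓ₃, h12, h23, hη⟩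
    rw [energy_mk hη h12 h23 (by omega) haK, brk_arc_eq hz, brk_arc_eq h1, brk_arc_eq h2,
      brk_arc_eq h3, hh]
  refine ⟨hen, ?_⟩; intro η hη ξ hadj hle; have hηe := hen η hη
  obtain ⟨ℓ₀, ℓ₁, ℓ₂, ℓ₃, h12, h23, hη⟩ := hη
  have hU := uni_mk (K := K) (k := k) (Z := arc ℓ₀ z) (by omega) haK h12 h23 (f := 2) le_rfl
  rw [← hη] at hU
  have hbrk : ∀ x, brk (col η.1 x) ≤ 1 := by
    rw [hη]; exact brk_col_mk (brk_arc_le _ _) (brk_arc_le _ _) (brk_arc_le _ _) (brk_arc_le _ _)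
  have hcBη : cB η.1 = h := by
    rw [energy_eq', hU.hB_eq] at hηe; omega
  obtain ⟨hcard, hB, hb⟩ := hU.neighbor (by rw [hη]; exact twoFull_mk ha haK) hbrk (by omega)
    hadj (by rw [energy_eq'] at hle; omega); have hcard' : ∀ j, j < K → (col ξ.1 (k - 2 + j)).card =
      (prof a (arc ℓ₀ z) (arc ℓ₁ w₁) (arc ℓ₂ w₂) (arc ℓ₃ w₃) j).card := fun j hj => by
    rw [hcard, hη, col_mk_index hj]
  have hE : ∀ j, j = 0 ∨ a + 5 ≤ j → j < K → col ξ.1 (k - 2 + j) = ∅ := by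
    intro j hj hjK
    rw [← card_eq_zero, hcard' j hjK, prof, if_neg (by omega), if_neg (by omega),
      if_neg (by omega), if_neg (by omega), if_neg (by omega), card_empty]
  have hF : ∀ j, 2 ≤ j → j ≤ a + 1 → col ξ.1 (k - 2 + j) = univ := by
    intro j hj hj'
    rw [← card_eq_iff_eq_univ, hcard' j (by omega), prof, if_neg (by omega),
      if_pos ⟨hj, hj'⟩, card_univ]
  have h0 : col ξ.1 (k - 2) = ∅ := by
    have := hE 0 (Or.inl rfl) (by omega); rwa [Nat.cast_zero, add_zero] at this
  have hlast : col ξ.1 (k - 2 - 1) = ∅ := by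
    rw [← sub_one_eq_index]; exact hE _ (Or.inr (by omega)) (by omega)
  have hUξ := uni_of_hB_eq h0 hlast (hF 2 le_rfl (by omega)) (by omega) hB
  refine mem_fam_of_mk (eq_mk_of_frame h0 (fun j hj => hE j (Or.inr hj)) hF) (hb _) (hb _)
    (hb _) (hb _) (hUξ.anti (a + 2) (by omega) (by omega)) (hUξ.anti (a + 3) (by omega) (by omega))
    ?_ ?_ ?_ ?_
  · rw [hcard' 1 (by omega), prof, if_pos rfl, card_arc hz]
  · rw [hcard' _ (by omega), prof, if_neg (by omega), if_neg (by omega), if_pos rfl, card_arc h1]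
  · rw [hcard' _ (by omega), prof, if_neg (by omega), if_neg (by omega), if_neg (by omega),
      if_pos rfl, card_arc h2]
  · rw [hcard' _ (by omega), prof, if_neg (by omega), if_neg (by omega), if_neg (by omega),
      if_neg (by omega), if_pos rfl, card_arc h3]

/-! ### The classified sets as families -/

/-- The sites of the column `x` with heights in `W`. -/
def vert (x : ZMod K) (W : Finset (ZMod L)) : Set (ZMod K × ZMod L) := {v | v.1 = x ∧ v.2 ∈ W}

theorem vert_empty (x : ZMod K) : vert x (∅ : Finset (ZMod L)) = ∅ := by
  ext; simp [vert]

theorem stick_eq (x : ZMod K) (m : ℕ) (ℓ : ZMod L) : stick x m ℓ = vert x (arc ℓ m) := by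
  ext v; simp only [stick, vert, Set.mem_ofPred_eq, mem_arc]

theorem sits_vert {x x' : ZMod K} {W W' : Finset (ZMod L)} :
    Sits (vert x W) (vert x' W') ↔ W' ⊆ W := by
  have : ∀ (x : ZMod K) (W : Finset (ZMod L)), Prod.snd '' vert x W = ↑W := by
    intro x W
    ext y; simp only [Set.mem_image, vert, Set.mem_ofPred_eq, mem_coe, Prod.exists]
    constructor
    · rintro ⟨a, b, ⟨-, h⟩, rfl⟩; exact h
    · intro h; exact ⟨x, y, ⟨rfl, h⟩, rfl⟩
  rw [Sits, this, this, coe_subset]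

theorem exists_sticks {x : ZMod K} {m : ℕ} {p : Set (ZMod K × ZMod L) → Prop} :
    (∃ W ∈ sticks x m, p W) ↔ ∃ ℓ, p (vert x (arc ℓ m)) := by
  simp only [sticks, Set.mem_range, exists_exists_eq_and, stick_eq]

theorem coe_mk {k : ZMod K} {a : ℕ} {Z W₁ W₂ W₃ : Finset (ZMod L)} (ha : a + 5 ≤ K := by omega) :
    (↑(mk k a Z W₁ W₂ W₃) : Set (ZMod K × ZMod L)) = cols k a ∪ vert (k - 1) Z ∪
      vert (k + a) W₁ ∪ vert (k + a + 1) W₂ ∪ vert (k + a + 2) W₃ := by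
  ext ⟨x, y⟩; obtain ⟨j, hj, rfl⟩ := exists_index (k - 2) x
  have hinj : ∀ i, i < K → (k - 2 + j = k - 2 + i ↔ j = i) := fun i hi =>
    ⟨fun e => add_natCast_inj e hj hi, fun e => by rw [e]⟩
  have hcols : (∃ i : ℕ, i < a ∧ k - 2 + j = k + i) ↔ 2 ≤ j ∧ j ≤ a + 1 := by
    constructor
    · rintro ⟨i, hi, e⟩
      rw [show k + i = k - 2 + ((i + 2 : ℕ) : ZMod K) by push_cast; ring, hinj _ (by omega)] at e
      omega
    · rintro ⟨h1, h2⟩; refine ⟨j - 2, by omega, ?_⟩; rw [Nat.cast_sub h1]; push_cast; ring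
  rw [mem_coe, ← mem_col, col_mk_index hj]
  simp only [Set.mem_union, vert, cols, Set.mem_ofPred_eq, hcols]
  rw [col_left_idx (k := k), col_three_idx (k := k) (a := a), col_two_idx (k := k) (a := a),
    col_one_idx (k := k) (a := a), hinj _ (by omega),
    hinj _ (by omega), hinj _ (by omega), hinj _ (by omega), prof]
  split_ifs with h1 h2 h3 h4 h5
  · simp [h1]
  · simp [h2]
  · simp [h3]
  · simp [h4]
  · simp [h5]
  · simp [h1, h3, h4, h5]; omega

theorem coe_flipSet_mk {c k : ZMod K} {a : ℕ} {Z W₁ W₂ W₃ : Finset (ZMod L)} (ha : a + 5 ≤ K) :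
    (↑(flipSet c (mk k a Z W₁ W₂ W₃)) : Set (ZMod K × ZMod L)) =
      cols (c - k - (a : ZMod K) + 1) a ∪ vert (c - k + 1) Z ∪
      vert (c - k - (a : ZMod K)) W₁ ∪ vert (c - k - (a : ZMod K) - 1) W₂ ∪
        vert (c - k - (a : ZMod K) - 2) W₃ := by
  ext ⟨x, y⟩; rw [mem_coe, mem_flipSet, ← mem_coe, coe_mk ha]
  have hcols : (∃ i : ℕ, i < a ∧ c - x = k + (i : ZMod K)) ↔
      ∃ i : ℕ, i < a ∧ x = c - k - (a : ZMod K) + 1 + (i : ZMod K) := by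
    constructor
    · rintro ⟨i, hi, e⟩; refine ⟨a - 1 - i, by omega, ?_⟩
      rw [Nat.cast_sub (by omega), Nat.cast_sub (by omega)]
      push_cast
      linear_combination -e
    · rintro ⟨i, hi, e⟩; refine ⟨a - 1 - i, by omega, ?_⟩
      rw [Nat.cast_sub (by omega), Nat.cast_sub (by omega)]
      push_cast
      linear_combination -e
  have hx : ∀ u v : ZMod K, u = c - v → (c - x = u ↔ x = v) := fun u v e => by
    rw [e]; exact ⟨fun h => by linear_combination -h, fun h => by rw [h]⟩
  simp only [Set.mem_union, vert, cols, Set.mem_ofPred_eq, flipSite, Equiv.coe_fn_mk, hcols]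
  rw [hx _ (c - k + 1) (by ring), hx _ (c - k - (a : ZMod K)) (by ring),
    hx _ (c - k - (a : ZMod K) - 1) (by ring), hx _ (c - k - (a : ZMod K) - 2) (by ring)]

theorem mem_fam {k : ZMod K} {a z w₁ w₂ w₃ : ℕ} (ha : a + 5 ≤ K) {η : Config K L N₀} :
    η ∈ Fam N₀ k a z w₁ w₂ w₃ ↔ ∃ ℓ₀ ℓ₁ ℓ₂ ℓ₃ : ZMod L, arc ℓ₂ w₂ ⊆ arc ℓ₁ w₁ ∧
      arc ℓ₃ w₃ ⊆ arc ℓ₂ w₂ ∧ occ η = cols k a ∪ vert (k - 1) (arc ℓ₀ z) ∪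
      vert (k + a) (arc ℓ₁ w₁) ∪ vert (k + a + 1) (arc ℓ₂ w₂) ∪ vert (k + a + 2) (arc ℓ₃ w₃) := by
  simp only [Fam, Set.mem_ofPred_eq, ← coe_mk ha, occ_eq_coe]

theorem mem_flip_fam {c k : ZMod K} {a z w₁ w₂ w₃ : ℕ} (ha : a + 5 ≤ K) {η : Config K L N₀} :
    η ∈ flipIso c '' Fam N₀ k a z w₁ w₂ w₃ ↔ ∃ ℓ₀ ℓ₁ ℓ₂ ℓ₃ : ZMod L, arc ℓ₂ w₂ ⊆ arc ℓ₁ w₁ ∧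
      arc ℓ₃ w₃ ⊆ arc ℓ₂ w₂ ∧ occ η = cols (c - k - (a : ZMod K) + 1) a ∪
      vert (c - k + 1) (arc ℓ₀ z) ∪ vert (c - k - (a : ZMod K)) (arc ℓ₁ w₁) ∪
      vert (c - k - (a : ZMod K) - 1) (arc ℓ₂ w₂) ∪
        vert (c - k - (a : ZMod K) - 2) (arc ℓ₃ w₃) := by
  have key : ∀ B : Sites K L, (flipIso c η).1 = B ↔ η.1 = flipSet c B := by
    intro B; rw [flipIso_val]
    constructor
    · rintro rfl; rw [flipSet_flipSet]
    · rintro h; rw [h, flipSet_flipSet]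
  simp only [mem_image_flipIso, Fam, Set.mem_ofPred_eq, key, ← coe_flipSet_mk ha, occ_eq_coe]

theorem bottom_eq {k : ZMod K} {m : ℕ} {ℓ ℓ' : ZMod L} {η : Config K L N₀} :
    η ∈ bottom k m ℓ ℓ' ↔ η.1 = mk (k + 1) (N₀ - 1) (arc ℓ (L - m)) (arc ℓ' m) ∅ ∅ := by
  have ⟨p1, p2, p3, p4, p5⟩ := hp
  rw [← occ_eq_coe, coe_mk, bottom, Set.mem_ofPred_eq, stick_eq, stick_eq, vert_empty,
    vert_empty, Set.union_empty, Set.union_empty, add_sub_cancel_right, Nat.cast_sub (by omega)]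
  rw [show k + 1 + ((N₀ : ZMod K) - ((1 : ℕ) : ZMod K)) = k + N₀ by push_cast; ring]

theorem bottoms_eq (k : ZMod K) (m : ℕ) :
    bottoms k m = Fam (L := L) N₀ (k + 1) (N₀ - 1) (L - m) m 0 0 := by
  ext η; simp only [bottoms, Set.mem_iUnion, bottom_eq, Fam, Set.mem_ofPred_eq, arc_zero]
  constructor
  · rintro ⟨ℓ, ℓ', h⟩; exact ⟨ℓ, ℓ', 0, 0, empty_subset _, empty_subset _, h⟩
  · rintro ⟨ℓ, ℓ', -, -, -, -, h⟩; exact ⟨ℓ, ℓ', h⟩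

theorem setRi_eq (k : ZMod K) (i : ℕ) : setRi k i = Fam (L := L) N₀ k (N₀ - 1) 0 (L - i) i 0 := by
  have ⟨p1, p2, p3, p4, p5⟩ := hp
  have e1 : k + ((N₀ - 1 : ℕ) : ZMod K) = k + N₀ - 1 := by
    rw [Nat.cast_sub (by omega)]; push_cast; ring
  ext η; rw [mem_fam (by omega), setRi, Set.mem_ofPred_eq]
  simp only [exists_sticks, sits_vert, arc_zero, vert_empty, Set.union_empty, e1,
    sub_add_cancel, empty_subset, true_and]
  constructor
  · rintro ⟨ℓ, ℓ', h⟩; exact ⟨0, ℓ, ℓ', 0, h⟩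
  · rintro ⟨-, ℓ, ℓ', -, h⟩; exact ⟨ℓ, ℓ', h⟩

theorem setR_eq (k : ZMod K) : setR k = Fam (L := L) N₀ k (N₀ - 1) 0 (L - 1) 1 0 := setRi_eq k 1

theorem setRmPlus_eq (k : ZMod K) (m : ℕ) :
    setRmPlus k m = Fam (L := L) N₀ (k + 1) (N₀ - 2) (L - m) (L - 1) (m + 1) 0 := by
  have ⟨p1, p2, p3, p4, p5⟩ := hp
  have e1 : k + 1 + ((N₀ - 2 : ℕ) : ZMod K) = k + N₀ - 1 := by
    rw [Nat.cast_sub (by omega)]; push_cast; ring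
  ext η; rw [mem_fam (by omega), setRmPlus, Set.mem_ofPred_eq]
  simp only [exists_sticks, sits_vert, arc_zero, vert_empty, Set.union_empty, e1,
    sub_add_cancel, add_sub_cancel_right, empty_subset, true_and]
  constructor
  · rintro ⟨ℓ, ℓ', ℓ'', h⟩; exact ⟨ℓ, ℓ', ℓ'', 0, h⟩
  · rintro ⟨ℓ, ℓ', ℓ'', -, h⟩; exact ⟨ℓ, ℓ', ℓ'', h⟩

theorem setRmMinus_eq (k : ZMod K) (m : ℕ) :
    setRmMinus k m = Fam (L := L) N₀ (k + 1) (N₀ - 1) (L - m) (m - 1) 1 0 := by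
  have ⟨p1, p2, p3, p4, p5⟩ := hp
  have e1 : k + 1 + ((N₀ - 1 : ℕ) : ZMod K) = k + N₀ := by
    rw [Nat.cast_sub (by omega)]; push_cast; ring
  ext η; rw [mem_fam (by omega), setRmMinus, Set.mem_ofPred_eq]
  simp only [exists_sticks, sits_vert, arc_zero, vert_empty, Set.union_empty, e1,
    add_sub_cancel_right, empty_subset, true_and]
  constructor
  · rintro ⟨ℓ, ℓ', ℓ'', h⟩; exact ⟨ℓ, ℓ', ℓ'', 0, h⟩
  · rintro ⟨ℓ, ℓ', ℓ'', -, h⟩; exact ⟨ℓ, ℓ', ℓ'', h⟩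

theorem setLmMinus_eq (k : ZMod K) {m : ℕ} : setLmMinus k m = flipIso (2 * k + (N₀ : ZMod K)) ''
      Fam (L := L) N₀ (k + 1) (N₀ - 2) m (L - 1) (L - m + 1) 0 := by
  have ⟨p1, p2, p3, p4, p5⟩ := hp
  have e : ((N₀ - 2 : ℕ) : ZMod K) = N₀ - 2 := by
    rw [Nat.cast_sub (by omega)]; push_cast; ring
  have e1 : 2 * k + N₀ - (k + 1) - ((N₀ : ZMod K) - 2) + 1 = k + 2 := by ring
  have e2 : 2 * k + N₀ - (k + 1) - ((N₀ : ZMod K) - 2) = k + 1 := by ring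
  have e3 : 2 * k + N₀ - (k + 1) + 1 = k + N₀ := by ring
  have e4 : k + 1 - 1 = k := by ring
  ext η; rw [mem_flip_fam (by omega), setLmMinus, Set.mem_ofPred_eq, e, e1, e2, e3, e4]
  simp only [exists_sticks, sits_vert, arc_zero, vert_empty, Set.union_empty,
    empty_subset, true_and]
  have hu : ∀ A B C D : Set (ZMod K × ZMod L), A ∪ B ∪ C ∪ D = A ∪ D ∪ C ∪ B := fun A B C D => by
    ext; simp only [Set.mem_union]; tauto
  constructor
  · rintro ⟨ℓ, ℓ', ℓ'', h, h'⟩; exact ⟨ℓ'', ℓ', ℓ, 0, h, by rw [h', hu]⟩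
  · rintro ⟨ℓ'', ℓ', ℓ, -, h, h'⟩; exact ⟨ℓ, ℓ', ℓ'', h, by rw [h', hu]⟩

theorem setLmPlus_eq (k : ZMod K) {m : ℕ} : setLmPlus k m = flipIso (2 * k + (N₀ : ZMod K)) ''
      Fam (L := L) N₀ (k + 1) (N₀ - 1) m (L - m - 1) 1 0 := by
  have ⟨p1, p2, p3, p4, p5⟩ := hp
  have e : ((N₀ - 1 : ℕ) : ZMod K) = N₀ - 1 := by
    rw [Nat.cast_sub (by omega)]; push_cast; ring
  have e1 : 2 * k + N₀ - (k + 1) - ((N₀ : ZMod K) - 1) + 1 = k + 1 := by ring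
  have e2 : 2 * k + N₀ - (k + 1) - ((N₀ : ZMod K) - 1) = k := by ring
  have e3 : 2 * k + N₀ - (k + 1) + 1 = k + N₀ := by ring
  ext η; rw [mem_flip_fam (by omega), setLmPlus, Set.mem_ofPred_eq, e, e1, e2, e3]
  simp only [exists_sticks, sits_vert, arc_zero, vert_empty, Set.union_empty,
    empty_subset, true_and]
  have hu : ∀ A B C D : Set (ZMod K × ZMod L), A ∪ B ∪ C ∪ D = A ∪ D ∪ C ∪ B := fun A B C D => by
    ext; simp only [Set.mem_union]; tauto
  constructor
  · rintro ⟨ℓ, ℓ', ℓ'', h, h'⟩; exact ⟨ℓ'', ℓ', ℓ, 0, h, by rw [h', hu]⟩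
  · rintro ⟨ℓ'', ℓ', ℓ, -, h, h'⟩; exact ⟨ℓ, ℓ', ℓ'', h, by rw [h', hu]⟩

theorem setRhatPlus_eq (k : ZMod K) (i : ℕ) :
    setRhatPlus k i = Fam (L := L) N₀ k (N₀ - 2) 0 (L - 1) (L - i + 1) i := by
  have ⟨p1, p2, p3, p4, p5⟩ := hp
  have e1 : k + ((N₀ - 2 : ℕ) : ZMod K) = k + N₀ - 2 := by
    rw [Nat.cast_sub (by omega)]; push_cast; ring
  have e2 : k + N₀ - 2 + 1 = k + N₀ - 1 := by ring
  have e3 : k + N₀ - 2 + 2 = k + N₀ := by ring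
  ext η; rw [mem_fam (by omega), setRhatPlus, Set.mem_ofPred_eq]
  simp only [exists_sticks, sits_vert, arc_zero, vert_empty, Set.union_empty, e1, e2, e3]
  constructor
  · rintro ⟨ℓ, ℓ', ℓ'', h⟩; exact ⟨0, ℓ, ℓ', ℓ'', h⟩
  · rintro ⟨-, ℓ, ℓ', ℓ'', h⟩; exact ⟨ℓ, ℓ', ℓ'', h⟩

theorem setRhatMinus_eq (k : ZMod K) (i : ℕ) :
    setRhatMinus k i = Fam (L := L) N₀ k (N₀ - 1) 0 (L - i) (i - 1) 1 := by
  have ⟨p1, p2, p3, p4, p5⟩ := hp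
  have e1 : k + ((N₀ - 1 : ℕ) : ZMod K) = k + N₀ - 1 := by
    rw [Nat.cast_sub (by omega)]; push_cast; ring
  have e2 : k + N₀ - 1 + 1 = k + N₀ := by ring
  have e3 : k + N₀ - 1 + 2 = k + N₀ + 1 := by ring
  ext η; rw [mem_fam (by omega), setRhatMinus, Set.mem_ofPred_eq]
  simp only [exists_sticks, sits_vert, arc_zero, vert_empty, Set.union_empty, e1, e2, e3]
  constructor
  · rintro ⟨ℓ, ℓ', ℓ'', h⟩; exact ⟨0, ℓ, ℓ', ℓ'', h⟩
  · rintro ⟨-, ℓ, ℓ', ℓ'', h⟩; exact ⟨ℓ, ℓ', ℓ'', h⟩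

theorem exists_mem_cols_one {x : ZMod K} {p : ZMod K × ZMod L → Prop} :
    (∃ w ∈ (cols x 1 : Set (ZMod K × ZMod L)), p w) ↔ ∃ y, p (x, y) := by
  constructor
  · rintro ⟨⟨x', y⟩, ⟨j, hj, e⟩, h⟩; obtain rfl : j = 0 := by omega
    rw [Nat.cast_zero, add_zero] at e
    dsimp only at e; exact ⟨y, e ▸ h⟩
  · rintro ⟨y, h⟩; exact ⟨(x, y), ⟨0, by omega, by simp⟩, h⟩

theorem setRiMinus_eq (k : ZMod K) (i : ℕ) :
    setRiMinus k i = Fam (L := L) N₀ k (N₀ - 1) 1 (L - i) (i - 1) 0 := by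
  have ⟨p1, p2, p3, p4, p5⟩ := hp
  have e1 : k + ((N₀ - 1 : ℕ) : ZMod K) = k + N₀ - 1 := by
    rw [Nat.cast_sub (by omega)]; push_cast; ring
  have e2 : ∀ y : ZMod L, ({(k - 1, y)} : Set (ZMod K × ZMod L)) = vert (k - 1) (arc y 1) := by
    intro y
    ext ⟨a, b⟩; simp [vert, arc_one]
  have hu : ∀ A B C D : Set (ZMod K × ZMod L), A ∪ B ∪ C ∪ D = A ∪ D ∪ B ∪ C := fun A B C D => by
    ext; simp only [Set.mem_union]; tauto
  ext η; rw [mem_fam (by omega), setRiMinus, Set.mem_ofPred_eq]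
  simp only [exists_sticks, sits_vert, arc_zero, vert_empty, Set.union_empty, e1,
    sub_add_cancel, empty_subset, true_and, exists_mem_cols_one]
  constructor
  · rintro ⟨ℓ, ℓ', y, h, h'⟩; exact ⟨y, ℓ, ℓ', 0, h, by rw [h', hu, e2]⟩
  · rintro ⟨y, ℓ, ℓ', -, h, h'⟩; exact ⟨ℓ, ℓ', y, h, by rw [h', e2, hu _ (vert (k - 1) _), hu]⟩

theorem erase_univ_eq_arc (hL : 2 ≤ L) (y : ZMod L) : univ.erase y = arc (y + 1) (L - 1) := by
  have h : arc y L = insert y (arc (y + 1) (L - 1)) := by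
    rw [← arc_succ', Nat.sub_add_cancel (by omega)]
  rw [arc_full] at h; rw [h, erase_insert]; intro hy; have := card_insert_of_mem hy
  rw [← h, card_univ, ZMod.card, card_arc] at this; omega

theorem setRiPlus_eq (k : ZMod K) (i : ℕ) :
    setRiPlus k i = Fam (L := L) N₀ (k + 1) (N₀ - 2) (L - 1) (L - i + 1) i 0 := by
  have ⟨p1, p2, p3, p4, p5⟩ := hp
  have e1 : k + 1 + ((N₀ - 2 : ℕ) : ZMod K) = k + N₀ - 1 := by
    rw [Nat.cast_sub (by omega)]; push_cast; ring
  have n1 : k ≠ k + N₀ - 1 := by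
    have : k + ((0 : ℕ) : ZMod K) ≠ k + ((N₀ - 1 : ℕ) : ZMod K) :=
      idx_ne (by omega)
    rw [Nat.cast_zero, add_zero, Nat.cast_sub (by omega), Nat.cast_one, ← add_sub_assoc] at this
    exact this
  have n2 : k ≠ k + N₀ := by
    have : k + ((0 : ℕ) : ZMod K) ≠ k + N₀ :=
      idx_ne (by omega); rwa [Nat.cast_zero, add_zero] at this
  have key : ∀ (y : ZMod L) (W W' : Finset (ZMod L)),
      (cols k (N₀ - 1) ∪ vert (k + N₀ - 1) W ∪ vert (k + N₀) W') \ {(k, y)} =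
      cols (k + 1) (N₀ - 2) ∪ vert k (arc (y + 1) (L - 1)) ∪
        vert (k + N₀ - 1) W ∪ vert (k + N₀) W' := by
    intro y W W'; rw [← erase_univ_eq_arc (by omega)]
    ext ⟨a, b⟩
    have hc : (∃ j : ℕ, j < N₀ - 1 ∧ a = k + j) ↔ a = k ∨ ∃ j : ℕ, j < N₀ - 2 ∧ a = k + 1 + j := by
      constructor
      · rintro ⟨j, hj, e⟩
        rcases Nat.eq_zero_or_pos j with rfl | hj0
        · left; rw [e]; simp
        · right; refine ⟨j - 1, by omega, ?_⟩; rw [e, Nat.cast_sub hj0]; push_cast; ring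
      · rintro (rfl | ⟨j, hj, e⟩)
        · exact ⟨0, by omega, by simp⟩
        · exact ⟨j + 1, by omega, by rw [e]; push_cast; ring⟩
    have hd : a = k → ¬ ∃ j : ℕ, j < N₀ - 2 ∧ a = k + 1 + j := by
      rintro rfl ⟨j, hj, e⟩
      have : a + ((0 : ℕ) : ZMod K) = a + ((j + 1 : ℕ) : ZMod K) := by
        rw [Nat.cast_zero, add_zero]
        nth_rewrite 1 [e]
        push_cast; ring
      exact (idx_ne (by omega)) this
    simp only [Set.mem_sdiff, Set.mem_union, vert, cols, Set.mem_ofPred_eq, hc,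
      Set.mem_singleton_iff, Prod.mk.injEq, mem_erase, mem_univ, and_true]
    by_cases ha : a = k
    · have hd := hd ha; subst ha; simp [hd, n1, n2]
    · simp [ha]
  ext η; rw [mem_fam (by omega), setRiPlus, Set.mem_ofPred_eq]
  simp only [exists_sticks, sits_vert, arc_zero, vert_empty, Set.union_empty, e1,
    sub_add_cancel, add_sub_cancel_right, empty_subset, true_and, exists_mem_cols_one, key]
  constructor
  · rintro ⟨ℓ, ℓ', y, h⟩; exact ⟨y + 1, ℓ, ℓ', 0, h⟩
  · rintro ⟨y, ℓ, ℓ', -, h⟩; exact ⟨ℓ, ℓ', y - 1, by rwa [sub_add_cancel]⟩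

/-! ### The shape of low unimodal configurations -/

theorem Uni.exists_edge {A : Sites K L} {z : ZMod K} {f : ℕ} (h : Uni A z f)
    (hq : (partialCols A).card ≤ 3) :
    (∃ x, col A x = ∅ ∧ col A (x + 1) ≠ univ ∧ col A (x + 2) = univ) ∨
    (∃ x, col A x = univ ∧ col A (x + 1) ≠ univ ∧ col A (x + 2) = ∅) := by
  classical
  have hue : (∅ : Finset (ZMod L)) ≠ univ := univ_nonempty.ne_empty.symm
  have hex : ∃ j : ℕ, col A (z + j) = univ := ⟨f, h.full⟩
  obtain ⟨g, hg, hmin⟩ : ∃ g : ℕ, col A (z + g) = univ ∧ ∀ j < g, col A (z + j) ≠ univ :=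
    ⟨Nat.find hex, Nat.find_spec hex, fun j hj => Nat.find_min hex hj⟩
  have hgf : g ≤ f := by
    by_contra hlt
    exact hmin f (by omega) h.full
  have hlt := h.lt
  match g, hg, hmin, hgf with
  | 0, hg, _, _ =>
    rw [Nat.cast_zero, add_zero, h.zero] at hg
    exact absurd hg hue
  | 1, hg, _, _ =>
    left
    refine ⟨z - 1, h.last, ?_, ?_⟩
    · rw [sub_add_cancel, h.zero]; exact hue
    · rw [← hg]; congr 1; push_cast; ring
  | g + 2, hg, hmin, hgf =>
    by_cases hg0 : col A (z + g) = ∅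
    · left
      refine ⟨_, hg0, ?_, ?_⟩
      · rw [show z + g + 1 = z + ((g + 1 : ℕ) : ZMod K) by push_cast; ring]
        exact hmin _ (by omega)
      · rw [← hg]; congr 1; push_cast; ring
    right
    have hex' : ∃ d : ℕ, col A (z + ((f + d : ℕ) : ZMod K)) ≠ univ := by
      refine ⟨K - 1 - f, ?_⟩
      rw [show f + (K - 1 - f) = K - 1 by omega, sub_one_eq_index, h.last]
      exact hue
    obtain ⟨d, hd, hdmin⟩ : ∃ d : ℕ, col A (z + ((f + d : ℕ) : ZMod K)) ≠ univ ∧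
        ∀ j < d, col A (z + ((f + j : ℕ) : ZMod K)) = univ :=
      ⟨Nat.find hex', Nat.find_spec hex', fun j hj => not_not.1 (Nat.find_min hex' hj)⟩
    have hd0 : d ≠ 0 := by
      rintro rfl
      exact hd h.full
    have hdK : f + d < K := by
      by_contra hge
      have := hdmin (K - 1 - f) (by omega)
      rw [show f + (K - 1 - f) = K - 1 by omega, sub_one_eq_index, h.last] at this
      exact hue this
    have e1 : z + ((f + (d - 1) : ℕ) : ZMod K) + 1 = z + ((f + d : ℕ) : ZMod K) := by
      rw [show f + d = f + (d - 1) + 1 by omega]; push_cast; ring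
    have e2 : z + ((f + (d - 1) : ℕ) : ZMod K) + 2 = z + ((f + d + 1 : ℕ) : ZMod K) := by
      rw [show f + d + 1 = f + (d - 1) + 2 by omega]; push_cast; ring
    refine ⟨z + ((f + (d - 1) : ℕ) : ZMod K), hdmin _ (by omega), by rwa [e1], ?_⟩
    rw [e2]
    by_contra hne
    have hdK' : f + d + 1 < K := by
      by_contra hge
      apply hne
      rw [show f + d + 1 = K by omega, ZMod.natCast_self, add_zero, h.zero]
    have s1 := h.mono g (by omega)
    have s2 := h.anti (f + d) (by omega) hdK
    have hsub : ({g, g + 1, f + d, f + d + 1} : Finset ℕ).image (fun j : ℕ => z + j) ⊆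
        partialCols A := by
      intro x hx
      simp only [mem_image, mem_insert, mem_singleton] at hx
      simp only [partialCols, mem_filter, mem_univ, true_and]
      obtain ⟨j, rfl | rfl | rfl | rfl, rfl⟩ := hx
      · exact ⟨hg0, hmin _ (by omega)⟩
      · refine ⟨fun e => hg0 ?_, hmin _ (by omega)⟩
        rw [e] at s1
        exact subset_empty.1 s1
      · refine ⟨fun e => hne ?_, hd⟩
        rw [e] at s2
        exact subset_empty.1 s2
      · refine ⟨hne, fun e => hd ?_⟩
        rw [e] at s2
        exact univ_subset_iff.1 s2
    have hc := card_le_card hsub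
    rw [card_image_of_injOn] at hc
    · rw [card_insert_of_notMem (by simp; omega),
        card_insert_of_notMem (by simp; omega),
        card_insert_of_notMem (by simp), card_singleton] at hc
      omega
    · intro i hi j hj e
      simp only [coe_insert, coe_singleton, Set.mem_insert_iff, Set.mem_singleton_iff] at hi hj
      exact add_natCast_inj e

/-- The normal form of the unimodal configurations of energy at most three above the ground
energy, up to reflection. -/
structure Shape (N₀ : ℕ) (k : ZMod K) (a : ℕ) (Z W₁ W₂ W₃ : Finset (ZMod L))
    (A : Sites K L) : Prop where
  eq : A = mk k a Z W₁ W₂ W₃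
  sub₂ : W₂ ⊆ W₁
  sub₃ : W₃ ⊆ W₂
  left : Z ≠ univ
  right : W₁ ≠ univ
  empty : Z = ∅ ∨ W₃ = ∅
  card : (a + 1 = N₀ ∧ Z.card + W₁.card + W₂.card + W₃.card = L) ∨
    (a + 2 = N₀ ∧ Z.card + W₁.card + W₂.card + W₃.card = 2 * L)

theorem exists_shape {A : Sites K L} (hA : A.card = L * N₀)
    (hh : hB A = L) (hc : cB A ≤ 3) (hc0 : (partialCols A).card ≠ 0) {x : ZMod K}
    (h0 : col A x = ∅) (h1 : col A (x + 1) ≠ univ) (h2 : col A (x + 2) = univ) :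
    ∃ a Z W₁ W₂ W₃, Shape N₀ (x + 2) a Z W₁ W₂ W₃ A := by
  classical
  have ⟨p1, p2, p3, p4, p5⟩ := hp
  have hue : (∅ : Finset (ZMod L)) ≠ univ := univ_nonempty.ne_empty.symm
  have hq := card_partialCols_le A
  have hfull := ((fullCols_bounds hA).2.2 hc0).1
  have e2 : x + ((2 : ℕ) : ZMod K) = x + 2 := by push_cast; ring
  rw [hB_frame A h0 (f := 2) (by rwa [e2]) (by omega)] at hh
  have hanti : ∀ j : ℕ, 2 ≤ j → j < K → col A (x + ((j + 1 : ℕ) : ZMod K)) ⊆ col A (x + j) := by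
    have : ∑ j ∈ Ico 2 K, (col A (x + ((j + 1 : ℕ) : ZMod K)) \ col A (x + j)).card = 0 := by omega
    rw [sum_eq_zero_iff] at this
    intro j hj hj'
    have := this j (mem_Ico.2 ⟨hj, hj'⟩)
    rwa [card_eq_zero, sdiff_eq_empty_iff_subset] at this
  have hanti' : ∀ i j : ℕ, 2 ≤ i → i ≤ j → j ≤ K → col A (x + j) ⊆ col A (x + i) := by
    intro i j hi hij
    induction j, hij using Nat.le_induction with
    | base => exact fun _ => subset_rfl
    | succ j hij ih => exact fun hj => (hanti j (by omega) (by omega)).trans (ih (by omega))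
  have hex : ∃ d : ℕ, col A (x + ((2 + d : ℕ) : ZMod K)) ≠ univ := by
    refine ⟨K - 2, ?_⟩
    rw [show 2 + (K - 2) = K by omega, ZMod.natCast_self, add_zero, h0]
    exact hue
  obtain ⟨a, ha, hamin⟩ : ∃ d : ℕ, col A (x + ((2 + d : ℕ) : ZMod K)) ≠ univ ∧
      ∀ j < d, col A (x + ((2 + j : ℕ) : ZMod K)) = univ :=
    ⟨Nat.find hex, Nat.find_spec hex, fun j hj => not_not.1 (Nat.find_min hex hj)⟩
  have haK : a + 2 ≤ K := by
    by_contra hlt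
    have := hamin (K - 2) (by omega)
    rw [show 2 + (K - 2) = K by omega, ZMod.natCast_self, add_zero, h0] at this
    exact hue this
  have haN : a < N₀ := by
    refine lt_of_le_of_lt ?_ hfull
    have : (range a).image (fun j : ℕ => x + ((2 + j : ℕ) : ZMod K)) ⊆ fullCols A := by
      intro y hy
      obtain ⟨j, hj, rfl⟩ := mem_image.1 hy
      simp only [fullCols, mem_filter, mem_univ, true_and]
      exact hamin j (mem_range.1 hj)
    have := card_le_card this
    rwa [card_image_of_injOn, card_range] at this
    intro i hi j hj e
    rw [mem_coe, mem_range] at hi hj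
    have := add_natCast_inj e
    omega
  have ha0 : 1 ≤ a := by
    rcases Nat.eq_zero_or_pos a with rfl | h
    · rw [add_zero, e2] at ha
      exact absurd h2 ha
    · exact h
  have hnotfull : ∀ j : ℕ, 2 + a ≤ j → j ≤ K → col A (x + j) ≠ univ := by
    intro j hj hjK e
    have := hanti' _ _ (by omega) hj hjK
    rw [e] at this
    exact ha (univ_subset_iff.1 this)
  have hE : ∀ j : ℕ, a + 5 ≤ j → j < K → col A (x + j) = ∅ := by
    intro j hj hjK
    by_contra hne
    have hsub : (Ico (a + 2) (a + 6)).image (fun j : ℕ => x + j) ⊆ partialCols A := by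
      intro y hy
      obtain ⟨i, hi, rfl⟩ := mem_image.1 hy
      rw [mem_Ico] at hi
      simp only [partialCols, mem_filter, mem_univ, true_and]
      refine ⟨fun e => hne ?_, hnotfull i (by omega) (by omega)⟩
      have := hanti' i j (by omega) (by omega) (by omega)
      rw [e] at this
      exact subset_empty.1 this
    have := card_le_card hsub
    rw [card_image_of_injOn, Nat.card_Ico] at this
    · omega
    · intro i hi j hj e
      rw [mem_coe, mem_Ico] at hi hj
      exact add_natCast_inj e
  have hx : x = x + 2 - 2 := by ring
  have heq := eq_mk_of_frame (k := x + 2) (a := a) (B := A) (by rwa [← hx])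
    (by rw [← hx]; exact hE) (by
      rw [← hx]
      intro j hj hj'
      have := hamin (j - 2) (by omega)
      rwa [show 2 + (j - 2) = j by omega] at this)
  rw [← hx] at heq
  have s2 := hanti (a + 2) (by omega) (by omega)
  have s3 := hanti (a + 3) (by omega) (by omega)
  have hW1 := hnotfull (a + 2) (by omega) (by omega)
  have hZ : col A (x + ((1 : ℕ) : ZMod K)) ≠ univ := by rwa [Nat.cast_one]
  generalize col A (x + ((1 : ℕ) : ZMod K)) = Z at *
  generalize col A (x + ((a + 2 : ℕ) : ZMod K)) = W₁ at *
  generalize col A (x + ((a + 3 : ℕ) : ZMod K)) = W₂ at *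
  generalize col A (x + ((a + 4 : ℕ) : ZMod K)) = W₃ at *
  have hW2 : W₂ ≠ univ := fun e => hW1 (univ_subset_iff.1 (e ▸ s2))
  have hW3 : W₃ ≠ univ := fun e => hW2 (univ_subset_iff.1 (e ▸ s3))
  have hcard : A.card = _ := heq ▸ card_mk
  rw [hA] at hcard
  have hcB : cB A = _ := heq ▸ cB_mk
  have hempty : Z = ∅ ∨ W₃ = ∅ := by
    by_contra hne
    replace hne : Z ≠ ∅ ∧ W₃ ≠ ∅ := not_or.1 hne
    have n2 : W₂ ≠ ∅ := fun e => hne.2 (subset_empty.1 (e ▸ s3))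
    have n1 : W₁ ≠ ∅ := fun e => n2 (subset_empty.1 (e ▸ s2))
    have := one_le_brk hne.1 hZ
    have := one_le_brk n1 hW1
    have := one_le_brk n2 hW2
    have := one_le_brk hne.2 hW3
    omega
  refine ⟨a, Z, W₁, W₂, W₃, heq, s2, s3, hZ, hW1, hempty, ?_⟩
  have c0 := card_lt_of_ne_univ hZ
  have c1 := card_lt_of_ne_univ hW1
  have c2 := card_lt_of_ne_univ hW2
  have c3 := card_lt_of_ne_univ hW3
  have hsum : Z.card + W₁.card + W₂.card + W₃.card < 3 * L := by
    rcases hempty with rfl | rfl <;> rw [card_empty] <;> omega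
  obtain ⟨b, rfl⟩ : ∃ b, N₀ = a + b := ⟨N₀ - a, by omega⟩
  have hb : L * (a + b) = a * L + b * L := by ring
  have hbL : Z.card + W₁.card + W₂.card + W₃.card = b * L := by omega
  have : b < 3 := by
    by_contra hge
    have := Nat.mul_le_mul_right L (show 3 ≤ b by omega)
    omega
  have : b = 1 ∨ b = 2 := by omega
  rcases this with rfl | rfl
  · left; omega
  · right; omega

/-- Up to a reflection, every low unimodal configuration has a normal form. -/
theorem exists_shape_or_flip {A : Sites K L}
    (hA : A.card = L * N₀) (ht : Tame A) (hh : hB A = L) (hc : cB A ≤ 3)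
    (hc0 : (partialCols A).card ≠ 0) :
    ∃ k a Z W₁ W₂ W₃, Shape N₀ k a Z W₁ W₂ W₃ A ∨ Shape N₀ k a Z W₁ W₂ W₃ (flipSet 0 A) := by
  have hq : (partialCols A).card ≤ 3 := (card_partialCols_le A).trans hc
  obtain ⟨z, f, hU⟩ := exists_uni hA ht.1 hq hh
  rcases hU.exists_edge hq with ⟨x, h0, h1, h2⟩ | ⟨x, h0, h1, h2⟩
  · obtain ⟨a, Z, W₁, W₂, W₃, h⟩ := exists_shape hA hh hc hc0 h0 h1 h2
    exact ⟨_, a, Z, W₁, W₂, W₃, Or.inl h⟩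
  · have hpc : (partialCols (flipSet 0 A)).card = (partialCols A).card := by
      refine card_bij (fun u _ => 0 - u) ?_ ?_ ?_
      · intro u hu; simpa only [partialCols, mem_filter, mem_univ, true_and, col_flipSet] using hu
      · intro u _ v _ e; exact sub_right_injective e
      · intro u hu; refine ⟨0 - u, ?_, sub_sub_cancel _ _⟩
        simpa only [partialCols, mem_filter, mem_univ, true_and, col_flipSet,
          sub_sub_cancel] using hu
    obtain ⟨a, Z, W₁, W₂, W₃, h⟩ := exists_shape (A := flipSet 0 A) (x := 0 - (x + 2))
      (by rw [flipSet, card_map, hA]) (by rw [hB_flipSet, hh]) (by rwa [cB_flipSet])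
      (by rwa [hpc]) (by rwa [col_flipSet, sub_sub_cancel])
      (by rw [col_flipSet, show (0 : ZMod K) - (0 - (x + 2) + 1) = x + 1 by ring]; exact h1)
      (by rw [col_flipSet, show (0 : ZMod K) - (0 - (x + 2) + 2) = x by ring]; exact h0)
    exact ⟨_, a, Z, W₁, W₂, W₃, Or.inr h⟩

/-! ### Reachability of the families -/

theorem erase_arc {ℓ : ZMod L} {m : ℕ} (hm : m < L) : (arc ℓ (m + 1)).erase (ℓ + m) = arc ℓ m := by
  rw [arc_succ, erase_insert (arc_pred_notMem hm)]

theorem last_mem_arc (ℓ : ZMod L) (m : ℕ) : ℓ + m ∈ arc ℓ (m + 1) := by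
  rw [arc_succ]; exact mem_insert_self _ _

theorem reachable_two_sided {k : ZMod K} {ℓ₀ ℓ₁ : ZMod L} {z m : ℕ}
    (hzm : z + m = L) {η : Config K L N₀}
    (hη : η.1 = mk k (N₀ - 1) (arc ℓ₀ z) (arc ℓ₁ m) ∅ ∅) :
    η ∈ reached K L N₀ :=
  mem_reachable.2 ⟨_, linked_two_sided_left (brk_arc_le _ _) (brk_arc_le _ _)
    (by rw [card_arc, card_arc, hzm]) hη⟩

theorem reachable_one_sided {k : ZMod K} {ℓ₁ ℓ₂ : ZMod L} {n m : ℕ}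
    (hnm : n + m = L) (hs : arc ℓ₂ m ⊆ arc ℓ₁ n) {η : Config K L N₀}
    (hη : η.1 = mk k (N₀ - 1) ∅ (arc ℓ₁ n) (arc ℓ₂ m) ∅) :
    η ∈ reached K L N₀ :=
  mem_reachable.2 ⟨_, linked_one_sided (brk_arc_le _ _) (brk_arc_le _ _) hs
    (by rw [card_arc, card_arc, hnm]) hη⟩

theorem reachable_of_linked {η ξ : Config K L N₀}
    (h : Linked (graph K L N₀) energy (H₀ L N₀ + 4) η ξ)
    (hξ : ξ ∈ reached K L N₀) : η ∈ reached K L N₀ := by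
  obtain ⟨k, hk⟩ := mem_reachable.1 hξ; exact mem_reachable.2 ⟨k, h.trans hk⟩

theorem reachable_of_erase {B : Sites K L} {z : ZMod K} {f : ℕ}
    (hB : Uni B z f) (hle : cB B ≤ 2) {v w : ZMod K × ZMod L} (hv : v ∈ B) (hw : w ∈ B)
    {η : Config K L N₀} (hη : η.1 = B.erase v)
    (h : ∀ ξ : Config K L N₀, ξ.1 = B.erase w → ξ ∈ reached K L N₀) :
    η ∈ reached K L N₀ := by
  let ξ : Config K L N₀ := ⟨B.erase w, by
    have := η.2; rwa [hη, card_erase_of_mem hv, ← card_erase_of_mem hw] at this⟩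
  exact reachable_of_linked (linked_erase hB (h := 4) (by omega) hv hw hη (ξ := ξ) rfl) (h ξ rfl)

theorem reachable_of_insert {B : Sites K L} {z : ZMod K} {f : ℕ}
    (hB : Uni B z f) (hle : cB B ≤ 2) {v w : ZMod K × ZMod L} (hv : v ∉ B) (hw : w ∉ B)
    {η : Config K L N₀} (hη : η.1 = insert v B)
    (h : ∀ ξ : Config K L N₀, ξ.1 = insert w B → ξ ∈ reached K L N₀) :
    η ∈ reached K L N₀ := by
  let ξ : Config K L N₀ := ⟨insert w B, by
    have := η.2; rwa [hη, card_insert_of_notMem hv, ← card_insert_of_notMem hw] at this⟩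
  exact reachable_of_linked (linked_insert hB (h := 4) (by omega) hv hw hη (ξ := ξ) rfl) (h ξ rfl)

theorem reachable_erase_two_sided {k : ZMod K} {ℓ₀ ℓ₁ : ZMod L} {z m : ℕ}
    (hzm : z + m = L) (hm : m < L) {v : ZMod K × ZMod L} {η : Config K L N₀}
    (hv : v ∈ mk k (N₀ - 1) (arc ℓ₀ z) (arc ℓ₁ (m + 1)) ∅ ∅)
    (hη : η.1 = (mk k (N₀ - 1) (arc ℓ₀ z) (arc ℓ₁ (m + 1)) ∅ ∅).erase v) :
    η ∈ reached K L N₀ := by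
  have ⟨p1, p2, p3, p4, p5⟩ := hp
  refine reachable_of_erase (uni_mk (by omega) (by omega) (empty_subset _)
    (empty_subset _) (f := 2) le_rfl) ?_ hv
    (w := (k + ((N₀ - 1 : ℕ) : ZMod K), ℓ₁ + (m : ZMod L))) ?_ hη fun ξ hξ => ?_
  · rw [cB_mk, brk_empty]; have := brk_arc_le ℓ₀ z; have := brk_arc_le ℓ₁ (m + 1); omega
  · rw [← mem_col, col_mk_one]; exact last_mem_arc _ _
  · rw [erase_mk_one, erase_arc hm] at hξ; exact reachable_two_sided hzm hξ

theorem reachable_erase_one_sided {k : ZMod K} {ℓ₁ ℓ₂ : ZMod L} {n m : ℕ}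
    (hnm : n + m = L) (hm : m < L) (hs : arc ℓ₂ (m + 1) ⊆ arc ℓ₁ n) {v : ZMod K × ZMod L}
    {η : Config K L N₀} (hv : v ∈ mk k (N₀ - 1) ∅ (arc ℓ₁ n) (arc ℓ₂ (m + 1)) ∅)
    (hη : η.1 = (mk k (N₀ - 1) ∅ (arc ℓ₁ n) (arc ℓ₂ (m + 1)) ∅).erase v) :
    η ∈ reached K L N₀ := by
  have ⟨p1, p2, p3, p4, p5⟩ := hp; refine reachable_of_erase (uni_mk (by omega) (by omega) hs
    (empty_subset _) (f := 2) le_rfl) ?_ hv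
    (w := (k + ((N₀ - 1 : ℕ) : ZMod K) + 1, ℓ₂ + (m : ZMod L))) ?_ hη fun ξ hξ => ?_
  · rw [cB_mk, brk_empty]; have := brk_arc_le ℓ₁ n; have := brk_arc_le ℓ₂ (m + 1); omega
  · rw [← mem_col, col_mk_two]; exact last_mem_arc _ _
  · rw [erase_mk_two, erase_arc hm] at hξ; exact reachable_one_sided hnm ((arc_mono _).trans hs) hξ

theorem reachable_insert_two_sided {k : ZMod K} {ℓ₀ ℓ₁ : ZMod L} {z m : ℕ}
    (hzm : z + m + 1 = L) {v : ZMod K × ZMod L} {η : Config K L N₀}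
    (hv : v ∉ mk k (N₀ - 1) (arc ℓ₀ z) (arc ℓ₁ m) ∅ ∅)
    (hη : η.1 = insert v (mk k (N₀ - 1) (arc ℓ₀ z) (arc ℓ₁ m) ∅ ∅)) :
    η ∈ reached K L N₀ := by
  have ⟨p1, p2, p3, p4, p5⟩ := hp
  refine reachable_of_insert (uni_mk (by omega) (by omega) (empty_subset _)
    (empty_subset _) (f := 2) le_rfl) ?_ hv
    (w := (k + ((N₀ - 1 : ℕ) : ZMod K), ℓ₁ + (m : ZMod L))) ?_ hη fun ξ hξ => ?_
  · rw [cB_mk, brk_empty]; have := brk_arc_le ℓ₀ z; have := brk_arc_le ℓ₁ m; omega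
  · rw [← mem_col, col_mk_one]; exact arc_pred_notMem
  · rw [insert_mk_one, ← arc_succ] at hξ; exact reachable_two_sided (by omega) hξ

theorem reachable_insert_one_sided {k : ZMod K} {ℓ₁ ℓ₂ : ZMod L} {n m : ℕ}
    (hnm : n + m + 1 = L) (hs : arc ℓ₂ m ⊆ arc ℓ₁ n) {v : ZMod K × ZMod L}
    {η : Config K L N₀} (hv : v ∉ mk k (N₀ - 1) ∅ (arc ℓ₁ n) (arc ℓ₂ m) ∅)
    (hη : η.1 = insert v (mk k (N₀ - 1) ∅ (arc ℓ₁ n) (arc ℓ₂ m) ∅)) :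
    η ∈ reached K L N₀ := by
  have ⟨p1, p2, p3, p4, p5⟩ := hp; refine reachable_of_insert (uni_mk (by omega) (by omega) hs
    (empty_subset _) (f := 2) le_rfl) ?_ hv
    (w := (k + ((N₀ - 1 : ℕ) : ZMod K), ℓ₁ + n)) ?_ hη fun ξ hξ => ?_
  · rw [cB_mk, brk_empty]; have := brk_arc_le ℓ₁ n; have := brk_arc_le ℓ₂ m; omega
  · rw [← mem_col, col_mk_one]; exact arc_pred_notMem
  · rw [insert_mk_one, ← arc_succ] at hξ
    exact reachable_one_sided (by omega) (hs.trans (arc_mono _)) hξ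

theorem fam_two_sided_subset (k : ZMod K) {z m : ℕ} (h : z + m = L) :
    Fam (L := L) N₀ k (N₀ - 1) z m 0 0 ⊆ reached K L N₀ := by
  rintro η ⟨ℓ₀, ℓ₁, ℓ₂, ℓ₃, -, -, hη⟩; rw [arc_zero, arc_zero] at hη; exact reachable_two_sided h hη

theorem fam_one_sided_subset (k : ZMod K) {n m : ℕ} (h : n + m = L) :
    Fam (L := L) N₀ k (N₀ - 1) 0 n m 0 ⊆ reached K L N₀ := by
  rintro η ⟨ℓ₀, ℓ₁, ℓ₂, ℓ₃, hs, -, hη⟩; rw [arc_zero, arc_zero] at hη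
  exact reachable_one_sided h hs hη

theorem arc_pred_eq_erase (hL : 2 ≤ L) (ℓ : ZMod L) : arc ℓ (L - 1) = univ.erase (ℓ - 1) := by
  rw [erase_univ_eq_arc hL, sub_add_cancel]

theorem fam_hole_two_sided_subset (k : ZMod K) {z m : ℕ} (h : z + m = L)
    (hm : m < L) : Fam (L := L) N₀ k (N₀ - 2) z (L - 1) (m + 1) 0 ⊆
      reached K L N₀ := by
  have ⟨p1, p2, p3, p4, p5⟩ := hp
  rintro η ⟨ℓ₀, ℓ₁, ℓ₂, ℓ₃, -, -, hη⟩
  rw [arc_zero, arc_pred_eq_erase (by omega), ← erase_mk_one, mk_univ_one,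
    show N₀ - 2 + 1 = N₀ - 1 by omega] at hη; refine reachable_erase_two_sided h hm ?_ hη
  rw [← mem_col, col_mk_full]; simp

theorem fam_hole_one_sided_subset (k : ZMod K) {n m : ℕ} (h : n + m = L)
    (hm : m < L) : Fam (L := L) N₀ k (N₀ - 2) 0 (L - 1) n (m + 1) ⊆
      reached K L N₀ := by
  have ⟨p1, p2, p3, p4, p5⟩ := hp
  rintro η ⟨ℓ₀, ℓ₁, ℓ₂, ℓ₃, -, hs, hη⟩
  rw [arc_zero, arc_pred_eq_erase (by omega), ← erase_mk_one, mk_univ_one,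
    show N₀ - 2 + 1 = N₀ - 1 by omega] at hη; refine reachable_erase_one_sided h hm hs ?_ hη
  rw [← mem_col, col_mk_full]; simp

theorem fam_left_hole_subset (k : ZMod K) {n m : ℕ} (h : n + m = L)
    (hm : m < L) : Fam (L := L) N₀ k (N₀ - 2) (L - 1) n (m + 1) 0 ⊆
      reached K L N₀ := by
  have ⟨p1, p2, p3, p4, p5⟩ := hp
  rintro η ⟨ℓ₀, ℓ₁, ℓ₂, ℓ₃, hs, -, hη⟩
  rw [arc_zero, arc_pred_eq_erase (by omega), ← erase_mk_left (by omega), mk_univ_left (by omega),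
    show N₀ - 2 + 1 = N₀ - 1 by omega] at hη; refine reachable_erase_one_sided h hm hs ?_ hη
  have := col_mk_full (k := k - 1) (a := N₀ - 1) (Z := ∅) (W₁ := arc ℓ₁ n)
    (W₂ := arc ℓ₂ (m + 1)) (W₃ := ∅) (j := 0) (K := K); rw [Nat.cast_zero, add_zero] at this
  rw [← mem_col, this]; simp

theorem fam_particle_two_sided_subset (k : ZMod K) {z m : ℕ}
    (h : z + m + 1 = L) : Fam (L := L) N₀ k (N₀ - 1) z m 1 0 ⊆ reached K L N₀ := by
  have ⟨p1, p2, p3, p4, p5⟩ := hp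
  rintro η ⟨ℓ₀, ℓ₁, ℓ₂, ℓ₃, -, -, hη⟩
  rw [arc_zero, arc_one, ← insert_empty_eq, ← insert_mk_two] at hη
  refine reachable_insert_two_sided h ?_ hη; rw [← mem_col, col_mk_two]; simp

theorem fam_particle_one_sided_subset (k : ZMod K) {n m : ℕ}
    (h : n + m + 1 = L) : Fam (L := L) N₀ k (N₀ - 1) 0 n m 1 ⊆ reached K L N₀ := by
  have ⟨p1, p2, p3, p4, p5⟩ := hp
  rintro η ⟨ℓ₀, ℓ₁, ℓ₂, ℓ₃, hs, -, hη⟩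
  rw [arc_zero, arc_one, ← insert_empty_eq, ← insert_mk_three (by omega)] at hη
  refine reachable_insert_one_sided h hs ?_ hη; rw [← mem_col, col_mk_three]; simp

theorem fam_left_particle_subset (k : ZMod K) {n m : ℕ}
    (h : n + m + 1 = L) : Fam (L := L) N₀ k (N₀ - 1) 1 n m 0 ⊆ reached K L N₀ := by
  have ⟨p1, p2, p3, p4, p5⟩ := hp
  rintro η ⟨ℓ₀, ℓ₁, ℓ₂, ℓ₃, hs, -, hη⟩
  rw [arc_zero, arc_one, ← insert_empty_eq, ← insert_mk_left] at hη
  refine reachable_insert_one_sided h hs ?_ hη; rw [← mem_col, col_mk_left]; simp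

/-! ### Unreachable configurations -/

section Unreachable

/-- The columns with indices `2, …, a + 1` relative to `k - 2` are full, the columns with indices in
`J` contain between `2` and `L - 2` particles, and all other columns are empty. -/
structure InFrame (k : ZMod K) (a : ℕ) (J : Finset ℕ) (A : Sites K L) : Prop where
  triv : ∀ j, j < K → j ∉ J → col A (k - 2 + j) = if 2 ≤ j ∧ j ≤ a + 1 then univ else ∅
  lo : ∀ j ∈ J, 2 ≤ (col A (k - 2 + j)).card
  hi : ∀ j ∈ J, (col A (k - 2 + j)).card + 2 ≤ L

/-- Three partially filled columns, at most one of them to the left of the full columns. -/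
structure FrameIndex (K a : ℕ) (J : Finset ℕ) : Prop where
  two_le : 2 ≤ a
  le : a + 6 ≤ K
  sub : ∀ j ∈ J, j = 1 ∨ j = a + 2 ∨ j = a + 3 ∨ j = a + 4
  card : J.card = 3
  two : a + 2 ∈ J
  three : a + 3 ∈ J
  four : a + 4 ∈ J ↔ 1 ∉ J

variable {k : ZMod K} {a : ℕ} {J : Finset ℕ} {A : Sites K L}

theorem FrameIndex.lt (hJ : FrameIndex K a J) {j : ℕ} (hj : j ∈ J) : j < K := by
  have := hJ.sub j hj; have := hJ.le; omega

theorem FrameIndex.notMem (hJ : FrameIndex K a J) {j : ℕ} (hj : 2 ≤ j ∧ j ≤ a + 1) : j ∉ J := by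
  intro h; have := hJ.sub j h; omega

theorem InFrame.full (hJ : FrameIndex K a J) (h : InFrame k a J A) {j : ℕ}
    (hj : 2 ≤ j ∧ j ≤ a + 1) : col A (k - 2 + j) = univ := by
  rw [h.triv j (by have := hJ.le; omega) (hJ.notMem hj), if_pos hj]

theorem InFrame.twoFull (hJ : FrameIndex K a J) (h : InFrame k a J A) : TwoFull A := by
  have := hJ.two_le; have := hJ.le
  exact ⟨_, _, idx_ne (i := 2) (j := 3) (by omega), h.full hJ (by omega), h.full hJ (by omega)⟩

theorem InFrame.empty (hJ : FrameIndex K a J) (h : InFrame k a J A) {j : ℕ}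
    (hj : j = 0 ∨ (a + 5 ≤ j ∧ j < K)) : col A (k - 2 + j) = ∅ := by
  have := hJ.le; rw [h.triv j (by omega), if_neg (by omega)]; intro hjJ; have := hJ.sub j hjJ; omega

theorem InFrame.zero (hJ : FrameIndex K a J) (h : InFrame k a J A) : col A (k - 2) = ∅ := by
  have := h.empty hJ (j := 0) (Or.inl rfl); rwa [Nat.cast_zero, add_zero] at this

theorem InFrame.last (hJ : FrameIndex K a J) (h : InFrame k a J A) : col A (k - 2 - 1) = ∅ := by
  rw [← sub_one_eq_index]; have := hJ.le; exact h.empty hJ (Or.inr (by omega))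

theorem InFrame.uni (hJ : FrameIndex K a J) (h : InFrame k a J A) (hh : hB A = L) :
    Uni A (k - 2) 2 := by
  have := hJ.two_le; have := hJ.le
  exact uni_of_hB_eq (h.zero hJ) (h.last hJ) (h.full hJ (by omega)) (by omega) hh

theorem InFrame.tame (hJ : FrameIndex K a J) (h : InFrame k a J A) : Tame A := by
  have := hJ.two_le; refine ⟨⟨_, h.full hJ (j := 2) (by omega)⟩, fun y e => ?_⟩
  have : k - 2 ∈ row A y := by rw [e]; simp
  rw [mem_row, ← mem_col, h.zero hJ] at this; simp at this

theorem InFrame.row_card_le (hJ : FrameIndex K a J) (h : InFrame k a J A) (y : ZMod L) :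
    (row A y).card + 2 ≤ K := by
  have hK := hJ.le
  have : row A y ⊆ univ \ {k - 2, k - 2 - 1} := by
    intro x hx; rw [mem_row, ← mem_col] at hx
    simp only [mem_sdiff, mem_univ, mem_insert, mem_singleton, true_and]
    rintro (rfl | rfl)
    · rw [h.zero hJ] at hx; simp at hx
    · rw [h.last hJ] at hx; simp at hx
  have h1 := card_le_card this
  have h2 := card_sdiff_add_card_eq_card (subset_univ ({k - 2, k - 2 - 1} : Finset (ZMod K)))
  rw [card_pair (self_ne_sub_one (by omega) _).symm, card_univ, ZMod.card] at h2; omega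

theorem FrameIndex.card_image (hJ : FrameIndex K a J) :
    (J.image fun j : ℕ => k - 2 + j).card = 3 := by
  rw [card_image_of_injOn, hJ.card]; intro i hi j hj e
  exact add_natCast_inj e (hJ.lt hi) (hJ.lt hj)

theorem InFrame.three_le_cB (hJ : FrameIndex K a J) (h : InFrame k a J A) :
    3 ≤ cB A := by
  rw [← hJ.card_image (k := k)]; refine (card_le_card fun x hx => ?_).trans (card_partialCols_le A)
  obtain ⟨j, hj, rfl⟩ := mem_image.1 hx; have := h.lo j hj; have := h.hi j hj
  exact mem_partialCols.2 (by omega)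

theorem InFrame.brk_le (hJ : FrameIndex K a J) (h : InFrame k a J A) {j : ℕ}
    (hj : j ∈ J) : brk (col A (k - 2 + j)) + 2 ≤ cB A := by
  have h1 := sum_brk_le_cB A (J.image fun j : ℕ => k - 2 + j)
  have hmem : k - 2 + j ∈ J.image fun j : ℕ => k - 2 + j :=
    mem_image_of_mem _ hj; rw [← add_sum_erase _ _ hmem] at h1
  have h2 : ((J.image fun j : ℕ => k - 2 + j).erase (k - 2 + j)).card * 1 ≤
      ∑ x ∈ (J.image fun j : ℕ => k - 2 + j).erase (k - 2 + j), brk (col A x) := by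
    refine (smul_eq_mul _ _).symm.trans_le (card_nsmul_le_sum _ _ _ fun x hx => ?_)
    obtain ⟨i, hi, rfl⟩ := mem_image.1 (mem_of_mem_erase hx); have a1 := h.lo i hi
    have a2 := h.hi i hi; refine one_le_brk (fun e => ?_) (fun e => ?_)
    · rw [e] at a1; simp at a1
    · rw [e, card_univ, ZMod.card] at a2; omega
  rw [card_erase_of_mem hmem, hJ.card_image] at h2; omega

/-- A full column has a full neighbor. -/
theorem InFrame.full_neighbor (hJ : FrameIndex K a J) (h : InFrame k a J A) {j : ℕ}
    (hj : 2 ≤ j ∧ j ≤ a + 1) {s : ZMod K} (hs : s = 1 ∨ s = -1)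
    (hne : col A (k - 2 + j + s) ≠ univ) :
    col A (k - 2 + j - s) = univ := by
  have h2 := hJ.two_le
  have e1 : k - 2 + j + 1 = k - 2 + ((j + 1 : ℕ) : ZMod K) := by push_cast; ring
  have e2 : k - 2 + j - 1 = k - 2 + ((j - 1 : ℕ) : ZMod K) := by
    rw [Nat.cast_sub (by omega)]; push_cast; ring
  rcases hs with rfl | rfl
  · rw [e1] at hne; rw [e2]
    by_cases h3 : j ≤ a
    · exact absurd (h.full hJ (by omega)) hne
    · exact h.full hJ (by omega)
  · rw [sub_neg_eq_add, e1]; rw [← sub_eq_add_neg, e2] at hne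
    by_cases h3 : 3 ≤ j
    · exact absurd (h.full hJ (by omega)) hne
    · exact h.full hJ (by omega)

/-- An empty column has an empty neighbor. -/
theorem InFrame.empty_neighbor (hJ : FrameIndex K a J) (h : InFrame k a J A) {j : ℕ} (hjK : j < K)
    (hjJ : j ∉ J) (hj : ¬ (2 ≤ j ∧ j ≤ a + 1)) {s : ZMod K} (hs : s = 1 ∨ s = -1)
    (hne : col A (k - 2 + j - s) ≠ ∅) :
    col A (k - 2 + j + s) = ∅ := by
  have hle := hJ.le; have h2 := hJ.two; have h3 := hJ.three; have h4 := hJ.four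
  have key : col A (k - 2 + j + 1) = ∅ ∨ col A (k - 2 + j - 1) = ∅ := by
    rcases Nat.eq_zero_or_pos j with rfl | hj0
    · right; rw [Nat.cast_zero, add_zero]; exact h.last hJ
    by_cases hj1 : j = 1
    · right; rw [hj1, Nat.cast_one, add_sub_cancel_right]; exact h.zero hJ
    left; have e1 : k - 2 + j + 1 = k - 2 + ((j + 1 : ℕ) : ZMod K) := by push_cast; ring
    rw [e1]
    by_cases hjK' : j + 1 = K
    · rw [hjK', ZMod.natCast_self, add_zero]; exact h.zero hJ
    have n2 : j ≠ a + 2 := fun e => hjJ (e ▸ h2); have n3 : j ≠ a + 3 := fun e => hjJ (e ▸ h3)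
    exact h.empty hJ (by omega)
  rcases hs with rfl | rfl
  · exact key.resolve_right hne
  · rw [sub_neg_eq_add] at hne; rw [← sub_eq_add_neg]; exact key.resolve_left hne

/-- The invariant states: either unimodal, or with a single split row `y` whose particles in the
partially filled columns on the right are free to be moved. -/
structure BadState (k : ZMod K) (a : ℕ) (J : Finset ℕ) (A : Sites K L) : Prop where
  frame : InFrame k a J A
  split : hB A = L ∨ (hB A = L + 1 ∧ ∃ y, 2 ≤ brk (row A y) ∧
    ∀ j ∈ J, j ≠ 1 → 2 ≤ ((col A (k - 2 + j)).erase y).card ∧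
      (insert y (col A (k - 2 + j))).card + 2 ≤ L)

theorem InFrame.split_row (hK : 4 ≤ K) (hJ : FrameIndex K a J) (h : InFrame k a J A) {y : ZMod L}
    (hrow : brk (row A y) = 1) {x s : ZMod K} (hs : s = 1 ∨ s = -1) (hy : (x, y) ∈ A)
    (hy' : (x + s, y) ∉ A) : x + s + s ∉ row A y ∧ x - s ∈ row A y := by
  have hcard := h.row_card_le hJ y; obtain ⟨u, u', huu, hu, hu'⟩ := h.twoFull hJ
  have hur : u ∈ row A y := by rw [mem_row, ← mem_col, hu]; simp
  have hur' : u' ∈ row A y := by rw [mem_row, ← mem_col, hu']; simp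
  rw [← mem_row] at hy hy'
  constructor
  · intro hc; have := two_le_brk_of_gap hs hy' hc (by rwa [add_sub_cancel_right]) (by omega); omega
  · by_contra hc
    have : ∃ v ∈ row A y, v ≠ x := by
      by_cases hux : u = x
      · exact ⟨u', hur', fun e => huu (hux.trans e.symm)⟩
      · exact ⟨u, hur, hux⟩
    obtain ⟨v, hv, hvx⟩ := this; have := two_le_brk_of_isolated hs hy hy' hc hv hvx; omega

/-- Moves that involve a column outside of the frame indices split the row. -/
theorem InFrame.two_le_brk_row_mv (hK : 4 ≤ K) (hJ : FrameIndex K a J) (h : InFrame k a J A)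
    {y : ZMod L} {x s : ZMod K} (hs : s = 1 ∨ s = -1) (hy : (x, y) ∈ A) (hy' : (x + s, y) ∉ A)
    (hT : x ∉ J.image (fun j : ℕ => k - 2 + j) ∨ x + s ∉ J.image (fun j : ℕ => k - 2 + j)) :
    2 ≤ brk (row (mv A (x, y) (x + s, y)) y) := by
  have hb := brk_move (W := row A y) (y := x) hs (by rwa [mem_row]) (by rwa [mem_row]) hK
  rw [← row_mv_horizontal] at hb
  have h1 := one_le_brk ((h.tame hJ).row_ne y).1 ((h.tame hJ).row_ne y).2
  by_cases hrow : brk (row A y) = 1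
  · obtain ⟨a1, a2⟩ := h.split_row hK hJ hrow hs hy hy'; rw [if_neg a1, if_pos a2] at hb; omega
  rcases hT with hT | hT
  · obtain ⟨j, hj, rfl⟩ := exists_index (k - 2) x
    have hjJ : j ∉ J := fun hc => hT (mem_image_of_mem _ hc)
    have hjf : 2 ≤ j ∧ j ≤ a + 1 := by
      by_contra hc
      rw [← mem_col, h.triv j hj hjJ, if_neg hc] at hy; simp at hy
    have := h.full_neighbor hJ hjf hs fun e => by
      rw [← mem_col, e] at hy'; simp at hy'
    have hm : k - 2 + j - s ∈ row A y := by
      rw [mem_row, ← mem_col, this]; simp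
    rw [if_pos hm] at hb
    split_ifs at hb <;> omega
  · obtain ⟨j, hj, e⟩ := exists_index (k - 2) (x + s)
    have hjJ : j ∉ J := fun hc => hT (by rw [e]; exact mem_image_of_mem _ hc)
    have hjf : ¬ (2 ≤ j ∧ j ≤ a + 1) := by
      intro hc; rw [← mem_col, e, h.full hJ hc] at hy'; simp at hy'
    have := h.empty_neighbor hJ hj hjJ hjf hs fun e' => by
      rw [← e, add_sub_cancel_right] at e'; rw [← mem_col, e'] at hy; simp at hy
    rw [← e] at this
    have hm : x + s + s ∉ row A y := by
      rw [mem_row, ← mem_col, this]; simp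
    rw [if_neg hm] at hb
    split_ifs at hb <;> omega

theorem InFrame.mv_not_low (hL : 4 ≤ L) (hK : 4 ≤ K) (hJ : FrameIndex K a J) (h : InFrame k a J A)
    {y : ZMod L} {x s : ZMod K} (hs : s = 1 ∨ s = -1) (hy : (x, y) ∈ A) (hy' : (x + s, y) ∉ A)
    (hT : x ∉ J.image (fun j : ℕ => k - 2 + j) ∨ x + s ∉ J.image (fun j : ℕ => k - 2 + j))
    (ht : Tame (mv A (x, y) (x + s, y))) :
    L + 5 ≤ cB (mv A (x, y) (x + s, y)) + hB (mv A (x, y) (x + s, y)) := by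
  have hxs : x ≠ x + s := by simpa using sign_ne_zero (n := K) hs
  have h1 := h.two_le_brk_row_mv hK hJ hs hy hy' hT
  have h2 := ht.add_card_le_hB {y} (by simpa using h1); rw [card_singleton] at h2
  have hcard := fun z => card_col_mv_horizontal (A := A) hxs y z; have c1 := col_mv_source A y hxs
  have c2 := col_mv_target A y hxs
  set B := mv A (x, y) (x + s, y)
  set T := J.image (fun j : ℕ => k - 2 + j) with hTdef
  have hTB : T ⊆ partialCols B := by
    intro u hu; obtain ⟨j, hj, rfl⟩ := mem_image.1 hu; have := h.lo j hj; have := h.hi j hj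
    have := hcard (k - 2 + j); exact mem_partialCols.2 (by omega)
  obtain ⟨u, huT, hu⟩ : ∃ u, u ∉ T ∧ u ∈ partialCols B := by
    rcases hT with hT | hT
    · refine ⟨x, hT, mem_partialCols.2 ?_⟩; obtain ⟨j, hj, rfl⟩ := exists_index (k - 2) x
      have hjJ : j ∉ J := fun hc => hT (mem_image_of_mem _ hc); rw [← mem_col] at hy
      have hc := h.triv j hj hjJ
      split_ifs at hc with hjf
      · rw [c1, card_erase_of_mem hy, hc, card_univ, ZMod.card]; omega
      · rw [hc] at hy; simp at hy
    · refine ⟨x + s, hT, mem_partialCols.2 ?_⟩; obtain ⟨j, hj, e⟩ := exists_index (k - 2) (x + s)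
      have hjJ : j ∉ J := fun hc => hT (by rw [e]; exact mem_image_of_mem _ hc)
      rw [← mem_col] at hy'; have hc := h.triv j hj hjJ; rw [← e] at hc
      split_ifs at hc with hjf
      · rw [hc] at hy'; simp at hy'
      · rw [c2, card_insert_of_notMem hy', hc, card_empty]; omega
  have h3 : insert u T ⊆ partialCols B := by
    intro w hw
    rcases mem_insert.1 hw with rfl | hw
    · exact hu
    · exact hTB hw
  have h4 := (card_le_card h3).trans (card_partialCols_le B)
  rw [card_insert_of_notMem huT, hTdef, hJ.card_image] at h4; omega

/-- Merging an isolated point of a column with its neighbor preserves unimodality. -/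
theorem hB_merge (hL : 4 ≤ L) (hK : 2 ≤ K) {O W I : Finset (ZMod L)} {x : ZMod K}
    (hOI : (col A (x + 1) = O ∧ col A (x - 1) = I) ∨ (col A (x - 1) = O ∧ col A (x + 1) = I))
    (hW : col A x = W) (hOW : O ⊆ W) (hWI : W ⊆ I) (hO : O.card ≠ 1) (hO' : brk O ≤ 1)
    (hI : I.card + 1 ≠ L) (hI' : brk I ≤ 1) {y s : ZMod L} (hs : s = 1 ∨ s = -1) (hy : y ∈ W)
    (hy' : y + s ∉ W) (h1 : y + s + s ∈ W) (h2 : y - s ∉ W) :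
    hB (mv A (x, y) (x, y + s)) = hB A := by
  have hyO : y ∉ O := by
    intro hc
    have := eq_singleton_of_nb_eq_zero (by omega) hc (by
      rw [nb_eq_of_sign hs, if_neg fun h => hy' (hOW h), if_neg fun h => h2 (hOW h)]) hO'
    rw [this] at hO; simp at hO
  have hyI : y + s ∈ I := by
    by_contra hc
    exact hI (card_add_one_of_nb_eq_two (by omega) hc (by
      rw [nb_eq_of_sign hs, if_pos (hWI h1), if_pos (by rw [add_sub_cancel_right]; exact hWI hy)])
      hI')
  have hOW' : O ⊆ insert (y + s) (W.erase y) := fun v hv =>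
    mem_insert_of_mem (mem_erase.2 ⟨fun e => hyO (e ▸ hv), hOW hv⟩)
  have hWI' : insert (y + s) (W.erase y) ⊆ I := by
    intro v hv
    rcases mem_insert.1 hv with rfl | hv
    · exact hyI
    · exact hWI (mem_of_mem_erase hv)
  have hcW : (insert (y + s) (W.erase y)).card = W.card := by
    rw [card_insert_of_notMem (fun h => hy' (mem_of_mem_erase h)), card_erase_add_one hy]
  have cx : col (mv A (x, y) (x, y + s)) x = insert (y + s) (W.erase y) := by
    rw [col_mv_vertical, hW]
  have c1 : col (mv A (x, y) (x, y + s)) (x + 1) = col A (x + 1) :=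
    col_mv_vertical_of_ne _ _ _ (self_ne_add_one hK x)
  have c2 : col (mv A (x, y) (x, y + s)) (x - 1) = col A (x - 1) :=
    col_mv_vertical_of_ne _ _ _ (self_ne_sub_one hK x)
  have key := sum_eq_of_two (a := x) (a' := x - 1) (self_ne_sub_one hK x).symm
    (f := fun u => (col (mv A (x, y) (x, y + s)) u \ col (mv A (x, y) (x, y + s)) (u + 1)).card)
    (g := fun u => (col A u \ col A (u + 1)).card) (fun u h1 h2 => by
      rw [col_mv_vertical_of_ne _ _ _ h1, col_mv_vertical_of_ne _ _ _ fun e => h2 (by rw [← e]; ring)])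
  simp only [sub_add_cancel, cx, c1, c2, hW] at key
  change hB _ + _ + _ = hB A + _ + _ at key
  have hcard : ∀ {S T : Finset (ZMod L)}, S ⊆ T → (T \ S).card + S.card = T.card := fun h =>
    card_sdiff_add_card_eq_card h
  have hzero : ∀ {S T : Finset (ZMod L)}, S ⊆ T → (S \ T).card = 0 := fun h => by
    rw [card_eq_zero, sdiff_eq_empty_iff_subset]; exact h
  rcases hOI with ⟨e1, e2⟩ | ⟨e1, e2⟩
  · rw [e1, e2] at key; have := hcard hOW; have := hcard hOW'; have := hcard hWI; have := hcard hWI'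
    omega
  · rw [e1, e2, hzero hOW, hzero hOW', hzero hWI, hzero hWI'] at key; omega

theorem BadState.step (hJ : FrameIndex K a J) {η ξ : Config K L N₀}
    (h : BadState k a J η.1) (hη : cB η.1 + hB η.1 ≤ L + 4) (hadj : (graph K L N₀).Adj η ξ)
    (hξ : cB ξ.1 + hB ξ.1 ≤ L + 4) : BadState k a J ξ.1 := by
  have ⟨p1, p2, p3, p4, p5⟩ := hp; obtain ⟨hF, hsplit⟩ := h; have hJle := hJ.le
  have ht : Tame ξ.1 := tame_step (hF.tame hJ) hadj (by rw [energy_eq']; omega)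
  have hLξ := ht.le_hB; have h3 := hF.three_le_cB hJ
  rcases exists_move hadj with ⟨x, y, s, hs, hpη, hqη, e⟩ | ⟨x, y, s, hs, hpη, hqη, e⟩
  · have hcard := fun z => card_col_mv_vertical hpη hqη z; rw [← e] at hcard
    obtain ⟨j, hj, rfl⟩ := exists_index (k - 2) x
    have hjJ : j ∈ J := by
      by_contra hc
      have := hF.triv j hj hc; rw [← mem_col] at hpη hqη
      split_ifs at this <;> rw [this] at hpη hqη <;> simp at hpη hqη
    have hFξ : InFrame k a J ξ.1 := by
      refine ⟨fun i hi hiJ => ?_, fun i hi => ?_, fun i hi => ?_⟩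
      · rw [e, col_mv_vertical_of_ne _ _ _ (idx_ne (by rintro rfl; exact hiJ hjJ) hi hj), hF.triv i hi hiJ]
      · rw [hcard]; exact hF.lo i hi
      · rw [hcard]; exact hF.hi i hi
    refine ⟨hFξ, Or.inl ?_⟩
    have hmove := brk_move hs (by rwa [mem_col]) (by rwa [mem_col]) p1 (W := col η.1 (k - 2 + j))
    have hfat : brk (col η.1 (k - 2 + j)) ≤ 1 → Fat (col η.1 (k - 2 + j)) := fun hb =>
      fat_of_brk_le_one hb (by have := hF.lo j hjJ; omega) (by have := hF.hi j hjJ; omega)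
    have hcBξ := hFξ.brk_le hJ hjJ; have hceq := cB_mv_vertical η.1 (k - 2 + j) y (y + s)
    rw [e, col_mv_vertical, ← e] at hcBξ; rw [← e] at hceq
    rcases hsplit with hh | ⟨hh, -⟩
    · by_contra hne
      have hb1 : ¬ brk (col η.1 (k - 2 + j)) ≤ 1 := fun hb => by
        have := (hfat hb).brk_move hs (by rwa [mem_col]) (by rwa [mem_col]) p1
        have : 1 ≤ brk (col η.1 (k - 2 + j)) := by
          have a1 := hF.lo j hjJ; have a2 := hF.hi j hjJ
          refine one_le_brk (fun e => ?_) (fun e => ?_)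
          · rw [e] at a1; simp at a1
          · rw [e, card_univ, ZMod.card] at a2; omega
        omega
      have hb2 := hF.brk_le hJ hjJ; have hU := hF.uni hJ hh
      have hm1 : y + s + s ∈ col η.1 (k - 2 + j) := by
        by_contra hc
        rw [if_neg hc] at hmove; omega
      have hm2 : y - s ∉ col η.1 (k - 2 + j) := by
        intro hc; rw [if_pos hm1, if_pos hc] at hmove; omega
      have hothers : ∀ i < K, i ≠ j → (col η.1 (k - 2 + i)).card ≠ 1 ∧
          (col η.1 (k - 2 + i)).card + 1 ≠ L ∧ brk (col η.1 (k - 2 + i)) ≤ 1 := by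
        intro i hi hij
        by_cases hiJ : i ∈ J
        · have a1 := hF.lo i hiJ; have a2 := hF.hi i hiJ; refine ⟨by omega, by omega, ?_⟩
          have := hFξ.brk_le hJ hiJ
          rw [e, col_mv_vertical_of_ne _ _ _ (idx_ne hij hi hj), ← e] at this; omega
        · rw [hF.triv i hi hiJ]
          split_ifs
          · rw [card_univ, ZMod.card, brk_univ]; omega
          · rw [card_empty, brk_empty]; omega
      have hjrange := hJ.sub j hjJ; have hJ2 := hJ.two_le
      have e1 : k - 2 + j + 1 = k - 2 + ((j + 1 : ℕ) : ZMod K) := by push_cast; ring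
      have e2 : k - 2 + j - 1 = k - 2 + ((j - 1 : ℕ) : ZMod K) := by
        rw [Nat.cast_sub (by omega)]; push_cast; ring
      have s1 : k - 2 + j = k - 2 + ((j - 1 + 1 : ℕ) : ZMod K) := by
        rw [Nat.sub_add_cancel (by omega)]
      obtain ⟨o1, o2, o3⟩ := hothers (j + 1) (by omega) (by omega)
      obtain ⟨i1, i2, i3⟩ := hothers (j - 1) (by omega) (by omega)
      have : hB ξ.1 = hB η.1 := by
        rw [e]
        by_cases hj1 : j = 1
        · refine hB_merge (I := col η.1 (k - 2 + ((j + 1 : ℕ) : ZMod K)))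
            (O := col η.1 (k - 2 + ((j - 1 : ℕ) : ZMod K))) p1 (by omega)
            (Or.inr ⟨by rw [e2], by rw [e1]⟩) rfl ?_ ?_ i1 i3 o2 o3 hs (by rwa [mem_col])
            (by rwa [mem_col]) hm1 hm2
          · rw [s1]; exact hU.mono (j - 1) (by omega)
          · exact hU.mono j (by omega)
        · refine hB_merge (O := col η.1 (k - 2 + ((j + 1 : ℕ) : ZMod K)))
            (I := col η.1 (k - 2 + ((j - 1 : ℕ) : ZMod K))) p1 (by omega)
            (Or.inl ⟨by rw [e1], by rw [e2]⟩) rfl ?_ ?_ o1 o3 i2 i3 hs (by rwa [mem_col])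
            (by rwa [mem_col]) hm1 hm2
          · exact hU.anti j (by omega) hj
          · nth_rewrite 1 [s1]; exact hU.anti (j - 1) (by omega) (by omega)
      omega
    · have hb : brk (col η.1 (k - 2 + j)) ≤ 1 := by
        have := hF.brk_le hJ hjJ; omega
      have := (hfat hb).brk_move hs (by rwa [mem_col]) (by rwa [mem_col]) p1
      have : 1 ≤ brk (col η.1 (k - 2 + j)) := by
        have a1 := hF.lo j hjJ; have a2 := hF.hi j hjJ
        refine one_le_brk (fun e => ?_) (fun e => ?_)
        · rw [e] at a1; simp at a1
        · rw [e, card_univ, ZMod.card] at a2; omega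
      omega
  · have hxs : x ≠ x + s := by simpa using sign_ne_zero (n := K) hs
    by_cases hT : x ∉ J.image (fun j : ℕ => k - 2 + j) ∨ x + s ∉ J.image (fun j : ℕ => k - 2 + j)
    · have := hF.mv_not_low p1 (by omega) hJ hs hpη hqη hT (by rwa [← e]); rw [← e] at this; omega
    push Not at hT; obtain ⟨i, hi, hxi⟩ := mem_image.1 hT.1
    obtain ⟨i', hi', hxi'⟩ := mem_image.1 hT.2; have hJ2 := hJ.two_le
    have hne1 : i ≠ 1 ∧ i' ≠ 1 := by
      have r1 := hJ.sub i hi; have r2 := hJ.sub i' hi'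
      have hrel : k - 2 + i' = k - 2 + ((i + 1 : ℕ) : ZMod K) ∨
          k - 2 + i = k - 2 + ((i' + 1 : ℕ) : ZMod K) := by
        rcases hs with rfl | rfl
        · left; rw [hxi', ← hxi]; push_cast; ring
        · right; rw [Nat.cast_add, ← add_assoc, hxi', ← hxi]; push_cast; ring
      have hlt := hJ.lt hi; have hlt' := hJ.lt hi'
      rcases hrel with hr | hr
      · have := add_natCast_inj hr hlt'; omega
      · have := add_natCast_inj hr hlt; omega
    have hcx : col ξ.1 x = (col η.1 x).erase y := by rw [e, col_mv_source _ _ hxs]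
    have hcx' : col ξ.1 (x + s) = insert y (col η.1 (x + s)) := by rw [e, col_mv_target _ _ hxs]
    have hco : ∀ u, u ≠ x → u ≠ x + s → col ξ.1 u = col η.1 u := fun u h1 h2 => by
      rw [e, col_mv_other _ _ h1 h2]
    have hey : ∀ u, (col ξ.1 u).erase y = (col η.1 u).erase y := by
      intro u
      by_cases h1 : u = x
      · rw [h1, hcx, erase_idem]
      by_cases h2 : u = x + s
      · rw [h2, hcx', erase_insert_eq_erase]
      rw [hco u h1 h2]
    have hiy : ∀ u, insert y (col ξ.1 u) = insert y (col η.1 u) := by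
      intro u
      by_cases h1 : u = x
      · rw [h1, hcx, insert_erase (by rwa [mem_col]), insert_eq_of_mem (by rwa [mem_col])]
      by_cases h2 : u = x + s
      · rw [h2, hcx', insert_idem]
      rw [hco u h1 h2]
    have frameξ : (∀ j ∈ J, j ≠ 1 → 2 ≤ ((col η.1 (k - 2 + j)).erase y).card ∧
        (insert y (col η.1 (k - 2 + j))).card + 2 ≤ L) → InFrame k a J ξ.1 := by
      intro hy; refine ⟨fun j hj hjJ => ?_, fun j hj => ?_, fun j hj => ?_⟩
      · rw [hco, hF.triv j hj hjJ]
        · rw [← hxi]; exact idx_ne (fun e => hjJ (e ▸ hi)) hj (hJ.lt hi)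
        · rw [← hxi']; exact idx_ne (fun e => hjJ (e ▸ hi')) hj (hJ.lt hi')
      · by_cases hj1 : j = 1
        · rw [hco, ]
          · exact hF.lo j hj
          · rw [← hxi]; exact idx_ne (by omega) (hJ.lt hj) (hJ.lt hi)
          · rw [← hxi']; exact idx_ne (by omega) (hJ.lt hj) (hJ.lt hi')
        · have := (hy j hj hj1).1; rw [← hey] at this
          exact this.trans (card_le_card (erase_subset _ _))
      · by_cases hj1 : j = 1
        · rw [hco]
          · exact hF.hi j hj
          · rw [← hxi]; exact idx_ne (by omega) (hJ.lt hj) (hJ.lt hi)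
          · rw [← hxi']; exact idx_ne (by omega) (hJ.lt hj) (hJ.lt hi')
        · have := (hy j hj hj1).2; rw [← hiy] at this
          exact le_trans (Nat.add_le_add_right (card_le_card (subset_insert _ _)) 2) this
    have hrowy : hB ξ.1 + brk (row η.1 y) = hB η.1 + brk (row ξ.1 y) := by
      have := hB_mv_horizontal η.1 x (x + s) y; rwa [← row_mv_horizontal, ← e] at this
    have hmove := brk_move (n := K) (W := row η.1 y) (y := x) hs (by rwa [mem_row]) (by rwa [mem_row])
    rw [← row_mv_horizontal, ← e] at hmove
    rcases hsplit with hh | ⟨hh, y₀, hy₀, hy⟩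
    · have hU := hF.uni hJ hh; have hrow := (hF.tame hJ).brk_row_eq_one hh y
      obtain ⟨a1, a2⟩ := hF.split_row (by omega) hJ hrow hs hpη hqη
      rw [if_neg a1, if_pos a2] at hmove
      have hcond : ∀ j ∈ J, j ≠ 1 → 2 ≤ ((col η.1 (k - 2 + j)).erase y).card ∧
        (insert y (col η.1 (k - 2 + j))).card + 2 ≤ L := by
        intro j hj hj1; have hchain : ∀ i ∈ J, i ≠ 1 → col η.1 (k - 2 + j) ⊆
            col η.1 (k - 2 + i) ∨ col η.1 (k - 2 + i) ⊆
            col η.1 (k - 2 + j) := by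
          intro i hi hi1; have := hJ.sub i hi; have := hJ.sub j hj; have := hJ.lt hi
          have := hJ.lt hj
          rcases le_total i j with hle | hle
          · exact Or.inl (hU.anti_le (by omega) hle (by omega))
          · exact Or.inr (hU.anti_le (by omega) hle (by omega))
        have c1 := hchain i hi hne1.1; have c2 := hchain i' hi' hne1.2; rw [hxi] at c1
        rw [hxi'] at c2; rw [← mem_col] at hpη hqη; have b1 := hF.lo j hj; have b2 := hF.hi j hj
        by_cases hyj : y ∈ col η.1 (k - 2 + j)
        · constructor
          · have hs' : col η.1 (x + s) ⊆ (col η.1 (k - 2 + j)).erase y := by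
              intro v hv; refine mem_erase.2 ⟨fun e => hqη (e ▸ hv), ?_⟩
              exact c2.resolve_left (fun hc => hqη (hc hyj)) hv
            have := hF.lo i' hi'; rw [hxi'] at this; exact this.trans (card_le_card hs')
          · rwa [insert_eq_of_mem hyj]
        · constructor
          · rwa [erase_eq_of_notMem hyj]
          · have hs' : insert y (col η.1 (k - 2 + j)) ⊆ col η.1 x := by
              intro v hv
              rcases mem_insert.1 hv with rfl | hv
              · exact hpη
              · exact c1.resolve_right (fun hc => hyj (hc hpη)) hv
            have := hF.hi i hi; rw [hxi] at this
            exact le_trans (Nat.add_le_add_right (card_le_card hs') 2) this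
      refine ⟨frameξ hcond, Or.inr ⟨by omega, y, by omega, ?_⟩⟩; intro j hj hj1; rw [hey, hiy]
      exact hcond j hj hj1
    · by_cases hyy : y = y₀
      · subst hyy; have hFξ := frameξ hy; have h3ξ := hFξ.three_le_cB hJ
        have hy2 : brk (row η.1 y) = 2 := by
          by_contra hne
          have := (hF.tame hJ).add_card_le_hB {y} (by simpa using hy₀)
          have hsum : hB η.1 = ∑ v, brk (row η.1 v) := hB_eq_sum_row _
          rw [← add_sum_erase _ _ (mem_univ y)] at hsum
          have : (univ.erase y).card * 1 ≤ ∑ v ∈ univ.erase y, brk (row η.1 v) :=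
            (smul_eq_mul _ _).symm.trans_le (card_nsmul_le_sum _ _ _ fun v _ =>
              one_le_brk ((hF.tame hJ).row_ne v).1 ((hF.tame hJ).row_ne v).2)
          rw [card_erase_of_mem (mem_univ y), card_univ, ZMod.card] at this; omega
        refine ⟨hFξ, ?_⟩
        by_cases hbξ : 2 ≤ brk (row ξ.1 y)
        · right; refine ⟨by omega, y, hbξ, ?_⟩; intro j hj hj1; rw [hey, hiy]; exact hy j hj hj1
        · left; omega
      · exfalso
        have hrow : brk (row η.1 y) = 1 := by
          have h1 := one_le_brk ((hF.tame hJ).row_ne y).1 ((hF.tame hJ).row_ne y).2; by_contra hne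
          have := (hF.tame hJ).add_card_le_hB {y, y₀} (by
            intro v hv; simp only [mem_insert, mem_singleton] at hv
            rcases hv with rfl | rfl
            · omega
            · exact hy₀)
          rw [card_pair hyy] at this; omega
        obtain ⟨a1, a2⟩ := hF.split_row (by omega) hJ hrow hs hpη hqη
        rw [if_neg a1, if_pos a2] at hmove
        have : J.image (fun j : ℕ => k - 2 + j) ⊆ partialCols ξ.1 := by
          intro u hu; obtain ⟨j, hj, rfl⟩ := mem_image.1 hu; have b1 := hF.lo j hj
          have b2 := hF.hi j hj; have := card_col_mv_horizontal (A := η.1) hxs y (k - 2 + j)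
          rw [← e] at this; exact mem_partialCols.2 (by omega)
        have := (card_le_card this).trans (card_partialCols_le _); rw [hJ.card_image] at this; omega

theorem BadState.not_reachable (hJ : FrameIndex K a J) {η : Config K L N₀}
    (h : BadState k a J η.1) :
    η ∉ reached K L N₀ := by
  intro hr; obtain ⟨k', hk'⟩ := mem_reachable.1 hr
  have := hk'.preserves (fun ζ => BadState k a J ζ.1) (fun x y hx hadj h1 h2 => by
    rw [energy_eq'] at h1 h2; exact hx.step hJ (by omega) hadj (by omega)) h
  have h3 := this.frame.three_le_cB hJ
  rw [show (stripConfig hp k').1 = stripSet L N₀ k' from rfl, cB_stripSet] at h3; omega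

end Unreachable

/-! ### Moving the particles of a single column -/

section ColumnPaths

variable {n : ℕ} [NeZero n]

/-- The set `X` lies between `lo` and `up` and has at most `q` runs. -/
def Between (lo up : Finset (ZMod n)) (q : ℕ) (X : Finset (ZMod n)) : Prop :=
  lo ⊆ X ∧ X ⊆ up ∧ brk X ≤ q

/-- One particle moves by one site. -/
def ColStep (lo up : Finset (ZMod n)) (q : ℕ) (X X' : Finset (ZMod n)) : Prop :=
  (∃ y s, (s = 1 ∨ s = -1) ∧ y ∈ X ∧ y + s ∉ X ∧ X' = insert (y + s) (X.erase y)) ∧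
    Between lo up q X ∧ Between lo up q X'

abbrev ColPath (lo up : Finset (ZMod n)) (q : ℕ) : Finset (ZMod n) → Finset (ZMod n) → Prop :=
  ReflTransGen (ColStep lo up q)

variable {lo up X X' : Finset (ZMod n)} {q : ℕ}

theorem ColStep.symm (h : ColStep lo up q X X') : ColStep lo up q X' X := by
  obtain ⟨⟨y, s, hs, hy, hy', rfl⟩, h1, h2⟩ := h
  refine ⟨⟨y + s, -s, by rcases hs with rfl | rfl <;> simp, mem_insert_self _ _, ?_, ?_⟩,
    h2, h1⟩
  · rw [add_neg_cancel_right, mem_insert, not_or]; exact ⟨fun e => hy' (e ▸ hy), notMem_erase _ _⟩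
  · rw [add_neg_cancel_right, erase_insert (fun hc => hy' (mem_of_mem_erase hc)), insert_erase hy]

theorem colPath_symm (h : ColPath lo up q X X') : ColPath lo up q X' X := by
  induction h with
  | refl => exact .refl
  | tail _ h ih => exact .head h.symm ih

theorem colStep_insert (hn : 2 ≤ n) {p s : ZMod n} (hs : s = 1 ∨ s = -1) (hp : p ∉ X)
    (hps : p + s ∉ X) (h1 : Between lo up q (insert p X))
    (h2 : Between lo up q (insert (p + s) X)) :
    ColStep lo up q (insert p X) (insert (p + s) X) := by
  refine ⟨⟨p, s, hs, mem_insert_self _ _, ?_, by rw [erase_insert hp]⟩, h1, h2⟩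
  rw [mem_insert, not_or]; refine ⟨?_, hps⟩
  rcases hs with rfl | rfl
  · exact self_ne_add_one hn p
  · rw [← sub_eq_add_neg]; exact self_ne_sub_one hn p

theorem colPath_slide (hn : 2 ≤ n) {p s : ZMod n} (hs : s = 1 ∨ s = -1) (hlo : lo ⊆ X)
    (hup : X ⊆ up) (hq : brk X + 1 ≤ q) (t : ℕ)
    (h : ∀ i : ℕ, i ≤ t → p + i * s ∉ X ∧ p + i * s ∈ up) :
    ColPath lo up q (insert p X) (insert (p + t * s) X) := by
  have hb : ∀ i : ℕ, i ≤ t → Between lo up q (insert (p + i * s) X) := fun i hi =>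
    ⟨hlo.trans (subset_insert _ _), insert_subset (h i hi).2 hup, (brk_insert_le hn _ _).trans hq⟩
  induction t with
  | zero => simp only [Nat.cast_zero, zero_mul, add_zero]; exact .refl
  | succ t ih =>
    refine (ih (fun i hi => h i (by omega)) (fun i hi => hb i (by omega))).tail ?_
    have e : p + ((t + 1 : ℕ) : ZMod n) * s = p + t * s + s := by push_cast; ring
    have h2 := hb (t + 1) le_rfl; have h3 := (h (t + 1) le_rfl).1; rw [e] at h2 h3 ⊢
    exact colStep_insert hn hs (h t (by omega)).1 h3 (hb t (by omega)) h2

theorem index_notMem_union {ℓ : ZMod n} {a b c i : ℕ} (ha : a ≤ i) (hb : i < b ∨ b + c ≤ i)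
    (h : b + c ≤ n := by omega) (hi : i < n := by omega) : ℓ + i ∉ arc ℓ a ∪ arc (ℓ + b) c := by
  rw [mem_union, not_or, mem_arc, mem_arc]
  constructor
  · rintro ⟨j, hj, e⟩; have := add_natCast_inj e hi; omega
  · rintro ⟨j, hj, e⟩; rw [add_assoc, ← Nat.cast_add] at e; have := add_natCast_inj e hi; omega

theorem arc_shift_subset (ℓ : ZMod n) {b c d : ℕ} (h : b + c ≤ d) :
    arc (ℓ + (b : ZMod n)) c ⊆ arc ℓ d := by
  refine Subset.trans ?_ (arc_mono ℓ h); rw [arc_add]; exact subset_union_right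

theorem two_arcs_succ (ℓ : ZMod n) (a b c : ℕ) : arc ℓ a ∪ arc (ℓ + b) (c + 1) =
      insert (ℓ + b) (arc ℓ a ∪ arc (ℓ + ((b + 1 : ℕ) : ZMod n)) c) := by
  rw [arc_succ', union_insert]
  push_cast; rw [add_assoc]

theorem two_arcs_succ_left (ℓ : ZMod n) (a : ℕ) (W : Finset (ZMod n)) :
    arc ℓ (a + 1) ∪ W = insert (ℓ + a) (arc ℓ a ∪ W) := by
  rw [arc_succ, insert_union]

/-- The particles of the second arc join the first one, one after the other. -/
theorem colPath_merge (hn : 2 ≤ n) {ℓ : ZMod n} : ∀ {a b c : ℕ}, a < b → b + c ≤ n →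
    lo ⊆ arc ℓ a → arc ℓ (b + c) ⊆ up →
    ColPath lo up 3 (arc ℓ a ∪ arc (ℓ + (b : ZMod n)) c) (arc ℓ (a + c))
  | a, b, 0, _, _, _, _ => by rw [arc_zero, union_empty, add_zero]
  | a, b, c + 1, hab, hbc, hlo, hup => by
    rw [show a + (c + 1) = a + 1 + c by ring]
    refine Relation.ReflTransGen.trans ?_ (colPath_merge hn (a := a + 1) (b := b + 1) (by omega)
      (by omega) (hlo.trans (arc_mono _)) ((arc_mono _).trans hup))
    rw [two_arcs_succ, two_arcs_succ_left]; have hidx : ∀ i : ℕ, i ≤ b - a →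
        ℓ + (b : ZMod n) + (i : ZMod n) * -1 = ℓ + ((b - i : ℕ) : ZMod n) := fun i hi => by
      rw [Nat.cast_sub (by omega)]; ring
    have := colPath_slide (lo := lo) (up := up) (q := 3) (p := ℓ + (b : ZMod n)) (s := -1)
      (X := arc ℓ a ∪ arc (ℓ + ((b + 1 : ℕ) : ZMod n)) c) hn
      (Or.inr rfl) (hlo.trans subset_union_left)
      (union_subset ((arc_mono _).trans hup) ((arc_shift_subset ℓ (by omega)).trans hup))
      (by have := brk_union_le (arc ℓ a) (arc (ℓ + ((b + 1 : ℕ) : ZMod n)) c)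
          have := brk_arc_le ℓ a; have := brk_arc_le (ℓ + ((b + 1 : ℕ) : ZMod n)) c
          omega) (b - a) (fun i hi => by
        rw [hidx i hi]
        exact ⟨index_notMem_union (by omega) (Or.inl (by omega)),
          hup ((mem_arc_index (by omega) (by omega)).2 (by omega))⟩)
    rwa [hidx _ le_rfl, show b - (b - a) = a by omega] at this

/-- An isolated hole above the first arc moves through the second arc. -/
theorem colPath_hole_up (hn : 2 ≤ n) {ℓ : ZMod n} : ∀ {a c : ℕ}, a + 1 + c ≤ n →
    lo ⊆ arc ℓ a → arc ℓ (a + 1 + c) ⊆ up →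
    ColPath lo up 2 (arc ℓ a ∪ arc (ℓ + ((a + 1 : ℕ) : ZMod n)) c) (arc ℓ (a + c))
  | a, 0, _, _, _ => by rw [arc_zero, union_empty, add_zero]
  | a, c + 1, hbc, hlo, hup => by
    have hlo' : lo ⊆ arc ℓ (a + 1) := hlo.trans (arc_mono _)
    have hb : ∀ b c' d, b + c' ≤ a + c + 2 → d ≤ a + c + 2 → lo ⊆ arc ℓ d →
        Between lo up 2 (arc ℓ d ∪ arc (ℓ + (b : ZMod n)) c') := fun b c' d hb hd hl => by
      refine ⟨hl.trans subset_union_left, union_subset ((arc_mono _).trans hup)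
          ((arc_shift_subset ℓ (by omega)).trans hup), ?_⟩
      have := brk_union_le (arc ℓ d) (arc (ℓ + (b : ZMod n)) c'); have := brk_arc_le ℓ d
      have := brk_arc_le (ℓ + (b : ZMod n)) c'; omega
    rw [show a + (c + 1) = a + 1 + c by ring]
    refine Relation.ReflTransGen.trans (.single ?_) (colPath_hole_up hn (a := a + 1) (by omega)
      hlo' ((arc_mono _).trans hup)); have h1 := hb (a + 1) (c + 1) a (by omega) (by omega) hlo
    have h2 := hb (a + 1 + 1) c (a + 1) (by omega) (by omega) hlo'; rw [two_arcs_succ] at h1 ⊢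
    rw [two_arcs_succ_left] at h2 ⊢
    have e : ℓ + ((a + 1 : ℕ) : ZMod n) + -1 = ℓ + (a : ZMod n) := by push_cast; ring
    rw [← e] at h2 ⊢; refine colStep_insert hn (Or.inr rfl) ?_ ?_ h1 h2
    · exact index_notMem_union (by omega) (Or.inl (by omega))
    · rw [e]; exact index_notMem_union (by omega) (Or.inl (by omega))

/-- An isolated hole below the first arc moves through the second arc. -/
theorem colPath_hole_down (hn : 2 ≤ n) {m : ZMod n} : ∀ {a c : ℕ}, a + 1 + c ≤ n →
    lo ⊆ arc (m + ((c + 1 : ℕ) : ZMod n)) a →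
    ColPath lo univ 2 (arc m c ∪ arc (m + ((c + 1 : ℕ) : ZMod n)) a) (arc (m + 1) (a + c))
  | a, 0, _, _ => by simp only [arc_zero, empty_union, add_zero, zero_add, Nat.cast_one]; exact .refl
  | a, c + 1, hbc, hlo => by
    have e : m + ((c : ℕ) : ZMod n) + 1 = m + ((c + 1 : ℕ) : ZMod n) := by push_cast; ring
    have e' : m + ((c + 1 : ℕ) : ZMod n) + 1 = m + ((c + 1 + 1 : ℕ) : ZMod n) := by push_cast; ring
    have hs : arc (m + ((c + 1 : ℕ) : ZMod n)) (a + 1) =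
        insert (m + ((c + 1 : ℕ) : ZMod n)) (arc (m + ((c + 1 + 1 : ℕ) : ZMod n)) a) := by
      rw [arc_succ', e']
    have hlo' : lo ⊆ arc (m + ((c + 1 : ℕ) : ZMod n)) (a + 1) := by
      rw [hs]; exact hlo.trans (subset_insert _ _)
    have hb : ∀ (d b c' : ℕ), lo ⊆ arc (m + b) c' →
        Between lo univ 2 (arc m d ∪ arc (m + (b : ZMod n)) c') := fun d b c' hl => by
      refine ⟨hl.trans subset_union_right, subset_univ _, ?_⟩
      have := brk_union_le (arc m d) (arc (m + b) c'); have := brk_arc_le m d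
      have := brk_arc_le (m + (b : ZMod n)) c'; omega
    rw [show a + (c + 1) = a + 1 + c by ring]
    refine ReflTransGen.trans (.single ?_) (colPath_hole_down hn (a := a + 1) (c := c)
      (by omega) hlo'); have h1 := hb (c + 1) (c + 1 + 1) a hlo
    have h2 := hb c (c + 1) (a + 1) hlo'; rw [two_arcs_succ_left] at h1 ⊢
    rw [hs, union_insert, ← e] at h2 ⊢; refine colStep_insert hn (Or.inl rfl) ?_ ?_ h1 h2
    · exact index_notMem_union (by omega) (Or.inl (by omega))
    · rw [e]; exact index_notMem_union (by omega) (Or.inl (by omega))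

/-- A set between two arcs that consists of two arcs `arc ℓ a` and `arc (ℓ + b) c`, the first one
containing the lower bound, such that the gap after `arc ℓ a` is contained in the upper bound. -/
structure TwoArcs (lo up X : Finset (ZMod n)) (ℓ : ZMod n) (a b c : ℕ) : Prop where
  pos : 0 < a
  lt : a < b
  pos' : 0 < c
  lt' : b + c < n
  eq : X = arc ℓ a ∪ arc (ℓ + b) c
  lo : lo ⊆ arc ℓ a
  up : arc ℓ (b + c) ⊆ up

theorem exists_twoArcs (hX : brk X = 2) (hlo : lo ⊆ X) (hup : X ⊆ up) (h1 : brk lo ≤ 1)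
    (h2 : brk up ≤ 1) (h : lo = ∅ ∨ up = univ) : ∃ ℓ a b c, TwoArcs lo up X ℓ a b c := by
  have hX0 : X ≠ ∅ := by rintro rfl; rw [brk_empty] at hX; omega
  have hX1 : X ≠ univ := by rintro rfl; rw [brk_univ] at hX; omega
  have hcardX := card_lt_of_ne_univ hX1
  by_cases hup1 : up = univ
  · subst hup1; obtain ⟨u, hu⟩ := exists_eq_arc h1
    by_cases hl : lo = ∅
    · obtain ⟨ℓ, hℓ, hℓ'⟩ := exists_start hX0 hX1
      obtain ⟨a, b, c, ha, hab, hc, hbc, e⟩ := eq_two_arcs hX hℓ hℓ'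
      exact ⟨ℓ, a, b, c, ha, hab, hc, hbc, e, by rw [hl]; exact empty_subset _, subset_univ _⟩
    · have hpos : 0 < lo.card := card_pos.2 (nonempty_iff_ne_empty.2 hl)
      have huX : ∀ i < lo.card, u + (i : ZMod n) ∈ X := fun i hi => by
        apply hlo; rw [hu]; exact mem_arc.2 ⟨i, hi, rfl⟩
      have h0 : u ∈ X := by simpa using huX 0 hpos
      have hex : ∃ d : ℕ, u - (d : ZMod n) ∉ X := by
        obtain ⟨v, hv⟩ : ∃ v, v ∉ X := by
          by_contra hne
          exact hX1 (eq_univ_iff_forall.2 fun v => by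
            by_contra hv; exact hne ⟨v, hv⟩)
        obtain ⟨i, -, hi⟩ := exists_index 0 (u - v)
        exact ⟨i, by rw [zero_add] at hi; rwa [← hi, sub_sub_cancel]⟩
      obtain ⟨d, hd, hdmin⟩ : ∃ d : ℕ, u - (d : ZMod n) ∉ X ∧ ∀ j < d, u - (j : ZMod n) ∈ X :=
        ⟨Nat.find hex, Nat.find_spec hex, fun j hj => not_not.1 (Nat.find_min hex hj)⟩
      have hd0 : d ≠ 0 := by rintro rfl; apply hd; simpa using h0
      have hrun : ∀ i < lo.card + (d - 1), u - ((d - 1 : ℕ) : ZMod n) + (i : ZMod n) ∈ X := by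
        intro i hi
        by_cases hid : i ≤ d - 1
        · have := hdmin (d - 1 - i) (by omega)
          rwa [Nat.cast_sub hid, sub_sub_eq_add_sub, add_sub_right_comm] at this
        · have := huX (i - (d - 1)) (by omega)
          rwa [Nat.cast_sub (by omega), ← add_sub_assoc, add_sub_right_comm] at this
      obtain ⟨a, b, c, ha, hab, hc, hbc, e⟩ := eq_two_arcs (ℓ := u - ((d - 1 : ℕ) : ZMod n)) hX
        (hdmin _ (by omega)) (by
          rw [sub_sub]
          rwa [show ((d - 1 : ℕ) : ZMod n) + 1 = (d : ZMod n) by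
            rw [← Nat.cast_succ]; congr 1; omega])
      refine ⟨_, a, b, c, ha, hab, hc, hbc, e, ?_, subset_univ _⟩
      have hle : lo.card + (d - 1) ≤ a := by
        by_contra hlt
        have := hrun a (by omega); rw [e] at this
        exact (index_notMem_union le_rfl (Or.inl hab)) this
      intro v hv; rw [hu, mem_arc] at hv; obtain ⟨j, hj, rfl⟩ := hv
      exact mem_arc.2 ⟨d - 1 + j, by omega, by push_cast; ring⟩
  · obtain rfl : lo = ∅ := h.resolve_right hup1; obtain ⟨u, hu⟩ := exists_eq_arc h2
    have hn := card_lt_of_ne_univ hup1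
    have hex : ∃ i : ℕ, u + (i : ZMod n) ∈ X := by
      obtain ⟨v, hv⟩ := nonempty_iff_ne_empty.2 hX0; obtain ⟨i, -, rfl⟩ := exists_index u v
      exact ⟨i, hv⟩
    obtain ⟨i, hi, himin⟩ : ∃ i : ℕ, u + (i : ZMod n) ∈ X ∧ ∀ j < i, u + (j : ZMod n) ∉ X :=
      ⟨Nat.find hex, Nat.find_spec hex, fun j hj => Nat.find_min hex hj⟩
    have hin : i < n := by
      by_contra hge
      obtain ⟨v, hv⟩ := nonempty_iff_ne_empty.2 hX0; obtain ⟨j, hj, rfl⟩ := exists_index u v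
      exact himin j (by omega) hv
    have hpred : u + (i : ZMod n) - 1 ∉ X := by
      rcases Nat.eq_zero_or_pos i with rfl | hpos
      · rw [Nat.cast_zero, add_zero, ← sub_one_eq_index]; intro hc; have := hup hc
        rw [hu, mem_arc_index] at this; omega
      · have := himin (i - 1) (by omega)
        rwa [Nat.cast_sub hpos, Nat.cast_one, ← add_sub_assoc] at this
    obtain ⟨a, b, c, ha, hab, hc, hbc, e⟩ := eq_two_arcs hX hi hpred
    refine ⟨_, a, b, c, ha, hab, hc, hbc, e, empty_subset _, ?_⟩
    have hlast : u + ((i + (b + c - 1) : ℕ) : ZMod n) ∈ X := by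
      rw [e, mem_union]
      right
      exact mem_arc.2 ⟨c - 1, by omega, by
        rw [show i + (b + c - 1) = i + b + (c - 1) by omega]; push_cast; ring⟩
    have hlt : i + (b + c - 1) < n := by
      by_contra hge
      apply himin (i + (b + c - 1) - n) (by omega)
      rwa [Nat.cast_sub (by omega), ZMod.natCast_self, sub_zero]
    have := hup hlast; rw [hu, mem_arc_index hlt] at this; rw [hu]
    exact arc_shift_subset u (by omega)

theorem TwoArcs.card_le {ℓ : ZMod n} {a b c : ℕ} (h : TwoArcs lo up X ℓ a b c) : lo.card ≤ a := by
  have := card_le_card h.lo; rwa [card_arc (by have := h.lt; have := h.lt'; omega)] at this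

theorem nb_eq_two_iff {W : Finset (ZMod n)} {y : ZMod n} : nb W y = 2 ↔ y - 1 ∈ W ∧ y + 1 ∈ W := by
  rw [nb]; split_ifs <;> simp_all

theorem TwoArcs.exists_colPath (hn : 2 ≤ n) {ℓ : ZMod n} {a b c : ℕ} (h : TwoArcs lo up X ℓ a b c)
    (hlo : lo = ∅ ∨ 2 ≤ lo.card) (hup : up = univ ∨ up.card + 2 ≤ n)
    (hd : a = 1 ∨ c = 1 ∨ b = a + 1 ∨ b + c + 1 = n) :
    ∃ X', brk X' ≤ 1 ∧ ColPath lo up 2 X X' := by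
  obtain ⟨ha, hab, hc, hbc, rfl, hl, hu⟩ := id h
  rcases hd with rfl | rfl | rfl | hd
  · have : lo = ∅ := hlo.resolve_right fun h2 => by have := h.card_le; omega
    subst this
    have hidx : ∀ i : ℕ, ℓ + (i : ZMod n) * 1 = ℓ + (i : ZMod n) := fun i => by rw [mul_one]
    have := colPath_slide (lo := ∅) (up := up) (q := 2) (p := ℓ) (s := 1)
      (X := arc (ℓ + (b : ZMod n)) c) hn (Or.inl rfl) (empty_subset _)
      ((arc_shift_subset ℓ le_rfl).trans hu)
      (by have := brk_arc_le (ℓ + (b : ZMod n)) c; omega) (b - 1) (fun i hi => by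
        rw [hidx]
        have := index_notMem_union (ℓ := ℓ) (a := 0) (b := b) (c := c) (i := i) (by omega) (Or.inl (by omega))
        rw [arc_zero, empty_union] at this
        exact ⟨this, hu ((mem_arc_index (by omega) (by omega)).2 (by omega))⟩)
    refine ⟨insert (ℓ + ((b - 1 : ℕ) : ZMod n) * 1) (arc (ℓ + (b : ZMod n)) c), ?_, by
      rwa [arc_one, ← insert_eq]⟩
    rw [hidx, show ℓ + (b : ZMod n) = ℓ + ((b - 1 : ℕ) : ZMod n) + 1 by
      rw [Nat.cast_sub (by omega)]; push_cast; ring, ← arc_succ']; exact brk_arc_le _ _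
  · have hidx : ∀ i : ℕ, i ≤ b - a →
        ℓ + (b : ZMod n) + (i : ZMod n) * -1 = ℓ + ((b - i : ℕ) : ZMod n) := fun i hi => by
      rw [Nat.cast_sub (by omega)]; ring
    have := colPath_slide (lo := lo) (up := up) (q := 2) (p := ℓ + (b : ZMod n)) (s := -1)
      (X := arc ℓ a) hn (Or.inr rfl) hl ((arc_mono _).trans hu)
      (by have := brk_arc_le ℓ a; omega) (b - a) (fun i hi => by
        rw [hidx i hi, mem_arc_index]
        exact ⟨by omega, hu ((mem_arc_index (by omega) (by omega)).2 (by omega))⟩)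
    refine ⟨insert (ℓ + (b : ZMod n) + ((b - a : ℕ) : ZMod n) * -1) (arc ℓ a), ?_, by
      rwa [arc_one, union_comm, ← insert_eq]⟩
    rw [hidx _ le_rfl, show b - (b - a) = a by omega, ← arc_succ]; exact brk_arc_le _ _
  · exact ⟨_, brk_arc_le _ _, colPath_hole_up hn (by omega) hl hu⟩
  · have : up = univ := hup.resolve_right fun h2 => by
      have := card_le_card hu; rw [card_arc] at this; omega
    subst this
    have e : ℓ = ℓ + (b : ZMod n) + ((c + 1 : ℕ) : ZMod n) := by
      rw [add_assoc, ← Nat.cast_add, ← add_assoc, hd, ZMod.natCast_self, add_zero]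
    refine ⟨_, brk_arc_le (ℓ + (b : ZMod n) + 1) (a + c), ?_⟩
    have := colPath_hole_down (lo := lo) hn (m := ℓ + (b : ZMod n)) (a := a) (c := c) (by omega)
      (by rwa [← e]); rwa [← e, union_comm] at this

/-- Any two points of `A` and `B` have distance at least three. -/
def Far (A B : Finset (ZMod n)) : Prop :=
  ∀ x ∈ A, ∀ y ∈ B, y ≠ x ∧ y ≠ x + 1 ∧ y + 1 ≠ x ∧ y ≠ x + 2 ∧ y + 2 ≠ x

theorem Far.symm {A B : Finset (ZMod n)} (h : Far A B) : Far B A := fun x hx y hy => by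
  obtain ⟨h1, h2, h3, h4, h5⟩ := h y hy x hx; exact ⟨h1.symm, h3.symm, h2.symm, h5.symm, h4.symm⟩

theorem Far.brk_union {A B : Finset (ZMod n)} (h : Far A B) : brk (A ∪ B) = brk A + brk B := by
  classical
  have key : ∀ {A B : Finset (ZMod n)}, Far A B → A.filter (fun y => y + 1 ∉ A ∪ B) =
      A.filter fun y => y + 1 ∉ A := fun {A B} h => by
    refine filter_congr fun y hy => ?_
    rw [mem_union, not_or]
    exact ⟨fun h => h.1, fun h' => ⟨h', fun hB => (h y hy _ hB).2.1 rfl⟩⟩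
  rw [brk, filter_union, key h, union_comm A B, key h.symm, card_union_of_disjoint]
  · rfl
  · rw [disjoint_left]
    intro x hx hx'
    exact (h x (mem_filter.1 hx).1 x (mem_filter.1 hx').1).1 rfl

theorem Far.fat_union {A B : Finset (ZMod n)} (h : Far A B) (hA : Fat A) (hB : Fat B) :
    Fat (A ∪ B) := by
  have mono : ∀ {A B : Finset (ZMod n)} y, A ⊆ B → nb A y ≤ nb B y := fun {A B} y hs => by
    have h1 := @hs (y - 1); have h2 := @hs (y + 1); rw [nb, nb]
    split_ifs <;> simp_all
  constructor
  · intro y hy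
    rcases mem_union.1 hy with hy | hy
    · exact (hA.1 y hy).trans (mono y subset_union_left)
    · exact (hB.1 y hy).trans (mono y subset_union_right)
  · intro y hy; rw [mem_union, not_or] at hy; have h1 := hA.2 y hy.1; have h2 := hB.2 y hy.2
    by_contra hlt
    have h3 := nb_le_two (A ∪ B) y
    obtain ⟨m1, m2⟩ := nb_eq_two_iff.1 (show nb (A ∪ B) y = 2 by omega)
    have e : y - 1 + 2 = y + 1 := by ring
    rcases mem_union.1 m1 with m1 | m1 <;> rcases mem_union.1 m2 with m2 | m2
    · rw [nb_eq_two_iff.2 ⟨m1, m2⟩] at h1; omega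
    · exact (h _ m1 _ m2).2.2.2.1 e.symm
    · exact (h _ m2 _ m1).2.2.2.2 e
    · rw [nb_eq_two_iff.2 ⟨m1, m2⟩] at h2; omega

theorem far_arcs {ℓ : ZMod n} {a b c : ℕ} (h : a + 2 ≤ b) (h' : b + c + 2 ≤ n) :
    Far (arc ℓ a) (arc (ℓ + b) c) := by
  intro x hx y hy; obtain ⟨i, hi, rfl⟩ := mem_arc.1 hx; obtain ⟨j, hj, rfl⟩ := mem_arc.1 hy
  have key : ∀ u v : ℕ, u < n → v < n → u ≠ v → ∀ p q : ZMod n, p = ℓ + u →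
      q = ℓ + v → p ≠ q := fun u v hu hv hne p q hp hq e => by
    rw [hp, hq] at e; exact hne (add_natCast_inj e hu hv)
  refine ⟨key (b + j) i (by omega) (by omega) (by omega) _ _ (by push_cast; ring) rfl,
    key (b + j) (i + 1) (by omega) (by omega) (by omega) _ _ (by push_cast; ring)
      (by push_cast; ring),
    key (b + j + 1) i (by omega) (by omega) (by omega) _ _ (by push_cast; ring) rfl,
    key (b + j) (i + 2) (by omega) (by omega) (by omega) _ _ (by push_cast; ring)
      (by push_cast; ring),
    key (b + j + 2) i (by omega) (by omega) (by omega) _ _ (by push_cast; ring) rfl⟩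

theorem TwoArcs.fat (hn : 2 ≤ n) {ℓ : ZMod n} {a b c : ℕ} (h : TwoArcs lo up X ℓ a b c)
    (h' : a ≠ 1 ∧ c ≠ 1 ∧ b ≠ a + 1 ∧ b + c + 1 ≠ n) : Fat X := by
  obtain ⟨ha, hab, hc, hbc, rfl, -, -⟩ := h
  refine (far_arcs (by omega) (by omega)).fat_union ?_ ?_ <;>
  · refine fat_of_brk_le_one (brk_arc_le _ _) ?_ ?_ hn <;> rw [card_arc] <;> omega

theorem TwoArcs.of_fat (hn : 2 ≤ n) {ℓ : ZMod n} {a b c : ℕ} (h : TwoArcs lo up X ℓ a b c)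
    (hX : Fat X) : 2 ≤ a ∧ 2 ≤ c ∧ a + 2 ≤ b ∧ b + c + 2 ≤ n := by
  obtain ⟨ha, hab, hc, hbc, rfl, -, -⟩ := h; have hin : ∀ i : ℕ, i < a ∨ (b ≤ i ∧ i < b + c) →
      ℓ + i ∈ arc ℓ a ∪ arc (ℓ + b) c := fun i hi => by
    rw [mem_union, mem_arc, mem_arc]
    rcases hi with hi | hi
    · exact Or.inl ⟨i, hi, rfl⟩
    · exact Or.inr ⟨i - b, by omega, by rw [Nat.cast_sub hi.1]; ring⟩
  have hout : ∀ i : ℕ, i < n → a ≤ i → (i < b ∨ b + c ≤ i) → ℓ + i ∉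
      arc ℓ a ∪ arc (ℓ + b) c := fun i hi ha hb =>
    index_notMem_union ha hb (by omega) hi
  have hpred : ∀ i : ℕ, 0 < i → ℓ + i - 1 = ℓ + ((i - 1 : ℕ) : ZMod n) := fun i hi => by
    rw [Nat.cast_sub hi]; push_cast; ring
  have hsucc : ∀ i : ℕ, ℓ + i + 1 = ℓ + ((i + 1 : ℕ) : ZMod n) := fun i => by
    push_cast; ring
  have hlast : ℓ - 1 ∉ arc ℓ a ∪ arc (ℓ + b) c := by
    rw [← sub_one_eq_index]; exact hout _ (by omega) (by omega) (Or.inr (by omega))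
  have h0 := hin 0 (Or.inl ha); refine ⟨?_, ?_, ?_, ?_⟩
  · by_contra hlt
    have := hX.1 _ h0; have h2 := hout 1 (by omega) (by omega) (by omega)
    rw [nb, Nat.cast_zero, add_zero, if_neg hlast, if_neg (by rwa [← Nat.cast_one])] at this; omega
  · by_contra hlt
    have := hX.1 _ (hin b (Or.inr (by omega)))
    rw [nb, hpred b (by omega), hsucc, if_neg (hout _ (by omega) (by omega) (by omega)),
      if_neg (hout _ (by omega) (by omega) (by omega))] at this; omega
  · by_contra hlt
    have := hX.2 _ (hout a (by omega) le_rfl (by omega))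
    rw [nb_eq_two_iff.2 ⟨by rw [hpred a ha]; exact hin _ (by omega),
      by rw [hsucc]; exact hin _ (by omega)⟩] at this; omega
  · by_contra hlt
    have := hX.2 _ hlast
    rw [nb_eq_two_iff.2 ⟨?_, by rw [Nat.cast_zero, add_zero] at h0; rwa [sub_add_cancel]⟩] at this
    · omega
    · have := hin (n - 1 - 1) (by omega); rwa [← hpred _ (by omega), sub_one_eq_index] at this

end ColumnPaths

/-! ### Column moves of configurations -/

section Slots

/-- The configurations `f X` differ only in the content `X` of the column `x`, and the number of
runs of `X` determines the energy as long as `X` is between `lo` and `up`. -/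
structure Slot (N₀ : ℕ) (x : ZMod K) (lo up : Finset (ZMod L)) (e : ℕ)
    (f : Finset (ZMod L) → Sites K L) : Prop where
  col : ∀ X, col (f X) x = X
  mv : ∀ X y y', mv (f X) (x, y) (x, y') = f (insert y' (X.erase y))
  energy : ∀ X, lo ⊆ X → X ⊆ up → ∀ η : Config K L N₀, η.1 = f X →
    energy η = H₀ L N₀ + (e + brk X : ℕ)

theorem slot_left {k : ZMod K} {a : ℕ} {W₁ W₂ W₃ : Finset (ZMod L)}
    (ha : 1 ≤ a) (haK : a + 6 ≤ K) (h12 : W₂ ⊆ W₁) (h23 : W₃ ⊆ W₂) :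
    Slot N₀ (k - 1) ∅ univ (brk W₁ + brk W₂ + brk W₃) fun X => mk k a X W₁ W₂ W₃ where
  col X := col_mk_left (by omega)
  mv X y y' := by rw [Kawasaki.mv, erase_mk_left (by omega), insert_mk_left]
  energy X _ _ η hη := by rw [energy_mk hη h12 h23 ha haK]; push_cast; ring

theorem slot_one {k : ZMod K} {a : ℕ} {Z W₂ W₃ : Finset (ZMod L)}
    (ha : 1 ≤ a) (haK : a + 6 ≤ K) (h23 : W₃ ⊆ W₂) :
    Slot N₀ (k + (a : ZMod K)) W₂ univ (brk Z + brk W₂ + brk W₃) fun X => mk k a Z X W₂ W₃ where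
  col X := col_mk_one (by omega)
  mv X y y' := by rw [Kawasaki.mv, erase_mk_one, insert_mk_one]
  energy X h _ η hη := by rw [energy_mk hη h h23 ha haK]; push_cast; ring

theorem slot_two {k : ZMod K} {a : ℕ} {Z W₁ W₃ : Finset (ZMod L)}
    (ha : 1 ≤ a := by omega) (haK : a + 6 ≤ K := by omega) :
    Slot N₀ (k + (a : ZMod K) + 1) W₃ W₁ (brk Z + brk W₁ + brk W₃) fun X => mk k a Z W₁ X W₃ where
  col X := col_mk_two (by omega)
  mv X y y' := by rw [Kawasaki.mv, erase_mk_two, insert_mk_two]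
  energy X h h' η hη := by rw [energy_mk hη h' h ha haK]; push_cast; ring

variable {x : ZMod K} {lo up : Finset (ZMod L)} {e q : ℕ}
  {f : Finset (ZMod L) → Sites K L} {X X' : Finset (ZMod L)}

theorem Slot.lift (hs : Slot N₀ x lo up e f) {R : Config K L N₀ → Config K L N₀ → Prop}
    (hR : ∀ X X' η ξ, ColStep lo up q X X' → η.1 = f X → ξ.1 = f X' →
      (∃ y y', IsExchange (x, y) (x, y') η ξ) → R η ξ)
    (h : ColPath lo up q X X') {η : Config K L N₀} (hη : η.1 = f X) :
    ∃ ξ : Config K L N₀, ξ.1 = f X' ∧ ReflTransGen R η ξ := by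
  have ⟨p1, p2, p3, p4, p5⟩ := hp
  induction h with
  | refl => exact ⟨η, hη, .refl⟩
  | @tail Y Y' _ hstep ih =>
    obtain ⟨ζ, hζ, hr⟩ := ih; obtain ⟨⟨y, s, hsgn, hy, hy', rfl⟩, -, -⟩ := id hstep
    have m1 : (x, y) ∈ ζ.1 := by rw [hζ, ← mem_col, hs.col]; exact hy
    have m2 : (x, y + s) ∉ ζ.1 := by rw [hζ, ← mem_col, hs.col]; exact hy'
    let ξ : Config K L N₀ := ⟨Kawasaki.mv ζ.1 (x, y) (x, y + s), by rw [card_mv m1 m2, ζ.2]⟩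
    have hξ : ξ.1 = f (insert (y + s) (Y.erase y)) := by rw [← hs.mv, ← hζ]
    refine ⟨ξ, hξ, hr.tail (hR _ _ _ _ hstep hζ hξ ⟨y, y + s, isExchange_iff.2 ⟨?_, Or.inl ⟨m1, m2, rfl⟩⟩⟩)⟩
    rw [torus_adj]
    rcases hsgn with rfl | rfl
    · exact Or.inl ⟨rfl, Or.inl rfl⟩
    · exact Or.inl ⟨rfl, Or.inr (sub_eq_add_neg _ _).symm⟩

/-- A move inside the column `x` at height at most `c`. -/
def ColumnJump (x : ZMod K) (c : ℤ) (η ξ : Config K L N₀) : Prop :=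
  (∃ y y', IsExchange (x, y) (x, y') η ξ) ∧ energy η ≤ c ∧ energy ξ ≤ c

theorem ColumnJump.linked {c : ℤ} {η ξ : Config K L N₀} (hη : energy η ≤ c)
    (h : ReflTransGen (ColumnJump x c) η ξ) : Linked (graph K L N₀) energy c η ξ := by
  induction h with
  | refl => exact .refl hη
  | tail _ h ih =>
    obtain ⟨⟨y, y', h1⟩, h2, h3⟩ := h; exact ih.trans (.of_adj ⟨_, _, h1⟩ h2 h3)

theorem Slot.columnJump (hs : Slot N₀ x lo up e f) {h : ℕ} (hq : e + q ≤ h)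
    (hX : ColPath lo up q X X') {η : Config K L N₀} (hη : η.1 = f X) :
    ∃ ξ : Config K L N₀, ξ.1 = f X' ∧ ReflTransGen (ColumnJump x (H₀ L N₀ + h)) η ξ := by
  refine hs.lift (fun Y Y' ζ ξ hstep hζ hξ hex => ⟨hex, ?_, ?_⟩) hX hη
  · obtain ⟨-, ⟨h1, h2, h3⟩, -⟩ := hstep; rw [hs.energy _ h1 h2 _ hζ]; omega
  · obtain ⟨-, -, h1, h2, h3⟩ := hstep; rw [hs.energy _ h1 h2 _ hξ]; omega

end Slots

/-! ### Configurations that do not belong to stable plateaux -/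

theorem mem_strip_of_partialCols_eq_empty {η : Config K L N₀}
    (h : partialCols η.1 = ∅) (hle : energy η ≤ H₀ L N₀ + 3) : ∃ k, η ∈ strip k := by
  have ⟨p1, p2, p3, p4, p5⟩ := hp
  obtain ⟨k, hk⟩ := exists_strip η.2 (fun x => by
    have := eq_empty_iff_forall_notMem.1 h x
    simp only [partialCols, mem_filter, mem_univ, true_and] at this; by_contra hne
    exact this (not_or.1 hne)) (by rw [energy_eq'] at hle; omega); exact ⟨k, mem_strip.2 hk⟩

theorem plateau_energy_le {P : Set (Config K L N₀)} (hP : P ∈ plateaux K L N₀)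
    {η : Config K L N₀} (hη : η ∈ P) : energy η ≤ H₀ L N₀ + 3 := by
  obtain ⟨k, hk⟩ := mem_reachable.1 (hP.2 hη); have hle := hk.left; by_contra hlt
  have e : energy η = H₀ L N₀ + 4 := by omega
  rw [← e] at hk; have := hP.1.energy_eq_of_linked hη hk
  rw [energy_strip (stripConfig_mem k)] at this; omega

theorem partialCols_ne_empty_of_linked {P : Set (Config K L N₀)}
    (hP : P ∈ plateaux K L N₀) {η ξ : Config K L N₀} (hη : η ∈ P) (he : energy η = H₀ L N₀ + 3)
    (h : Linked (graph K L N₀) energy (H₀ L N₀ + 3) η ξ) : partialCols ξ.1 ≠ ∅ := by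
  intro hξ; obtain ⟨k, hk⟩ := mem_strip_of_partialCols_eq_empty hξ h.right; rw [← he] at h
  have := hP.1.energy_eq_of_linked hη h; rw [energy_strip hk] at this; omega

theorem brk_col_le_one {A : Sites K L} (h : cB A ≤ (partialCols A).card)
    (x : ZMod K) : brk (col A x) ≤ 1 := by
  by_contra hlt
  have hx : x ∈ partialCols A := by
    simp only [partialCols, mem_filter, mem_univ, true_and]
    refine ⟨fun e => ?_, fun e => ?_⟩ <;> rw [e] at hlt
    · rw [brk_empty] at hlt; omega
    · rw [brk_univ] at hlt; omega
  have h1 : ∑ _u ∈ partialCols A, 1 < ∑ u ∈ partialCols A, brk (col A u) :=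
    sum_lt_sum (fun u hu => by
      simp only [partialCols, mem_filter, mem_univ, true_and] at hu
      exact one_le_brk hu.1 hu.2) ⟨x, hx, by omega⟩; have h2 := sum_brk_le_cB A (partialCols A)
  rw [sum_const, smul_eq_mul, mul_one] at h1; omega

theorem hB_insert (hK : 2 ≤ K) {A : Sites K L} {x : ZMod K} {y : ZMod L}
    (h : (x, y) ∉ A) : hB (insert (x, y) A) + nb (row A y) x = hB A + 1 := by
  have := sum_eq_of_one (f := fun v => brk (row (insert (x, y) A) v))
    (g := fun v => brk (row A v)) y fun v hv => by rw [row_insert_of_ne A x hv]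
  have h2 := brk_insert hK (W := row A y) (y := x) (by rwa [mem_row])
  simp only [← hB_eq_sum_row, row_insert_self] at this; omega

theorem hB_erase (hK : 2 ≤ K) {A : Sites K L} {x : ZMod K} {y : ZMod L}
    (h : (x, y) ∈ A) : hB (A.erase (x, y)) + 1 = hB A + nb (row A y) x := by
  have := sum_eq_of_one (f := fun v => brk (row (A.erase (x, y)) v))
    (g := fun v => brk (row A v)) y fun v hv => by rw [row_erase_of_ne A x hv]
  have h2 := brk_erase hK (W := row A y) (y := x) (by rwa [mem_row])
  simp only [← hB_eq_sum_row, row_erase_self] at this; omega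

theorem cB_insert (A : Sites K L) (x : ZMod K) (y : ZMod L) :
    cB (insert (x, y) A) + brk (col A x) = cB A + brk (insert y (col A x)) := by
  have := sum_eq_of_one (f := fun v => brk (col (insert (x, y) A) v))
    (g := fun v => brk (col A v)) x fun v hv => by rw [col_insert_of_ne A y hv]
  rwa [col_insert_self] at this

theorem cB_erase (A : Sites K L) (x : ZMod K) (y : ZMod L) :
    cB (A.erase (x, y)) + brk (col A x) = cB A + brk ((col A x).erase y) := by
  have := sum_eq_of_one (f := fun v => brk (col (A.erase (x, y)) v))
    (g := fun v => brk (col A v)) x fun v hv => by rw [col_erase_of_ne A y hv]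
  rwa [col_erase_self] at this

/-- If there is one horizontal bond more than in the unimodal case, then exactly one particle
overhangs. -/
theorem exists_defect {A : Sites K L} {z u : ZMod K} (hz : col A z = ∅)
    (hf : col A u = univ) (hh : hB A = L + 1) :
    ∃ x y s, (s = 1 ∨ s = -1) ∧ col A (x + s) \ col A x = {y} ∧ col A x ⊆ col A (x - s) ∧
      col A (x + s + s) ⊆ col A (x + s) := by
  classical
  obtain ⟨f, hfK, rfl⟩ := exists_index z u
  rw [hB_frame A hz hf hfK] at hh
  set g₁ : ℕ → ℕ := fun j => (col A (z + j) \ col A (z + ((j + 1 : ℕ) : ZMod K))).card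
  set g₂ : ℕ → ℕ := fun j => (col A (z + ((j + 1 : ℕ) : ZMod K)) \ col A (z + j)).card
  have hK0 : col A (z + ((K : ℕ) : ZMod K)) = ∅ := by rw [ZMod.natCast_self, add_zero, hz]
  have hz0 : col A (z + ((0 : ℕ) : ZMod K)) = ∅ := by rw [Nat.cast_zero, add_zero, hz]
  have one : ∀ (S : Finset ℕ) (g : ℕ → ℕ), ∑ j ∈ S, g j = 1 →
      ∃ j ∈ S, g j = 1 ∧ ∀ i ∈ S, i ≠ j → g i = 0 := by
    intro S g h
    obtain ⟨j, hj, hj0⟩ := exists_ne_zero_of_sum_ne_zero (by omega : ∑ j ∈ S, g j ≠ 0)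
    rw [← add_sum_erase _ _ hj] at h
    refine ⟨j, hj, by omega, fun i hi hij => ?_⟩
    exact sum_eq_zero_iff.1 (by omega : ∑ i ∈ S.erase j, g i = 0) i (mem_erase.2 ⟨hij, hi⟩)
  have sub : ∀ B C : Finset (ZMod L), (B \ C).card = 0 → B ⊆ C := fun B C h =>
    sdiff_eq_empty_iff_subset.1 (card_eq_zero.1 h)
  have hcases : (∑ j ∈ range f, g₁ j = 1 ∧ ∑ j ∈ Ico f K, g₂ j = 0) ∨
      (∑ j ∈ range f, g₁ j = 0 ∧ ∑ j ∈ Ico f K, g₂ j = 1) := by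
    change L + ∑ j ∈ range f, g₁ j + ∑ j ∈ Ico f K, g₂ j = L + 1 at hh
    omega
  rcases hcases with ⟨h1, h2⟩ | ⟨h1, h2⟩
  · obtain ⟨j, hj, hj1, hj'⟩ := one _ _ h1
    rw [mem_range] at hj
    obtain ⟨y, hy⟩ := card_eq_one.1 hj1
    have e1 : z + ((j + 1 : ℕ) : ZMod K) + -1 = z + j := by push_cast; ring
    have e2 : z + ((j + 1 : ℕ) : ZMod K) - -1 = z + ((j + 1 + 1 : ℕ) : ZMod K) := by push_cast; ring
    refine ⟨z + ((j + 1 : ℕ) : ZMod K), y, -1, Or.inr rfl, by rw [e1, hy], ?_, ?_⟩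
    · rw [e2]
      by_cases hjf : j + 1 < f
      · exact sub _ _ (hj' _ (mem_range.2 hjf) (by omega))
      · rw [show j + 1 = f by omega, hf, sdiff_eq_empty_iff_subset.2 (subset_univ _)] at hy
        exact absurd hy.symm (singleton_ne_empty y)
    · rw [e1]
      rcases Nat.eq_zero_or_pos j with rfl | hj0
      · rw [hz0, empty_sdiff] at hy
        exact absurd hy.symm (singleton_ne_empty y)
      · have := sub _ _ (hj' (j - 1) (mem_range.2 (by omega)) (by omega))
        rwa [show j - 1 + 1 = j by omega, Nat.cast_sub hj0, Nat.cast_one, ← add_sub_assoc,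
          sub_eq_add_neg] at this
  · obtain ⟨j, hj, hj1, hj'⟩ := one _ _ h2
    rw [mem_Ico] at hj
    obtain ⟨y, hy⟩ := card_eq_one.1 hj1
    have e1 : z + j + 1 = z + ((j + 1 : ℕ) : ZMod K) := by push_cast; ring
    have e2 : z + ((j + 1 : ℕ) : ZMod K) + 1 = z + ((j + 1 + 1 : ℕ) : ZMod K) := by push_cast; ring
    refine ⟨z + j, y, 1, Or.inl rfl, by rw [e1, hy], ?_, ?_⟩
    · rcases eq_or_lt_of_le hj.1 with rfl | hlt
      · rw [hf, sdiff_eq_empty_iff_subset.2 (subset_univ _)] at hy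
        exact absurd hy.symm (singleton_ne_empty y)
      · have := sub _ _ (hj' (j - 1) (mem_Ico.2 (by omega)) (by omega))
        rwa [show j - 1 + 1 = j by omega, Nat.cast_sub (by omega), Nat.cast_one,
          ← add_sub_assoc] at this
    · rw [e1, e2]
      by_cases hjK : j + 1 < K
      · exact sub _ _ (hj' _ (mem_Ico.2 (by omega)) (by omega))
      · rw [show j + 1 = K by omega, hK0, empty_sdiff] at hy
        exact absurd hy.symm (singleton_ne_empty y)

theorem hB_ne_add_one_of_mem_plateau {P : Set (Config K L N₀)}
    (hP : P ∈ plateaux K L N₀) {η : Config K L N₀} (hη : η ∈ P) (hq : (partialCols η.1).card = 2)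
    (hc : cB η.1 = 2) : hB η.1 ≠ L + 1 := by
  classical
  intro hh
  have ⟨p1, p2, p3, p4, p5⟩ := hp
  have he : energy η = H₀ L N₀ + 3 := by rw [energy_eq']; omega
  have hbrk := brk_col_le_one (hc.trans hq.symm).le
  have hE := two_le_card_emptyCols η.2 (by omega)
  obtain ⟨u, hu⟩ := (tame_of_reachable (hP.2 hη)).1
  obtain ⟨z, hz⟩ := card_pos.1 (by omega : 0 < (univ.filter fun x => col η.1 x = ∅).card)
  obtain ⟨x, y, s, hs, hy, hU, hV⟩ := exists_defect (mem_filter.1 hz).2 hu hh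
  have hs0 : x + s ≠ x := by simpa using sign_ne_zero (n := K) hs
  have hs1 : x + s + s ≠ x + s := by simpa using sign_ne_zero (n := K) hs
  have hs2 : x + s + s ≠ x := by
    rw [add_assoc]; simpa using two_sign_ne_zero (n := K) hs
  have hs3 : x - s ≠ x := by simpa using sign_ne_zero (n := K) hs
  have hs4 : x - s ≠ x + s := fun e => hs2 (by rw [← e]; ring)
  have hsize : ∀ {p p'}, p ∈ partialCols η.1 → p' ∈ partialCols η.1 → p ≠ p' →
      (col η.1 p).card + (col η.1 p').card = L ∧
        ∀ w, w ≠ p → w ≠ p' → w ∉ partialCols η.1 := by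
    intro p p' h h' hne
    have hpair : partialCols η.1 = {p, p'} := (eq_of_subset_of_card_le
      (by intro w hw
          rcases mem_insert.1 hw with rfl | hw
          · exact h
          · rwa [mem_singleton.1 hw]) (by rw [hq, card_pair hne])).symm
    have h1 := card_eq_full_add η.1
    have h2 := (fullCols_bounds η.2).2.2 (by omega)
    rw [η.2, hpair, sum_pair hne] at h1
    refine ⟨?_, fun w h1 h2 hw => ?_⟩
    · have h3 : L * N₀ = L * ((fullCols η.1).card + 1) := congrArg (L * ·) (by omega)
      rw [mul_add, mul_comm L (fullCols η.1).card] at h3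
      omega
    · rw [hpair, mem_insert, mem_singleton] at hw
      exact hw.elim h1 h2
  have htriv : ∀ w, w ∉ partialCols η.1 → col η.1 w = ∅ ∨ col η.1 w = univ := by
    intro w hw
    simp only [partialCols, mem_filter, mem_univ, true_and] at hw
    by_contra hne
    exact hw (not_or.1 hne)
  have hy1 : y ∈ col η.1 (x + s) ∧ y ∉ col η.1 x := by
    rw [← mem_sdiff, hy]; exact mem_singleton_self _
  have hsub : (col η.1 (x + s)).erase y ⊆ col η.1 x := by
    intro v hv
    obtain ⟨hv1, hv2⟩ := mem_erase.1 hv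
    by_contra hv3
    have : v ∈ col η.1 (x + s) \ col η.1 x := mem_sdiff.2 ⟨hv2, hv3⟩
    rw [hy] at this
    exact hv1 (mem_singleton.1 this)
  have hnot : ∀ {ξ : Config K L N₀}, Linked (graph K L N₀) energy (H₀ L N₀ + 3) η ξ →
      partialCols ξ.1 ≠ ∅ := partialCols_ne_empty_of_linked hP hη he
  by_cases hW : col η.1 x = ∅
  · have hW' : col η.1 (x + s) = {y} := by rw [← hy, hW, sdiff_empty]
    have hm : x + s ∈ partialCols η.1 := by
      rw [mem_partialCols, hW', card_singleton]; omega
    obtain ⟨v, hv, hvx⟩ := exists_mem_ne (by omega : 1 < (partialCols η.1).card) (x + s)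
    obtain ⟨hcard, hothers⟩ := hsize hm hv hvx.symm
    rw [hW', card_singleton] at hcard
    have hV' : y ∉ col η.1 (x + s + s) := by
      intro hyV
      have e : col η.1 (x + s + s) = {y} := by
        rw [hW'] at hV
        exact Subset.antisymm hV (singleton_subset_iff.2 hyV)
      have := (hsize (p' := x + s + s) hm (by
        rw [mem_partialCols, e, card_singleton]; omega) hs1.symm).1
      rw [hW', e, card_singleton] at this
      omega
    have hmem : (x + s, y) ∈ η.1 := mem_col.1 hy1.1
    set B := η.1.erase (x + s, y) with hB
    have hηB : η.1 = insert (x + s, y) B := (insert_erase hmem).symm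
    have h1 := hB_erase (by omega : 2 ≤ K) hmem
    rw [nb_eq_of_sign hs, if_neg (by rwa [mem_row, ← mem_col]), if_neg (by
      rw [mem_row, ← mem_col, add_sub_cancel_right]; exact hy1.2), ← hB] at h1
    have h2 := cB_erase η.1 (x + s) y
    rw [hW', erase_singleton, brk_empty, ← hW', ← hB] at h2
    have h3 := one_le_brk (W := col η.1 (x + s)) (by rw [hW']; exact singleton_ne_empty y)
      (by intro e; have := mem_partialCols.1 hm; rw [e, card_univ, ZMod.card] at this; omega)
    obtain ⟨z, f, hUni⟩ := exists_uni_of_two_empty (A := B) (hE.trans (card_le_card (by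
      intro w hw
      rw [mem_filter] at hw ⊢
      refine ⟨hw.1, ?_⟩
      rw [hB, col_erase_of_ne _ _ (by rintro rfl; rw [hW'] at hw; exact singleton_ne_empty y hw.2), hw.2])))
      ⟨u, by rw [hB, col_erase_of_ne _ _ (by
        rintro rfl; rw [hu] at hW'
        have := congrArg card hW'
        rw [card_univ, ZMod.card, card_singleton] at this; omega), hu]⟩ (by omega)
    obtain ⟨t, ht⟩ : ∃ t, t ∉ col η.1 v := by
      by_contra hne
      have : col η.1 v = univ := eq_univ_iff_forall.2 fun t => by
        by_contra ht; exact hne ⟨t, ht⟩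
      rw [this, card_univ, ZMod.card] at hcard
      omega
    have htB : (v, t) ∉ B := fun h => ht (mem_col.2 (mem_of_mem_erase h))
    let ξ : Config K L N₀ := ⟨insert (v, t) B, by
      rw [card_insert_of_notMem htB, ← η.2, hηB,
        card_insert_of_notMem (notMem_erase _ _)]⟩
    refine hnot (linked_insert hUni (h := 3) (by omega) (notMem_erase _ _) htB hηB
      (ξ := ξ) rfl) (eq_empty_iff_forall_notMem.2 fun w hw => ?_)
    rw [mem_partialCols, show ξ.1 = insert (v, t) B from rfl] at hw
    by_cases h1 : w = v
    · rw [h1, col_insert_self, hB, col_erase_of_ne _ _ hvx, card_insert_of_notMem ht] at hw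
      omega
    rw [col_insert_of_ne _ _ h1, hB] at hw
    by_cases h2 : w = x + s
    · rw [h2, col_erase_self, hW', erase_singleton, card_empty] at hw
      omega
    rw [col_erase_of_ne _ _ h2] at hw
    exact hothers w h2 h1 (mem_partialCols.2 hw)
  have hlt : (col η.1 x).card < L := card_lt_of_ne_univ fun e => hy1.2 (e ▸ mem_univ y)
  have hm : x ∈ partialCols η.1 := mem_partialCols.2
    ⟨card_pos.2 (nonempty_iff_ne_empty.2 hW), hlt⟩
  by_cases hW' : col η.1 (x + s) = univ
  · have hW2 : (col η.1 x).card + 1 = L := by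
      have h1 := card_le_card hsub
      rw [hW', card_erase_of_mem (mem_univ y), card_univ, ZMod.card] at h1
      omega
    obtain ⟨v, hv, hvx⟩ := exists_mem_ne (by omega : 1 < (partialCols η.1).card) x
    obtain ⟨hcard, hothers⟩ := hsize hm hv hvx.symm
    obtain ⟨t, ht⟩ := card_eq_one.1 (by omega : (col η.1 v).card = 1)
    have hyU : y ∈ col η.1 (x - s) := by
      by_contra hyU
      have h1 := card_le_card hU
      have h2 : (col η.1 (x - s)).card < L :=
        card_lt_of_ne_univ fun e => hyU (e ▸ mem_univ y)
      have := (hsize hm (p' := x - s) (mem_partialCols.2 (by omega)) hs3.symm).1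
      omega
    have hmem : (x, y) ∉ η.1 := fun h => hy1.2 (mem_col.2 h)
    set B := insert (x, y) η.1 with hB
    have hηB : η.1 = B.erase (x, y) := (erase_insert hmem).symm
    have h1 := hB_insert (by omega : 2 ≤ K) hmem
    rw [nb_eq_of_sign hs, if_pos (by rw [mem_row, ← mem_col]; exact hy1.1),
      if_pos (by rwa [mem_row, ← mem_col]), ← hB] at h1
    have hins : insert y (col η.1 x) = univ := by
      rw [← card_eq_iff_eq_univ, card_insert_of_notMem hy1.2, ZMod.card, hW2]
    have h2 := cB_insert η.1 x y
    rw [hins, brk_univ, ← hB] at h2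
    have h3 := one_le_brk hW (fun e => hy1.2 (e ▸ mem_univ y))
    obtain ⟨z, f, hUni⟩ := exists_uni_of_two_empty (A := B) (hE.trans (card_le_card (by
      intro w hw
      rw [mem_filter] at hw ⊢
      refine ⟨hw.1, ?_⟩
      rw [hB, col_insert_of_ne _ _ (by rintro rfl; exact hW hw.2), hw.2])))
      ⟨x, by rw [hB, col_insert_self, hins]⟩ (by omega)
    have htB : (v, t) ∈ B := mem_insert_of_mem (mem_col.1 (by rw [ht]; simp))
    let ξ : Config K L N₀ := ⟨B.erase (v, t), by
      rw [card_erase_of_mem htB, ← η.2, hB, card_insert_of_notMem hmem,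
        Nat.add_sub_cancel]⟩
    refine hnot (linked_erase hUni (h := 3) (by omega) (mem_insert_self _ _) htB hηB
      (ξ := ξ) rfl) (eq_empty_iff_forall_notMem.2 fun w hw => ?_)
    rw [mem_partialCols, show ξ.1 = B.erase (v, t) from rfl] at hw
    by_cases h1 : w = v
    · rw [h1, col_erase_self, hB, col_insert_of_ne _ _ hvx, ht, erase_singleton,
        card_empty] at hw
      omega
    rw [col_erase_of_ne _ _ h1, hB] at hw
    by_cases h2 : w = x
    · rw [h2, col_insert_self, hins, card_univ, ZMod.card] at hw
      omega
    rw [col_insert_of_ne _ _ h2] at hw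
    exact hothers w h2 h1 (mem_partialCols.2 hw)
  · have hpos : 0 < (col η.1 (x + s)).card := card_pos.2 ⟨y, hy1.1⟩
    have hm' : x + s ∈ partialCols η.1 := mem_partialCols.2 ⟨hpos, card_lt_of_ne_univ hW'⟩
    obtain ⟨hcard, hothers⟩ := hsize hm hm' hs0.symm
    have hU' : col η.1 (x - s) = univ := by
      refine (htriv _ (hothers _ hs3 hs4)).resolve_left fun e => hW ?_
      rw [e] at hU
      exact subset_empty.1 hU
    have hV' : col η.1 (x + s + s) = ∅ := by
      refine (htriv _ (hothers _ hs2 hs1)).resolve_right fun e => hW' ?_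
      rw [e] at hV
      exact univ_subset_iff.1 hV
    have m1 : (x + s, y) ∈ η.1 := mem_col.1 hy1.1
    have m2 : (x, y) ∉ η.1 := fun h => hy1.2 (mem_col.2 h)
    let ξ : Config K L N₀ := ⟨mv η.1 (x + s, y) (x, y), by rw [card_mv m1 m2, η.2]⟩
    have hadj : (graph K L N₀).Adj η ξ := by
      refine graph_adj.2 ⟨_, _, ?_, m1, m2, rfl⟩
      rw [torus_adj]
      refine Or.inr ⟨rfl, ?_⟩
      rcases hs with rfl | rfl
      · exact Or.inr (add_sub_cancel_right _ _).symm
      · exact Or.inl (neg_add_cancel_right _ _).symm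
    have hb := brk_move (n := K) (W := row η.1 y) (s := -s) (y := x + s)
      (by rcases hs with rfl | rfl <;> simp) (by rwa [mem_row]) (by rwa [add_neg_cancel_right, mem_row])
    rw [add_neg_cancel_right, ← sub_eq_add_neg, sub_neg_eq_add, if_pos (by
      rw [mem_row, ← mem_col, hU']; exact mem_univ _), if_neg (by
      rw [mem_row, ← mem_col, hV']; exact notMem_empty _)] at hb
    have hhξ := hB_mv_horizontal η.1 (x + s) x y
    have hcξ := cB_mv_horizontal η.1 hs0 y
    have b0 := hbrk x
    have b0' := hbrk (x + s)
    have b1 := one_le_brk hW (fun e => hy1.2 (e ▸ mem_univ y))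
    have b1' := one_le_brk (nonempty_iff_ne_empty.1 ⟨y, hy1.1⟩) hW'
    have hle : brk ((col η.1 (x + s)).erase y) + brk (insert y (col η.1 x)) ≤ 2 := by
      by_cases hone : (col η.1 (x + s)).card = 1
      · have e1 : (col η.1 (x + s)).erase y = ∅ := by
          rw [← card_eq_zero, card_erase_of_mem hy1.1, hone]
        have e2 : insert y (col η.1 x) = univ := by
          rw [← card_eq_iff_eq_univ, card_insert_of_notMem hy1.2, ZMod.card]
          omega
        rw [e1, e2, brk_empty, brk_univ]
        omega
      · have hnb : 1 ≤ nb (col η.1 (x + s)) y := by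
          by_contra h0
          have := eq_singleton_of_nb_eq_zero (by omega) hy1.1 (by omega) b0'
          rw [this] at hone
          exact hone (card_singleton y)
        have hmono : nb (col η.1 (x + s)) y ≤ nb (col η.1 x) y := by
          rw [← nb_erase (by omega)]
          have h1 := @hsub (y - 1)
          have h2 := @hsub (y + 1)
          rw [nb, nb]
          split_ifs <;> simp_all
        have hnb2 : nb (col η.1 (x + s)) y ≤ 1 := by
          by_contra h2
          have := nb_le_two (col η.1 x) y
          have := card_add_one_of_nb_eq_two (by omega) hy1.2 (by omega) b0
          omega
        have h1 := brk_insert (n := L) (by omega) hy1.2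
        have h2 := brk_erase (n := L) (by omega) hy1.1
        omega
    have hlow : energy ξ ≤ H₀ L N₀ + 2 := by
      rw [energy_eq', show ξ.1 = mv η.1 (x + s, y) (x, y) from rfl]
      omega
    have := hP.1.energy_eq_of_linked hη (.of_adj hadj le_rfl (by omega))
    omega

/-! ### Columns with two runs -/

section TwoRuns

theorem colPath_between {n q : ℕ} [NeZero n] {lo up X X' : Finset (ZMod n)}
    (h : ColPath lo up q X X') (hlo : lo ⊆ X) (hup : X ⊆ up) :
    lo ⊆ X' ∧ X' ⊆ up ∧ X'.card = X.card := by
  induction h with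
  | refl => exact ⟨hlo, hup, rfl⟩
  | tail _ h ih =>
    obtain ⟨⟨y, s, -, hy, hy', rfl⟩, -, h⟩ := h; refine ⟨h.1, h.2.1, ?_⟩
    rw [card_insert_of_notMem (fun hc => hy' (mem_of_mem_erase hc)), card_erase_add_one hy, ih.2.2]

variable {x : ZMod K} {lo up : Finset (ZMod L)} {e : ℕ}
  {f : Finset (ZMod L) → Sites K L} {X : Finset (ZMod L)}

/-- A column with two runs one of which can join the other one at height `H₀ + e + 3`. -/
theorem Slot.exists_jump (hs : Slot N₀ x lo up e f) (hX : brk X = 2)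
    (hlo : lo ⊆ X) (hup : X ⊆ up) (h1 : brk lo ≤ 1) (h2 : brk up ≤ 1)
    (h : lo = ∅ ∨ up = univ) {η : Config K L N₀} (hη : η.1 = f X) {c : ℕ} (hc : e + 3 ≤ c) :
    ∃ (ξ : Config K L N₀) (X' : Finset (ZMod L)), ξ.1 = f X' ∧ brk X' ≤ 1 ∧
      (lo ⊆ X' ∧ X' ⊆ up ∧ X'.card = X.card) ∧
      ReflTransGen (ColumnJump x (H₀ L N₀ + c)) η ξ := by
  have hL := hp.1; obtain ⟨ℓ, a, b, c, ht⟩ := exists_twoArcs hX hlo hup h1 h2 h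
  have hpath := colPath_merge (n := L) (by omega) ht.lt ht.lt'.le ht.lo ht.up; rw [← ht.eq] at hpath
  obtain ⟨ξ, hξ, hr⟩ := hs.columnJump hc hpath hη
  exact ⟨ξ, _, hξ, brk_arc_le _ _, colPath_between hpath hlo hup, hr⟩

/-- A column with two runs that is not fat can be transformed into an arc at constant energy. -/
theorem Slot.exists_linked_of_not_fat (hs : Slot N₀ x lo up e f)
    (hX : brk X = 2) (hlo : lo ⊆ X) (hup : X ⊆ up) (h1 : brk lo ≤ 1) (h2 : brk up ≤ 1)
    (h : lo = ∅ ∨ up = univ) (hl : lo = ∅ ∨ 2 ≤ lo.card)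
    (hu : up = univ ∨ up.card + 2 ≤ L) (hnf : ¬ Fat X) {η : Config K L N₀}
    (hη : η.1 = f X) :
    ∃ (ξ : Config K L N₀) (X' : Finset (ZMod L)), ξ.1 = f X' ∧ brk X' ≤ 1 ∧
      (lo ⊆ X' ∧ X' ⊆ up ∧ X'.card = X.card) ∧
      Linked (graph K L N₀) Kawasaki.energy (Kawasaki.energy η) η ξ := by
  have hL := hp.1; obtain ⟨ℓ, a, b, c, ht⟩ := exists_twoArcs hX hlo hup h1 h2 h
  obtain ⟨X', hX', hpath⟩ := ht.exists_colPath (by omega) hl hu (by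
    by_contra hne
    exact hnf (ht.fat (by omega) (by omega))); obtain ⟨ξ, hξ, hr⟩ := hs.columnJump le_rfl hpath hη
  refine ⟨ξ, X', hξ, hX', colPath_between hpath hlo hup, ?_⟩; rw [hs.energy X hlo hup η hη, hX]
  refine ColumnJump.linked ?_ hr; rw [hs.energy X hlo hup η hη, hX]

theorem Slot.fat_of_mem_plateau (hs : Slot N₀ x lo up e f)
    (hX : brk X = 2) (hlo : lo ⊆ X) (hup : X ⊆ up) (h1 : brk lo ≤ 1) (h2 : brk up ≤ 1)
    (h : lo = ∅ ∨ up = univ) (hl : lo = ∅ ∨ 2 ≤ lo.card)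
    (hu : up = univ ∨ up.card + 2 ≤ L) {P : Set (Config K L N₀)}
    (hP : P ∈ plateaux K L N₀) {η : Config K L N₀} (hηP : η ∈ P) (hη : η.1 = f X) : Fat X := by
  by_contra hnf
  obtain ⟨ξ, X', hξ, hX', hb, hlink⟩ :=
    hs.exists_linked_of_not_fat hX hlo hup h1 h2 h hl hu hnf hη
  have := hP.1.energy_eq_of_linked hηP hlink
  rw [hs.energy X hlo hup η hη, hs.energy X' hb.1 hb.2.1 ξ hξ] at this; omega

theorem isExchange_symm {p q : ZMod K × ZMod L} {η ξ : Config K L N₀} (h : IsExchange p q η ξ) :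
    IsExchange p q ξ η := by
  refine ⟨h.1, h.2.1.symm, ?_⟩; rw [h.2.2, Set.image_image]; simp

theorem ColumnJump.symm {c : ℤ} {η ξ : Config K L N₀} (h : ReflTransGen (ColumnJump x c) η ξ) :
    ReflTransGen (ColumnJump x c) ξ η := by
  induction h with
  | refl => exact .refl
  | tail _ h ih =>
    obtain ⟨⟨y, y', h1⟩, h2, h3⟩ := h; exact .head ⟨⟨y, y', isExchange_symm h1⟩, h3, h2⟩ ih

theorem ColumnJump.allowed {U : Set (ZMod K × ZMod L)} (hU : ∀ y, (x, y) ∈ U)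
    {η ξ : Config K L N₀} (h : ReflTransGen (ColumnJump x (H₀ L N₀ + (4 : ℕ))) η ξ) :
    ReflTransGen (AllowedJumpIn U) η ξ := by
  refine ReflTransGen.mono ?_ _ _ h
  rintro ζ ζ' ⟨⟨y, y', h1⟩, h2, h3⟩; exact ⟨⟨_, hU y, _, hU y', h1⟩, h2, h3⟩

end TwoRuns

/-! ### The collections `D^k_m` -/

theorem singleton_basin {k : ZMod K} {a : ℕ} {Z W₁ W₂ W₃ : Finset (ZMod L)}
    {η : Config K L N₀} (hη : η.1 = mk k a Z W₁ W₂ W₃) (h12 : W₂ ⊆ W₁) (h23 : W₃ ⊆ W₂)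
    (f0 : Fat Z) (f1 : Fat W₁) (f2 : Fat W₂) (f3 : Fat W₃)
    (h4 : brk Z + brk W₁ + brk W₂ + brk W₃ ≤ 4) (ha : 2 ≤ a := by omega)
    (haK : a + 6 ≤ K := by omega) :
    Basin (graph K L N₀) energy (energy η) {η} := by
  have hU := uni_mk (K := K) (k := k) (Z := Z) (by omega) haK h12 h23 (f := 2) le_rfl
  rw [← hη] at hU; refine hU.basin_singleton (by rw [hη]; exact twoFull_mk ha haK) (fun x => ?_) ?_
  · rw [hη]; exact fat_col_mk f0 f1 f2 f3 x
  · rw [hη, cB_mk]; exact h4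

/-- The two-sided configurations of energy `H₀ + 3` with fat columns. -/
def FatTwoSided (N₀ : ℕ) (k : ZMod K) (m : ℕ) : Set (Config K L N₀) :=
  {η | ∃ Z W : Finset (ZMod L), η.1 = mk k (N₀ - 1) Z W ∅ ∅ ∧ Z.card + m = L ∧ W.card = m ∧
    brk Z + brk W = 3 ∧ Fat Z ∧ Fat W}

theorem proper_of_card {W : Finset (ZMod L)} {m : ℕ} (h : W.card = m) (h0 : 0 < m := by omega)
    (h1 : m < L := by omega) :
    1 ≤ brk W := by
  refine one_le_brk ?_ ?_
  · rintro rfl; rw [card_empty] at h; omega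
  · rintro rfl; rw [card_univ, ZMod.card] at h; omega

theorem mem_bottoms_of_mk {k : ZMod K} {m : ℕ} (hm : m ≤ L)
    {Z W : Finset (ZMod L)} {η : Config K L N₀} (hη : η.1 = mk (k + 1) (N₀ - 1) Z W ∅ ∅)
    (h0 : brk Z ≤ 1) (h1 : brk W ≤ 1) (c0 : Z.card + m = L) (c1 : W.card = m) :
    η ∈ bottoms k m := by
  rw [bottoms_eq]
  exact mem_fam_of_mk hη h0 h1 (by simp [brk_empty]) (by simp [brk_empty]) (empty_subset _)
    (empty_subset _) (by omega) c1 rfl rfl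

/-- A two-sided configuration of energy `H₀ + 3` is connected to the shallow bottoms inside the two
partially filled columns. -/
theorem exists_bottom_jump {k : ZMod K} {m : ℕ} (h1 : 1 ≤ m) (h2 : m < L)
    {Z W : Finset (ZMod L)} {η : Config K L N₀} (hη : η.1 = mk (k + 1) (N₀ - 1) Z W ∅ ∅)
    (c0 : Z.card + m = L) (c1 : W.card = m) (hb : brk Z + brk W = 3) :
    ∃ ξ ∈ bottoms k m, (ReflTransGen (ColumnJump k (H₀ L N₀ + (4 : ℕ))) η ξ ∨
        Relation.ReflTransGen (ColumnJump (k + (N₀ : ZMod K)) (H₀ L N₀ + (4 : ℕ))) η ξ) ∧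
      (¬ Fat Z ∨ ¬ Fat W → 2 ≤ m → m + 2 ≤ L →
        ∃ ξ ∈ bottoms k m, Linked (graph K L N₀) energy (energy η) η ξ) := by
  have ⟨p1, p2, p3, p4, p5⟩ := hp; have b0 := proper_of_card (W := Z) (m := L - m) (by omega)
  have b1 := proper_of_card c1 (by omega) h2
  have e : k + 1 + ((N₀ - 1 : ℕ) : ZMod K) = k + N₀ := by
    rw [Nat.cast_sub (by omega)]; push_cast; ring
  have be := brk_empty_le (n := L)
  have bu : brk (univ : Finset (ZMod L)) ≤ 1 := by rw [brk_univ]; omega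
  have hcases : (brk Z = 2 ∧ brk W = 1) ∨ (brk Z = 1 ∧ brk W = 2) := by omega
  have hfat : ∀ {X : Finset (ZMod L)}, brk X = 1 → X.card ≠ 1 → X.card + 1 ≠ L → Fat X :=
    fun hX => fat_of_brk_le_one hX.le
  rcases hcases with ⟨h, h'⟩ | ⟨h, h'⟩
  · have hs := slot_left (N₀ := N₀) (k := k + 1) (a := N₀ - 1) (W₁ := W) (W₂ := ∅) (W₃ := ∅) (by omega)
      (by omega) (empty_subset _) (empty_subset _); rw [add_sub_cancel_right] at hs
    obtain ⟨ξ, X', hξ, hX', ⟨-, -, hc⟩, hr⟩ := hs.exists_jump h (empty_subset _)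
      (subset_univ _) be bu (Or.inl rfl) hη (c := 4) (by rw [h', brk_empty])
    refine ⟨ξ, mem_bottoms_of_mk h2.le hξ hX' h'.le (by omega) c1, Or.inl hr, ?_⟩; intro hnf hm hm'
    have hW := hfat h' (by omega) (by omega)
    obtain ⟨ξ, X', hξ, hX', ⟨-, -, hc⟩, hl⟩ := hs.exists_linked_of_not_fat h
      (empty_subset _) (subset_univ _) be bu (Or.inl rfl) (Or.inl rfl) (Or.inl rfl)
      (hnf.resolve_right fun hn => hn hW) hη
    exact ⟨ξ, mem_bottoms_of_mk h2.le hξ hX' h'.le (by omega) c1, hl⟩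
  · have hs := slot_one (N₀ := N₀) (k := k + 1) (a := N₀ - 1) (Z := Z) (W₂ := ∅) (W₃ := ∅) (by omega)
      (by omega) (empty_subset _); rw [e] at hs
    obtain ⟨ξ, X', hξ, hX', ⟨-, -, hc⟩, hr⟩ := hs.exists_jump h' (empty_subset _)
      (subset_univ _) be bu (Or.inl rfl) hη (c := 4) (by rw [h, brk_empty])
    refine ⟨ξ, mem_bottoms_of_mk h2.le hξ h.le hX' c0 (by omega), Or.inr hr, ?_⟩; intro hnf hm hm'
    have hZ := hfat h (by omega) (by omega)
    obtain ⟨ξ, X', hξ, hX', ⟨-, -, hc⟩, hl⟩ := hs.exists_linked_of_not_fat h'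
      (empty_subset _) (subset_univ _) be bu (Or.inl rfl) (Or.inl rfl) (Or.inl rfl)
      (hnf.resolve_left fun hn => hn hZ) hη
    exact ⟨ξ, mem_bottoms_of_mk h2.le hξ h.le hX' c0 (by omega), hl⟩

theorem energy_bottoms {k : ZMod K} {m : ℕ} (h1 : 1 ≤ m) (h2 : m < L)
    {η : Config K L N₀} (hη : η ∈ bottoms k m) : energy η = H₀ L N₀ + 2 := by
  have ⟨p1, p2, p3, p4, p5⟩ := hp; rw [bottoms_eq] at hη
  exact (fam_basin (h := 2) (by simp only [ind]; split_ifs <;> omega)).energy η hη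

theorem mem_valley_iff {k : ZMod K} {m : ℕ} {η : Config K L N₀} :
    η ∈ valley k m ↔ ∃ σ ∈ bottoms k m, Linked (graph K L N₀) energy (H₀ L N₀ + 3) σ η := by
  have h := H₀_neg hp.1 hp.3
  simp only [valley, nbhd, Set.mem_iUnion, Set.mem_ofPred_eq, exists_prop]
  refine exists_congr fun σ => and_congr_right fun _ => ?_
  rw [← commHeight_le_iff energy_ge (by omega)]; omega

theorem jump_preserves_two_sided {k : ZMod K} {m : ℕ} {η ξ : Config K L N₀}
    (h : AllowedJumpIn (cols k 1 ∪ cols (k + N₀) 1) η ξ)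
    (hη : ∃ Z W : Finset (ZMod L), η.1 = mk (k + 1) (N₀ - 1) Z W ∅ ∅ ∧ Z.card + m = L ∧
      W.card = m) :
    ∃ Z W : Finset (ZMod L), ξ.1 = mk (k + 1) (N₀ - 1) Z W ∅ ∅ ∧ Z.card + m = L ∧ W.card = m := by
  have ⟨p1, p2, p3, p4, p5⟩ := hp
  have e : k + 1 + ((N₀ - 1 : ℕ) : ZMod K) = k + N₀ := by
    rw [Nat.cast_sub (by omega)]; push_cast; ring
  have e' : k + 1 - 1 = k := add_sub_cancel_right _ _
  have hcol : ∀ v ∈ (cols k 1 ∪ cols (k + N₀) 1 : Set (ZMod K × ZMod L)),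
      v.1 = k ∨ v.1 = k + N₀ := by
    rintro v (⟨j, hj, h⟩ | ⟨j, hj, h⟩) <;> obtain rfl : j = 0 := by omega
    · left; simpa using h
    · right; simpa using h
  have hne : ∀ i : ℕ, (i = 0 ∨ i = N₀) → ∀ j : ℕ, (j = 0 ∨ j = N₀) →
      k + j ≠ k + i + 1 := fun i hi j hj => by
    rw [add_assoc, ← Nat.cast_succ]; exact idx_ne (by omega)
  have hcol' : ∀ v ∈ (cols k 1 ∪ cols (k + N₀) 1 : Set (ZMod K × ZMod L)),
      ∃ i : ℕ, (i = 0 ∨ i = N₀) ∧ v.1 = k + i := fun v hv => by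
    rcases hcol v hv with h | h
    · exact ⟨0, Or.inl rfl, by rw [h, Nat.cast_zero, add_zero]⟩
    · exact ⟨N₀, Or.inr rfl, h⟩
  have key : ∀ p ∈ (cols k 1 ∪ cols (k + N₀) 1 : Set (ZMod K × ZMod L)), ∀ y',
      p ∈ η.1 → (p.1, y') ∉ η.1 → ξ.1 = mv η.1 p (p.1, y') →
      ∃ Z W : Finset (ZMod L), ξ.1 = mk (k + 1) (N₀ - 1) Z W ∅ ∅ ∧ Z.card + m = L ∧ W.card = m := by
    rintro ⟨x, y⟩ hx y' hy hy' hξ; obtain ⟨Z, W, hη, c0, c1⟩ := hη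
    have hcard : ∀ X : Finset (ZMod L), y ∈ X → y' ∉ X → (insert y' (X.erase y)).card = X.card := by
      intro X h1 h2
      rw [card_insert_of_notMem (fun hc => h2 (mem_of_mem_erase hc)), card_erase_add_one h1]
    rw [hη] at hy hy' hξ; rw [← mem_col] at hy hy'
    rcases hcol _ hx with h | h <;> dsimp only at h hξ hy hy'
    · have hs := slot_left (N₀ := N₀) (k := k + 1) (a := N₀ - 1) (W₁ := W) (W₂ := ∅) (W₃ := ∅) (by omega)
        (by omega) (empty_subset _) (empty_subset _); rw [e'] at hs; rw [h, hs.col] at hy hy'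
      exact ⟨_, W, by rw [hξ, h, hs.mv], by rw [hcard Z hy hy']; exact c0, c1⟩
    · have hs := slot_one (N₀ := N₀) (k := k + 1) (a := N₀ - 1) (Z := Z) (W₂ := ∅) (W₃ := ∅) (by omega)
        (by omega) (empty_subset _); rw [e] at hs; rw [h, hs.col] at hy hy'
      exact ⟨Z, _, by rw [hξ, h, hs.mv], c0, by rw [hcard W hy hy']; exact c1⟩
  obtain ⟨⟨p, hp', q, hq, hex⟩, -, -⟩ := h; obtain ⟨hadj, hor⟩ := isExchange_iff.1 hex
  have hfst : p.1 = q.1 := by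
    rw [torus_adj] at hadj
    rcases hadj with ⟨h, -⟩ | ⟨-, h | h⟩
    · exact h
    · obtain ⟨i, hi, hpi⟩ := hcol' p hp'; obtain ⟨j, hj, hqj⟩ := hcol' q hq; rw [hpi, hqj] at h
      exact absurd h (hne i hi j hj)
    · obtain ⟨i, hi, hpi⟩ := hcol' p hp'; obtain ⟨j, hj, hqj⟩ := hcol' q hq; rw [hpi, hqj] at h
      exact absurd (by rw [h, sub_add_cancel]) (hne j hj i hi)
  rcases hor with ⟨h1, h2, h3⟩ | ⟨h1, h2, h3⟩
  · exact key p hp' q.2 h1 (by rwa [hfst]) (by rw [h3, hfst])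
  · exact key q hq p.2 h1 (by rwa [← hfst]) (by rw [h3, ← hfst])

theorem setD_eq (k : ZMod K) {m : ℕ} (h1 : 2 ≤ m) (h2 : m + 2 ≤ L) :
    setD k m = FatTwoSided (L := L) N₀ (k + 1) m := by
  obtain ⟨p1, p2, p3, p4, p5⟩ := id hp
  ext η
  constructor
  · rintro ⟨he, hv, σ, hσ, hr⟩
    have hstart : ∃ Z W : Finset (ZMod L), σ.1 = mk (k + 1) (N₀ - 1) Z W ∅ ∅ ∧ Z.card + m = L ∧
        W.card = m := by
      rw [bottoms_eq] at hσ; obtain ⟨ℓ₀, ℓ₁, ℓ₂, ℓ₃, -, -, h⟩ := hσ; rw [arc_zero, arc_zero] at h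
      exact ⟨_, _, h, by rw [card_arc]; omega, card_arc⟩
    have hend : ∃ Z W : Finset (ZMod L), η.1 = mk (k + 1) (N₀ - 1) Z W ∅ ∅ ∧ Z.card + m = L ∧
        W.card = m := by
      clear he hv
      induction hr with
      | refl => exact hstart
      | tail _ h ih =>
        refine jump_preserves_two_sided h ?_; exact ih
    obtain ⟨Z, W, hη, c0, c1⟩ := hend
    have hb : brk Z + brk W = 3 := by
      rw [energy_mk hη (empty_subset _) (empty_subset _), brk_empty] at he; omega
    obtain ⟨ξ, -, -, hl⟩ := exists_bottom_jump (by omega) (by omega) hη c0 c1 hb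
    have hfat : Fat Z ∧ Fat W := by
      by_contra hne
      obtain ⟨ξ, hξ, hl⟩ := hl (by
        by_contra hc
        exact hne ⟨not_not.1 (not_or.1 hc).1, not_not.1 (not_or.1 hc).2⟩) h1 h2; rw [he] at hl
      exact hv (mem_valley_iff.2 ⟨ξ, hξ, hl.symm⟩)
    exact ⟨Z, W, hη, c0, c1, hb, hfat.1, hfat.2⟩
  · rintro ⟨Z, W, hη, c0, c1, hb, f0, f1⟩
    have he : energy η = H₀ L N₀ + 3 := by
      rw [energy_mk hη (empty_subset _) (empty_subset _), brk_empty]; omega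
    refine ⟨he, fun hv => ?_, ?_⟩
    · obtain ⟨σ, hσ, hl⟩ := mem_valley_iff.1 hv
      have hB := singleton_basin hη (empty_subset _) (empty_subset _) f0 f1
        fat_empty fat_empty (by rw [brk_empty]; omega)
      have := hl.symm.preserves (· ∈ ({η} : Set _)) (fun u v hu huv _ hv =>
        hB.closed u hu v huv (by rw [he]; exact hv)) rfl; rw [Set.mem_singleton_iff] at this
      have h3 := energy_bottoms (by omega) (by omega) hσ; rw [this] at h3; omega
    · obtain ⟨ξ, hξ, hr | hr, -⟩ := exists_bottom_jump (by omega) (by omega) hη c0 c1 hb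
      · exact ⟨ξ, hξ, ColumnJump.allowed (fun y => Or.inl ⟨0, by omega, by simp⟩) (ColumnJump.symm hr)⟩
      · exact ⟨ξ, hξ, ColumnJump.allowed (fun y => Or.inr ⟨0, by omega, by simp⟩) (ColumnJump.symm hr)⟩

theorem fatTwoSided_subset (k : ZMod K) {m : ℕ} (h1 : 1 ≤ m) (h2 : m < L) :
    FatTwoSided (L := L) N₀ k m ⊆ reached K L N₀ := by
  rintro η ⟨Z, W, hη, c0, c1, hb, -, -⟩; rw [← sub_add_cancel k 1] at hη
  obtain ⟨ξ, hξ, hr, -⟩ := exists_bottom_jump h1 h2 hη c0 c1 hb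
  have he : energy η ≤ H₀ L N₀ + (4 : ℕ) := by
    have := hp.3; have := hp.5; rw [energy_mk hη (empty_subset _) (empty_subset _), brk_empty]
    omega
  refine reachable_of_linked (ξ := ξ) ?_ ?_
  · rcases hr with hr | hr <;> exact ColumnJump.linked he hr
  · rw [bottoms_eq] at hξ; exact fam_two_sided_subset _ (by omega) hξ

/-! ### The collections `R̂^k_(i)` -/

theorem torus_reachable_column (hK : 2 ≤ K) (hL : 2 ≤ L) (x : ZMod K) (y y' : ZMod L) :
    (torus K L).Reachable (x, y) (x, y') := by
  obtain ⟨j, -, rfl⟩ := exists_index y y'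
  induction j with
  | zero => simp
  | succ j ih =>
    refine ih.trans (SimpleGraph.Adj.reachable ?_); rw [torus_adj hK hL]
    left; exact ⟨rfl, Or.inl (by push_cast; ring)⟩

theorem three_le_dist_column (hK : 2 ≤ K) (hL : 2 ≤ L) (x : ZMod K) (y y' : ZMod L) :
    3 ≤ (torus K L).dist (x, y) (x, y') ↔
      y' ≠ y ∧ y' ≠ y + 1 ∧ y' + 1 ≠ y ∧ y' ≠ y + 2 ∧ y' + 2 ≠ y := by
  have hadj : ∀ y : ZMod L, (torus K L).Adj (x, y) (x, y + 1) := fun y => by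
    rw [torus_adj hK hL]; exact Or.inl ⟨rfl, Or.inl rfl⟩
  constructor
  · intro h; refine ⟨?_, ?_, ?_, ?_, ?_⟩
    · rintro rfl; rw [SimpleGraph.dist_self] at h; omega
    · rintro rfl; have := SimpleGraph.dist_le (SimpleGraph.Walk.cons (hadj y) .nil)
      simp only [SimpleGraph.Walk.length_cons, SimpleGraph.Walk.length_nil] at this; omega
    · rintro rfl; have := SimpleGraph.dist_le (SimpleGraph.Walk.cons (hadj y').symm .nil)
      simp only [SimpleGraph.Walk.length_cons, SimpleGraph.Walk.length_nil] at this; omega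
    · rintro rfl
      have := SimpleGraph.dist_le (SimpleGraph.Walk.cons (hadj y) (.cons (hadj (y + 1)) .nil))
      simp only [SimpleGraph.Walk.length_cons, SimpleGraph.Walk.length_nil, add_assoc,
        one_add_one_eq_two] at this h; omega
    · rintro rfl; have := SimpleGraph.dist_le
        (SimpleGraph.Walk.cons (hadj (y' + 1)).symm (.cons (hadj y').symm .nil))
      simp only [SimpleGraph.Walk.length_cons, SimpleGraph.Walk.length_nil, add_assoc,
        one_add_one_eq_two] at this h; omega
  · rintro ⟨h0, h1, h2, h3, h4⟩; by_contra hd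
    obtain ⟨w, hw⟩ := (torus_reachable_column hK hL x y y').exists_walk_length_eq_dist
    have hx : ∀ x : ZMod K, x + 1 ≠ x ∧ x - 1 ≠ x := fun x =>
      ⟨fun h => one_ne_zero' hK (by linear_combination h),
        fun h => one_ne_zero' hK (by linear_combination -h)⟩
    match w, hw with
    | .nil, _ => exact h0 rfl
    | .cons ha .nil, _ =>
      rcases (torus_adj hK hL).1 ha with ⟨-, h | h⟩ | ⟨h, -⟩
      · exact h1 h
      · exact h2 (eq_sub_iff_add_eq.1 h)
      · exact h0 h.symm
    | .cons (v := v) ha (.cons hb .nil), hw' =>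
      have ha' := (torus_adj hK hL).1 ha; have hb' := (torus_adj hK hL).1 hb
      clear hw' ha hb; obtain ⟨u, t⟩ := v
      dsimp only at ha' hb'
      rcases ha' with ⟨rfl, ha⟩ | ⟨rfl, ha⟩ <;> rcases hb' with ⟨e, hb⟩ | ⟨rfl, hb⟩
      · rcases ha with rfl | rfl <;> rcases hb with rfl | rfl
        · exact h3 (by ring)
        · exact h0 (by ring)
        · exact h0 (by ring)
        · exact h4 (by ring)
      · rcases hb with hb | hb
        · exact (hx _).1 hb.symm
        · exact (hx _).2 hb.symm
      · subst e
        rcases ha with ha | ha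
        · exact (hx _).1 ha.symm
        · exact (hx _).2 ha.symm
      · exact h0 rfl
    | .cons ha (.cons hb (.cons hc w)), hw =>
      simp only [SimpleGraph.Walk.length_cons] at hw; omega

theorem separated_vert (hK : 2 ≤ K) (hL : 2 ≤ L) {x : ZMod K} {A B : Finset (ZMod L)} :
    Separated (vert x A) (vert x B) ↔ Far A B := by
  constructor
  · intro h y hy y' hy'; exact (three_le_dist_column hK hL x y y').1 (h _ ⟨rfl, hy⟩ _ ⟨rfl, hy'⟩)
  · rintro h ⟨_, y⟩ ⟨rfl, hy⟩ ⟨x', y'⟩ ⟨h2, hy'⟩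
    dsimp only at h2; subst h2; exact (three_le_dist_column hK hL _ y y').2 (h y hy y' hy')

theorem vert_union (x : ZMod K) (A B : Finset (ZMod L)) : vert x (A ∪ B) = vert x A ∪ vert x B := by
  ext v; simp only [vert, Set.mem_union, Set.mem_ofPred_eq, mem_union]
  tauto

theorem occ_one_sided {k : ZMod K} {W₁ W₂ : Finset (ZMod L)}
    {η : Config K L N₀} : η.1 = mk k (N₀ - 1) ∅ W₁ W₂ ∅ ↔
      occ η = cols k (N₀ - 1) ∪ vert (k + N₀ - 1) W₁ ∪ vert (k + N₀) W₂ := by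
  have ⟨p1, p2, p3, p4, p5⟩ := hp
  have e1 : k + ((N₀ - 1 : ℕ) : ZMod K) = k + N₀ - 1 := by
    rw [Nat.cast_sub (by omega)]; push_cast; ring
  have h := coe_mk (k := k) (a := N₀ - 1) (Z := ∅) (W₁ := W₁) (W₂ := W₂) (W₃ := ∅)
  rw [e1, vert_empty, vert_empty, Set.union_empty, Set.union_empty, sub_add_cancel] at h
  rw [← h, occ, coe_inj]

theorem Far.disjoint {n : ℕ} {A B : Finset (ZMod n)} (h : Far A B) : Disjoint A B :=
  disjoint_left.2 fun x hx hx' => (h x hx x hx').1 rfl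

/-- The one-sided configurations of energy `H₀ + 3` with fat columns. -/
def FatOneSided (N₀ : ℕ) (k : ZMod K) (i : ℕ) : Set (Config K L N₀) :=
  {η | ∃ W₁ W₂ : Finset (ZMod L), η.1 = mk k (N₀ - 1) ∅ W₁ W₂ ∅ ∧ W₂ ⊆ W₁ ∧ W₁.card + i = L ∧
    W₂.card = i ∧ brk W₁ + brk W₂ = 3 ∧ Fat W₁ ∧ Fat W₂}

theorem far_union_spec {ℓ ℓ' : ZMod L} {a b : ℕ} (ha : 2 ≤ a) (hb : 2 ≤ b)
    (hf : Far (arc ℓ a) (arc ℓ' b)) (hab : a + b + 2 ≤ L) :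
    brk (arc ℓ a ∪ arc ℓ' b) = 2 ∧ (arc ℓ a ∪ arc ℓ' b).card = a + b ∧
      Fat (arc ℓ a ∪ arc ℓ' b) := by
  refine ⟨?_, ?_, hf.fat_union ?_ ?_⟩
  · rw [hf.brk_union, brk_arc, brk_arc]
  · rw [card_union_of_disjoint hf.disjoint, card_arc, card_arc]
  all_goals refine fat_of_brk_le_one (brk_arc_le _ _) ?_ ?_ <;> rw [card_arc] <;> omega

theorem setRhat_eq (k : ZMod K) {i : ℕ} (h1 : 2 ≤ i) (h2 : 2 * i + 2 ≤ L) :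
    setRhat k i = FatOneSided (L := L) N₀ k i := by
  have ⟨p1, p2, p3, p4, p5⟩ := hp
  have hfat : ∀ {ℓ : ZMod L} {m : ℕ}, 2 ≤ m → m + 2 ≤ L → brk (arc ℓ m) = 1 ∧ Fat (arc ℓ m) :=
    fun h h' => ⟨brk_arc, fat_of_brk_le_one (brk_arc_le _ _) (by rw [card_arc]; omega) (by rw [card_arc]; omega)⟩
  ext η
  simp only [setRhat, FatOneSided, Set.mem_ofPred_eq, exists_sticks,
    separated_vert (show 2 ≤ K by omega) (show 2 ≤ L by omega), sits_vert, occ_one_sided]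
  constructor
  · rintro (⟨a, b, ha, hb, -, hab, ℓ, ℓ', ℓ'', hf, hs, h⟩ |
      ⟨a, b, ha, hb, -, hab, ℓ, ℓ', ℓ'', hf, hs, hs', h⟩)
    · obtain ⟨e1, e2, e3⟩ := far_union_spec ha hb hf (by omega)
      obtain ⟨e4, e5⟩ := hfat (ℓ := ℓ'') h1 (by omega)
      refine ⟨arc ℓ a ∪ arc ℓ' b, arc ℓ'' i, by rw [h, vert_union, ← Set.union_assoc],
        hs.trans subset_union_left, by omega, card_arc, by omega, e3, e5⟩
    · obtain ⟨e1, e2, e3⟩ := far_union_spec ha hb hf (by omega)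
      obtain ⟨e4, e5⟩ := hfat (ℓ := ℓ) (m := L - i) (by omega) (by omega)
      refine ⟨arc ℓ (L - i), arc ℓ' a ∪ arc ℓ'' b, by rw [h, vert_union, ← Set.union_assoc],
        union_subset hs hs', by rw [card_arc]; omega, by omega, by omega, e5, e3⟩
  · rintro ⟨W₁, W₂, h, hs, c1, c2, hb, f1, f2⟩
    have b1 := proper_of_card (W := W₁) (m := L - i) (by omega); have b2 := proper_of_card c2
    have hcases : (brk W₁ = 2 ∧ brk W₂ = 1) ∨ (brk W₁ = 1 ∧ brk W₂ = 2) := by omega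
    rcases hcases with ⟨q1, q2⟩ | ⟨q1, q2⟩
    · left; obtain ⟨ℓ, a, b, c, ht⟩ := exists_twoArcs q1 hs (subset_univ _) q2.le
        (by rw [brk_univ]; omega) (Or.inr rfl); obtain ⟨t1, t2, t3, t4⟩ := ht.of_fat (by omega) f1
      obtain ⟨ℓ'', e⟩ := exists_eq_arc q2.le; have hf := far_arcs (ℓ := ℓ) t3 t4
      have hc := card_union_of_disjoint hf.disjoint; rw [← ht.eq, card_arc, card_arc] at hc
      rw [c2] at e; refine ⟨a, c, t1, t2, h1, by omega, ℓ, _, ℓ'', hf, e ▸ ht.lo, ?_⟩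
      rw [h, ht.eq, vert_union, ← Set.union_assoc, e]
    · right; obtain ⟨ℓ, a, b, c, ht⟩ := exists_twoArcs q2 (empty_subset _) hs
        (by rw [brk_empty]; omega) q1.le (Or.inl rfl)
      obtain ⟨t1, t2, t3, t4⟩ := ht.of_fat (by omega) f2; obtain ⟨ℓ'', e⟩ := exists_eq_arc q1.le
      have hf := far_arcs (ℓ := ℓ) t3 t4; have hc := card_union_of_disjoint hf.disjoint
      rw [← ht.eq, card_arc, card_arc] at hc; rw [show W₁.card = L - i by omega] at e
      have hs' := hs; rw [ht.eq, union_subset_iff, e] at hs'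
      refine ⟨a, c, t1, t2, by omega, by omega, ℓ'', ℓ, _, hf, hs'.1, hs'.2, ?_⟩
      rw [h, ht.eq, vert_union, ← Set.union_assoc, e]

theorem fatOneSided_subset (k : ZMod K) {i : ℕ} (h1 : 1 ≤ i) (h2 : i < L) :
    FatOneSided (L := L) N₀ k i ⊆ reached K L N₀ := by
  have ⟨p1, p2, p3, p4, p5⟩ := hp
  rintro η ⟨W₁, W₂, hη, hs, c1, c2, hb, -, -⟩
  have b1 := proper_of_card (W := W₁) (m := L - i) (by omega) (by omega) (by omega)
  have b2 := proper_of_card c2 (by omega) (by omega)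
  have hcases : (brk W₁ = 2 ∧ brk W₂ = 1) ∨ (brk W₁ = 1 ∧ brk W₂ = 2) := by omega
  have he : energy η ≤ H₀ L N₀ + (4 : ℕ) := by
    rw [energy_mk hη hs (empty_subset _) (by omega) (by omega), brk_empty]; omega
  have be : brk (∅ : Finset (ZMod L)) = 0 := brk_empty
  have bu : brk (univ : Finset (ZMod L)) = 0 := brk_univ
  rcases hcases with ⟨q1, q2⟩ | ⟨q1, q2⟩
  · obtain ⟨ξ, X, hξ, hX, ⟨i1, i2, i3⟩, hr⟩ := (slot_one (by omega) (by omega)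
      (empty_subset _)).exists_jump q1 hs (subset_univ _) q2.le (by omega)
      (Or.inr rfl) hη (c := 4) (by omega)
    exact reachable_of_linked (ColumnJump.linked he hr) (mem_reachable.2
      ⟨_, linked_one_sided hX q2.le i1 (by omega) hξ⟩)
  · obtain ⟨ξ, X, hξ, hX, ⟨i1, i2, i3⟩, hr⟩ := (slot_two (by omega)
      (by omega)).exists_jump q2 (empty_subset _) hs (by omega) q1.le
      (Or.inl rfl) hη (c := 4) (by omega)
    exact reachable_of_linked (ColumnJump.linked he hr) (mem_reachable.2
      ⟨_, linked_one_sided q1.le hX i2 (by omega) hξ⟩)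

/-! ### Connected plateaux with a mobile particle and a mobile hole -/

theorem colPath_single (hL : 2 ≤ L) {up : Finset (ZMod L)} (p : ZMod L) (t : ℕ)
    (h : ∀ i : ℕ, i ≤ t → p + i ∈ up) : ColPath ∅ up 1 {p} {p + t} := by
  have := colPath_slide (lo := ∅) (up := up) (X := ∅) (q := 1) hL (p := p) (s := 1) (Or.inl rfl)
    (empty_subset _) (empty_subset _) (by rw [brk_empty]) t
    (fun i hi => ⟨notMem_empty _, by rw [mul_one]; exact h i hi⟩); rwa [mul_one] at this

theorem colStep_hole (hL : 2 ≤ L) {lo : Finset (ZMod L)} {h : ZMod L} (h0 : h ∉ lo)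
    (h1 : h + 1 ∉ lo) :
    ColStep lo univ 1 (univ.erase h) (univ.erase (h + 1)) := by
  have hb : ∀ y : ZMod L, y ∉ lo → Between lo univ 1 (univ.erase y) := fun y hy =>
    ⟨fun x hx => mem_erase.2 ⟨fun e => hy (e ▸ hx), mem_univ _⟩,
      subset_univ _, by rw [erase_univ_eq_arc hL]; exact brk_arc_le _ _⟩
  have hne := self_ne_add_one hL h
  refine ⟨⟨h + 1, -1, Or.inr rfl, mem_erase.2 ⟨hne, mem_univ _⟩, ?_, ?_⟩, hb _ h0, hb _ h1⟩
  · rw [add_neg_cancel_right]; exact notMem_erase _ _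
  · rw [add_neg_cancel_right, erase_right_comm, insert_erase]
    exact mem_erase.2 ⟨hne.symm, mem_univ _⟩

theorem colPath_hole (hL : 2 ≤ L) (h : ZMod L) (t : ℕ) :
    ColPath ∅ univ 1 (univ.erase h) (univ.erase (h + t)) := by
  induction t with
  | zero => rw [Nat.cast_zero, add_zero]
  | succ t ih =>
    rw [Nat.cast_succ, ← add_assoc]
    exact ih.tail (colStep_hole hL (notMem_empty _) (notMem_empty _))

/-- Rotating an arc of length `1` or `L - 1`. -/
theorem colPath_rotate (hL : 2 ≤ L) {m : ℕ} (hm : m = 1 ∨ m = L - 1) (ℓ ℓ' : ZMod L) :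
    ColPath ∅ univ 1 (arc ℓ m) (arc ℓ' m) := by
  rcases hm with rfl | rfl
  · obtain ⟨t, -, rfl⟩ := exists_index ℓ ℓ'; rw [arc_one, arc_one]
    exact colPath_single hL ℓ t fun _ _ => mem_univ _
  · obtain ⟨t, -, e⟩ := exists_index (ℓ - 1) (ℓ' - 1); have h := colPath_hole hL (ℓ - 1) t
    rwa [← e, erase_univ_eq_arc hL, erase_univ_eq_arc hL, sub_add_cancel, sub_add_cancel] at h

theorem Slot.stepIn {x : ZMod K} {lo up : Finset (ZMod L)} {e q : ℕ}
    {f : Finset (ZMod L) → Sites K L} (hs : Slot N₀ x lo up e f)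
    {A : Set (Config K L N₀)} {w : ℕ}
    (hA : ∀ X (η : Config K L N₀), Between lo up q X → X.card = w → η.1 = f X → η ∈ A)
    {X X' : Finset (ZMod L)} (h : ColPath lo up q X X') (hX : X.card = w) {η : Config K L N₀}
    (hη : η.1 = f X) :
    ∃ ξ : Config K L N₀, ξ.1 = f X' ∧ ReflTransGen (StepIn (graph K L N₀) A) η ξ := by
  obtain ⟨ξ, hξ, hr⟩ := hs.lift (q := q) (R := fun η ξ => (Kawasaki.col η.1 x).card = w →
      StepIn (graph K L N₀) A η ξ ∧ (Kawasaki.col ξ.1 x).card = w) (by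
    rintro Y Y' ζ ζ' hstep hζ hζ' ⟨y, y', hex⟩ hc; rw [hζ, hs.col] at hc
    obtain ⟨⟨u, s, -, hu, hu', e⟩, b1, b2⟩ := hstep
    have hc' : Y'.card = w := by
      rw [e, card_insert_of_notMem (fun hc => hu' (mem_of_mem_erase hc)), card_erase_add_one hu, hc]
    exact ⟨⟨⟨_, _, hex⟩, hA _ _ b1 hc hζ, hA _ _ b2 hc' hζ'⟩, by rw [hζ', hs.col, hc']⟩) h hη
  refine ⟨ξ, hξ, ?_⟩
  have key : ReflTransGen (StepIn (graph K L N₀) A) η ξ ∧ (Kawasaki.col ξ.1 x).card = w := by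
    clear hξ
    induction hr with
    | refl => exact ⟨.refl, by rw [hη, hs.col, hX]⟩
    | tail _ h ih => exact ⟨ih.1.tail (h ih.2).1, (h ih.2).2⟩
  exact key.1

theorem fam_two_sided_connected {k : ZMod K} {z m : ℕ} (hz : z = 1 ∨ z = L - 1)
    (hm : m = 1 ∨ m = L - 1) :
    ∀ η ∈ Fam (L := L) N₀ k (N₀ - 1) z m 0 0, ∀ ξ ∈ Fam (L := L) N₀ k (N₀ - 1) z m 0 0,
      ReflTransGen (StepIn (graph K L N₀) (Fam N₀ k (N₀ - 1) z m 0 0)) η ξ := by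
  have ⟨p1, p2, p3, p4, p5⟩ := hp
  rintro η ⟨ℓ₀, ℓ₁, _, _, -, -, hη⟩ ξ ⟨ℓ₀', ℓ₁', _, _, -, -, hξ⟩; simp only [arc_zero] at hη hξ
  have be := brk_empty_le (n := L)
  obtain ⟨ζ, hζ, h1⟩ := (slot_left (by omega) (by omega) (empty_subset _)
    (empty_subset _)).stepIn (A := Fam N₀ k (N₀ - 1) z m 0 0) (w := z)
    (fun X η hX hc hη => mem_fam_of_mk hη hX.2.2 (brk_arc_le _ _) be be (empty_subset _)
      (empty_subset _) hc card_arc rfl rfl)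
    (colPath_rotate (by omega) hz ℓ₀ ℓ₀') card_arc hη
  obtain ⟨ζ', hζ', h2⟩ := (slot_one (by omega) (by omega)
    (empty_subset _)).stepIn (A := Fam N₀ k (N₀ - 1) z m 0 0) (w := m)
    (fun X η hX hc hη => mem_fam_of_mk hη (brk_arc_le _ _) hX.2.2 be be (empty_subset _)
      (empty_subset _) card_arc hc rfl rfl)
    (colPath_rotate (by omega) hm ℓ₁ ℓ₁') card_arc hζ
  obtain rfl : ζ' = ξ := Subtype.ext (hζ'.trans hξ.symm); exact h1.trans h2

theorem bottoms_connected {k : ZMod K} {m : ℕ} (hm : m = 1 ∨ m = L - 1) :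
    ∀ η ∈ bottoms (N₀ := N₀) k m, ∀ ξ ∈ bottoms (N₀ := N₀) k m,
      ReflTransGen (StepIn (graph K L N₀) (bottoms (L := L) k m)) η ξ := by
  have := hp.1; rw [bottoms_eq]; exact fam_two_sided_connected (by omega) hm

theorem setR_connected (k : ZMod K) :
    ∀ η ∈ setR (L := L) (N₀ := N₀) k, ∀ ξ ∈ setR (L := L) (N₀ := N₀) k,
      ReflTransGen (StepIn (graph K L N₀) (setR k)) η ξ := by
  have ⟨p1, p2, p3, p4, p5⟩ := hp
  have be := brk_empty_le (n := L)
  have hcard : ∀ h : ZMod L, (univ.erase h).card = L - 1 := fun h => by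
    rw [erase_univ_eq_arc (by omega), card_arc (by omega)]
  have hbrk : ∀ h : ZMod L, brk (univ.erase h) ≤ 1 := fun h => by
    rw [erase_univ_eq_arc (by omega)]; exact brk_arc_le _ _
  have hbrk' : ∀ p : ZMod L, brk {p} ≤ 1 := fun p => by rw [← arc_one]; exact brk_arc_le _ _
  -- Moving the particle.
  have particle : ∀ (h p : ZMod L) (X : Finset (ZMod L)),
      ColPath ∅ (univ.erase h) 1 {p} X → ∀ η : Config K L N₀,
      η.1 = mk k (N₀ - 1) ∅ (univ.erase h) {p} ∅ →
      ∃ ξ : Config K L N₀, ξ.1 = mk k (N₀ - 1) ∅ (univ.erase h) X ∅ ∧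
        ReflTransGen (StepIn (graph K L N₀) (setR k)) η ξ := by
    intro h p X hX η hη
    refine (slot_two (by omega) (by omega)).stepIn (w := 1) (fun X η hX hc hη => ?_) hX
      (card_singleton _) hη; rw [setR_eq]
    exact mem_fam_of_mk hη be (hbrk h) hX.2.2 be hX.2.1 (empty_subset _) rfl (hcard h) hc rfl
  -- Moving the hole.
  have hole : ∀ (h p : ZMod L), p ≠ h → p ≠ h + 1 → ∀ η : Config K L N₀,
      η.1 = mk k (N₀ - 1) ∅ (univ.erase h) {p} ∅ →
      ∃ ξ : Config K L N₀, ξ.1 = mk k (N₀ - 1) ∅ (univ.erase (h + 1)) {p} ∅ ∧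
        ReflTransGen (StepIn (graph K L N₀) (setR k)) η ξ := by
    intro h p h0 h1 η hη
    refine (slot_one (by omega) (by omega) (empty_subset _)).stepIn (w := L - 1)
      (fun X η hX hc hη => ?_) (.single (colStep_hole (by omega)
      (fun hc => h0 (mem_singleton.1 hc).symm)
      (fun hc => h1 (mem_singleton.1 hc).symm))) (hcard h) hη; rw [setR_eq]
    exact mem_fam_of_mk hη be hX.2.2 (hbrk' p) be hX.1 (empty_subset _) rfl hc
      (card_singleton _) rfl
  have hne : ∀ (h : ZMod L) (i : ℕ), 0 < i → i < L → h + i ≠ h := fun h i h0 h1 e => by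
    have := add_natCast_inj (n := L) (a := h) (i := i) (j := 0) (by simpa using e) h1; omega
  have rotate : ∀ (t : ℕ) (h : ZMod L) (η : Config K L N₀),
      η.1 = mk k (N₀ - 1) ∅ (univ.erase h) {h + 1} ∅ →
      ∃ ξ : Config K L N₀, ξ.1 = mk k (N₀ - 1) ∅ (univ.erase (h + (t : ZMod L))) {h + t + 1} ∅ ∧
        ReflTransGen (StepIn (graph K L N₀) (setR k)) η ξ := by
    intro t h η hη
    induction t with
    | zero => exact ⟨η, by rw [Nat.cast_zero, add_zero]; exact hη, .refl⟩
    | succ t ih =>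
      obtain ⟨ζ, hζ, h1⟩ := ih; rw [Nat.cast_succ, ← add_assoc]
      generalize h + t = g at hζ
      obtain ⟨ζ', hζ', h2⟩ := particle g (g + 1) _ (colPath_single (by omega) (g + 1) 1
        fun i hi => mem_erase.2 ⟨by
          have := hne g (1 + i) (by omega) (by omega)
          rwa [Nat.cast_add, Nat.cast_one, ← add_assoc] at this, mem_univ _⟩) ζ hζ
      rw [Nat.cast_one] at hζ'
      obtain ⟨ζ'', hζ'', h3⟩ := hole g (g + 1 + 1) (by
        have := hne g 2 (by omega) (by omega)
        rwa [Nat.cast_ofNat, ← one_add_one_eq_two, ← add_assoc] at this) (by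
        have := hne (g + 1) 1 (by omega) (by omega); rwa [Nat.cast_one] at this) ζ' hζ'
      exact ⟨ζ'', hζ'', (h1.trans h2).trans h3⟩
  have normal : ∀ η ∈ setR (L := L) (N₀ := N₀) k, ∃ (h : ZMod L) (ζ : Config K L N₀),
      ζ.1 = mk k (N₀ - 1) ∅ (univ.erase h) {h + 1} ∅ ∧
        ReflTransGen (StepIn (graph K L N₀) (setR k)) η ζ := by
    intro η hη; rw [setR_eq] at hη; obtain ⟨_, ℓ₁, p, _, hs, -, hη⟩ := hη
    have e := erase_univ_eq_arc (L := L) (by omega) (ℓ₁ - 1); rw [sub_add_cancel] at e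
    rw [← e, arc_one] at hs hη; rw [arc_zero, arc_zero] at hη
    generalize ℓ₁ - 1 = h at hs hη; obtain ⟨t, ht, rfl⟩ := exists_index (h + 1) p
    have hp' := mem_erase.1 (hs (mem_singleton_self _))
    have ht' : t + 1 ≠ L := fun e => hp'.1 (by
      rw [add_assoc, add_comm 1, ← Nat.cast_succ, Nat.succ_eq_add_one, e, ZMod.natCast_self, add_zero])
    obtain ⟨ζ, hζ, hr⟩ := particle h _ _ (colPath_symm (colPath_single (by omega) (h + 1) t
      fun i hi => mem_erase.2 ⟨by
        have := hne h (1 + i) (by omega) (by omega)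
        rwa [Nat.cast_add, Nat.cast_one, ← add_assoc] at this, mem_univ _⟩)) η hη
    exact ⟨h, ζ, hζ, hr⟩
  intro η hη ξ hξ; obtain ⟨h, ζ, hζ, h1⟩ := normal η hη; obtain ⟨h', ζ', hζ', h2⟩ := normal ξ hξ
  obtain ⟨t, -, rfl⟩ := exists_index h h'; obtain ⟨ζ'', hζ'', h3⟩ := rotate t h ζ hζ
  obtain rfl : ζ'' = ζ' := Subtype.ext (hζ''.trans hζ'.symm)
  exact (h1.trans h3).trans (stepIn_symm h2)

/-! ### The plateaux of the listed types -/

/-- The plateaux of energy `H₀ + 2` with partially filled columns on both sides. -/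
def TwoSidedTwo (P : Set (Config K L N₀)) : Prop :=
  ∃ k : ZMod K, (∃ m : ℕ, 2 ≤ m ∧ m + 2 ≤ L ∧ ∃ ℓ ℓ' : ZMod L, P = bottom k m ℓ ℓ') ∨
    P = bottoms k 1 ∨ P = bottoms k (L - 1)

/-- The plateaux of energy `H₀ + 3` with two partially filled columns on opposite sides. -/
def TwoSidedThree (P : Set (Config K L N₀)) : Prop :=
  ∃ k : ZMod K, ∃ m : ℕ, 2 ≤ m ∧ m + 2 ≤ L ∧ ∃ η ∈ setD k m, P = {η}

/-- The plateaux of energy `H₀ + 2` with partially filled columns on the right. -/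
def OneSidedTwo (P : Set (Config K L N₀)) : Prop :=
  ∃ k : ZMod K, P = setR k ∨ ∃ i : ℕ, 2 ≤ i ∧ 2 * i ≤ L ∧ ∃ η ∈ setRi k i, P = {η}

/-- The plateaux of energy `H₀ + 3` with at least two partially filled columns on the right. -/
def OneSidedThree (P : Set (Config K L N₀)) : Prop :=
  ∃ k : ZMod K, (∃ m : ℕ, 2 ≤ m ∧ m + 2 ≤ L ∧ (P ∈ components (graph K L N₀) (setRmPlus k m) ∨
      P ∈ components (graph K L N₀) (setRmMinus k m))) ∨
    (∃ i : ℕ, 2 ≤ i ∧ 2 * i + 2 ≤ L ∧ ∃ η ∈ setRhat k i, P = {η}) ∨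
    (∃ i : ℕ, 2 ≤ i ∧ 2 * i ≤ L + 1 ∧ (P ∈ components (graph K L N₀) (setRiPlus k i) ∨
      P ∈ components (graph K L N₀) (setRiMinus k i) ∨
      P ∈ components (graph K L N₀) (setRhatPlus k i) ∨
      P ∈ components (graph K L N₀) (setRhatMinus k i)))

theorem mem_plateaux_of_component {h : ℤ} {A P : Set (Config K L N₀)}
    (hA : Basin (graph K L N₀) energy h A) (hr : A ⊆ reached K L N₀)
    (hP : P ∈ components (graph K L N₀) A) : P ∈ plateaux K L N₀ ∧ HasEnergy energy P h :=
  ⟨⟨(hA.component_isStablePlateau hP).1, (hA.component_isStablePlateau hP).2.trans hr⟩,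
    fun η hη => hA.energy η ((hA.component_isStablePlateau hP).2 hη)⟩

theorem mem_plateaux_of_connected {h : ℤ} {A : Set (Config K L N₀)}
    (hA : Basin (graph K L N₀) energy h A) (hr : A ⊆ reached K L N₀)
    (hc : ∀ a ∈ A, ∀ b ∈ A, ReflTransGen (StepIn (graph K L N₀) A) a b)
    (hne : A.Nonempty) : A ∈ plateaux K L N₀ ∧ HasEnergy energy A h :=
  ⟨⟨hA.isStablePlateau_of_connected hc hne, hr⟩, hA.energy⟩

theorem fam_nonempty {k : ZMod K} {a z w₁ w₂ w₃ : ℕ} (ha : a + 5 ≤ K := by omega)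
    (hz : z ≤ L := by omega) (h1 : w₁ ≤ L := by omega) (h2 : w₂ ≤ w₁ := by omega)
    (h3 : w₃ ≤ w₂ := by omega) (h : a * L + z + w₁ + w₂ + w₃ = L * N₀ := by omega) :
    (Fam (L := L) N₀ k a z w₁ w₂ w₃).Nonempty :=
  ⟨⟨mk k a (arc 0 z) (arc 0 w₁) (arc 0 w₂) (arc 0 w₃), by
    rw [card_mk ha, card_arc hz, card_arc h1, card_arc, card_arc, h]⟩,
    0, 0, 0, 0, arc_mono _ h2, arc_mono _ h3, rfl⟩

theorem fat_arc {ℓ : ZMod L} {m : ℕ} (h : 2 ≤ m := by omega)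
    (h' : m + 2 ≤ L := by omega) : Fat (arc ℓ m) :=
  fat_of_brk_le_one (brk_arc_le _ _) (by rw [card_arc]; omega) (by rw [card_arc]; omega)

theorem singleton_mem_plateaux {k : ZMod K} {Z W₁ W₂ : Finset (ZMod L)}
    {η : Config K L N₀} (hη : η.1 = mk k (N₀ - 1) Z W₁ W₂ ∅) (h12 : W₂ ⊆ W₁) (f0 : Fat Z)
    (f1 : Fat W₁) (f2 : Fat W₂) {h : ℕ} (hh : brk Z + brk W₁ + brk W₂ = h) (h3 : h ≤ 3)
    (hr : η ∈ reached K L N₀) :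
    {η} ∈ plateaux K L N₀ ∧ HasEnergy energy {η} (H₀ L N₀ + h) := by
  have ⟨p1, p2, p3, p4, p5⟩ := hp
  have he : energy η = H₀ L N₀ + h := by
    rw [energy_mk hη h12 (empty_subset _), brk_empty, add_zero, hh]
  have hB := singleton_basin hη h12 (empty_subset _) f0 f1 f2 fat_empty (by rw [brk_empty]; omega)
  rw [he] at hB
  exact mem_plateaux_of_connected hB (Set.singleton_subset_iff.2 hr) (singleton_connected η) ⟨η, rfl⟩

theorem TwoSidedTwo.mem_plateaux {P : Set (Config K L N₀)}
    (h : TwoSidedTwo P) : P ∈ plateaux K L N₀ ∧ HasEnergy energy P (H₀ L N₀ + 2) := by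
  have ⟨p1, p2, p3, p4, p5⟩ := hp
  have hN : (N₀ - 1) * L + L = L * N₀ := by
    rw [← Nat.succ_mul, Nat.succ_eq_add_one, Nat.sub_add_cancel (by omega), mul_comm]
  have key : ∀ (k : ZMod K) (m : ℕ), m = 1 ∨ m = L - 1 → bottoms (L := L) k m ∈ plateaux K L N₀ ∧
      HasEnergy energy (bottoms (L := L) (N₀ := N₀) k m) (H₀ L N₀ + 2) := by
    intro k m hm
    refine mem_plateaux_of_connected ?_ ?_ (bottoms_connected hm) ?_ <;> rw [bottoms_eq]
    · exact fam_basin (h := 2) (by simp only [ind]; split_ifs <;> omega)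
    · exact fam_two_sided_subset _ (by omega)
    · exact fam_nonempty
  obtain ⟨k, ⟨m, h1, h2, ℓ, ℓ', rfl⟩ | rfl | rfl⟩ := h
  · obtain ⟨η, hη⟩ : ∃ η : Config K L N₀,
        η.1 = mk (k + 1) (N₀ - 1) (arc ℓ (L - m)) (arc ℓ' m) ∅ ∅ :=
      ⟨⟨mk (k + 1) (N₀ - 1) (arc ℓ (L - m)) (arc ℓ' m) ∅ ∅, by
        rw [card_mk, card_arc, card_arc, card_empty]
        omega⟩, rfl⟩
    have e : bottom k m ℓ ℓ' = {η} := by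
      ext ξ; rw [bottom_eq, ← hη, Set.mem_singleton_iff, Subtype.ext_iff]
    rw [e]; refine singleton_mem_plateaux hη (empty_subset _) fat_arc
      (fat_arc h1 h2) fat_empty (h := 2) ?_ (by omega) (reachable_two_sided (by omega) hη)
    rw [brk_arc, brk_arc, brk_empty]
  · exact key k 1 (Or.inl rfl)
  · exact key k _ (Or.inr rfl)

theorem TwoSidedThree.mem_plateaux {P : Set (Config K L N₀)}
    (h : TwoSidedThree P) : P ∈ plateaux K L N₀ ∧ HasEnergy energy P (H₀ L N₀ + 3) := by
  obtain ⟨k, m, h1, h2, η, hη, rfl⟩ := h; rw [setD_eq k h1 h2] at hη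
  have hr := fatTwoSided_subset _ (by omega) (by omega) hη
  obtain ⟨Z, W, hη, -, -, hb, f0, f1⟩ := hη
  exact singleton_mem_plateaux hη (empty_subset _) f0 f1 fat_empty (h := 3)
    (by rw [brk_empty]; omega) le_rfl hr

theorem OneSidedTwo.mem_plateaux {P : Set (Config K L N₀)}
    (h : OneSidedTwo P) : P ∈ plateaux K L N₀ ∧ HasEnergy energy P (H₀ L N₀ + 2) := by
  have ⟨p1, p2, p3, p4, p5⟩ := hp
  have hN : (N₀ - 1) * L + L = L * N₀ := by
    rw [← Nat.succ_mul, Nat.succ_eq_add_one, Nat.sub_add_cancel (by omega), mul_comm]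
  obtain ⟨k, rfl | ⟨i, h1, h2, η, hη, rfl⟩⟩ := h
  · refine mem_plateaux_of_connected ?_ ?_ (setR_connected k) ?_ <;> rw [setR_eq]
    · exact fam_basin (h := 2) (by simp only [ind]; split_ifs <;> omega)
    · exact fam_one_sided_subset _ (by omega)
    · exact fam_nonempty
  · rw [setRi_eq] at hη; have hr := fam_one_sided_subset _ (by omega) hη
    obtain ⟨ℓ₀, ℓ₁, ℓ₂, ℓ₃, hs, -, hη⟩ := hη; rw [arc_zero, arc_zero] at hη
    refine singleton_mem_plateaux hη hs fat_empty fat_arc (fat_arc h1) (h := 2) ?_ (by omega) hr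
    rw [brk_arc, brk_arc, brk_empty]

theorem basin_three {k : ZMod K} {a z w₁ w₂ w₃ : ℕ} (ha : a = N₀ - 1 ∨ a = N₀ - 2 := by omega)
    (hz : z < L := by omega) (h1 : w₁ < L := by omega) (h2 : w₂ < L := by omega)
    (h3 : w₃ < L := by omega)
    (h : 0 < w₁ ∧ 0 < w₂ ∧ (0 < z ∧ w₃ = 0 ∨ z = 0 ∧ 0 < w₃) := by omega) :
    Basin (graph K L N₀) energy (H₀ L N₀ + 3) (Fam N₀ k a z w₁ w₂ w₃) := by
  have ⟨p1, p2, p3, p4, p5⟩ := hp; refine fam_basin (h := 3) ?_; simp only [ind]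
  split_ifs <;> omega

theorem OneSidedThree.mem_plateaux {P : Set (Config K L N₀)}
    (h : OneSidedThree P) : P ∈ plateaux K L N₀ ∧ HasEnergy energy P (H₀ L N₀ + 3) := by
  have ⟨p1, p2, p3, p4, p5⟩ := hp
  obtain ⟨k, ⟨m, h1, h2, h | h⟩ | ⟨i, h1, h2, η, hη, rfl⟩ | ⟨i, h1, h2, h | h | h | h⟩⟩ := h
  · rw [setRmPlus_eq] at h
    exact mem_plateaux_of_component basin_three (fam_hole_two_sided_subset _ (by omega) (by omega)) h
  · rw [setRmMinus_eq] at h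
    exact mem_plateaux_of_component basin_three (fam_particle_two_sided_subset _ (by omega)) h
  · rw [setRhat_eq k h1 h2] at hη; have hr := fatOneSided_subset _ (by omega) (by omega) hη
    obtain ⟨W₁, W₂, hη, hs, -, -, hb, f1, f2⟩ := hη
    exact singleton_mem_plateaux hη hs fat_empty f1 f2 (h := 3) (by rw [brk_empty]; omega) le_rfl hr
  · rw [setRiPlus_eq] at h; obtain ⟨j, rfl⟩ : ∃ j, i = j + 1 := ⟨i - 1, by omega⟩
    exact mem_plateaux_of_component basin_three (fam_left_hole_subset _ (by omega) (by omega)) h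
  · rw [setRiMinus_eq] at h
    exact mem_plateaux_of_component basin_three (fam_left_particle_subset _ (by omega)) h
  · rw [setRhatPlus_eq] at h; obtain ⟨j, rfl⟩ : ∃ j, i = j + 1 := ⟨i - 1, by omega⟩
    exact mem_plateaux_of_component basin_three
      (fam_hole_one_sided_subset _ (by omega) (by omega)) h
  · rw [setRhatMinus_eq] at h
    exact mem_plateaux_of_component basin_three (fam_particle_one_sided_subset _ (by omega)) h

theorem strip_mem_plateaux (k : ZMod K) : strip (L := L) k ∈ plateaux K L N₀ ∧
      HasEnergy energy (strip (L := L) (N₀ := N₀) k) (H₀ L N₀) := by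
  have ⟨p1, p2, p3, p4, p5⟩ := hp
  have e : strip k = {stripConfig hp k} := by
    ext ξ; rw [mem_strip, Set.mem_singleton_iff, Subtype.ext_iff]; rfl
  have hη : (stripConfig hp k).1 = mk k (N₀ - 1) ∅ univ ∅ ∅ := mk_strip k
  have := singleton_mem_plateaux hη (empty_subset _) fat_empty fat_univ fat_empty (h := 0)
    (by rw [brk_empty, brk_univ]) (by omega) (mem_reachable.2
      ⟨k, .refl (by rw [energy_strip (stripConfig_mem k)]; omega)⟩); rw [e]; simpa using this

/-! ### Classification of the plateaux -/

section Classification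

theorem brk_le_card {n : ℕ} (W : Finset (ZMod n)) : brk W ≤ W.card :=
  card_filter_le _ _

theorem brk_add_card_le {n : ℕ} [NeZero n] (W : Finset (ZMod n)) : brk W + W.card ≤ n := by
  have h : brk W ≤ Wᶜ.card := card_le_card_of_injOn (· + 1)
    (fun y hy => by
      rw [mem_coe, mem_compl]; exact (mem_filter.1 hy).2) (add_left_injective 1).injOn
  rw [card_compl, ZMod.card] at h; have := card_le_univ W; rw [ZMod.card] at this; omega

theorem eq_singleton_of_fat {k : ZMod K} {Z W₁ W₂ : Finset (ZMod L)}
    {η : Config K L N₀} (hη : η.1 = mk k (N₀ - 1) Z W₁ W₂ ∅) (h12 : W₂ ⊆ W₁) (f0 : Fat Z)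
    (f1 : Fat W₁) (f2 : Fat W₂) (h3 : brk Z + brk W₁ + brk W₂ ≤ 3) {P : Set (Config K L N₀)}
    (hP : P ∈ plateaux K L N₀) (hηP : η ∈ P) : P = {η} := by
  have ⟨p1, p2, p3, p4, p5⟩ := hp; exact (singleton_basin hη h12 (empty_subset _) f0 f1 f2 fat_empty
    (by rw [brk_empty]; omega)).eq_of_connected (singleton_connected η)
    hP.1 hηP rfl

variable {P : Set (Config K L N₀)} {η : Config K L N₀} {k : ZMod K} {a : ℕ}
  {Z W₁ W₂ W₃ : Finset (ZMod L)}

theorem classify_two_sided (hP : P ∈ plateaux K L N₀) (hη : η ∈ P)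
    (h : Shape N₀ k a Z W₁ ∅ W₃ η.1) : TwoSidedTwo P ∨ TwoSidedThree P := by
  have ⟨p1, p2, p3, p4, p5⟩ := hp; obtain ⟨heq, -, h23, hZ, hW, -, hcard⟩ := h
  obtain rfl := subset_empty.1 h23; have hz := card_lt_of_ne_univ hZ
  have hw := card_lt_of_ne_univ hW; rw [card_empty] at hcard; obtain rfl : a = N₀ - 1 := by omega
  have hsum : Z.card + W₁.card = L := by omega
  have hle := plateau_energy_le hP hη
  rw [energy_mk heq (empty_subset _) (empty_subset _), brk_empty] at hle
  have bZ := proper_of_card (W := Z) rfl (by omega) hz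
  have bW := proper_of_card (W := W₁) rfl (by omega) hw
  have heq' : η.1 = mk (k - 1 + 1) (N₀ - 1) Z W₁ ∅ ∅ := by rw [sub_add_cancel]; exact heq
  have hfat : ∀ {X : Finset (ZMod L)}, brk X = 1 → 2 ≤ X.card → X.card + 2 ≤ L → Fat X :=
    fun hX _ _ => fat_of_brk_le_one hX.le (by omega) (by omega)
  have hcases : (brk Z = 1 ∧ brk W₁ = 1) ∨ (brk Z = 2 ∧ brk W₁ = 1) ∨
      (brk Z = 1 ∧ brk W₁ = 2) := by omega
  rcases hcases with ⟨b1, b2⟩ | hb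
  · left; have hmem := mem_bottoms_of_mk (m := W₁.card) hw.le heq' b1.le b2.le hsum rfl
    have hB : ∀ m, m = 1 ∨ m = L - 1 →
        Basin (graph K L N₀) energy (H₀ L N₀ + 2) (bottoms (k - 1) m) := fun m hm => by
      rw [bottoms_eq]; exact fam_basin (h := 2) (by simp only [ind]; split_ifs <;> omega)
    refine ⟨k - 1, ?_⟩
    by_cases h1 : W₁.card = 1
    · rw [h1] at hmem; exact Or.inr (Or.inl ((hB 1 (Or.inl rfl)).eq_of_connected
        (bottoms_connected (Or.inl rfl)) hP.1 hη hmem))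
    by_cases h2 : W₁.card = L - 1
    · rw [h2] at hmem; exact Or.inr (Or.inr ((hB _ (Or.inr rfl)).eq_of_connected
        (bottoms_connected (Or.inr rfl)) hP.1 hη hmem))
    · left; obtain ⟨ℓ, e1⟩ := exists_eq_arc b1.le; obtain ⟨ℓ', e2⟩ := exists_eq_arc b2.le
      refine ⟨W₁.card, by omega, by omega, ℓ, ℓ', ?_⟩
      rw [eq_singleton_of_fat heq (empty_subset _) (hfat b1 (by omega) (by omega))
        (hfat b2 (by omega) (by omega)) fat_empty (by rw [brk_empty]; omega) hP hη]
      ext ξ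
      rw [bottom_eq, Set.mem_singleton_iff, Subtype.ext_iff, heq', ← e2,
        show L - W₁.card = Z.card by omega, ← e1]
  · right; have be := brk_empty_le (n := L)
    have bu : brk (univ : Finset (ZMod L)) ≤ 1 := by rw [brk_univ]; omega
    have hsize : 2 ≤ W₁.card ∧ W₁.card + 2 ≤ L := by
      rcases hb with ⟨b1, -⟩ | ⟨-, b1⟩
      · have := brk_le_card Z; have := brk_add_card_le Z; omega
      · have := brk_le_card W₁; have := brk_add_card_le W₁; omega
    have hf : Fat Z ∧ Fat W₁ := by
      rcases hb with ⟨b1, b2⟩ | ⟨b1, b2⟩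
      · exact ⟨(slot_left (by omega) (by omega) (empty_subset _)
          (empty_subset _)).fat_of_mem_plateau b1 (empty_subset _)
          (subset_univ _) be bu (Or.inl rfl) (Or.inl rfl) (Or.inl rfl) hP hη heq,
          hfat b2 (by omega) (by omega)⟩
      · exact ⟨hfat b1 (by omega) (by omega), (slot_one (by omega) (by omega)
          (empty_subset _)).fat_of_mem_plateau b2 (empty_subset _)
          (subset_univ _) be bu (Or.inl rfl) (Or.inl rfl) (Or.inl rfl) hP hη heq⟩
    refine ⟨k - 1, W₁.card, hsize.1, hsize.2, η, ?_, ?_⟩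
    · rw [setD_eq _ hsize.1 hsize.2]; exact ⟨Z, W₁, heq', hsum, rfl, by omega, hf.1, hf.2⟩
    · exact eq_singleton_of_fat heq (empty_subset _) hf.1 hf.2 fat_empty
        (by rw [brk_empty]; omega) hP hη

/-- In a one-sided configuration with fat columns, one of which has two runs, the column further to
the right is shorter by at least two. -/
theorem card_add_two_le (hL : 2 ≤ L) (h12 : W₂ ⊆ W₁)
    (hb : (brk W₁ = 2 ∧ brk W₂ = 1 ∧ Fat W₁) ∨ (brk W₁ = 1 ∧ brk W₂ = 2 ∧ Fat W₂)) :
    W₂.card + 2 ≤ W₁.card := by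
  rcases hb with ⟨b1, b2, hf⟩ | ⟨b1, b2, hf⟩
  · obtain ⟨ℓ, a, b, c, ht⟩ := exists_twoArcs b1 h12 (subset_univ _) b2.le
      (by rw [brk_univ]; omega) (Or.inr rfl); obtain ⟨t1, t2, t3, t4⟩ := ht.of_fat hL hf
    have hc := card_union_of_disjoint (far_arcs (ℓ := ℓ) t3 t4).disjoint
    rw [← ht.eq, card_arc, card_arc] at hc; have := ht.card_le; omega
  · obtain ⟨ℓ, a, b, c, ht⟩ := exists_twoArcs b2 (empty_subset _) h12
      (by rw [brk_empty]; omega) b1.le (Or.inl rfl); obtain ⟨t1, t2, t3, t4⟩ := ht.of_fat hL hf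
    have hc := card_union_of_disjoint (far_arcs (ℓ := ℓ) t3 t4).disjoint
    rw [← ht.eq, card_arc, card_arc] at hc; have := card_le_card ht.up; rw [card_arc] at this; omega

theorem classify_one_sided (hP : P ∈ plateaux K L N₀) (hη : η ∈ P)
    (heq : η.1 = mk k (N₀ - 1) ∅ W₁ W₂ ∅) (h12 : W₂ ⊆ W₁) (h0 : W₂ ≠ ∅) (hW : W₁ ≠ univ)
    (hsum : W₁.card + W₂.card = L) : OneSidedTwo P ∨ OneSidedThree P := by
  have ⟨p1, p2, p3, p4, p5⟩ := hp; have hw := card_lt_of_ne_univ hW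
  have hw2 := card_pos.2 (nonempty_iff_ne_empty.2 h0); have hc12 := card_le_card h12
  have hle := plateau_energy_le hP hη
  rw [energy_mk heq h12 (empty_subset _) (by omega) (by omega), brk_empty] at hle
  have b1' := proper_of_card (W := W₁) rfl (by omega) hw
  have b2' := proper_of_card (W := W₂) rfl (by omega) (by omega)
  have hfat : ∀ {X : Finset (ZMod L)}, brk X = 1 → 2 ≤ X.card → X.card + 2 ≤ L → Fat X :=
    fun hX _ _ => fat_of_brk_le_one hX.le (by omega) (by omega)
  have be : brk (∅ : Finset (ZMod L)) = 0 := brk_empty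
  have bu : brk (univ : Finset (ZMod L)) = 0 := brk_univ
  have hcases : (brk W₁ = 1 ∧ brk W₂ = 1) ∨ (brk W₁ = 2 ∧ brk W₂ = 1) ∨
      (brk W₁ = 1 ∧ brk W₂ = 2) := by omega
  rcases hcases with ⟨b1, b2⟩ | hb
  · left
    have hmem : η ∈ setRi k W₂.card := by
      rw [setRi_eq]; exact mem_fam_of_mk heq (by omega) b1.le b2.le (by omega) h12 (empty_subset _)
        rfl (by omega) rfl rfl
    refine ⟨k, ?_⟩
    by_cases h1 : W₂.card = 1
    · left; rw [h1] at hmem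
      refine Basin.eq_of_connected (h := H₀ L N₀ + 2) ?_ (setR_connected k) hP.1 hη hmem
      rw [setR_eq]; exact fam_basin (h := 2) (by simp only [ind]; split_ifs <;> omega)
    · exact Or.inr ⟨W₂.card, by omega, by omega, η, hmem, eq_singleton_of_fat heq h12 fat_empty
        (hfat b1 (by omega) (by omega)) (hfat b2 (by omega) (by omega)) (by omega) hP hη⟩
  · right
    have hsize : 2 ≤ W₂.card ∧ W₁.card + 2 ≤ L := by
      rcases hb with ⟨b1, -⟩ | ⟨-, b1⟩
      · have := brk_add_card_le W₁; omega
      · have := brk_le_card W₂; omega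
    have hf : Fat W₁ ∧ Fat W₂ := by
      rcases hb with ⟨b1, b2⟩ | ⟨b1, b2⟩
      · exact ⟨(slot_one (by omega) (by omega) (empty_subset _)).fat_of_mem_plateau b1
          h12 (subset_univ _) b2.le (by omega) (Or.inr rfl) (Or.inr hsize.1) (Or.inl rfl)
          hP hη heq, hfat b2 (by omega) (by omega)⟩
      · exact ⟨hfat b1 (by omega) (by omega), (slot_two (by omega)
          (by omega)).fat_of_mem_plateau b2 (empty_subset _) h12 (by omega) b1.le
          (Or.inl rfl) (Or.inl rfl) (Or.inr hsize.2) hP hη heq⟩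
    have hgap := card_add_two_le (by omega) h12 (by
      rcases hb with ⟨b1, b2⟩ | ⟨b1, b2⟩
      · exact Or.inl ⟨b1, b2, hf.1⟩
      · exact Or.inr ⟨b1, b2, hf.2⟩)
    refine ⟨k, Or.inr (Or.inl ⟨W₂.card, hsize.1, by omega, η, ?_, ?_⟩)⟩
    · rw [setRhat_eq _ hsize.1 (by omega)]
      exact ⟨W₁, W₂, heq, h12, hsum, rfl, by omega, hf.1, hf.2⟩
    · exact eq_singleton_of_fat heq h12 fat_empty hf.1 hf.2 (by omega) hP hη

theorem badState_mk {J : Finset ℕ} (hJ : FrameIndex K a J) (heq : η.1 = mk k a Z W₁ W₂ W₃)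
    (h12 : W₂ ⊆ W₁) (h23 : W₃ ⊆ W₂) (h : ∀ j ∈ J, 2 ≤ (prof a Z W₁ W₂ W₃ j).card ∧
      (prof a Z W₁ W₂ W₃ j).card + 2 ≤ L) (h0 : Z = ∅ ∧ 1 ∉ J ∨ W₃ = ∅ ∧ 1 ∈ J) :
    BadState k a J η.1 := by
  have h1 := hJ.two_le; have h2 := hJ.le; rw [heq]
  refine ⟨⟨fun j hj hjJ => ?_, fun j hj => ?_, fun j hj => ?_⟩, Or.inl (hB_mk (by omega) h2 h12 h23)⟩
  · rw [col_mk_index hj, prof]; have e2 : j ≠ a + 2 := fun e => hjJ (e ▸ hJ.two)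
    have e3 : j ≠ a + 3 := fun e => hjJ (e ▸ hJ.three); rw [if_neg e2, if_neg e3]
    rcases h0 with ⟨rfl, h1⟩ | ⟨rfl, h1⟩
    · have e4 : j ≠ a + 4 := fun e => hjJ (e ▸ hJ.four.2 h1); rw [if_neg e4]
      split_ifs <;> first | rfl | omega
    · have e1 : j ≠ 1 := fun e => hjJ (e ▸ h1); rw [if_neg e1, ite_self]
  · rw [col_mk_index (hJ.lt hj)]; exact (h j hj).1
  · rw [col_mk_index (hJ.lt hj)]; exact (h j hj).2

theorem frameIndex_left (ha : 2 ≤ a) (haK : a + 6 ≤ K) : FrameIndex K a {1, a + 2, a + 3} where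
  two_le := ha
  le := haK
  sub := by simp
  card := by rw [card_eq_three]; exact ⟨_, _, _, by omega, by omega, by omega, rfl⟩
  two := by simp
  three := by simp
  four := by simp

theorem frameIndex_right (ha : 2 ≤ a) (haK : a + 6 ≤ K) : FrameIndex K a {a + 2, a + 3, a + 4} where
  two_le := ha
  le := haK
  sub := by simp
  card := by rw [card_eq_three]; exact ⟨_, _, _, by omega, by omega, by omega, rfl⟩
  two := by simp
  three := by simp
  four := by simp

theorem prof_values (Z W₁ W₂ W₃ : Finset (ZMod L)) (a : ℕ) :
    prof a Z W₁ W₂ W₃ 1 = Z ∧ prof a Z W₁ W₂ W₃ (a + 2) = W₁ ∧ prof a Z W₁ W₂ W₃ (a + 3) = W₂ ∧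
      prof a Z W₁ W₂ W₃ (a + 4) = W₃ := by
  refine ⟨?_, ?_, ?_, ?_⟩ <;> rw [prof] <;> split_ifs <;> first | rfl | omega

theorem classify_three (hP : P ∈ plateaux K L N₀) (hη : η ∈ P)
    (h : Shape N₀ k a Z W₁ W₂ W₃ η.1) (h0 : W₂ ≠ ∅) (h3 : Z ≠ ∅ ∨ W₃ ≠ ∅) : OneSidedThree P := by
  have ⟨p1, p2, p3, p4, p5⟩ := hp; obtain ⟨heq, h12, h23, hZ, hW, hemp, hcard⟩ := h
  have hz := card_lt_of_ne_univ hZ; have hw := card_lt_of_ne_univ hW; have c12 := card_le_card h12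
  have c23 := card_le_card h23; have hw2 := card_pos.2 (nonempty_iff_ne_empty.2 h0)
  have haK : 2 ≤ a ∧ a + 6 ≤ K := by omega
  have hle := plateau_energy_le hP hη; rw [energy_mk heq h12 h23 (by omega) haK.2] at hle
  have b1 := proper_of_card (W := W₁) rfl (by omega) hw; have b2 := proper_of_card (W := W₂) rfl
  obtain ⟨v1, v2, v3, v4⟩ := prof_values Z W₁ W₂ W₃ a; have hreach := hP.2 hη
  have hcB : cB η.1 + hB η.1 ≤ L + 4 := by
    rw [heq, hB_mk (by omega) haK.2 h12 h23, cB_mk]; omega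
  have mem : ∀ {k' : ZMod K} {a' z w₁ w₂ w₃ : ℕ}, k' = k → a' = a → brk Z ≤ 1 → brk W₃ ≤ 1 →
      brk W₁ ≤ 1 → brk W₂ ≤ 1 → Z.card = z → W₁.card = w₁ → W₂.card = w₂ → W₃.card = w₃ →
      (a' = N₀ - 1 ∨ a' = N₀ - 2) → (0 < z ∧ w₃ = 0 ∨ z = 0 ∧ 0 < w₃) →
      P ∈ components (graph K L N₀) (Fam N₀ k' a' z w₁ w₂ w₃) := by
    rintro k' a' z w₁ w₂ w₃ rfl rfl d0 d3 d1 d2 rfl rfl rfl rfl ha hh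
    exact (basin_three ha hz hw (by omega) (by omega) ⟨by omega, hw2, hh⟩).mem_components_of_mem
      hP.1 hη (mem_fam_of_mk heq d0 d1 d2 d3 h12 h23 rfl rfl rfl rfl)
  by_cases hz0 : Z = ∅
  · subst hz0; have hW3 := h3.resolve_left (fun h => h rfl)
    have hw3 := card_pos.2 (nonempty_iff_ne_empty.2 hW3); have b3 := proper_of_card (W := W₃) rfl
    rw [card_empty] at hcard; rw [brk_empty] at hle
    have be := brk_empty_le (n := L)
    have bad : 2 ≤ W₃.card → W₁.card + 2 ≤ L → False := fun t1 t2 => by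
      refine (badState_mk (frameIndex_right haK.1 haK.2) heq h12 h23 ?_
        (Or.inl ⟨rfl, by simp⟩)).not_reachable (frameIndex_right haK.1 haK.2) hreach
      simp only [mem_insert, mem_singleton]
      rintro j (rfl | rfl | rfl)
      · rw [v2]; omega
      · rw [v3]; omega
      · rw [v4]; omega
    refine ⟨k, Or.inr (Or.inr ?_)⟩
    rcases hcard with ⟨ha, hc⟩ | ⟨ha, hc⟩
    · have e3 : W₃.card = 1 := by
        by_contra hne
        exact bad (by omega) (by omega)
      refine ⟨W₂.card + 1, by omega, by omega, Or.inr (Or.inr (Or.inr ?_))⟩; rw [setRhatMinus_eq]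
      exact mem rfl (by omega) be (by omega) (by omega) (by omega) rfl (by omega) (by omega) e3
        (by omega) (by omega)
    · have e1 : W₁.card = L - 1 := by
        by_contra hne
        exact bad (by omega) (by omega)
      refine ⟨W₃.card, by omega, by omega, Or.inr (Or.inr (Or.inl ?_))⟩; rw [setRhatPlus_eq]
      exact mem rfl (by omega) be (by omega) (by omega) (by omega) rfl e1 (by omega) rfl
        (by omega) (by omega)
  · obtain rfl := hemp.resolve_left hz0; have hz1 := card_pos.2 (nonempty_iff_ne_empty.2 hz0)
    have b0 := proper_of_card (W := Z) rfl (by omega) hz; rw [card_empty] at hcard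
    rw [brk_empty] at hle; have be := brk_empty_le (n := L)
    have bad : 2 ≤ W₂.card → W₁.card + 2 ≤ L → 2 ≤ Z.card → Z.card + 2 ≤ L → False :=
      fun t1 t2 t3 t4 => by
        refine (badState_mk (frameIndex_left haK.1 haK.2) heq h12 h23 ?_
          (Or.inr ⟨rfl, by simp⟩)).not_reachable (frameIndex_left haK.1 haK.2) hreach
        simp only [mem_insert, mem_singleton]
        rintro j (rfl | rfl | rfl)
        · rw [v1]; omega
        · rw [v2]; omega
        · rw [v3]; omega
    rcases hcard with ⟨ha, hc⟩ | ⟨ha, hc⟩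
    · by_cases e1 : Z.card = 1
      · refine ⟨k, Or.inr (Or.inr ⟨W₂.card + 1, by omega, by omega, Or.inr (Or.inl ?_)⟩)⟩
        rw [setRiMinus_eq]
        exact mem rfl (by omega) (by omega) be (by omega) (by omega) e1 (by omega) (by omega) rfl
          (by omega) (by omega)
      · have e2 : W₂.card = 1 := by
          by_contra hne
          exact bad (by omega) (by omega) (by omega) (by omega)
        refine ⟨k - 1, Or.inl ⟨L - Z.card, by omega, by omega, Or.inr ?_⟩⟩; rw [setRmMinus_eq]
        exact mem (sub_add_cancel _ _) (by omega) (by omega) be (by omega) (by omega) (by omega)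
          (by omega) e2 rfl (by omega) (by omega)
    · by_cases e1 : Z.card = L - 1
      · refine ⟨k - 1, Or.inr (Or.inr ⟨W₂.card, by omega, by omega, Or.inl ?_⟩)⟩; rw [setRiPlus_eq]
        exact mem (sub_add_cancel _ _) (by omega) (by omega) be (by omega) (by omega) e1 (by omega)
          rfl rfl (by omega) (by omega)
      · have e2 : W₁.card = L - 1 := by
          by_contra hne
          exact bad (by omega) (by omega) (by omega) (by omega)
        refine ⟨k - 1, Or.inl ⟨L - Z.card, by omega, by omega, Or.inl ?_⟩⟩; rw [setRmPlus_eq]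
        exact mem (sub_add_cancel _ _) (by omega) (by omega) be (by omega) (by omega) (by omega)
          e2 (by omega) rfl (by omega) (by omega)

theorem classify_right (hP : P ∈ plateaux K L N₀) (hη : η ∈ P)
    (h : Shape N₀ k a Z W₁ W₂ W₃ η.1) (h0 : W₂ ≠ ∅) : OneSidedTwo P ∨ OneSidedThree P := by
  have := hp.1
  by_cases h3 : Z = ∅ ∧ W₃ = ∅
  · obtain ⟨rfl, rfl⟩ := h3; obtain ⟨heq, h12, -, -, hW, -, hcard⟩ := h
    have hw := card_lt_of_ne_univ hW; have := card_le_card h12; rw [card_empty] at hcard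
    obtain rfl : a = N₀ - 1 := by omega
    exact classify_one_sided hP hη heq h12 h0 hW (by omega)
  · exact Or.inr (classify_three hP hη h h0 (not_and_or.1 h3))

end Classification

/-! ### Reflected families -/

section Reflected

theorem flipIso_eq_mk_congr {c c' k k' : ZMod K} (h : c - k = c' - k') {a : ℕ}
    {Z W₁ W₂ W₃ : Finset (ZMod L)} {η : Config K L N₀}
    (hη : (flipIso c η).1 = mk k a Z W₁ W₂ W₃) :
    (flipIso c' η).1 = mk k' a Z W₁ W₂ W₃ := by
  rw [flipIso_val] at hη ⊢; rw [← flipSet_flipSet c η.1, hη, flipSet_mk_congr h, flipSet_flipSet]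

/-- The reflections of the members of a translation invariant family depend only on the images of
the base columns. -/
def Equivariant (𝓕 : ZMod K → Set (Config K L N₀)) : Prop :=
  ∀ c c' k k', c - k = c' - k' → flipIso c '' 𝓕 k ⊆ flipIso c' '' 𝓕 k'

theorem equivariant_fam (s : ZMod K) (a z w₁ w₂ w₃ : ℕ) :
    Equivariant fun k : ZMod K => Fam (L := L) N₀ (k + s) a z w₁ w₂ w₃ := by
  intro c c' k k' h η hη; rw [mem_image_flipIso] at hη ⊢
  obtain ⟨ℓ₀, ℓ₁, ℓ₂, ℓ₃, h12, h23, hη⟩ := hη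
  exact ⟨ℓ₀, ℓ₁, ℓ₂, ℓ₃, h12, h23, flipIso_eq_mk_congr (by linear_combination h) hη⟩

theorem equivariant_fam_zero (a z w₁ w₂ w₃ : ℕ) :
    Equivariant fun k : ZMod K => Fam (L := L) N₀ k a z w₁ w₂ w₃ := by
  simpa using equivariant_fam (K := K) (L := L) (N₀ := N₀) 0 a z w₁ w₂ w₃

theorem equivariant_fatOneSided (i : ℕ) :
    Equivariant fun k : ZMod K => FatOneSided (L := L) N₀ k i := by
  intro c c' k k' h η hη; rw [mem_image_flipIso] at hη ⊢; obtain ⟨W₁, W₂, hη, h⟩ := hη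
  exact ⟨W₁, W₂, flipIso_eq_mk_congr (by assumption) hη, h⟩

theorem Equivariant.eq {𝓕 : ZMod K → Set (Config K L N₀)}
    (h : Equivariant 𝓕) {c c' k k' : ZMod K} (e : c - k = c' - k') :
    flipIso c '' 𝓕 k = flipIso c' '' 𝓕 k' :=
  (h c c' k k' e).antisymm (h c' c k' k e.symm)

theorem Equivariant.exists_reflect {𝓕 : ZMod K → Set (Config K L N₀)}
    (h : Equivariant 𝓕) (c k : ZMod K) :
    flipIso c '' 𝓕 k = reflect (c - k - (N₀ : ZMod K) + 1) (𝓕 (c - k - (N₀ : ZMod K) + 1)) := by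
  rw [reflect_eq]; exact h.eq (by ring)

theorem mem_components_flipIso (c : ZMod K) {A P : Set (Config K L N₀)} :
    flipIso c '' P ∈ components (graph K L N₀) A ↔
      P ∈ components (graph K L N₀) (flipIso c '' A) := by
  constructor
  · intro h; have := image_components (flipIso c) h; rwa [image_flipIso_flipIso] at this
  · intro h; have := image_components (flipIso c) h; rwa [image_flipIso_flipIso] at this

theorem image_flipIso_eq_singleton (c : ZMod K) {A P : Set (Config K L N₀)} :
    (∃ η ∈ A, flipIso c '' P = {η}) ↔ ∃ η ∈ flipIso c '' A, P = {η} := by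
  constructor
  · rintro ⟨η, hη, h⟩; refine ⟨_, ⟨η, hη, rfl⟩, ?_⟩
    rw [← image_flipIso_flipIso c P, h, Set.image_singleton]
  · rintro ⟨_, ⟨η, hη, rfl⟩, rfl⟩; exact ⟨η, hη, by rw [Set.image_singleton, flipIso_flipIso]⟩

theorem setLmMinus_eq_image (k : ZMod K) {m : ℕ} (hm : m ≤ L) :
    setLmMinus k m = flipIso (2 * k + (N₀ : ZMod K)) '' setRmPlus (L := L) (N₀ := N₀) k (L - m) := by
  rw [setLmMinus_eq, setRmPlus_eq, Nat.sub_sub_self hm]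

theorem setLmPlus_eq_image (k : ZMod K) {m : ℕ} (hm : m ≤ L) :
    setLmPlus k m = flipIso (2 * k + (N₀ : ZMod K)) '' setRmMinus (L := L) (N₀ := N₀) k (L - m) := by
  rw [setLmPlus_eq, setRmMinus_eq, Nat.sub_sub_self hm]

theorem equivariant_setRmPlus (m : ℕ) :
    Equivariant (N₀ := N₀) fun k : ZMod K => setRmPlus (L := L) k m := by
  simp only [setRmPlus_eq]; exact equivariant_fam _ _ _ _ _ _

theorem equivariant_setRmMinus (m : ℕ) :
    Equivariant (N₀ := N₀) fun k : ZMod K => setRmMinus (L := L) k m := by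
  simp only [setRmMinus_eq]; exact equivariant_fam _ _ _ _ _ _

theorem equivariant_setRi (i : ℕ) :
    Equivariant (N₀ := N₀) fun k : ZMod K => setRi (L := L) k i := by
  simp only [setRi_eq]; exact equivariant_fam_zero _ _ _ _ _

theorem equivariant_setRiPlus (i : ℕ) :
    Equivariant (N₀ := N₀) fun k : ZMod K => setRiPlus (L := L) k i := by
  simp only [setRiPlus_eq]; exact equivariant_fam _ _ _ _ _ _

theorem equivariant_setRiMinus (i : ℕ) :
    Equivariant (N₀ := N₀) fun k : ZMod K => setRiMinus (L := L) k i := by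
  simp only [setRiMinus_eq]; exact equivariant_fam_zero _ _ _ _ _

theorem equivariant_setRhatPlus (i : ℕ) :
    Equivariant (N₀ := N₀) fun k : ZMod K => setRhatPlus (L := L) k i := by
  simp only [setRhatPlus_eq]; exact equivariant_fam_zero _ _ _ _ _

theorem equivariant_setRhatMinus (i : ℕ) :
    Equivariant (N₀ := N₀) fun k : ZMod K => setRhatMinus (L := L) k i := by
  simp only [setRhatMinus_eq]; exact equivariant_fam_zero _ _ _ _ _

theorem equivariant_setRhat {i : ℕ} (h1 : 2 ≤ i) (h2 : 2 * i + 2 ≤ L) :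
    Equivariant (N₀ := N₀) fun k : ZMod K => setRhat (L := L) k i := by
  simp only [setRhat_eq _ h1 h2]; exact equivariant_fatOneSided _

variable {P : Set (Config K L N₀)}

theorem TwoSidedTwo.listed (h : TwoSidedTwo P) : ListedTwo P := by
  obtain ⟨k, h | h | h⟩ := h
  · exact ⟨k, Or.inl h⟩
  · exact ⟨k, Or.inr (Or.inl h)⟩
  · exact ⟨k + 1, Or.inr (Or.inr (Or.inl (by rw [add_sub_cancel_right]; exact h)))⟩

theorem OneSidedTwo.listed (h : OneSidedTwo P) : ListedTwo P := by
  obtain ⟨k, h | ⟨i, h1, h2, η, hη, h⟩⟩ := h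
  · exact ⟨k, Or.inr (Or.inr (Or.inr (Or.inl h)))⟩
  · exact ⟨k, Or.inr (Or.inr (Or.inr (Or.inr (Or.inr ⟨i, h1, h2, η, Or.inl hη, h⟩))))⟩

theorem OneSidedTwo.listed_of_flip {c : ZMod K}
    (h : OneSidedTwo (flipIso c '' P)) : ListedTwo P := by
  obtain ⟨k, h | ⟨i, h1, h2, h⟩⟩ := h
  · refine ⟨c - k - (N₀ : ZMod K) + 1, Or.inr (Or.inr (Or.inr (Or.inr (Or.inl ?_))))⟩
    rw [← image_flipIso_flipIso c P, h]; exact (equivariant_setRi 1).exists_reflect c k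
  · rw [image_flipIso_eq_singleton, (equivariant_setRi i).exists_reflect c k] at h
    obtain ⟨η, hη, h⟩ := h
    exact ⟨_, Or.inr (Or.inr (Or.inr (Or.inr (Or.inr ⟨i, h1, h2, η, Or.inr hη, h⟩))))⟩

theorem TwoSidedThree.listed (h : TwoSidedThree P) : ListedThree P := by
  obtain ⟨k, h⟩ := h; exact ⟨k, Or.inl h⟩

theorem OneSidedThree.listed (h : OneSidedThree P) : ListedThree P := by
  obtain ⟨k, ⟨m, h1, h2, h⟩ | ⟨i, h1, h2, η, hη, h⟩ | ⟨i, h1, h2, h⟩⟩ := h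
  · refine ⟨k, Or.inr (Or.inl ⟨m, h1, h2, ?_⟩)⟩
    rcases h with h | h
    · exact ⟨_, by simp, h⟩
    · exact ⟨setRmMinus k m, by simp, h⟩
  · exact ⟨k, Or.inr (Or.inr (Or.inl ⟨i, h1, h2, η, Or.inl hη, h⟩))⟩
  · refine ⟨k, Or.inr (Or.inr (Or.inr ⟨i, h1, h2, ?_⟩))⟩
    rcases h with h | h | h | h
    · exact ⟨setRiPlus k i, by simp, h⟩
    · exact ⟨setRiMinus k i, by simp, h⟩
    · exact ⟨setRhatPlus k i, by simp, h⟩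
    · exact ⟨setRhatMinus k i, by simp, h⟩

theorem OneSidedThree.listed_of_flip {c : ZMod K}
    (h : OneSidedThree (flipIso c '' P)) : ListedThree P := by
  obtain ⟨k, ⟨m, h1, h2, h⟩ | ⟨i, h1, h2, h⟩ | ⟨i, h1, h2, h⟩⟩ := h
  · have e : c - k = 2 * (c - k - (N₀ : ZMod K)) + (N₀ : ZMod K) - (c - k - (N₀ : ZMod K)) := by
      ring
    refine ⟨c - k - (N₀ : ZMod K), Or.inr (Or.inl ⟨L - m, by omega, by omega, ?_⟩)⟩
    simp only [mem_components_flipIso] at h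
    rw [(equivariant_setRmPlus m).eq e, (equivariant_setRmMinus m).eq e] at h
    have hm := Nat.sub_sub_self (show m ≤ L by omega)
    have e1 := setLmMinus_eq_image (N₀ := N₀) (c - k - (N₀ : ZMod K)) (Nat.sub_le L m)
    have e2 := setLmPlus_eq_image (N₀ := N₀) (c - k - (N₀ : ZMod K)) (Nat.sub_le L m)
    rw [hm] at e1 e2; rw [← e1, ← e2] at h
    rcases h with h | h
    · exact ⟨_, by simp, h⟩
    · exact ⟨setLmPlus _ _, by simp, h⟩
  · rw [image_flipIso_eq_singleton, (equivariant_setRhat h1 h2).exists_reflect c k] at h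
    obtain ⟨η, hη, h⟩ := h; exact ⟨_, Or.inr (Or.inr (Or.inl ⟨i, h1, h2, η, Or.inr hη, h⟩))⟩
  · simp only [mem_components_flipIso] at h
    rw [(equivariant_setRiPlus i).exists_reflect c k, (equivariant_setRiMinus i).exists_reflect c k,
      (equivariant_setRhatPlus i).exists_reflect c k,
      (equivariant_setRhatMinus i).exists_reflect c k] at h
    refine ⟨c - k - (N₀ : ZMod K) + 1, Or.inr (Or.inr (Or.inr ⟨i, h1, h2, ?_⟩))⟩
    rcases h with h | h | h | h
    · exact ⟨setLiMinus _ i, by simp, h⟩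
    · exact ⟨setLiPlus _ i, by simp, h⟩
    · exact ⟨setLhatMinus _ i, by simp, h⟩
    · exact ⟨setLhatPlus _ i, by simp, h⟩

theorem ListedTwo.cases (h : ListedTwo P) :
    TwoSidedTwo P ∨ OneSidedTwo P ∨ ∃ c, OneSidedTwo (flipIso c '' P) := by
  obtain ⟨k, h | h | h | h | h | ⟨i, h1, h2, η, hη | hη, h⟩⟩ := h
  · exact Or.inl ⟨k, Or.inl h⟩
  · exact Or.inl ⟨k, Or.inr (Or.inl h)⟩
  · exact Or.inl ⟨k - 1, Or.inr (Or.inr h)⟩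
  · exact Or.inr (Or.inl ⟨k, Or.inl h⟩)
  · refine Or.inr (Or.inr ⟨2 * k + N₀ - 1, k, Or.inl ?_⟩)
    rw [h, setL, reflect_eq, image_flipIso_flipIso]
  · exact Or.inr (Or.inl ⟨k, Or.inr ⟨i, h1, h2, η, hη, h⟩⟩)
  · rw [setLi, reflect_eq] at hη
    exact Or.inr (Or.inr ⟨_, k, Or.inr ⟨i, h1, h2, (image_flipIso_eq_singleton _).2 ⟨η, hη, h⟩⟩⟩)

theorem ListedThree.cases (h : ListedThree P) :
    TwoSidedThree P ∨ OneSidedThree P ∨ ∃ c, OneSidedThree (flipIso c '' P) := by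
  obtain ⟨k, h | ⟨m, h1, h2, 𝒜, h𝒜, h⟩ | ⟨i, h1, h2, η, hη | hη, h⟩ | ⟨i, h1, h2, 𝒜, h𝒜, h⟩⟩ := h
  · exact Or.inl ⟨k, h⟩
  · have h3 : 2 ≤ L - m := by omega
    have h4 : L - m + 2 ≤ L := by omega
    rcases h𝒜 with rfl | rfl | rfl | rfl
    · exact Or.inr (Or.inl ⟨k, Or.inl ⟨m, h1, h2, Or.inl h⟩⟩)
    · exact Or.inr (Or.inl ⟨k, Or.inl ⟨m, h1, h2, Or.inr h⟩⟩)
    · rw [setLmMinus_eq_image k (by omega), ← mem_components_flipIso] at h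
      exact Or.inr (Or.inr ⟨_, k, Or.inl ⟨L - m, h3, h4, Or.inl h⟩⟩)
    · rw [setLmPlus_eq_image k (by omega), ← mem_components_flipIso] at h
      exact Or.inr (Or.inr ⟨_, k, Or.inl ⟨L - m, h3, h4, Or.inr h⟩⟩)
  · exact Or.inr (Or.inl ⟨k, Or.inr (Or.inl ⟨i, h1, h2, η, hη, h⟩)⟩)
  · rw [setLhat, reflect_eq] at hη
    exact Or.inr (Or.inr ⟨_, k, Or.inr (Or.inl ⟨i, h1, h2,
      (image_flipIso_eq_singleton _).2 ⟨η, hη, h⟩⟩)⟩)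
  · have hR : ∀ 𝓑 : Set (Config K L N₀), P ∈ components (graph K L N₀) (reflect k 𝓑) →
        flipIso (2 * k + (N₀ : ZMod K) - 1) '' P ∈ components (graph K L N₀) 𝓑 :=
      fun 𝓑 h => by rwa [mem_components_flipIso, ← reflect_eq]
    rcases h𝒜 with rfl | rfl | rfl | rfl | rfl | rfl | rfl | rfl
    · exact Or.inr (Or.inl ⟨k, Or.inr (Or.inr ⟨i, h1, h2, Or.inl h⟩)⟩)
    · exact Or.inr (Or.inl ⟨k, Or.inr (Or.inr ⟨i, h1, h2, Or.inr (Or.inl h)⟩)⟩)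
    · exact Or.inr (Or.inr ⟨_, k, Or.inr (Or.inr ⟨i, h1, h2, Or.inl (hR _ h)⟩)⟩)
    · exact Or.inr (Or.inr ⟨_, k, Or.inr (Or.inr ⟨i, h1, h2, Or.inr (Or.inl (hR _ h))⟩)⟩)
    · exact Or.inr (Or.inl ⟨k, Or.inr (Or.inr ⟨i, h1, h2, Or.inr (Or.inr (Or.inl h))⟩)⟩)
    · exact Or.inr (Or.inl ⟨k, Or.inr (Or.inr ⟨i, h1, h2, Or.inr (Or.inr (Or.inr h))⟩)⟩)
    · exact Or.inr (Or.inr ⟨_, k, Or.inr (Or.inr ⟨i, h1, h2, Or.inr (Or.inr (Or.inl (hR _ h)))⟩)⟩)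
    · exact Or.inr (Or.inr ⟨_, k, Or.inr (Or.inr ⟨i, h1, h2, Or.inr (Or.inr (Or.inr (hR _ h)))⟩)⟩)

theorem of_image_flipIso {c : ZMod K} {h : ℤ}
    (hQ : flipIso c '' P ∈ plateaux K L N₀ ∧ HasEnergy energy (flipIso c '' P) h) :
    P ∈ plateaux K L N₀ ∧ HasEnergy energy P h := by
  constructor
  · rw [← image_flipIso_flipIso c P]; exact image_mem_plateaux c hQ.1
  · intro η hη; rw [← energy_flipIso c]; exact hQ.2 _ ⟨η, hη, rfl⟩

theorem ListedTwo.mem_plateaux (h : ListedTwo P) :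
    P ∈ plateaux K L N₀ ∧ HasEnergy energy P (H₀ L N₀ + 2) := by
  rcases h.cases with h | h | ⟨c, h⟩
  · exact h.mem_plateaux
  · exact h.mem_plateaux
  · exact of_image_flipIso h.mem_plateaux

theorem ListedThree.mem_plateaux (h : ListedThree P) :
    P ∈ plateaux K L N₀ ∧ HasEnergy energy P (H₀ L N₀ + 3) := by
  rcases h.cases with h | h | ⟨c, h⟩
  · exact h.mem_plateaux
  · exact h.mem_plateaux
  · exact of_image_flipIso h.mem_plateaux

/-- A two-sided configuration remains two-sided under reflections. -/
theorem Shape.flip_two_sided {k c : ZMod K} {a : ℕ} {Z W₁ W₃ : Finset (ZMod L)} {A : Sites K L}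
    (h : Shape N₀ k a Z W₁ ∅ W₃ (flipSet c A)) :
    Shape N₀ (c - k - (a : ZMod K) + 1) a W₁ Z ∅ ∅ A := by
  have ⟨p1, p2, p3, p4, p5⟩ := hp; obtain ⟨heq, -, h23, hZ, hW, -, hcard⟩ := h
  obtain rfl := subset_empty.1 h23
  refine ⟨?_, empty_subset _, empty_subset _, hW, hZ, Or.inr rfl, by omega⟩
  rw [← flipSet_flipSet c A, heq, ← coe_inj, coe_flipSet_mk (by omega), coe_mk]
  rw [show c - k - a + 1 - 1 = c - k - a by ring, show c - k - a + 1 + a = c - k + 1 by ring]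
  simp only [vert_empty, Set.union_empty]
  rw [Set.union_assoc, Set.union_comm (vert (c - k + 1) Z), ← Set.union_assoc]

theorem listed_of_mem_plateaux (hP : P ∈ plateaux K L N₀) :
    ListedZero P ∨ ListedTwo P ∨ ListedThree P := by
  have ⟨p1, p2, p3, p4, p5⟩ := hp; obtain ⟨⟨η, hη⟩⟩ := hP.1.connected.nonempty
  have hle := plateau_energy_le hP hη; have htame := tame_of_reachable (hP.2 hη)
  by_cases hq : (partialCols η.1).card = 0
  · left; obtain ⟨k, hk⟩ := mem_strip_of_partialCols_eq_empty (card_eq_zero.1 hq) hle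
    refine ⟨k, ?_⟩
    have hs : ∀ ξ : Config K L N₀, ξ ∈ strip k ↔ ξ = η := fun ξ => by
      rw [mem_strip, Subtype.ext_iff, mem_strip.1 hk]
    have e : strip k = {η} := Set.ext hs; rw [e]
    have hη' : η.1 = mk k (N₀ - 1) ∅ univ ∅ ∅ := (mem_strip.1 hk).trans (mk_strip k)
    exact eq_singleton_of_fat hη' (empty_subset _) fat_empty fat_univ fat_empty
      (by rw [brk_empty, brk_univ]; omega) hP hη
  right; have hq1 := (fullCols_bounds η.2).1; have hqc := card_partialCols_le η.1
  have hhB := htame.le_hB; rw [energy_eq'] at hle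
  have hh : hB η.1 = L := by
    by_contra hne
    exact hB_ne_add_one_of_mem_plateau hP hη (by omega) (by omega) (by omega)
  obtain ⟨k, a, Z, W₁, W₂, W₃, h | h⟩ := exists_shape_or_flip η.2 htame hh (by omega) hq
  · by_cases h0 : W₂ = ∅
    · subst h0; exact (classify_two_sided hP hη h).imp TwoSidedTwo.listed TwoSidedThree.listed
    · exact (classify_right hP hη h h0).imp OneSidedTwo.listed OneSidedThree.listed
  · by_cases h0 : W₂ = ∅
    · subst h0
      exact (classify_two_sided hP hη h.flip_two_sided).imp TwoSidedTwo.listed TwoSidedThree.listed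
    · exact (classify_right (image_mem_plateaux 0 hP) ⟨η, hη, rfl⟩ h h0).imp
        OneSidedTwo.listed_of_flip OneSidedThree.listed_of_flip

end Reflected

end Kawasaki

theorem theorem3p4 (K L N₀ : ℕ) (hL : 4 ≤ L) (hKL : L < K) (hN₀ : 4 ≤ N₀)
    (hLN : L < 4 * N₀) (hNK : 2 * N₀ < K) (P : Set (Kawasaki.Config K L N₀)) :
    (P ∈ Kawasaki.plateaux K L N₀ ↔
      Kawasaki.ListedZero P ∨ Kawasaki.ListedTwo P ∨ Kawasaki.ListedThree P) ∧
    (Kawasaki.ListedZero P → Landscape.HasEnergy Kawasaki.energy P (Kawasaki.H₀ L N₀)) ∧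
    (Kawasaki.ListedTwo P → Landscape.HasEnergy Kawasaki.energy P (Kawasaki.H₀ L N₀ + 2)) ∧
    (Kawasaki.ListedThree P → Landscape.HasEnergy Kawasaki.energy P (Kawasaki.H₀ L N₀ + 3)) := by
  have : NeZero K := ⟨by omega⟩; have : NeZero L := ⟨by omega⟩
  have : Kawasaki.Adm K L N₀ := ⟨hL, hKL, hN₀, hLN, hNK⟩
  have h0 : ∀ h : Kawasaki.ListedZero P, P ∈ Kawasaki.plateaux K L N₀ ∧
      Landscape.HasEnergy Kawasaki.energy P (Kawasaki.H₀ L N₀) := by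
    rintro ⟨k, rfl⟩; exact Kawasaki.strip_mem_plateaux k
  refine ⟨⟨Kawasaki.listed_of_mem_plateaux, ?_⟩, fun h => (h0 h).2,
    fun h => h.mem_plateaux.2, fun h => h.mem_plateaux.2⟩
  rintro (h | h | h)
  · exact (h0 h).1
  · exact h.mem_plateaux.1
  · exact h.mem_plateaux.1
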